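/- Let $d\ge 2$. Fix a smooth even function $\eta_0:\mathbb R\to[0,1]$ supported in $\{|\mu|\le 8/5\}$ and equal to $1$ on $\{|\mu|\le 5/4\}$, and put $\chi_k(\mu)=\eta_0(\mu/2^k)-\eta_0(\mu/2^{k-1})$ for $k\in\mathbb Z$. For $\mathbf e\in\mathbb S^{d-1}$ let $P_k$, $P_{k,\mathbf e}$ and $e^{it\Delta}$ be the operators on $L^2(\mathbb R^d)$ with Fourier multipliers $\chi_k(|\xi|)$, $\chi_k(\xi\cdot\mathbf e)$ and $e^{-it|\xi|^2}$ (where $\xi$ is the frequency dual to $x$ through $e^{ix\cdot\xi}$). For $p,q\in[1,\infty]$, with $H_{\mathbf e}$ the orthogonal complement of $\mathbf e$ with its induced measure, let $$\|h\|_{L^{p,q}_{\mathbf e}}=\Big[\int_{\mathbb R}\Big[\int_{H_{\mathbf e}\times\mathbb R}|h(x_1\mathbf e+x',t)|^q\,dx'\,dt\Big]^{p/q}dx_1\Big]^{1/p}$$ (usual modifications if $p=\infty$ or $q=\infty$), and for $\lambda\in\mathbb R$ let $\|h\|_{L^{p,q}_{\mathbf e,\lambda}}=\|T_{\lambda\mathbf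 e}h\|_{L^{p,q}_{\mathbf e}}$, where $T_w h(x,t)=e^{-ix\cdot w/2}e^{-it|w|^2/4}h(x+tw,t)$. For a finite set $W\subseteq\mathbb R$ let $$\|\phi\|^2_{\Sigma^2L^{p,q}_{\mathbf e,W}}=|W|\,\inf_{\phi=\sum_{\lambda\in W}\phi_\lambda}\ \sum_{\lambda\in W}\|\phi_\lambda\|^2_{L^{p,q}_{\mathbf e,\lambda}}.$$ For $\mathcal K\in\{0,1,2,\dots\}$ and $k\in\mathbb Z$ let $W_k=W_k(\mathcal K)=\{\lambda\in[-2^k,2^k]:2^{k+2\mathcal K}\lambda\in\mathbb Z\}$. Let $p_d=(2d+4)/d$. Then the following estimates hold for all $f\in L^2(\mathbb R^d)$, $k\in\mathbb Z$ and $\mathbf e\in\mathbb S^{d-1}$. The implicit constants depend only on $d$ and $\eta_0$, and in the last estimate also on $p$. (i) Local smoothing: $$\sup_{|\lambda|\le 2^{k-5}}\|e^{it\Delta}P_{k,\mathbf e}f\|_{L^{\infty,2}_{\mathbf e,\lambda}}\lesssim 2^{-k/2}\|f\|_{L^2}.$$ (ii) Maximal function estimates: if $d\ge 3$, then $$\|e^{it\Delta}P_kf\|_{L^{2,\infty}_{\mathbf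 e}}\lesssim 2^{k(d-1)/2}\|f\|_{L^2};$$ if $d=2$, then for every $\mathcal K\in\{0,1,2,\dots\}$ $$\|1_{[-2^{2\mathcal K},2^{2\mathcal K}]}(t)\,e^{it\Delta}P_kf\|_{\Sigma^2L^{2,\infty}_{\mathbf e,W_{k+5}(\mathcal K)}}\lesssim 2^{k/2}\|f\|_{L^2}.$$ (iii) Strichartz-type estimates: $$\|e^{it\Delta}f\|_{L^{p_d}_{x,t}}\lesssim\|f\|_{L^2},\qquad \|e^{it\Delta}P_kf\|_{L^{p_d}_xL^\infty_t}\lesssim 2^{kd/(d+2)}\|f\|_{L^2}.$$ If $d=2$ and $(p,q)\in(2,\infty]\times[2,\infty]$ satisfy $1/p+1/q=1/2$, then $$\|e^{it\Delta}P_{k,\mathbf e}f\|_{L^{p,q}_{\mathbf e}}\lesssim 2^{k(2/p-1/2)}\|f\|_{L^2}\ \text{ if } p\ge q,\qquad \|e^{it\Delta}P_kf\|_{L^{p,q}_{\mathbf e}}\lesssim_p 2^{k(2/p-1/2)}\|f\|_{L^2}\ \text{ if } p\le q.$$ -/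

import Mathlib

open MeasureTheory FourierTransform
open scoped ENNReal

noncomputable section

/-- The Euclidean space `ℝ^d`. -/
abbrev RSpace (d : ℕ) : Type := EuclideanSpace ℝ (Fin d)

/-- The complex Hilbert space `L²(ℝ^d)`. -/
abbrev L2Space (d : ℕ) : Type := Lp (α := RSpace d) ℂ 2 (volume : Measure (RSpace d))

/-! ### Cutoffs and Fourier multipliers -/

/-- The admissible base cutoffs: `η : ℝ → [0,1]` smooth and even, supported in `|μ| ≤ 8/5`,
equal to `1` on `|μ| ≤ 5/4`. -/
structure IsBaseCutoff (η : ℝ → ℝ) : Prop where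
  smooth : ContDiff ℝ ((⊤ : ℕ∞) : WithTop ℕ∞) η
  even : ∀ μ, η (-μ) = η μ
  mem_Icc : ∀ μ, η μ ∈ Set.Icc (0 : ℝ) 1
  support : ∀ μ, 8 / 5 < |μ| → η μ = 0
  eq_one : ∀ μ, |μ| ≤ 5 / 4 → η μ = 1

/-- The dyadic cutoff `χ_k(μ) = η(μ / 2^k) - η(μ / 2^(k-1))`. -/
def dyadicCutoff (η : ℝ → ℝ) (k : ℤ) (μ : ℝ) : ℝ :=
  η (μ / 2 ^ k) - η (μ / 2 ^ (k - 1))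

open scoped Classical in
/-- The Fourier multiplier on `L²(ℝ^d)` with symbol `m`, with respect to the angular frequency
`ξ` (the characters are `e^{i x·ξ}`).  Mathlib's transform `𝓕` uses the characters
`e^{2π i x·ζ}`, so that `ξ = 2π ζ`.  The value is `0` if the product of the symbol with the
transform is not square integrable, which never happens for the bounded continuous symbols
used below (see `memLp_symbol_mul`). -/
def fourierMultiplier {d : ℕ} (m : RSpace d → ℂ) (f : L2Space d) : L2Space d :=
  if h : MemLp (fun ζ : RSpace d => m ((2 * Real.pi) • ζ) * (𝓕 f : L2Space d) ζ) 2 volume then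
    𝓕⁻ h.toLp
  else 0

/-- The Littlewood-Paley operator `P_k`, with symbol `χ_k(|ξ|)`. -/
def lpProj {d : ℕ} (η : ℝ → ℝ) (k : ℤ) : L2Space d → L2Space d :=
  fourierMultiplier fun ξ => (dyadicCutoff η k ‖ξ‖ : ℂ)

/-- The directional operator `P_{k,e}`, with symbol `χ_k(ξ · e)`. -/
def lpProjDir {d : ℕ} (η : ℝ → ℝ) (k : ℤ) (e : RSpace d) : L2Space d → L2Space d :=
  fourierMultiplier fun ξ => (dyadicCutoff η k (inner ℝ ξ e) : ℂ)

/-- The Schrödinger group `e^{itΔ}` on `L²(ℝ^d)`, with symbol `e^{-it|ξ|²}`. -/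
def schrodingerGroup {d : ℕ} (t : ℝ) : L2Space d → L2Space d :=
  fourierMultiplier fun ξ => Complex.exp (-(Complex.I * (t * ‖ξ‖ ^ 2 : ℝ)))

theorem memLp_symbol_mul {d : ℕ} {m : RSpace d → ℂ} (hm : Continuous m) {B : ℝ}
    (hB : ∀ ξ, ‖m ξ‖ ≤ B) (f : L2Space d) :
    MemLp (fun ζ : RSpace d => m ((2 * Real.pi) • ζ) * (f : L2Space d) ζ) 2 volume := by
  refine (Lp.memLp f).of_le_mul (c := B) ?_ ?_
  · exact (hm.comp (continuous_const_smul _)).aestronglyMeasurable.mul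
      (Lp.memLp f).aestronglyMeasurable
  · refine Filter.Eventually.of_forall fun ζ => ?_
    rw [norm_mul]
    exact mul_le_mul_of_nonneg_right (hB _) (norm_nonneg _)

theorem continuous_schrodingerSymbol {d : ℕ} (t : ℝ) :
    Continuous fun ξ : RSpace d => Complex.exp (-(Complex.I * (t * ‖ξ‖ ^ 2 : ℝ))) := by
  fun_prop

theorem norm_schrodingerSymbol {d : ℕ} (t : ℝ) (ξ : RSpace d) :
    ‖Complex.exp (-(Complex.I * (t * ‖ξ‖ ^ 2 : ℝ)))‖ = 1 := by
  have h : -(Complex.I * ((t * ‖ξ‖ ^ 2 : ℝ) : ℂ)) = ((-(t * ‖ξ‖ ^ 2) : ℝ) : ℂ) * Complex.I := by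
    push_cast; ring
  rw [h, Complex.norm_exp_ofReal_mul_I]

theorem continuous_schrodingerGroup {d : ℕ} (f : L2Space d) :
    Continuous fun t : ℝ => schrodingerGroup t f := by
  have hmem := fun t : ℝ => memLp_symbol_mul (continuous_schrodingerSymbol (d := d) t)
    (fun ξ => (norm_schrodingerSymbol t ξ).le) (𝓕 f : L2Space d)
  have heq : (fun t : ℝ => schrodingerGroup t f) = fun t => 𝓕⁻ (hmem t).toLp := by
    funext t
    exact dif_pos (hmem t)
  rw [heq]
  refine (Lp.fourierTransformₗᵢ (RSpace d) ℂ).symm.continuous.comp ?_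
  rw [continuous_iff_continuousAt]
  intro s
  refine (Lp.tendsto_Lp_iff_tendsto_eLpNorm'' _ hmem _ (hmem s)).2 ?_
  have h2 : (2 : ℝ≥0∞) ≠ 0 := two_ne_zero
  simp only [eLpNorm_eq_lintegral_rpow_enorm_toReal h2 ENNReal.ofNat_ne_top]
  have hlim : Filter.Tendsto (fun t : ℝ => ∫⁻ ζ : RSpace d,
      ‖((fun ζ : RSpace d => Complex.exp (-(Complex.I * (t * ‖(2 * Real.pi) • ζ‖ ^ 2 : ℝ))) *
        (𝓕 f : L2Space d) ζ) - fun ζ : RSpace d =>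
        Complex.exp (-(Complex.I * (s * ‖(2 * Real.pi) • ζ‖ ^ 2 : ℝ))) *
        (𝓕 f : L2Space d) ζ) ζ‖ₑ ^ (2 : ℝ≥0∞).toReal) (nhds s)
      (nhds (∫⁻ _ : RSpace d, 0)) := by
    refine tendsto_lintegral_filter_of_dominated_convergence'
      (fun ζ => (2 * ‖(𝓕 f : L2Space d) ζ‖ₑ) ^ (2 : ℝ≥0∞).toReal) ?_ ?_ ?_ ?_
    · exact Filter.Eventually.of_forall fun t =>
        (((hmem t).sub (hmem s)).aestronglyMeasurable.enorm).pow_const _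
    · refine Filter.Eventually.of_forall fun t => Filter.Eventually.of_forall fun ζ => ?_
      refine ENNReal.rpow_le_rpow ?_ (by simp)
      simp only [Pi.sub_apply]
      have key : ∀ r : ℝ, ‖Complex.exp (-(Complex.I * (r * ‖(2 * Real.pi) • ζ‖ ^ 2 : ℝ))) *
          (𝓕 f : L2Space d) ζ‖ₑ = ‖(𝓕 f : L2Space d) ζ‖ₑ := fun r => by
        rw [enorm_mul, ← ofReal_norm (Complex.exp _), norm_schrodingerSymbol]
        simp
      refine enorm_sub_le.trans (le_of_eq ?_)
      rw [key, key, two_mul]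
    · have := (Lp.memLp (𝓕 f : L2Space d)).eLpNorm_lt_top
      rw [eLpNorm_lt_top_iff_lintegral_rpow_enorm_lt_top h2 ENNReal.ofNat_ne_top] at this
      simp only [ENNReal.mul_rpow_of_nonneg _ _ (ENNReal.toReal_nonneg (a := 2))]
      rw [lintegral_const_mul' _ _ (by simp)]
      exact ENNReal.mul_ne_top (by simp) this.ne
    · refine Filter.Eventually.of_forall fun ζ => ?_
      have : Continuous fun t : ℝ =>
          ‖((fun ζ : RSpace d => Complex.exp (-(Complex.I * (t * ‖(2 * Real.pi) • ζ‖ ^ 2 : ℝ))) *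
        (𝓕 f : L2Space d) ζ) - fun ζ : RSpace d =>
        Complex.exp (-(Complex.I * (s * ‖(2 * Real.pi) • ζ‖ ^ 2 : ℝ))) *
        (𝓕 f : L2Space d) ζ) ζ‖ₑ ^ (2 : ℝ≥0∞).toReal := by
        simp only [Pi.sub_apply]
        refine (ENNReal.continuous_rpow_const).comp (continuous_enorm.comp ?_)
        fun_prop
      have h := this.tendsto s
      simpa using h
  rw [lintegral_zero] at hlim
  have := hlim.ennrpow_const (1 / (2 : ℝ≥0∞).toReal)
  simpa using this

/-- A continuous curve in `L²` is represented by a jointly measurable function. -/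
theorem exists_measurable_representative {d : ℕ} {F : ℝ → L2Space d} (hF : Continuous F) :
    ∃ u : RSpace d × ℝ → ℂ, Measurable u ∧ ∀ t, (fun x => u (x, t)) =ᵐ[volume] F t := by
  have : Fact ((2 : ℝ≥0∞) ≠ ∞) := ⟨ENNReal.ofNat_ne_top⟩
  have hdense := TopologicalSpace.denseRange_denseSeq (L2Space d)
  set D := TopologicalSpace.denseSeq (L2Space d)
  have hex : ∀ (n : ℕ) (t : ℝ), ∃ i, dist (F t) (D i) < (1 / 2 : ℝ) ^ n := fun n t =>
    hdense.exists_dist_lt (F t) (by positivity)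
  classical
  let N : ℕ → ℝ → ℕ := fun n t => Nat.find (hex n t)
  have hN : ∀ n, Measurable (N n) := fun n => by
    refine measurable_find (hex n) fun i => ?_
    exact (isOpen_lt (hF.dist continuous_const) continuous_const).measurableSet
  let v : ℕ → RSpace d × ℝ → ℂ := fun n z => D (N n z.2) z.1
  have hv : ∀ n, StronglyMeasurable (v n) := fun n => by
    have h1 : Measurable fun p : ℕ × RSpace d => (D p.1 : RSpace d → ℂ) p.2 :=
      measurable_from_prod_countable_right fun i => (Lp.stronglyMeasurable (D i)).measurable
    exact (h1.comp (((hN n).comp measurable_snd).prodMk measurable_fst)).stronglyMeasurable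
  refine ⟨fun z => Filter.limUnder Filter.atTop fun n => v n z,
    (StronglyMeasurable.limUnder hv).measurable, fun t => ?_⟩
  have hbd : ∀ n, eLpNorm (fun x => v n (x, t) - F t x) 2 volume ≤ (1 / 2 : ℝ≥0∞) ^ n := by
    intro n
    have h1 : dist (F t) (D (N n t)) < (1 / 2 : ℝ) ^ n := Nat.find_spec (hex n t)
    have h2 : edist (D (N n t)) (F t) = eLpNorm (fun x => v n (x, t) - F t x) 2 volume := by
      rw [Lp.edist_def]; rfl
    rw [← h2, edist_comm, edist_dist]
    refine (ENNReal.ofReal_le_ofReal h1.le).trans (le_of_eq ?_)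
    rw [ENNReal.ofReal_pow (by norm_num)]
    congr 1
    rw [ENNReal.ofReal_div_of_pos (by norm_num)]
    simp
  have hint : ∀ n, ∫⁻ x, ‖v n (x, t) - F t x‖ₑ ^ (2 : ℝ) ≤ (1 / 2 : ℝ≥0∞) ^ n := by
    intro n
    have h := hbd n
    rw [eLpNorm_eq_lintegral_rpow_enorm_toReal two_ne_zero ENNReal.ofNat_ne_top] at h
    simp only [ENNReal.toReal_ofNat] at h
    rw [one_div, ENNReal.rpow_inv_le_iff (by norm_num)] at h
    refine h.trans ?_
    simp only [one_div]
    rw [ENNReal.rpow_ofNat, pow_two]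
    refine mul_le_of_le_one_left zero_le ?_
    exact pow_le_one₀ zero_le (by simp)
  have hsum : ∫⁻ x, ∑' n, ‖v n (x, t) - F t x‖ₑ ^ (2 : ℝ) ≠ ∞ := by
    rw [lintegral_tsum]
    · refine ne_top_of_le_ne_top ?_ (ENNReal.tsum_le_tsum hint)
      rw [ENNReal.tsum_geometric]
      simp
    · intro n
      have h1 : StronglyMeasurable fun x => v n (x, t) :=
        (hv n).comp_measurable (measurable_id.prodMk measurable_const)
      exact ((h1.sub (Lp.stronglyMeasurable (F t))).enorm.pow_const _).aemeasurable
  have hmeas : AEMeasurable (fun x => ∑' n, ‖v n (x, t) - F t x‖ₑ ^ (2 : ℝ)) volume := by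
    refine AEMeasurable.tsum fun n => ?_
    have h1 : StronglyMeasurable fun x => v n (x, t) :=
      (hv n).comp_measurable (measurable_id.prodMk measurable_const)
    exact ((h1.sub (Lp.stronglyMeasurable (F t))).enorm.pow_const _).aemeasurable
  filter_upwards [ae_lt_top' hmeas hsum] with x hx
  refine Filter.Tendsto.limUnder_eq ?_
  have h1 := ENNReal.tendsto_atTop_zero_of_tsum_ne_top hx.ne
  have h2 := h1.ennrpow_const (1 / 2)
  simp only [← ENNReal.rpow_mul] at h2
  norm_num at h2
  rw [tendsto_iff_edist_tendsto_0]
  simpa [edist_eq_enorm_sub] using h2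

theorem exists_freeEvolution {d : ℕ} (f : L2Space d) :
    ∃ u : RSpace d × ℝ → ℂ, Measurable u ∧
      ∀ t, (fun x => u (x, t)) =ᵐ[volume] schrodingerGroup t f :=
  exists_measurable_representative (continuous_schrodingerGroup f)

/-- The free solution `(x, t) ↦ (e^{itΔ} f)(x)` as a measurable function on `ℝ^d × ℝ`
(unique up to a null set of `ℝ^d × ℝ`). -/
def freeEvolution {d : ℕ} (f : L2Space d) : RSpace d × ℝ → ℂ :=
  (exists_freeEvolution f).choose

theorem freeEvolution_spec {d : ℕ} (f : L2Space d) :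
    Measurable (freeEvolution f) ∧
      ∀ t, (fun x => freeEvolution f (x, t)) =ᵐ[volume] schrodingerGroup t f :=
  (exists_freeEvolution f).choose_spec

/-! ### Lateral spaces -/

/-- The norm of the lateral space `L^{p,q}_e`: for `x = x₁ e + x'` with `x'` in the orthogonal
complement of `e`, the `L^p` norm in `x₁` of the `L^q` norm in `(x', t)`. -/
def lateralNorm {d : ℕ} (p q : ℝ≥0∞) (e : RSpace d) (h : RSpace d × ℝ → ℂ) : ℝ≥0∞ :=
  eLpNorm (fun x₁ : ℝ =>
    eLpNorm (fun y : (Submodule.span ℝ {e})ᗮ × ℝ => h (x₁ • e + (y.1 : RSpace d), y.2))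
      q volume) p volume

/-- The Galilean operator
`T_w h (x, t) = e^{-i x·w/2} e^{-i t|w|²/4} h(x + t w, t)`. -/
def galilean {d : ℕ} (w : RSpace d) (h : RSpace d × ℝ → ℂ) : RSpace d × ℝ → ℂ := fun z =>
  Complex.exp (-(Complex.I * (inner ℝ z.1 w / 2 : ℝ))) *
    Complex.exp (-(Complex.I * (z.2 * ‖w‖ ^ 2 / 4 : ℝ))) * h (z.1 + z.2 • w, z.2)

/-- The norm of `L^{p,q}_{e,l}`, that is `‖T_{l e} h‖` in `L^{p,q}_e`. -/
def galileanNorm {d : ℕ} (p q : ℝ≥0∞) (e : RSpace d) (l : ℝ) (h : RSpace d × ℝ → ℂ) : ℝ≥0∞ :=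
  lateralNorm p q e (galilean (l • e) h)

/-- The norm of the sum space `∑^r L^{p,q}_{e,W}` for finite `W` and `1 ≤ r < ∞`:
its `r`-th power is `|W|^{r-1} inf ∑_{l ∈ W} ‖φ_l‖^r`, the infimum being over all
decompositions `φ = ∑_{l ∈ W} φ_l` (almost everywhere) into measurable functions. -/
def sumSpaceNorm {d : ℕ} (r : ℝ) (p q : ℝ≥0∞) (e : RSpace d) (W : Finset ℝ)
    (φ : RSpace d × ℝ → ℂ) : ℝ≥0∞ :=
  ((W.card : ℝ≥0∞) ^ (r - 1) *
    ⨅ (ψ : ℝ → RSpace d × ℝ → ℂ) (_ : ∀ l ∈ W, AEStronglyMeasurable (ψ l) volume)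
      (_ : φ =ᵐ[volume] fun z => ∑ l ∈ W, ψ l z),
      ∑ l ∈ W, galileanNorm p q e l (ψ l) ^ r) ^ (1 / r)

/-- The set `W_k(K) = {l ∈ [-2^k, 2^k] : 2^(k+2K) l ∈ ℤ}`. -/
def speedSet (K : ℕ) (k : ℤ) : Set ℝ :=
  {l : ℝ | l ∈ Set.Icc (-(2 : ℝ) ^ k) (2 ^ k) ∧
    ∃ n : ℤ, (2 : ℝ) ^ (k + 2 * (K : ℤ)) * l = n}

theorem speedSet_finite (K : ℕ) (k : ℤ) : (speedSet K k).Finite := by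
  have hc : (0 : ℝ) < 2 ^ (k + 2 * (K : ℤ)) := by positivity
  have hfin : (Set.Icc (-⌈(2 : ℝ) ^ (k + 2 * (K : ℤ)) * 2 ^ k⌉)
      ⌈(2 : ℝ) ^ (k + 2 * (K : ℤ)) * 2 ^ k⌉).Finite := Set.finite_Icc _ _
  refine (hfin.image fun n : ℤ => (n : ℝ) / 2 ^ (k + 2 * (K : ℤ))).subset ?_
  rintro l ⟨⟨h1, h2⟩, n, hn⟩
  have h3 := Int.le_ceil ((2 : ℝ) ^ (k + 2 * (K : ℤ)) * 2 ^ k)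
  have h4 := mul_le_mul_of_nonneg_left h1 hc.le
  have h5 := mul_le_mul_of_nonneg_left h2 hc.le
  refine ⟨n, ⟨?_, ?_⟩, ?_⟩
  · have : ((-⌈(2 : ℝ) ^ (k + 2 * (K : ℤ)) * 2 ^ k⌉ : ℤ) : ℝ) ≤ n := by
      push_cast; rw [← hn]; linarith
    exact_mod_cast this
  · have : ((n : ℤ) : ℝ) ≤ (⌈(2 : ℝ) ^ (k + 2 * (K : ℤ)) * 2 ^ k⌉ : ℤ) := by
      rw [← hn]; linarith
    exact_mod_cast this
  · simp only
    rw [← hn]; field_simp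

/-- The finite set `W_k(K)`. -/
def speeds (K : ℕ) (k : ℤ) : Finset ℝ := (speedSet_finite K k).toFinset

/-- Restriction in time: `1_{[-T,T]}(t) h(x, t)`. -/
def timeCut {d : ℕ} (T : ℝ) (h : RSpace d × ℝ → ℂ) : RSpace d × ℝ → ℂ :=
  fun z => (Set.Icc (-T) T).indicator (fun _ => h z) z.2

/-- The norm of `L^p_x L^∞_t`. -/
def maximalNorm {d : ℕ} (p : ℝ≥0∞) (h : RSpace d × ℝ → ℂ) : ℝ≥0∞ :=
  eLpNorm (fun x : RSpace d => eLpNorm (fun t : ℝ => h (x, t)) ∞ volume) p volume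

/-- The Strichartz exponent `p_d = (2d+4)/d`. -/
def strichartzExponent (d : ℕ) : ℝ≥0∞ := ENNReal.ofReal ((2 * d + 4) / d)

end

/-!
The inverse Fourier transform turns the free evolution of `f` into a superposition
`∫ e^{i(2π x·ζ - 4π² t|ζ|²)} g(ζ) dζ` of plane waves. After regularizing `g` by an envelope (a Gaussian,
or a cutoff in `ζ·e`) its value at `z = (x, t)` is a coefficient `⟪wave z, g⟫` against a bounded
continuous family of vectors of `L²`. Every estimate but local smoothing is then a statement about the
Gram kernel `⟪wave z, wave z'⟫`, by the `TT*` method. For the Gaussian envelope this kernel is a heat kernel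
at complex time, so that the dispersive bound `|t|^{-d/2}` holds uniformly in the regularization, and
`exists_tendsto_freeEvolution` removes the regularization.

* Strichartz: energy and dispersive bounds, bilinear real interpolation (`bilinear_interpolation`), and the
  Hardy-Littlewood-Sobolev inequality in time (`lintegral_lintegral_abs_sub_rpow_le`, by a Whitney
  decomposition of the complement of the diagonal) give `enorm_synthesis_le_of_dispersive`; duality gives
  the estimate itself.
* Maximal Strichartz: on frequencies of size `2^k` a time derivative costs `2^{2k}`, so Sobolev's inequality
  in time reduces it to the Strichartz estimate.
* Local smoothing: on `ζ·e > 0`, for a fixed frequency across `e`, the evolution along a line in a direction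
  close to the time axis is a one-dimensional integral with phase quadratic in `ω`. The change of variables
  `s = 2π ω²` makes it a Fourier transform in time, and Plancherel applies; the Jacobian is the gain `2^{-k/2}`.
* Lateral estimates in dimension two: `p = q = 4` is the Strichartz estimate. For `q ≤ p` they follow by
  Hölder's inequality between this and local smoothing. For `p ≤ q` the decay of the kernel in
  `|x₁ - y₁|` at frequency `2^k` is interpolated with the `L⁴` bound on each Whitney square
  (`enorm_synthesis_le_of_lateral`).
* Maximal functions, `d ≥ 3`: the kernel at frequency `2^k` decays in `x₁` like `|2^k x₁|^{-3/2}`, uniformly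
  in the other variables. This is summable over cells of length `2^{-k}`, and Schur's test for one point in
  each cell bounds the supremum (`lintegral_iSup_enorm_inner_sq_le`).
* Maximal functions, `d = 2`: the decay is only `|2^k x₁|^{-1}`, which just fails to be summable; this is what
  the sum over the speeds `l` repairs. The kernel is `O(2^{2k})` times the average over `l` of the profiles
  `1 / (1 + 2^{2k}(x₁ - l t)²)`: in the region swept by the lines `x₁ = l t` by dispersion, since the average
  there is at least about `1 / (2^{2k}|t|)`, and elsewhere by two integrations by parts in `ζ·e`. Each profile is up to
  constants a Gram kernel of translates in `L²(ℝ)`. A domination of Gram kernels passes to the coefficients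
  by the Hahn-Banach theorem (`exists_norm_inner_le_inner_of_gram_le`): the evolution is bounded
  pointwise by a sum over `l` of functions of `x₁ - l t` alone, with controlled `L²` norms, which is the
  decomposition that the norm of the sum space asks for.
-/

/-! ### Dyadic sums -/

theorem tsum_int_le_eq_tsum_nat {g : ℤ → ℝ≥0∞} (m₀ : ℤ) (h : ∀ m, m₀ < m → g m = 0) :
    ∑' m, g m = ∑' n : ℕ, g (m₀ - n) := by
  have hinj : Function.Injective fun n : ℕ => m₀ - (n : ℤ) := fun a b hab => by
    simp only at hab; omega
  refine (hinj.tsum_eq ?_).symm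
  intro m hm
  have : m ≤ m₀ := by
    by_contra hlt
    exact hm (h m (not_le.1 hlt))
  exact ⟨(m₀ - m).toNat, by simp only; omega⟩

theorem tsum_int_ge_eq_tsum_nat {g : ℤ → ℝ≥0∞} (m₀ : ℤ) (h : ∀ m, m < m₀ → g m = 0) :
    ∑' m, g m = ∑' n : ℕ, g (m₀ + n) := by
  have hinj : Function.Injective fun n : ℕ => m₀ + (n : ℤ) := fun a b hab => by
    simp only at hab; omega
  refine (hinj.tsum_eq ?_).symm
  intro m hm
  have : m₀ ≤ m := by
    by_contra hlt
    exact hm (h m (not_le.1 hlt))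
  exact ⟨(m - m₀).toNat, by simp only; omega⟩

theorem exists_int_two_rpow {x : ℝ≥0∞} (h0 : x ≠ 0) (ht : x ≠ ∞) :
    ∃ m : ℤ, (2 : ℝ≥0∞) ^ (m : ℝ) ≤ x ∧ x < (2 : ℝ≥0∞) ^ ((m : ℝ) + 1) := by
  obtain ⟨m, h1, h2⟩ := ENNReal.exists_mem_Ico_zpow h0 ht ENNReal.one_lt_two ENNReal.ofNat_ne_top
  refine ⟨m, ?_, ?_⟩
  · rwa [ENNReal.rpow_intCast]
  · have : (m : ℝ) + 1 = ((m + 1 : ℤ) : ℝ) := by push_cast; ring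
    rwa [this, ENNReal.rpow_intCast]

/-- The constant `∑ 2^(-nδ)` of the dyadic geometric series. -/
noncomputable def geomConst (δ : ℝ) : ℝ≥0∞ := (1 - (2 : ℝ≥0∞) ^ (-δ))⁻¹

theorem geomConst_ne_top {δ : ℝ} (hδ : 0 < δ) : geomConst δ ≠ ∞ := by
  unfold geomConst
  rw [ENNReal.inv_ne_top, ne_eq, tsub_eq_zero_iff_le, not_le]
  exact ENNReal.rpow_lt_one_of_one_lt_of_neg ENNReal.one_lt_two (by linarith)

theorem one_le_geomConst (δ : ℝ) : 1 ≤ geomConst δ := by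
  unfold geomConst
  rw [ENNReal.one_le_inv]
  exact tsub_le_self

theorem tsum_two_rpow_nat (δ : ℝ) : ∑' n : ℕ, (2 : ℝ≥0∞) ^ (-(n : ℝ) * δ) = geomConst δ := by
  rw [geomConst, ← ENNReal.tsum_geometric]
  congr 1; ext n
  rw [← ENNReal.rpow_natCast, ← ENNReal.rpow_mul]
  congr 1; ring

theorem tsum_two_rpow_le {δ : ℝ} (hδ : 0 < δ) (x : ℝ≥0∞) :
    ∑' m : ℤ, (if (2 : ℝ≥0∞) ^ (m : ℝ) ≤ x then (2 : ℝ≥0∞) ^ ((m : ℝ) * δ) else 0) ≤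
      geomConst δ * x ^ δ := by
  rcases eq_or_ne x 0 with rfl | h0
  · refine le_of_eq_of_le ?_ zero_le
    rw [ENNReal.tsum_eq_zero]
    intro m
    rw [if_neg]
    rw [nonpos_iff_eq_zero]
    exact (ENNReal.rpow_pos (by simp) (by simp)).ne'
  rcases eq_or_ne x ∞ with rfl | ht
  · rw [ENNReal.top_rpow_of_pos hδ, ENNReal.mul_top]
    · exact le_top
    · exact (zero_lt_one.trans_le (one_le_geomConst δ)).ne'
  obtain ⟨m₀, h1, h2⟩ := exists_int_two_rpow h0 ht
  rw [tsum_int_le_eq_tsum_nat m₀, mul_comm, ← tsum_two_rpow_nat, ← ENNReal.tsum_mul_left]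
  · refine ENNReal.tsum_le_tsum fun n => ?_
    split_ifs
    · have : (((m₀ - n : ℤ) : ℝ) * δ) = (m₀ : ℝ) * δ + (-(n : ℝ) * δ) := by push_cast; ring
      rw [this, ENNReal.rpow_add _ _ (by simp) (by simp), ENNReal.rpow_mul]
      gcongr
    · exact zero_le
  · intro m hm
    rw [if_neg]
    rw [not_le]
    refine h2.trans_le (ENNReal.rpow_le_rpow_of_exponent_le one_le_two ?_)
    exact_mod_cast hm

theorem tsum_two_rpow_neg_le {δ : ℝ} (hδ : 0 < δ) (x : ℝ≥0∞) :
    ∑' m : ℤ, (if x < (2 : ℝ≥0∞) ^ (m : ℝ) then (2 : ℝ≥0∞) ^ (-(m : ℝ) * δ) else 0) ≤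
      geomConst δ * x ^ (-δ) := by
  rcases eq_or_ne x 0 with rfl | h0
  · rw [ENNReal.zero_rpow_of_neg (by linarith), ENNReal.mul_top]
    · exact le_top
    · exact (zero_lt_one.trans_le (one_le_geomConst δ)).ne'
  rcases eq_or_ne x ∞ with rfl | ht
  · simp
  obtain ⟨m₀, h1, h2⟩ := exists_int_two_rpow h0 ht
  rw [tsum_int_ge_eq_tsum_nat (m₀ + 1), mul_comm, ← tsum_two_rpow_nat, ← ENNReal.tsum_mul_left]
  · refine ENNReal.tsum_le_tsum fun n => ?_
    split_ifs
    · have : (-((m₀ + 1 + n : ℤ) : ℝ) * δ) = ((m₀ : ℝ) + 1) * (-δ) + (-(n : ℝ) * δ) := by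
        push_cast; ring
      rw [this, ENNReal.rpow_add _ _ (by simp) (by simp), ENNReal.rpow_mul]
      gcongr ?_ * _
      rw [ENNReal.rpow_neg, ENNReal.rpow_neg]
      exact ENNReal.inv_le_inv.2 (ENNReal.rpow_le_rpow h2.le hδ.le)
    · exact zero_le
  · intro m hm
    rw [if_neg]
    rw [not_lt]
    refine le_trans (ENNReal.rpow_le_rpow_of_exponent_le one_le_two ?_) h1
    exact_mod_cast Int.lt_add_one_iff.1 hm

theorem ENNReal.tsum_rpow_le_rpow_tsum {ι : Type*} (a : ι → ℝ≥0∞) {p : ℝ} (hp : 1 ≤ p) :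
    ∑' i, a i ^ p ≤ (∑' i, a i) ^ p := by
  have key : ∀ x : ℝ≥0∞, x ^ p = x * x ^ (p - 1) := fun x => by
    rcases eq_or_lt_of_le hp with rfl | hp
    · simp
    · conv_lhs => rw [show p = 1 + (p - 1) by ring]
      rw [ENNReal.rpow_add_of_nonneg _ _ zero_le_one (by linarith), ENNReal.rpow_one]
  calc ∑' i, a i ^ p ≤ ∑' i, a i * (∑' i, a i) ^ (p - 1) := by
        refine ENNReal.tsum_le_tsum fun i => ?_
        rw [key]
        exact mul_le_mul_right (ENNReal.rpow_le_rpow (ENNReal.le_tsum i) (by linarith)) _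
    _ = (∑' i, a i) ^ p := by rw [ENNReal.tsum_mul_right, key]

/-! ### Dyadic intervals -/

/-- The dyadic interval `[i 2^m, (i + 1) 2^m)`. -/
def dyadicInterval (m i : ℤ) : Set ℝ := {x | ⌊x / 2 ^ m⌋ = i}

theorem dyadicInterval_eq (m i : ℤ) :
    dyadicInterval m i = Set.Ico ((i : ℝ) * 2 ^ m) ((i + 1) * 2 ^ m) := by
  ext x
  have h : (0 : ℝ) < 2 ^ m := by positivity
  rw [dyadicInterval, Set.mem_ofPred_eq, Int.floor_eq_iff, le_div_iff₀ h, div_lt_iff₀ h, Set.mem_Ico]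

theorem measurableSet_dyadicInterval (m i : ℤ) : MeasurableSet (dyadicInterval m i) := by
  rw [dyadicInterval_eq]; exact measurableSet_Ico

theorem volume_dyadicInterval (m i : ℤ) :
    volume (dyadicInterval m i) = (2 : ℝ≥0∞) ^ (m : ℝ) := by
  rw [dyadicInterval_eq, Real.volume_Ico, ENNReal.rpow_intCast,
    show ((i : ℝ) + 1) * 2 ^ m - i * 2 ^ m = 2 ^ m by ring]
  rw [← Real.rpow_intCast, ← ENNReal.ofReal_rpow_of_pos (by norm_num), ENNReal.rpow_intCast]
  simp

theorem iUnion_dyadicInterval (m : ℤ) : ⋃ i, dyadicInterval m i = Set.univ := by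
  ext x; simp [dyadicInterval]

theorem pairwise_disjoint_dyadicInterval (m : ℤ) :
    Pairwise (Function.onFun Disjoint (dyadicInterval m)) := by
  intro i j hij
  rw [Function.onFun, Set.disjoint_left]
  intro x hx hx'
  exact hij (hx.symm.trans hx')

theorem tsum_setLIntegral_dyadicInterval (m : ℤ) (S : Set ℝ) (hS : MeasurableSet S) (f : ℝ → ℝ≥0∞) :
    ∑' i, ∫⁻ x in dyadicInterval m i ∩ S, f x = ∫⁻ x in S, f x := by
  rw [← lintegral_iUnion]
  · rw [← Set.iUnion_inter, iUnion_dyadicInterval, Set.univ_inter]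
  · exact fun i => (measurableSet_dyadicInterval m i).inter hS
  · intro i j hij
    exact (pairwise_disjoint_dyadicInterval m hij).mono Set.inter_subset_left Set.inter_subset_left

/-- Jensen's inequality on a set of finite measure. -/
theorem setLIntegral_rpow_le {α : Type*} [MeasurableSpace α] {μ : Measure α} {s q : ℝ} (hs : 0 < s)
    (hsq : s ≤ q) (S : Set α) {f : α → ℝ≥0∞} (hf : AEMeasurable f (μ.restrict S)) :
    (∫⁻ x in S, f x ^ s ∂μ) ^ (q / s) ≤ (μ S) ^ (q / s - 1) * ∫⁻ x in S, f x ^ q ∂μ := by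
  rcases eq_or_lt_of_le hsq with rfl | hsq
  · simp [hs.ne']
  have hpq : (q / s).HolderConjugate (q / (q - s)) := by
    rw [Real.holderConjugate_iff]
    constructor
    · rw [lt_div_iff₀ hs]; linarith
    · have : q ≠ 0 := by linarith
      field_simp; ring
  have h := ENNReal.lintegral_mul_le_Lp_mul_Lq (μ.restrict S) hpq (hf.pow_const s)
    (aemeasurable_const (b := (1 : ℝ≥0∞)))
  have hq : 0 < q := hs.trans hsq
  simp only [Pi.mul_apply, mul_one, ← ENNReal.rpow_mul, ENNReal.one_rpow, lintegral_const,
    Measure.restrict_apply_univ, one_mul] at h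
  rw [mul_div_cancel₀ _ hs.ne'] at h
  calc _ ≤ ((∫⁻ x in S, f x ^ q ∂μ) ^ (1 / (q / s)) * μ S ^ (1 / (q / (q - s)))) ^ (q / s) := by
        gcongr
    _ = _ := by
      rw [ENNReal.mul_rpow_of_nonneg _ _ (by positivity), ← ENNReal.rpow_mul, ← ENNReal.rpow_mul,
        mul_comm]
      congr 2
      · field_simp
      · rw [one_div_mul_cancel (by positivity), ENNReal.rpow_one]

/-- For `s < r < 2`, the `L^r` norm controls the sum over all dyadic intervals `I` of
`|I|^(2/r - 2/s) ‖f‖²_{L^s(I)}`. -/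
theorem tsum_dyadic_le {s r : ℝ} (hs : 1 ≤ s) (hsr : s < r) (hr : r < 2) :
    ∃ C : ℝ≥0∞, C ≠ ∞ ∧ ∀ f : ℝ → ℝ≥0∞, Measurable f →
      ∑' m : ℤ, (2 : ℝ≥0∞) ^ ((m : ℝ) * (2 / r - 2 / s)) *
        ∑' i, (∫⁻ x in dyadicInterval m i, f x ^ s) ^ (2 / s) ≤
      C * (∫⁻ x, f x ^ r) ^ (2 / r) := by
  have hs0 : 0 < s := by linarith
  have hr0 : 0 < r := by linarith
  have hδ : 0 < 1 - s / r := by rw [sub_pos, div_lt_one hr0]; exact hsr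
  have hδ' : 0 < 2 / r - 1 := by rw [sub_pos, lt_div_iff₀ hr0]; linarith
  set C₀ : ℝ≥0∞ := (2 : ℝ≥0∞) ^ (2 / s - 1)
  have h2s : 1 ≤ 2 / s := by rw [le_div_iff₀ hs0]; linarith
  refine ⟨C₀ * (geomConst (1 - s / r) ^ (2 / s) + geomConst (2 / r - 1)), ?_, ?_⟩
  · refine ENNReal.mul_ne_top (by simp [C₀]) (ENNReal.add_ne_top.2 ⟨?_, geomConst_ne_top hδ'⟩)
    exact ENNReal.rpow_ne_top_of_nonneg (by positivity) (geomConst_ne_top hδ)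
  intro f hf
  set A := ∫⁻ x, f x ^ r with hA
  rcases eq_or_ne A 0 with h0 | h0
  · have hf0 : f =ᵐ[volume] 0 := by
      have := (lintegral_eq_zero_iff (hf.pow_const r)).1 h0
      filter_upwards [this] with x hx
      simpa [ENNReal.rpow_eq_zero_iff, hr0, hr0.not_gt] using hx
    refine le_of_eq_of_le ?_ zero_le
    rw [ENNReal.tsum_eq_zero]; intro m
    have : ∀ i, (∫⁻ x in dyadicInterval m i, f x ^ s) = 0 := fun i => by
      rw [← lintegral_zero (μ := volume.restrict (dyadicInterval m i))]
      refine lintegral_congr_ae ?_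
      filter_upwards [ae_restrict_of_ae hf0] with x hx
      simp [hx, hs0]
    simp [this, hs0]
  rcases eq_or_ne A ∞ with ht | ht
  · rw [ht, ENNReal.top_rpow_of_pos (by positivity), ENNReal.mul_top]
    · exact le_top
    · refine mul_ne_zero (by simp [C₀]) ?_
      exact (zero_lt_one.trans_le ((one_le_geomConst _).trans le_add_self)).ne'
  have hfin : ∀ᵐ x, f x ≠ ∞ := by
    filter_upwards [ae_lt_top' (hf.pow_const r).aemeasurable ht] with x hx
    intro h
    simp [h, hr0] at hx
  -- at scale `2^m`, the part of `f` above the height `(A / 2^m)^(1/r)`, which is the natural height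
  -- for intervals of that length, is treated differently from the part below
  let P : ℤ → Set ℝ := fun m => {x | A < (2 : ℝ≥0∞) ^ (m : ℝ) * f x ^ r}
  have hP : ∀ m, MeasurableSet (P m) := fun m =>
    measurableSet_lt measurable_const ((hf.pow_const r).const_mul _)
  have hfr : ∀ x, f x ≠ 0 → f x ≠ ∞ → f x ^ r ≠ 0 ∧ f x ^ r ≠ ∞ := fun x h1 h2 =>
    ⟨by simp [ENNReal.rpow_eq_zero_iff, h1, h2], by simp [ENNReal.rpow_eq_top_iff, h1, h2]⟩
  -- above the height: `ℓ¹ ⊆ ℓ^(2/s)`, and a geometric series in `m`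
  have hhigh : ∑' m : ℤ, (2 : ℝ≥0∞) ^ ((m : ℝ) * (2 / r - 2 / s)) *
      ∑' i, (∫⁻ x in dyadicInterval m i ∩ P m, f x ^ s) ^ (2 / s) ≤
      geomConst (1 - s / r) ^ (2 / s) * A ^ (2 / r) := by
    calc _ ≤ ∑' m : ℤ, ((2 : ℝ≥0∞) ^ (-(m : ℝ) * (1 - s / r)) * ∫⁻ x in P m, f x ^ s) ^ (2 / s) := by
          refine ENNReal.tsum_le_tsum fun m => ?_
          rw [ENNReal.mul_rpow_of_nonneg _ _ (by positivity), ← ENNReal.rpow_mul]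
          have : -(m : ℝ) * (1 - s / r) * (2 / s) = (m : ℝ) * (2 / r - 2 / s) := by
            field_simp; ring
          rw [this]
          gcongr
          rw [← tsum_setLIntegral_dyadicInterval m (P m) (hP m)]
          exact ENNReal.tsum_rpow_le_rpow_tsum _ h2s
      _ ≤ (∑' m : ℤ, (2 : ℝ≥0∞) ^ (-(m : ℝ) * (1 - s / r)) * ∫⁻ x in P m, f x ^ s) ^ (2 / s) :=
          ENNReal.tsum_rpow_le_rpow_tsum _ h2s
      _ ≤ (geomConst (1 - s / r) * A ^ (s / r)) ^ (2 / s) := by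
          gcongr
          have h1 : ∀ m : ℤ, (2 : ℝ≥0∞) ^ (-(m : ℝ) * (1 - s / r)) * ∫⁻ x in P m, f x ^ s =
              ∫⁻ x, (if A < (2 : ℝ≥0∞) ^ (m : ℝ) * f x ^ r then
                (2 : ℝ≥0∞) ^ (-(m : ℝ) * (1 - s / r)) else 0) * f x ^ s := fun m => by
            rw [← lintegral_const_mul _ (hf.pow_const s), ← lintegral_indicator (hP m)]
            refine lintegral_congr fun x => ?_
            by_cases hx : A < (2 : ℝ≥0∞) ^ (m : ℝ) * f x ^ r
            · rw [Set.indicator_of_mem (show x ∈ P m from hx), if_pos hx]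
            · rw [Set.indicator_of_notMem (show x ∉ P m from hx), if_neg hx, zero_mul]
          simp_rw [h1]
          rw [← lintegral_tsum]
          swap
          · intro m
            refine (Measurable.mul (Measurable.ite (hP m) measurable_const measurable_const)
              (hf.pow_const s)).aemeasurable
          calc _ ≤ ∫⁻ x, geomConst (1 - s / r) * A ^ (-(1 - s / r)) * f x ^ r := by
                refine lintegral_mono_ae ?_
                filter_upwards [hfin] with x hx
                rw [ENNReal.tsum_mul_right]
                rcases eq_or_ne (f x) 0 with hx0 | hx0
                · simp [hx0, hs0]
                obtain ⟨hr1, hr2⟩ := hfr x hx0 hx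
                have h2 : ∀ m : ℤ, (A < (2 : ℝ≥0∞) ^ (m : ℝ) * f x ^ r) ↔
                    (A / f x ^ r < (2 : ℝ≥0∞) ^ (m : ℝ)) := fun m => by
                  rw [ENNReal.div_lt_iff (Or.inl hr1) (Or.inl hr2)]
                simp_rw [h2]
                refine (mul_le_mul_left (tsum_two_rpow_neg_le hδ _) _).trans (le_of_eq ?_)
                rw [ENNReal.div_eq_inv_mul, ENNReal.mul_rpow_of_ne_top (by simpa using hr1) ht,
                  ENNReal.inv_rpow, ← ENNReal.rpow_neg, ← ENNReal.rpow_mul]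
                have : f x ^ r = f x ^ (r * - -(1 - s / r)) * f x ^ s := by
                  rw [← ENNReal.rpow_add _ _ hx0 hx]
                  congr 1; field_simp; ring
                rw [this]; ring
            _ = _ := by
                rw [lintegral_const_mul _ (hf.pow_const r), ← hA, mul_assoc]
                congr 1
                nth_rewrite 2 [← ENNReal.rpow_one A]
                rw [← ENNReal.rpow_add _ _ h0 ht]
                congr 1; ring
      _ = _ := by
          rw [ENNReal.mul_rpow_of_nonneg _ _ (by positivity), ← ENNReal.rpow_mul]
          congr 2; field_simp
  -- below the height: Jensen's inequality raises the exponent from `s` to `2`, where the sum over the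
  -- intervals is exact
  have hlow : ∑' m : ℤ, (2 : ℝ≥0∞) ^ ((m : ℝ) * (2 / r - 2 / s)) *
      ∑' i, (∫⁻ x in dyadicInterval m i \ P m, f x ^ s) ^ (2 / s) ≤
      geomConst (2 / r - 1) * A ^ (2 / r) := by
    calc _ ≤ ∑' m : ℤ, (2 : ℝ≥0∞) ^ ((m : ℝ) * (2 / r - 1)) * ∫⁻ x in (P m)ᶜ, f x ^ (2 : ℝ) := by
          refine ENNReal.tsum_le_tsum fun m => ?_
          rw [← tsum_setLIntegral_dyadicInterval m (P m)ᶜ (hP m).compl, ← ENNReal.tsum_mul_left,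
            ← ENNReal.tsum_mul_left]
          refine ENNReal.tsum_le_tsum fun i => ?_
          have h1 := setLIntegral_rpow_le (μ := volume) hs0 (by linarith : s ≤ 2)
            (dyadicInterval m i \ P m) (f := f) hf.aemeasurable
          have h2 : volume (dyadicInterval m i \ P m) ≤ (2 : ℝ≥0∞) ^ (m : ℝ) :=
            (measure_mono Set.sdiff_subset).trans (volume_dyadicInterval m i).le
          have h3 : (2 : ℝ≥0∞) ^ ((m : ℝ) * (2 / r - 1)) =
              (2 : ℝ≥0∞) ^ ((m : ℝ) * (2 / r - 2 / s)) * ((2 : ℝ≥0∞) ^ (m : ℝ)) ^ (2 / s - 1) := by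
            rw [← ENNReal.rpow_mul, ← ENNReal.rpow_add _ _ (by simp) (by simp)]
            congr 1; ring
          rw [h3, mul_assoc, ← Set.sdiff_eq]
          gcongr
          refine h1.trans ?_
          gcongr
      _ ≤ ∫⁻ x, geomConst (2 / r - 1) * A ^ (2 / r - 1) * f x ^ r := by
          have h1 : ∀ m : ℤ, (2 : ℝ≥0∞) ^ ((m : ℝ) * (2 / r - 1)) * ∫⁻ x in (P m)ᶜ, f x ^ (2 : ℝ) =
              ∫⁻ x, (if (2 : ℝ≥0∞) ^ (m : ℝ) * f x ^ r ≤ A then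
                (2 : ℝ≥0∞) ^ ((m : ℝ) * (2 / r - 1)) else 0) * f x ^ (2 : ℝ) := fun m => by
            rw [← lintegral_const_mul _ (hf.pow_const _), ← lintegral_indicator (hP m).compl]
            refine lintegral_congr fun x => ?_
            by_cases hx : A < (2 : ℝ≥0∞) ^ (m : ℝ) * f x ^ r
            · rw [Set.indicator_of_notMem (show x ∉ (P m)ᶜ from fun h => h hx),
                if_neg (not_le.2 hx), zero_mul]
            · rw [Set.indicator_of_mem (show x ∈ (P m)ᶜ from hx), if_pos (not_lt.1 hx)]
          simp_rw [h1]
          rw [← lintegral_tsum]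
          swap
          · intro m
            refine (Measurable.mul (Measurable.ite ?_ measurable_const measurable_const)
              (hf.pow_const _)).aemeasurable
            exact measurableSet_le ((hf.pow_const r).const_mul _) measurable_const
          refine lintegral_mono_ae ?_
          filter_upwards [hfin] with x hx
          rw [ENNReal.tsum_mul_right]
          rcases eq_or_ne (f x) 0 with hx0 | hx0
          · simp [hx0]
          obtain ⟨hr1, hr2⟩ := hfr x hx0 hx
          have h2 : ∀ m : ℤ, ((2 : ℝ≥0∞) ^ (m : ℝ) * f x ^ r ≤ A) ↔
              ((2 : ℝ≥0∞) ^ (m : ℝ) ≤ A / f x ^ r) := fun m => by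
            rw [ENNReal.le_div_iff_mul_le (Or.inl hr1) (Or.inl hr2)]
          simp_rw [h2]
          refine (mul_le_mul_left (tsum_two_rpow_le hδ' _) _).trans (le_of_eq ?_)
          rw [ENNReal.div_eq_inv_mul, ENNReal.mul_rpow_of_ne_top (by simpa using hr1) ht,
            ENNReal.inv_rpow, ← ENNReal.rpow_neg, ← ENNReal.rpow_mul]
          have : f x ^ r = f x ^ (r * -(2 / r - 1)) * f x ^ (2 : ℝ) := by
            rw [← ENNReal.rpow_add _ _ hx0 hx]
            congr 1; field_simp; ring
          rw [this]; ring
      _ = _ := by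
          rw [lintegral_const_mul _ (hf.pow_const r), ← hA, mul_assoc]
          congr 1
          nth_rewrite 2 [← ENNReal.rpow_one A]
          rw [← ENNReal.rpow_add _ _ h0 ht]
          congr 1; ring
  calc _ ≤ ∑' m : ℤ, (C₀ * ((2 : ℝ≥0∞) ^ ((m : ℝ) * (2 / r - 2 / s)) *
          ∑' i, (∫⁻ x in dyadicInterval m i ∩ P m, f x ^ s) ^ (2 / s)) +
        C₀ * ((2 : ℝ≥0∞) ^ ((m : ℝ) * (2 / r - 2 / s)) *
          ∑' i, (∫⁻ x in dyadicInterval m i \ P m, f x ^ s) ^ (2 / s))) := by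
        refine ENNReal.tsum_le_tsum fun m => ?_
        rw [← mul_add, ← mul_add, ← ENNReal.tsum_add, mul_left_comm]
        gcongr
        rw [← ENNReal.tsum_mul_left]
        refine ENNReal.tsum_le_tsum fun i => ?_
        rw [← lintegral_inter_add_sdiff (fun x => f x ^ s) (dyadicInterval m i) (hP m)]
        exact ENNReal.rpow_add_le_mul_rpow_add_rpow _ _ h2s
    _ ≤ C₀ * (geomConst (1 - s / r) ^ (2 / s) * A ^ (2 / r)) +
        C₀ * (geomConst (2 / r - 1) * A ^ (2 / r)) := by
        rw [ENNReal.tsum_add, ENNReal.tsum_mul_left, ENNReal.tsum_mul_left]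
        gcongr
    _ = _ := by ring

/-! ### Whitney decomposition of the complement of the diagonal -/

theorem floor_div_two_zpow_succ (x : ℝ) (m : ℤ) : ⌊x / 2 ^ (m + 1)⌋ = ⌊x / 2 ^ m⌋ / 2 := by
  have h : x / 2 ^ (m + 1) = (x / 2 ^ m) / 2 := by
    rw [zpow_add₀ (by norm_num), zpow_one, div_div]
  rw [h]
  set z := x / 2 ^ m
  rw [Int.floor_eq_iff]
  have h1 := Int.floor_le z
  have h2 := Int.lt_floor_add_one z
  have h3 : (((⌊z⌋ / 2 : ℤ) : ℝ)) * 2 ≤ (⌊z⌋ : ℝ) := by exact_mod_cast (by omega)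
  have h4 : (⌊z⌋ : ℝ) + 1 ≤ (((⌊z⌋ / 2 : ℤ) : ℝ)) * 2 + 2 := by exact_mod_cast (by omega)
  constructor <;> linarith

/-- The index set of the Whitney decomposition of `{(x, y) : x ≠ y}`: the triple `(m, i, j)`
stands for the square `[i 2^m, (i + 1) 2^m) × [j 2^m, (j + 1) 2^m)`, whose sides are not adjacent
although their dyadic parents are adjacent or equal. -/
abbrev WhitneyIndex : Type :=
  {w : ℤ × ℤ × ℤ // 2 ≤ |w.2.1 - w.2.2| ∧ |w.2.1 / 2 - w.2.2 / 2| ≤ 1}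

/-- The Whitney square with index `w`. -/
def whitneySquare (w : WhitneyIndex) : Set (ℝ × ℝ) :=
  dyadicInterval w.1.1 w.1.2.1 ×ˢ dyadicInterval w.1.1 w.1.2.2

/-- The square containing `(x, y)` comes from the largest scale at which the dyadic intervals of `x`
and `y` are neither equal nor adjacent. -/
theorem exists_mem_whitneySquare {x y : ℝ} (hxy : x ≠ y) : ∃ w, (x, y) ∈ whitneySquare w := by
  let P : ℤ → Prop := fun m => 2 ≤ |⌊x / 2 ^ m⌋ - ⌊y / 2 ^ m⌋|
  obtain ⟨n, hn⟩ := pow_unbounded_of_one_lt (|x| + |y| + 1) (one_lt_two (α := ℝ))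
  obtain ⟨n', hn'⟩ := pow_unbounded_of_one_lt (3 / |x - y|) (one_lt_two (α := ℝ))
  -- at large scales both intervals touch the origin
  have hbd : ∀ m : ℤ, P m → m ≤ n := by
    intro m hm
    by_contra! hlt
    have h1 : (2 : ℝ) ^ n < 2 ^ m := by
      rw [← zpow_natCast]; exact zpow_lt_zpow_right₀ one_lt_two hlt
    have h0 : (0 : ℝ) < 2 ^ m := by positivity
    have key : ∀ u : ℝ, |u| < 2 ^ m → ⌊u / 2 ^ m⌋ = 0 ∨ ⌊u / 2 ^ m⌋ = -1 := by
      intro u hu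
      rw [abs_lt] at hu
      have h2 : -1 < u / 2 ^ m := by rw [lt_div_iff₀ h0]; linarith
      have h3 : u / 2 ^ m < 1 := by rw [div_lt_iff₀ h0]; linarith
      have h4 : (-1 : ℤ) ≤ ⌊u / 2 ^ m⌋ := Int.le_floor.2 (by push_cast; linarith)
      have h5 : ⌊u / 2 ^ m⌋ < 1 := Int.floor_lt.2 (by push_cast; linarith)
      omega
    have hx := key x (by linarith [abs_nonneg y])
    have hy := key y (by linarith [abs_nonneg x])
    have hm' : 2 ≤ |⌊x / 2 ^ m⌋ - ⌊y / 2 ^ m⌋| := hm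
    rw [le_abs] at hm'
    omega
  have hex : P (-n') := by
    have h0 : (0 : ℝ) < |x - y| := abs_pos.2 (sub_ne_zero.2 hxy)
    rw [div_lt_iff₀ h0] at hn'
    have h1 : |x / 2 ^ (-n' : ℤ) - y / 2 ^ (-n' : ℤ)| = 2 ^ n' * |x - y| := by
      rw [zpow_neg, zpow_natCast, div_inv_eq_mul, div_inv_eq_mul, ← sub_mul, abs_mul, mul_comm]
      simp
    rw [← h1] at hn'
    change 2 ≤ |⌊x / 2 ^ (-n' : ℤ)⌋ - ⌊y / 2 ^ (-n' : ℤ)⌋|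
    by_contra! hlt
    have h2 : (|⌊x / 2 ^ (-n' : ℤ)⌋ - ⌊y / 2 ^ (-n' : ℤ)⌋| : ℝ) < 2 := by exact_mod_cast hlt
    have h3 := Int.floor_le (x / 2 ^ (-n' : ℤ))
    have h4 := Int.lt_floor_add_one (x / 2 ^ (-n' : ℤ))
    have h5 := Int.floor_le (y / 2 ^ (-n' : ℤ))
    have h6 := Int.lt_floor_add_one (y / 2 ^ (-n' : ℤ))
    rw [abs_lt] at h2
    rw [lt_abs] at hn'
    rcases hn' with h | h <;> linarith
  obtain ⟨m, hm, hmax⟩ := Int.exists_greatest_of_bdd (P := P) ⟨n, hbd⟩ ⟨_, hex⟩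
  refine ⟨⟨(m, ⌊x / 2 ^ m⌋, ⌊y / 2 ^ m⌋), hm, ?_⟩, rfl, rfl⟩
  simp only
  rw [← floor_div_two_zpow_succ, ← floor_div_two_zpow_succ]
  by_contra! hlt
  have := hmax (m + 1) hlt
  omega

theorem pairwise_disjoint_whitneySquare : Pairwise (Function.onFun Disjoint whitneySquare) := by
  intro v w hvw
  rw [Function.onFun, Set.disjoint_left]
  rintro ⟨x, y⟩ ⟨h1, h2⟩ ⟨h3, h4⟩
  refine hvw ?_
  -- if the dyadic intervals of `x` and `y` touch, so do their ancestors
  have hmono : ∀ m m' : ℤ, m ≤ m' → |⌊x / 2 ^ m⌋ - ⌊y / 2 ^ m⌋| ≤ 1 →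
      |⌊x / 2 ^ m'⌋ - ⌊y / 2 ^ m'⌋| ≤ 1 := by
    intro m m' hmm' h
    induction m', hmm' using Int.leInduction with
    | base => exact h
    | succ n _ ih =>
      rw [floor_div_two_zpow_succ, floor_div_two_zpow_succ]
      rw [abs_le] at ih ⊢
      omega
  obtain ⟨⟨m, i, j⟩, ha, hb⟩ := v
  obtain ⟨⟨m', i', j'⟩, ha', hb'⟩ := w
  simp only [dyadicInterval, Set.mem_ofPred_eq] at h1 h2 h3 h4 ha hb ha' hb'
  have hmm : m = m' := by
    rw [← h1, ← h2, ← floor_div_two_zpow_succ, ← floor_div_two_zpow_succ] at hb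
    rw [← h3, ← h4, ← floor_div_two_zpow_succ, ← floor_div_two_zpow_succ] at hb'
    rw [← h1, ← h2] at ha
    rw [← h3, ← h4] at ha'
    by_contra hne
    rcases lt_or_gt_of_ne hne with hlt | hlt
    · have := hmono (m + 1) m' hlt hb
      omega
    · have := hmono (m' + 1) m hlt hb'
      omega
  subst hmm
  simp [← h1, ← h2, ← h3, ← h4]

theorem measurableSet_whitneySquare (w : WhitneyIndex) : MeasurableSet (whitneySquare w) :=
  (measurableSet_dyadicInterval _ _).prod (measurableSet_dyadicInterval _ _)

theorem two_zpow_le_of_mem_whitneySquare {x y : ℝ} {w : WhitneyIndex}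
    (h : (x, y) ∈ whitneySquare w) : (2 : ℝ) ^ w.1.1 ≤ |x - y| := by
  obtain ⟨⟨m, i, j⟩, ha, hb⟩ := w
  obtain ⟨h1, h2⟩ := h
  simp only [dyadicInterval_eq, Set.mem_Ico] at h1 h2 ha ⊢
  have h0 : (0 : ℝ) < 2 ^ m := by positivity
  rw [le_abs] at ha ⊢
  rcases ha with ha | ha
  · left
    have : (2 : ℝ) ≤ i - j := by exact_mod_cast ha
    nlinarith
  · right
    have : (2 : ℝ) ≤ -(i - j) := by exact_mod_cast ha
    nlinarith

theorem WhitneyIndex.sub_mem (w : WhitneyIndex) :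
    w.1.2.2 - w.1.2.1 ∈ ({-3, -2, 2, 3} : Finset ℤ) := by
  obtain ⟨⟨m, i, j⟩, ha, hb⟩ := w
  simp only [Finset.mem_insert, Finset.mem_singleton] at ha hb ⊢
  rw [le_abs] at ha
  rw [abs_le] at hb
  omega

theorem tsum_whitneyIndex_le (g : ℤ → ℤ → ℤ → ℝ≥0∞) :
    ∑' w : WhitneyIndex, g w.1.1 w.1.2.1 w.1.2.2 ≤
      ∑ j ∈ ({-3, -2, 2, 3} : Finset ℤ), ∑' m, ∑' i, g m i (i + j) := by
  set J : Finset ℤ := {-3, -2, 2, 3} with hJ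
  let φ : WhitneyIndex → J × ℤ × ℤ := fun w =>
    (⟨w.1.2.2 - w.1.2.1, w.sub_mem⟩, w.1.1, w.1.2.1)
  have hφ : Function.Injective φ := by
    rintro ⟨⟨m, i, j⟩, _⟩ ⟨⟨m', i', j'⟩, _⟩ h
    simp only [φ, Prod.mk.injEq, Subtype.mk.injEq] at h ⊢
    omega
  calc _ = ∑' w, (fun p : J × ℤ × ℤ => g p.2.1 p.2.2 (p.2.2 + p.1)) (φ w) := by
        refine tsum_congr fun w => ?_
        simp [φ]
    _ ≤ ∑' p : J × ℤ × ℤ, g p.2.1 p.2.2 (p.2.2 + p.1) :=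
        ENNReal.tsum_comp_le_tsum_of_injective hφ _
    _ = ∑' j : J, ∑' m, ∑' i, g m i (i + j) := by
        rw [ENNReal.tsum_prod']
        refine tsum_congr fun j => ?_
        rw [ENNReal.tsum_prod']
    _ = _ := by
        rw [tsum_fintype, Finset.sum_coe_sort J fun j => ∑' m, ∑' i, g m i (i + j)]

/-- Off-diagonal form of `tsum_dyadic_le`: the sum over the Whitney squares `I × J` of
`|I|^(2/r - 2/s) ‖f‖_{L^s(I)} ‖f‖_{L^s(J)}` is controlled by `‖f‖²_{L^r}`. -/
theorem tsum_whitney_le {s r : ℝ} (hs : 1 ≤ s) (hsr : s < r) (hr : r < 2) :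
    ∃ C : ℝ≥0∞, C ≠ ∞ ∧ ∀ f : ℝ → ℝ≥0∞, Measurable f →
      ∑' w : WhitneyIndex, (2 : ℝ≥0∞) ^ ((w.1.1 : ℝ) * (2 / r - 2 / s)) *
        ((∫⁻ x in dyadicInterval w.1.1 w.1.2.1, f x ^ s) ^ (1 / s) *
          (∫⁻ x in dyadicInterval w.1.1 w.1.2.2, f x ^ s) ^ (1 / s)) ≤
      C * (∫⁻ x, f x ^ r) ^ (2 / r) := by
  obtain ⟨C, hC, h⟩ := tsum_dyadic_le hs hsr hr
  refine ⟨8 * C, ENNReal.mul_ne_top (by simp) hC, fun f hf => ?_⟩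
  set b : ℤ → ℤ → ℝ≥0∞ := fun m i => ∫⁻ x in dyadicInterval m i, f x ^ s
  set S := C * (∫⁻ x, f x ^ r) ^ (2 / r)
  have hS : ∑' m : ℤ, ∑' i, (2 : ℝ≥0∞) ^ ((m : ℝ) * (2 / r - 2 / s)) * b m i ^ (2 / s) ≤ S := by
    refine le_of_eq_of_le ?_ (h f hf)
    refine tsum_congr fun m => ?_
    rw [ENNReal.tsum_mul_left]
  have hab : ∀ a c : ℝ≥0∞, a ^ (1 / s) * c ^ (1 / s) ≤ a ^ (2 / s) + c ^ (2 / s) := by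
    intro a c
    have h2 : ∀ a : ℝ≥0∞, a ^ (2 / s) = a ^ (1 / s) * a ^ (1 / s) := fun a => by
      rw [← ENNReal.rpow_add_of_nonneg _ _ (by positivity) (by positivity)]
      congr 1; ring
    rw [h2, h2]
    rcases le_total a c with hac | hac
    · refine le_trans ?_ le_add_self
      gcongr
    · refine le_trans ?_ le_self_add
      gcongr
  calc _ ≤ ∑' w : WhitneyIndex, (2 : ℝ≥0∞) ^ ((w.1.1 : ℝ) * (2 / r - 2 / s)) *
        (b w.1.1 w.1.2.1 ^ (2 / s) + b w.1.1 w.1.2.2 ^ (2 / s)) := by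
        refine ENNReal.tsum_le_tsum fun w => ?_
        gcongr
        exact hab _ _
    _ ≤ ∑ j ∈ ({-3, -2, 2, 3} : Finset ℤ), ∑' m : ℤ, ∑' i : ℤ,
          (2 : ℝ≥0∞) ^ ((m : ℝ) * (2 / r - 2 / s)) * (b m i ^ (2 / s) + b m (i + j) ^ (2 / s)) :=
        tsum_whitneyIndex_le fun m i j =>
          (2 : ℝ≥0∞) ^ ((m : ℝ) * (2 / r - 2 / s)) * (b m i ^ (2 / s) + b m j ^ (2 / s))
    _ ≤ ∑ j ∈ ({-3, -2, 2, 3} : Finset ℤ), 2 * S := by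
        refine Finset.sum_le_sum fun j _ => ?_
        simp_rw [mul_add, ENNReal.tsum_add]
        rw [two_mul]
        refine add_le_add hS (le_of_eq_of_le ?_ hS)
        refine tsum_congr fun m => ?_
        exact (Equiv.addRight j).tsum_eq
          fun i => (2 : ℝ≥0∞) ^ ((m : ℝ) * (2 / r - 2 / s)) * b m i ^ (2 / s)
    _ = _ := by
        simp only [Finset.sum_const]
        rw [show ({-3, -2, 2, 3} : Finset ℤ).card = 4 by decide, nsmul_eq_mul]
        simp only [S]
        push_cast
        ring

/-- The Hardy-Littlewood-Sobolev inequality on the line, in the symmetric case: on each Whitney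
square the kernel is comparable to a power of the side, so that `tsum_whitney_le` with `s = 1`
applies. -/
theorem lintegral_lintegral_abs_sub_rpow_le {r : ℝ} (hr1 : 1 < r) (hr : r < 2) :
    ∃ C : ℝ≥0∞, C ≠ ∞ ∧ ∀ f : ℝ → ℝ≥0∞, Measurable f →
      ∫⁻ x, ∫⁻ y, ENNReal.ofReal |x - y| ^ (2 / r - 2) * (f x * f y) ≤
        C * (∫⁻ x, f x ^ r) ^ (2 / r) := by
  obtain ⟨C, hC, h⟩ := tsum_whitney_le le_rfl hr1 hr
  refine ⟨C, hC, fun f hf => le_trans ?_ (h f hf)⟩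
  have hneg : 2 / r - 2 ≤ 0 := by
    rw [sub_nonpos, div_le_iff₀ (by linarith)]; linarith
  set k : ℝ × ℝ → ℝ≥0∞ := fun z => ENNReal.ofReal |z.1 - z.2| ^ (2 / r - 2) * (f z.1 * f z.2)
  have hk : Measurable k := by
    refine Measurable.mul ?_ ((hf.comp measurable_fst).mul (hf.comp measurable_snd))
    refine Measurable.pow_const ?_ _
    exact ENNReal.measurable_ofReal.comp (by fun_prop)
  have hcover : ∀ x : ℝ, ∀ᵐ y, (x, y) ∈ ⋃ w, whitneySquare w := by
    intro x
    filter_upwards [measure_eq_zero_iff_ae_notMem.1 (measure_singleton (μ := volume) x)] with y hy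
    rw [Set.mem_iUnion]
    exact exists_mem_whitneySquare fun h => hy h.symm
  calc _ = ∫⁻ x, ∫⁻ y, k (x, y) := rfl
    _ ≤ ∫⁻ x, ∫⁻ y, ∑' w, (whitneySquare w).indicator k (x, y) := by
        refine lintegral_mono fun x => lintegral_mono_ae ?_
        filter_upwards [hcover x] with y hy
        obtain ⟨w, hw⟩ := Set.mem_iUnion.1 hy
        refine le_trans ?_ (ENNReal.le_tsum w)
        rw [Set.indicator_of_mem hw]
    _ = ∑' w, ∫⁻ x, ∫⁻ y, (whitneySquare w).indicator k (x, y) := by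
        have hmi : ∀ w, Measurable ((whitneySquare w).indicator k) := fun w =>
          hk.indicator (measurableSet_whitneySquare w)
        rw [← lintegral_tsum]
        · refine lintegral_congr fun x => ?_
          rw [lintegral_tsum]
          exact fun w => ((hmi w).comp measurable_prodMk_left).aemeasurable
        · exact fun w => ((hmi w).lintegral_prod_right').aemeasurable
    _ ≤ _ := by
        refine ENNReal.tsum_le_tsum fun w => ?_
        simp only [ENNReal.rpow_one, div_one]
        set I := dyadicInterval w.1.1 w.1.2.1
        set J := dyadicInterval w.1.1 w.1.2.2
        have hI : MeasurableSet I := measurableSet_dyadicInterval _ _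
        have hJ : MeasurableSet J := measurableSet_dyadicInterval _ _
        calc _ ≤ ∫⁻ x, ∫⁻ y, (2 : ℝ≥0∞) ^ ((w.1.1 : ℝ) * (2 / r - 2)) *
              (I.indicator f x * J.indicator f y) := by
              refine lintegral_mono fun x => lintegral_mono fun y => ?_
              by_cases hw : (x, y) ∈ whitneySquare w
              · rw [Set.indicator_of_mem hw, Set.indicator_of_mem hw.1, Set.indicator_of_mem hw.2]
                simp only [k]
                gcongr ?_ * _
                rw [ENNReal.rpow_mul]
                have h1 := two_zpow_le_of_mem_whitneySquare hw
                have h2 : (2 : ℝ≥0∞) ^ (w.1.1 : ℝ) ≤ ENNReal.ofReal |x - y| := by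
                  refine le_trans (le_of_eq ?_) (ENNReal.ofReal_le_ofReal h1)
                  rw [← Real.rpow_intCast, ← ENNReal.ofReal_rpow_of_pos (by norm_num)]
                  simp
                rw [← neg_neg (2 / r - 2), ENNReal.rpow_neg, ENNReal.rpow_neg (x := 2 ^ _)]
                exact ENNReal.inv_le_inv.2 (ENNReal.rpow_le_rpow h2 (by linarith))
              · rw [Set.indicator_of_notMem hw]
                exact zero_le
          _ = _ := by
              simp_rw [← mul_assoc]
              have hfJ := hf.indicator hJ
              have hfI := hf.indicator hI
              simp_rw [lintegral_const_mul _ hfJ, lintegral_indicator hJ]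
              rw [lintegral_mul_const _ (hfI.const_mul _), lintegral_const_mul _ hfI,
                lintegral_indicator hI]

/-! ### Bilinear interpolation -/

theorem ENNReal.tsum_mul_le_sqrt_mul_sqrt {ι : Type*} (a b : ι → ℝ≥0∞) :
    ∑' i, a i * b i ≤ (∑' i, a i ^ (2 : ℝ)) ^ (1 / 2 : ℝ) * (∑' i, b i ^ (2 : ℝ)) ^ (1 / 2 : ℝ) := by
  let _ : MeasurableSpace ι := ⊤
  have h := ENNReal.lintegral_mul_le_Lp_mul_Lq (Measure.count : Measure ι) Real.HolderConjugate.two_two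
    (f := a) (g := b) (measurable_from_top).aemeasurable (measurable_from_top).aemeasurable
  simpa [lintegral_count' measurable_from_top] using h

theorem ENNReal.tsum_rpow_mul_rpow_le {ι : Type*} (a b : ι → ℝ≥0∞) {q : ℝ} (hq : 0 < q) (hq2 : q ≤ 2) :
    ∑' i, a i ^ (1 / q) * b i ^ (1 / q) ≤ (∑' i, a i) ^ (1 / q) * (∑' i, b i) ^ (1 / q) := by
  have key : ∀ c : ι → ℝ≥0∞, (∑' i, (c i ^ (1 / q)) ^ (2 : ℝ)) ^ (1 / 2 : ℝ) ≤ (∑' i, c i) ^ (1 / q) := by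
    intro c
    calc _ ≤ ((∑' i, c i) ^ (2 / q)) ^ (1 / 2 : ℝ) := by
          gcongr
          refine le_trans (le_of_eq ?_)
            (ENNReal.tsum_rpow_le_rpow_tsum c (p := 2 / q) (by rw [le_div_iff₀ hq]; linarith))
          refine tsum_congr fun i => ?_
          rw [← ENNReal.rpow_mul]; congr 1; ring
      _ = _ := by
          rw [← ENNReal.rpow_mul]; congr 1; ring
  exact (ENNReal.tsum_mul_le_sqrt_mul_sqrt _ _).trans (mul_le_mul' (key a) (key b))

theorem enorm_indicator_rpow {α : Type*} (S : Set α) (F : α → ℂ) {p : ℝ} (hp : 0 < p) (x : α) :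
    ‖S.indicator F x‖ₑ ^ p = S.indicator (fun x => ‖F x‖ₑ ^ p) x := by
  by_cases hx : x ∈ S <;> simp [hx, hp]

theorem lintegral_enorm_indicator_rpow {α : Type*} [MeasurableSpace α] (μ : Measure α) {S : Set α}
    (hS : MeasurableSet S) (F : α → ℂ) {p : ℝ} (hp : 0 < p) :
    ∫⁻ x, ‖S.indicator F x‖ₑ ^ p ∂μ = ∫⁻ x in S, ‖F x‖ₑ ^ p ∂μ := by
  simp_rw [enorm_indicator_rpow S F hp, lintegral_indicator hS]

theorem lintegral_enorm_indicator {α : Type*} [MeasurableSpace α] (μ : Measure α) {S : Set α}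
    (hS : MeasurableSet S) (F : α → ℂ) :
    ∫⁻ x, ‖S.indicator F x‖ₑ ∂μ = ∫⁻ x in S, ‖F x‖ₑ ∂μ := by
  simpa using lintegral_enorm_indicator_rpow μ hS F one_pos

theorem lintegral_enorm_eq_zero_of_rpow {α : Type*} [MeasurableSpace α] (μ : Measure α) {r : ℝ}
    (hr : 0 < r) {F : α → ℂ} (hF : Measurable F) (h : ∫⁻ x, ‖F x‖ₑ ^ r ∂μ = 0) :
    ∫⁻ x, ‖F x‖ₑ ∂μ = 0 := by
  rw [lintegral_eq_zero_iff (hF.enorm.pow_const r)] at h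
  rw [lintegral_eq_zero_iff hF.enorm]
  filter_upwards [h] with x hx
  simpa [ENNReal.rpow_eq_zero_iff, hr, hr.not_gt] using hx

/-- The set where `|F|` has size between `2^m` and `2^(m+1)`. -/
def levelSet {α : Type*} (F : α → ℂ) (m : ℤ) : Set α :=
  {x | (2 : ℝ≥0∞) ^ (m : ℝ) ≤ ‖F x‖ₑ ∧ ‖F x‖ₑ < (2 : ℝ≥0∞) ^ ((m : ℝ) + 1)}

theorem measurableSet_levelSet {α : Type*} [MeasurableSpace α] {F : α → ℂ} (hF : Measurable F)
    (m : ℤ) : MeasurableSet (levelSet F m) :=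
  (measurableSet_le measurable_const hF.enorm).inter (measurableSet_lt hF.enorm measurable_const)

theorem pairwise_disjoint_levelSet {α : Type*} (F : α → ℂ) :
    Pairwise (Function.onFun Disjoint (levelSet F)) := by
  have key : ∀ m m' : ℤ, m < m' → Disjoint (levelSet F m) (levelSet F m') := by
    intro m m' h
    rw [Set.disjoint_left]
    rintro x ⟨_, h1⟩ ⟨h2, _⟩
    refine absurd (h1.trans_le (le_trans ?_ h2)) (lt_irrefl _)
    refine ENNReal.rpow_le_rpow_of_exponent_le one_le_two ?_
    exact_mod_cast h
  intro m m' h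
  rcases lt_or_gt_of_ne h with h | h
  · exact key _ _ h
  · exact (key _ _ h).symm

theorem exists_mem_levelSet {α : Type*} {F : α → ℂ} {x : α} (hx : F x ≠ 0) :
    ∃ m, x ∈ levelSet F m :=
  exists_int_two_rpow (by simpa using hx) (by simp)

/-- A functional that is subadditive and controlled by the `L¹` norm is countably subadditive
along the decomposition of a function into its level sets. -/
theorem le_tsum_levelSet {α : Type*} [MeasurableSpace α] {μ : Measure α} (Φ : (α → ℂ) → ℝ≥0∞)
    (hadd : ∀ F F', Measurable F → Integrable F μ → Measurable F' → Integrable F' μ →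
      Φ (F + F') ≤ Φ F + Φ F') {D : ℝ≥0∞} (hD : D ≠ ∞)
    (hbd : ∀ F, Measurable F → Integrable F μ → Φ F ≤ D * ∫⁻ x, ‖F x‖ₑ ∂μ)
    {F : α → ℂ} (hF : Measurable F) (hFi : Integrable F μ) :
    Φ F ≤ ∑' m : ℤ, Φ ((levelSet F m).indicator F) := by
  let I : ℕ → Finset ℤ := fun n => Finset.Ico (-(n : ℤ)) n
  let U : ℕ → Set α := fun n => ⋃ m ∈ I n, levelSet F m
  have hU : ∀ n, MeasurableSet (U n) := fun n =>
    Finset.measurableSet_biUnion _ fun m _ => measurableSet_levelSet hF m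
  have hfin : ∀ s : Finset ℤ, Φ (∑ m ∈ s, (levelSet F m).indicator F) ≤
      ∑ m ∈ s, Φ ((levelSet F m).indicator F) := by
    intro s
    induction s using Finset.induction_on with
    | empty =>
      simpa using hbd 0 measurable_const (integrable_zero _ _ _)
    | insert a s ha ih =>
      rw [Finset.sum_insert ha, Finset.sum_insert ha]
      refine (hadd _ _ (hF.indicator (measurableSet_levelSet hF a))
        (hFi.indicator (measurableSet_levelSet hF a)) ?_ ?_).trans (add_le_add_right ih _)
      · rw [Finset.sum_fn]; exact Finset.measurable_sum _ fun m _ => hF.indicator (measurableSet_levelSet hF m)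
      · rw [Finset.sum_fn]; exact integrable_finsetSum _ fun m _ => hFi.indicator (measurableSet_levelSet hF m)
  -- finitely many levels, plus a remainder which is small in `L¹`
  have hstep : ∀ n, Φ F ≤ D * ∫⁻ x, ‖(U n)ᶜ.indicator F x‖ₑ ∂μ +
      ∑' m : ℤ, Φ ((levelSet F m).indicator F) := by
    intro n
    have hdec : F = (U n)ᶜ.indicator F + ∑ m ∈ I n, (levelSet F m).indicator F := by
      have h1 : (U n).indicator F = ∑ m ∈ I n, (levelSet F m).indicator F := by
        ext x
        rw [Finset.sum_apply]
        exact congrFun (Finset.indicator_biUnion (I n) (levelSet F)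
          (fun i _ j _ hij => pairwise_disjoint_levelSet F hij) (f := F)) x
      rw [← h1, Set.indicator_compl_add_self]
    calc Φ F = Φ ((U n)ᶜ.indicator F + ∑ m ∈ I n, (levelSet F m).indicator F) := by rw [← hdec]
      _ ≤ _ := by
        refine (hadd _ _ (hF.indicator (hU n).compl) (hFi.indicator (hU n).compl) ?_ ?_).trans ?_
        · rw [Finset.sum_fn]; exact Finset.measurable_sum _ fun m _ => hF.indicator (measurableSet_levelSet hF m)
        · rw [Finset.sum_fn]; exact integrable_finsetSum _ fun m _ => hFi.indicator (measurableSet_levelSet hF m)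
        · refine add_le_add (hbd _ (hF.indicator (hU n).compl) (hFi.indicator (hU n).compl)) ?_
          exact (hfin _).trans (ENNReal.sum_le_tsum _)
  have hlim : Filter.Tendsto (fun n => ∫⁻ x, ‖(U n)ᶜ.indicator F x‖ₑ ∂μ) Filter.atTop
      (nhds (∫⁻ _, 0 ∂μ)) := by
    refine tendsto_lintegral_of_dominated_convergence (fun x => ‖F x‖ₑ) ?_ ?_ hFi.2.ne ?_
    · exact fun n => (hF.indicator (hU n).compl).enorm
    · refine fun n => Filter.Eventually.of_forall fun x => ?_
      exact enorm_indicator_le_enorm_self _ _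
    · refine Filter.Eventually.of_forall fun x => ?_
      refine tendsto_const_nhds.congr' ?_
      by_cases hx : F x = 0
      · refine Filter.Eventually.of_forall fun n => ?_
        by_cases h : x ∈ (U n)ᶜ <;> simp [h, hx]
      · obtain ⟨m, hm⟩ := exists_mem_levelSet hx
        filter_upwards [Filter.eventually_gt_atTop m.natAbs] with n hn
        rw [Set.indicator_of_notMem, enorm_zero]
        refine not_not.2 (Set.mem_biUnion (x := m) ?_ hm)
        simp only [I, Finset.coe_Ico, Set.mem_Ico]
        omega
  rw [lintegral_zero] at hlim
  have hlim2 : Filter.Tendsto (fun n => D * ∫⁻ x, ‖(U n)ᶜ.indicator F x‖ₑ ∂μ +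
      ∑' m : ℤ, Φ ((levelSet F m).indicator F)) Filter.atTop
      (nhds (D * 0 + ∑' m : ℤ, Φ ((levelSet F m).indicator F))) :=
    (ENNReal.Tendsto.const_mul hlim (Or.inr hD)).add tendsto_const_nhds
  rw [mul_zero, zero_add] at hlim2
  exact ge_of_tendsto' hlim2 hstep

/-- The constant of `bilinear_interpolation`. -/
noncomputable def interpConst (r b : ℝ) : ℝ≥0∞ :=
  1 + ((2 : ℝ≥0∞) ^ (b - r) * geomConst (b - r)) ^ (1 / b)

theorem interpConst_ne_top {r b : ℝ} (hr : 0 < r) (hrb : r < b) : interpConst r b ≠ ∞ := by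
  have hb : 0 < b := hr.trans hrb
  refine ENNReal.add_ne_top.2 ⟨by simp, ENNReal.rpow_ne_top_of_nonneg (by positivity) ?_⟩
  exact ENNReal.mul_ne_top (by simp) (geomConst_ne_top (by linarith))

/-- Real interpolation for a bilinear functional: bounds on `L¹ × L¹` and on `L^b × L^b`, `b ≤ 2`,
give the intermediate bound on `L^r × L^r`. -/
theorem bilinear_interpolation {α β : Type*} [MeasurableSpace α] [MeasurableSpace β]
    {μ : Measure α} {ν : Measure β} (Φ : (α → ℂ) → (β → ℂ) → ℝ≥0∞)
    (haddl : ∀ F F' G, Measurable F → Integrable F μ → Measurable F' → Integrable F' μ →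
      Measurable G → Integrable G ν → Φ (F + F') G ≤ Φ F G + Φ F' G)
    (haddr : ∀ F G G', Measurable F → Integrable F μ → Measurable G → Integrable G ν →
      Measurable G' → Integrable G' ν → Φ F (G + G') ≤ Φ F G + Φ F G')
    {r b : ℝ} (hr : 1 < r) (hrb : r < b) (hb : b ≤ 2) {D M : ℝ≥0∞}
    (hD0 : D ≠ 0) (hD : D ≠ ∞) (hM0 : M ≠ 0) (hM : M ≠ ∞)
    (h1 : ∀ F G, Measurable F → Integrable F μ → Measurable G → Integrable G ν →
      Φ F G ≤ D * (∫⁻ x, ‖F x‖ₑ ∂μ) * (∫⁻ y, ‖G y‖ₑ ∂ν))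
    (h2 : ∀ F G, Measurable F → Integrable F μ → (∃ c : ℝ, ∀ x, ‖F x‖ ≤ c) →
      Measurable G → Integrable G ν → (∃ c : ℝ, ∀ y, ‖G y‖ ≤ c) →
      Φ F G ≤ M * (∫⁻ x, ‖F x‖ₑ ^ b ∂μ) ^ (1 / b) * (∫⁻ y, ‖G y‖ₑ ^ b ∂ν) ^ (1 / b))
    {F : α → ℂ} {G : β → ℂ} (hF : Measurable F) (hFi : Integrable F μ) (hG : Measurable G)
    (hGi : Integrable G ν) :
    Φ F G ≤ interpConst r b * (D ^ ((b - r) / (r * (b - 1))) * M ^ (1 - (b - r) / (r * (b - 1)))) *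
      ((∫⁻ x, ‖F x‖ₑ ^ r ∂μ) ^ (1 / r) * (∫⁻ y, ‖G y‖ₑ ^ r ∂ν) ^ (1 / r)) := by
  have hr0 : 0 < r := by linarith
  have hb0 : 0 < b := by linarith
  have hb1 : 0 < b - 1 := by linarith
  set θ := (b - r) / (r * (b - 1)) with hθ
  set A := ∫⁻ x, ‖F x‖ₑ ^ r ∂μ with hA
  set B := ∫⁻ y, ‖G y‖ₑ ^ r ∂ν with hB
  rcases eq_or_ne A 0 with hA0 | hA0
  · have h := h1 F G hF hFi hG hGi
    rw [lintegral_enorm_eq_zero_of_rpow μ hr0 hF hA0] at h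
    simp only [mul_zero, zero_mul, nonpos_iff_eq_zero] at h
    rw [h]; exact zero_le
  rcases eq_or_ne B 0 with hB0 | hB0
  · have h := h1 F G hF hFi hG hGi
    rw [lintegral_enorm_eq_zero_of_rpow ν hr0 hG hB0] at h
    simp only [mul_zero, nonpos_iff_eq_zero] at h
    rw [h]; exact zero_le
  have hDM0 : ∀ x y : ℝ, D ^ x * M ^ y ≠ 0 := fun x y =>
    mul_ne_zero (ENNReal.rpow_pos (pos_iff_ne_zero.2 hD0) hD).ne'
      (ENNReal.rpow_pos (pos_iff_ne_zero.2 hM0) hM).ne'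
  have hI0 : interpConst r b ≠ 0 := (zero_lt_one.trans_le le_self_add).ne'
  by_cases htop : A = ∞ ∨ B = ∞
  · have : A ^ (1 / r) * B ^ (1 / r) = ∞ := by
      rcases htop with h | h
      · rw [h, ENNReal.top_rpow_of_pos (by positivity), ENNReal.top_mul]
        rw [ne_eq, ENNReal.rpow_eq_zero_iff]; simp [hB0, hr0.not_gt]
      · rw [h, ENNReal.top_rpow_of_pos (by positivity), ENNReal.mul_top]
        rw [ne_eq, ENNReal.rpow_eq_zero_iff]; simp [hA0, hr0.not_gt]
    rw [this, ENNReal.mul_top (mul_ne_zero hI0 (hDM0 _ _))]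
    exact le_top
  obtain ⟨hAt, hBt⟩ := not_or.1 htop
  have hAB0 : A * B ≠ 0 := mul_ne_zero hA0 hB0
  have hABt : A * B ≠ ∞ := ENNReal.mul_ne_top hAt hBt
  have hDM : D / M ≠ 0 := by simp [ENNReal.div_eq_zero_iff, hD0, hM]
  have hDMt : D / M ≠ ∞ := by simp [ENNReal.div_eq_top, hD, hM0]
  -- the height that balances the two estimates
  set κ : ℝ≥0∞ := (D / M) ^ (b / (r * (b - 1))) * (A * B) ^ (1 / r) with hκ
  have hκ0 : κ ≠ 0 := mul_ne_zero (ENNReal.rpow_pos (pos_iff_ne_zero.2 hDM) hDMt).ne'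
    (ENNReal.rpow_pos (pos_iff_ne_zero.2 hAB0) hABt).ne'
  have hκt : κ ≠ ∞ := ENNReal.mul_ne_top (ENNReal.rpow_ne_top_of_ne_zero hDM hDMt)
    (ENNReal.rpow_ne_top_of_ne_zero hAB0 hABt)
  let S : ℤ → Set α := levelSet F
  have hS : ∀ m, MeasurableSet (S m) := measurableSet_levelSet hF
  let Q : ℤ → Set β := fun m => {y | κ < (2 : ℝ≥0∞) ^ (m : ℝ) * ‖G y‖ₑ}
  have hQ : ∀ m, MeasurableSet (Q m) := fun m =>
    measurableSet_lt measurable_const (hG.enorm.const_mul _)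
  let c : ℤ → ℝ≥0∞ := fun m => ∫⁻ x in S m, ‖F x‖ₑ ^ r ∂μ
  have hc : ∑' m, c m ≤ A := by
    rw [← lintegral_iUnion hS (pairwise_disjoint_levelSet F)]
    exact setLIntegral_le_lintegral _ _
  have h2p : ∀ x : ℝ, (2 : ℝ≥0∞) ^ x ≠ 0 := fun x => (ENNReal.rpow_pos (by simp) (by simp)).ne'
  have h2t : ∀ x : ℝ, (2 : ℝ≥0∞) ^ x ≠ ∞ := fun x => ENNReal.rpow_ne_top_of_ne_zero (by simp) (by simp)
  -- at the level `|F| ≈ 2^m`, split `G` at height `κ 2^(-m)`: the `L¹` bound for the large part of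
  -- `G`, the `L^b` bound for the small part
  have hmain : ∀ m, Φ ((S m).indicator F) G ≤ D * κ ^ (1 - r) * B * c m +
      M * (c m ^ (1 / b) * ((2 : ℝ≥0∞) ^ (((m : ℝ) + 1) * (b - r)) *
        ∫⁻ y in (Q m)ᶜ, ‖G y‖ₑ ^ b ∂ν) ^ (1 / b)) := by
    intro m
    have hFm := hF.indicator (hS m)
    have hFmi := hFi.indicator (hS m)
    have hdec : G = (Q m).indicator G + (Q m)ᶜ.indicator G := by
      rw [Set.indicator_self_add_compl]
    calc Φ ((S m).indicator F) G
        = Φ ((S m).indicator F) ((Q m).indicator G + (Q m)ᶜ.indicator G) := by rw [← hdec]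
      _ ≤ _ := haddr _ _ _ hFm hFmi (hG.indicator (hQ m)) (hGi.indicator (hQ m))
          (hG.indicator (hQ m).compl) (hGi.indicator (hQ m).compl)
      _ ≤ _ := by
        refine add_le_add ?_ ?_
        · refine (h1 _ _ hFm hFmi (hG.indicator (hQ m)) (hGi.indicator (hQ m))).trans ?_
          rw [lintegral_enorm_indicator μ (hS m), lintegral_enorm_indicator ν (hQ m)]
          have e1 : ∫⁻ x in S m, ‖F x‖ₑ ∂μ ≤ (2 : ℝ≥0∞) ^ ((m : ℝ) * (1 - r)) * c m := by
            rw [← lintegral_const_mul _ (hF.enorm.pow_const r)]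
            refine setLIntegral_mono' (hS m) fun x hx => ?_
            have h0 : ‖F x‖ₑ ≠ 0 := ((pos_iff_ne_zero.2 (h2p _)).trans_le hx.1).ne'
            calc ‖F x‖ₑ = ‖F x‖ₑ ^ (1 - r) * ‖F x‖ₑ ^ r := by
                  rw [← ENNReal.rpow_add _ _ h0 enorm_ne_top]; simp
              _ ≤ _ := by
                  gcongr ?_ * _
                  rw [ENNReal.rpow_mul, ← neg_sub r 1, ENNReal.rpow_neg, ENNReal.rpow_neg]
                  exact ENNReal.inv_le_inv.2 (ENNReal.rpow_le_rpow hx.1 (by linarith))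
          have e2 : ∫⁻ y in Q m, ‖G y‖ₑ ∂ν ≤
              κ ^ (1 - r) * (2 : ℝ≥0∞) ^ ((m : ℝ) * (r - 1)) * B := by
            have : ∫⁻ y in Q m, κ ^ (1 - r) * (2 : ℝ≥0∞) ^ ((m : ℝ) * (r - 1)) * ‖G y‖ₑ ^ r ∂ν ≤
                κ ^ (1 - r) * (2 : ℝ≥0∞) ^ ((m : ℝ) * (r - 1)) * B := by
              rw [lintegral_const_mul _ (hG.enorm.pow_const r)]
              gcongr
              exact setLIntegral_le_lintegral _ _
            refine le_trans (setLIntegral_mono' (hQ m) fun y hy => ?_) this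
            have hy' : κ < (2 : ℝ≥0∞) ^ (m : ℝ) * ‖G y‖ₑ := hy
            have h0 : ‖G y‖ₑ ≠ 0 := by
              intro h; rw [h, mul_zero] at hy'; exact not_lt_zero hy'
            have e3 : ((2 : ℝ≥0∞) ^ (m : ℝ) * ‖G y‖ₑ) ^ (1 - r) ≤ κ ^ (1 - r) := by
              rw [← neg_sub r 1, ENNReal.rpow_neg, ENNReal.rpow_neg]
              exact ENNReal.inv_le_inv.2 (ENNReal.rpow_le_rpow hy'.le (by linarith))
            calc ‖G y‖ₑ = ((2 : ℝ≥0∞) ^ (m : ℝ) * ‖G y‖ₑ) ^ (1 - r) *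
                    (2 : ℝ≥0∞) ^ ((m : ℝ) * (r - 1)) * ‖G y‖ₑ ^ r := by
                  rw [ENNReal.mul_rpow_of_ne_top (h2t _) enorm_ne_top, ← ENNReal.rpow_mul]
                  have : ‖G y‖ₑ = ‖G y‖ₑ ^ (1 - r) * ‖G y‖ₑ ^ r := by
                    rw [← ENNReal.rpow_add _ _ h0 enorm_ne_top]; simp
                  nth_rewrite 1 [this]
                  have h3 : (2 : ℝ≥0∞) ^ ((m : ℝ) * (1 - r)) * (2 : ℝ≥0∞) ^ ((m : ℝ) * (r - 1)) = 1 := by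
                    rw [← ENNReal.rpow_add _ _ (by simp) (by simp)]
                    rw [show (m : ℝ) * (1 - r) + m * (r - 1) = 0 by ring, ENNReal.rpow_zero]
                  rw [mul_right_comm ((2 : ℝ≥0∞) ^ _), h3, one_mul]
              _ ≤ _ := by gcongr
          calc _ ≤ D * ((2 : ℝ≥0∞) ^ ((m : ℝ) * (1 - r)) * c m) *
                (κ ^ (1 - r) * (2 : ℝ≥0∞) ^ ((m : ℝ) * (r - 1)) * B) := by gcongr
            _ = ((2 : ℝ≥0∞) ^ ((m : ℝ) * (1 - r)) * (2 : ℝ≥0∞) ^ ((m : ℝ) * (r - 1))) *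
                (D * κ ^ (1 - r) * B * c m) := by ring
            _ = _ := by
              rw [← ENNReal.rpow_add _ _ (by simp) (by simp)]
              rw [show (m : ℝ) * (1 - r) + m * (r - 1) = 0 by ring, ENNReal.rpow_zero, one_mul]
        · have hbF : ∃ C : ℝ, ∀ x, ‖(S m).indicator F x‖ ≤ C := by
            refine ⟨((2 : ℝ≥0∞) ^ ((m : ℝ) + 1)).toReal, fun x => ?_⟩
            by_cases hx : x ∈ S m
            · rw [Set.indicator_of_mem hx, ← toReal_enorm]
              exact ENNReal.toReal_mono (h2t _) hx.2.le
            · rw [Set.indicator_of_notMem hx, norm_zero]; exact ENNReal.toReal_nonneg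
          have hbG : ∃ C : ℝ, ∀ x, ‖(Q m)ᶜ.indicator G x‖ ≤ C := by
            refine ⟨(κ / (2 : ℝ≥0∞) ^ (m : ℝ)).toReal, fun x => ?_⟩
            by_cases hx : x ∈ (Q m)ᶜ
            · rw [Set.indicator_of_mem hx, ← toReal_enorm]
              refine ENNReal.toReal_mono (ENNReal.div_ne_top hκt (h2p _)) ?_
              rw [ENNReal.le_div_iff_mul_le (Or.inl (h2p _)) (Or.inl (h2t _)), mul_comm]
              exact not_lt.1 hx
            · rw [Set.indicator_of_notMem hx, norm_zero]; exact ENNReal.toReal_nonneg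
          refine (h2 _ _ hFm hFmi hbF (hG.indicator (hQ m).compl)
            (hGi.indicator (hQ m).compl) hbG).trans ?_
          rw [lintegral_enorm_indicator_rpow μ (hS m) F hb0,
            lintegral_enorm_indicator_rpow ν (hQ m).compl G hb0]
          have e1 : ∫⁻ x in S m, ‖F x‖ₑ ^ b ∂μ ≤ (2 : ℝ≥0∞) ^ (((m : ℝ) + 1) * (b - r)) * c m := by
            rw [← lintegral_const_mul _ (hF.enorm.pow_const r)]
            refine setLIntegral_mono' (hS m) fun x hx => ?_
            have h0 : ‖F x‖ₑ ≠ 0 := ((pos_iff_ne_zero.2 (h2p _)).trans_le hx.1).ne'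
            calc ‖F x‖ₑ ^ b = ‖F x‖ₑ ^ (b - r) * ‖F x‖ₑ ^ r := by
                  rw [← ENNReal.rpow_add _ _ h0 enorm_ne_top]; simp
              _ ≤ _ := by
                  gcongr ?_ * _
                  rw [ENNReal.rpow_mul]
                  exact ENNReal.rpow_le_rpow hx.2.le (by linarith)
          rw [mul_assoc]
          gcongr M * ?_
          calc _ ≤ ((2 : ℝ≥0∞) ^ (((m : ℝ) + 1) * (b - r)) * c m) ^ (1 / b) *
                (∫⁻ y in (Q m)ᶜ, ‖G y‖ₑ ^ b ∂ν) ^ (1 / b) := by gcongr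
            _ = _ := by
              rw [ENNReal.mul_rpow_of_nonneg _ _ (by positivity),
                ENNReal.mul_rpow_of_nonneg _ _ (by positivity)]
              ring
  have hlow : ∑' m : ℤ, ((2 : ℝ≥0∞) ^ (((m : ℝ) + 1) * (b - r)) *
        ∫⁻ y in (Q m)ᶜ, ‖G y‖ₑ ^ b ∂ν) ≤
      (2 : ℝ≥0∞) ^ (b - r) * geomConst (b - r) * κ ^ (b - r) * B := by
    have h3 : ∀ m : ℤ, ((2 : ℝ≥0∞) ^ (((m : ℝ) + 1) * (b - r)) *
        ∫⁻ y in (Q m)ᶜ, ‖G y‖ₑ ^ b ∂ν) = ∫⁻ y, (2 : ℝ≥0∞) ^ (b - r) *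
          (if (2 : ℝ≥0∞) ^ (m : ℝ) * ‖G y‖ₑ ≤ κ then (2 : ℝ≥0∞) ^ ((m : ℝ) * (b - r)) else 0) *
          ‖G y‖ₑ ^ b ∂ν := fun m => by
      rw [← lintegral_const_mul _ (hG.enorm.pow_const _), ← lintegral_indicator (hQ m).compl]
      refine lintegral_congr fun y => ?_
      by_cases hy : κ < (2 : ℝ≥0∞) ^ (m : ℝ) * ‖G y‖ₑ
      · rw [Set.indicator_of_notMem (show y ∉ (Q m)ᶜ from fun h => h hy), if_neg (not_le.2 hy)]
        simp
      · rw [Set.indicator_of_mem (show y ∈ (Q m)ᶜ from hy), if_pos (not_lt.1 hy)]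
        rw [← ENNReal.rpow_add _ _ (by simp) (by simp)]
        congr 2; ring
    simp_rw [h3]
    rw [← lintegral_tsum]
    swap
    · intro m
      refine (Measurable.mul (Measurable.mul measurable_const
        (Measurable.ite ?_ measurable_const measurable_const)) (hG.enorm.pow_const _)).aemeasurable
      exact measurableSet_le (hG.enorm.const_mul _) measurable_const
    rw [hB, ← lintegral_const_mul _ (hG.enorm.pow_const r)]
    refine lintegral_mono fun y => ?_
    rw [ENNReal.tsum_mul_right, ENNReal.tsum_mul_left]
    rcases eq_or_ne (‖G y‖ₑ) 0 with h0 | h0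
    · simp [h0, hb0]
    have h4 : ∀ m : ℤ, ((2 : ℝ≥0∞) ^ (m : ℝ) * ‖G y‖ₑ ≤ κ) ↔
        ((2 : ℝ≥0∞) ^ (m : ℝ) ≤ κ / ‖G y‖ₑ) := fun m => by
      rw [ENNReal.le_div_iff_mul_le (Or.inl h0) (Or.inl enorm_ne_top)]
    simp_rw [h4]
    calc _ ≤ (2 : ℝ≥0∞) ^ (b - r) * (geomConst (b - r) * (κ / ‖G y‖ₑ) ^ (b - r)) * ‖G y‖ₑ ^ b := by
          gcongr
          exact tsum_two_rpow_le (by linarith) _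
      _ = _ := by
          rw [ENNReal.div_rpow_of_nonneg _ _ (by linarith), ENNReal.div_eq_inv_mul,
            ← ENNReal.rpow_neg]
          have : ‖G y‖ₑ ^ r = ‖G y‖ₑ ^ (-(b - r)) * ‖G y‖ₑ ^ b := by
            rw [← ENNReal.rpow_add _ _ h0 enorm_ne_top]; congr 1; ring
          rw [this]; ring
  set E : ℝ≥0∞ := (2 : ℝ≥0∞) ^ (b - r) * geomConst (b - r)
  -- both contributions have the claimed size by the choice of `κ`
  have hone : D * κ ^ (1 - r) * B * A = D ^ θ * M ^ (1 - θ) * (A ^ (1 / r) * B ^ (1 / r)) := by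
    rw [hκ, ENNReal.mul_rpow_of_ne_top (ENNReal.rpow_ne_top_of_ne_zero hDM hDMt)
      (ENNReal.rpow_ne_top_of_ne_zero hAB0 hABt), ← ENNReal.rpow_mul, ← ENNReal.rpow_mul,
      ENNReal.div_eq_inv_mul, ENNReal.mul_rpow_of_ne_top (by simpa using hM0) hD, ENNReal.inv_rpow,
      ← ENNReal.rpow_neg, ← ENNReal.mul_rpow_of_nonneg _ _ (by positivity)]
    have e1 : D ^ θ = D * D ^ (b / (r * (b - 1)) * (1 - r)) := by
      nth_rewrite 2 [← ENNReal.rpow_one D]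
      rw [← ENNReal.rpow_add _ _ hD0 hD]
      congr 1; rw [hθ]; field_simp; ring
    have e2 : (A * B) ^ (1 / r) = (A * B) ^ (1 / r * (1 - r)) * (A * B) := by
      nth_rewrite 3 [← ENNReal.rpow_one (A * B)]
      rw [← ENNReal.rpow_add _ _ hAB0 hABt]
      congr 1; field_simp; ring
    have e3 : 1 - θ = -(b / (r * (b - 1)) * (1 - r)) := by
      rw [hθ]; field_simp; ring
    rw [e1, e2, e3]; ring
  have htwo : M * (A ^ (1 / b) * (E * κ ^ (b - r) * B) ^ (1 / b)) =
      E ^ (1 / b) * (D ^ θ * M ^ (1 - θ)) * (A ^ (1 / r) * B ^ (1 / r)) := by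
    rw [ENNReal.mul_rpow_of_nonneg _ _ (by positivity), ENNReal.mul_rpow_of_nonneg _ _ (by positivity),
      ← ENNReal.rpow_mul]
    rw [hκ, ENNReal.mul_rpow_of_ne_top (ENNReal.rpow_ne_top_of_ne_zero hDM hDMt)
      (ENNReal.rpow_ne_top_of_ne_zero hAB0 hABt), ← ENNReal.rpow_mul, ← ENNReal.rpow_mul,
      ENNReal.div_eq_inv_mul, ENNReal.mul_rpow_of_ne_top (by simpa using hM0) hD, ENNReal.inv_rpow,
      ← ENNReal.rpow_neg, ← ENNReal.mul_rpow_of_nonneg A B (z := 1 / r) (by positivity)]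
    have e0 : b / (r * (b - 1)) * ((b - r) * (1 / b)) = θ := by
      rw [hθ]; field_simp
    have e2 : (A * B) ^ (1 / r) = (A * B) ^ (1 / r * ((b - r) * (1 / b))) *
        (A ^ (1 / b) * B ^ (1 / b)) := by
      rw [← ENNReal.mul_rpow_of_nonneg A B (by positivity), ← ENNReal.rpow_add _ _ hAB0 hABt]
      congr 1; field_simp; ring
    have e3 : M ^ (1 - θ) = M * M ^ (-θ) := by
      nth_rewrite 2 [← ENNReal.rpow_one M]
      rw [← ENNReal.rpow_add _ _ hM0 hM]
      congr 1
    rw [e0, e2, e3]; ring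
  calc Φ F G ≤ ∑' m, Φ ((S m).indicator F) G := by
        refine le_tsum_levelSet (fun F => Φ F G) (fun F F' hF hFi hF' hFi' =>
          haddl F F' G hF hFi hF' hFi' hG hGi) (D := D * ∫⁻ y, ‖G y‖ₑ ∂ν)
          (ENNReal.mul_ne_top hD hGi.2.ne) (fun F hF hFi => ?_) hF hFi
        rw [mul_right_comm]
        exact h1 F G hF hFi hG hGi
    _ ≤ D * κ ^ (1 - r) * B * A + M * (A ^ (1 / b) * (E * κ ^ (b - r) * B) ^ (1 / b)) := by
        refine (ENNReal.tsum_le_tsum hmain).trans ?_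
        rw [ENNReal.tsum_add, ENNReal.tsum_mul_left, ENNReal.tsum_mul_left]
        gcongr
        refine (ENNReal.tsum_rpow_mul_rpow_le _ _ hb0 hb).trans ?_
        gcongr
    _ = _ := by
        rw [hone, htwo, interpConst]; ring

/-! ### The `TT*` method for a bounded family of vectors in a Hilbert space -/

section TTStar

variable {H : Type*} [NormedAddCommGroup H] [InnerProductSpace ℂ H]

theorem enorm_inner_le (v w : H) : ‖inner ℂ v w‖ₑ ≤ ‖v‖ₑ * ‖w‖ₑ := by
  rw [← ofReal_norm, ← ofReal_norm, ← ofReal_norm, ← ENNReal.ofReal_mul (norm_nonneg _)]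
  exact ENNReal.ofReal_le_ofReal (norm_inner_le_norm v w)

theorem enorm_sq_eq_enorm_inner (v : H) : ‖v‖ₑ ^ (2 : ℝ) = ‖inner ℂ v v‖ₑ := by
  rw [inner_self_eq_norm_sq_to_K]
  simp only [enorm_pow]
  rw [ENNReal.rpow_ofNat]
  simp [← ofReal_norm]

variable {α β : Type*} [MeasurableSpace α] [MeasurableSpace β] {μ : Measure α} {ν : Measure β}

theorem integrable_smul_family {e : α → H} (he : StronglyMeasurable e) {c : ℝ} (hc : ∀ x, ‖e x‖ ≤ c)
    {F : α → ℂ} (hF : Integrable F μ) : Integrable (fun x => F x • e x) μ :=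
  hF.smul_bdd c he.aestronglyMeasurable (Filter.Eventually.of_forall hc)

/-- Finite Schur test: the values `⟨e_i, g⟩` are square summable as soon as the rows of the Gram
matrix of the `e_i` have absolute sums at most `M`. -/
theorem sum_norm_inner_sq_le_of_schur {ι : Type*} (s : Finset ι) (e : ι → H) {M : ℝ} (hM0 : 0 ≤ M)
    (hM : ∀ i ∈ s, ∑ j ∈ s, ‖inner ℂ (e i) (e j)‖ ≤ M) (g : H) :
    ∑ i ∈ s, ‖inner ℂ (e i) g‖ ^ 2 ≤ M * ‖g‖ ^ 2 := by
  set u : ι → ℂ := fun i => inner ℂ (e i) g with hu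
  set S := ∑ i ∈ s, ‖u i‖ ^ 2 with hS
  set V := ∑ i ∈ s, u i • e i with hV
  have hS0 : 0 ≤ S := Finset.sum_nonneg fun i _ => by positivity
  -- duality with `V = ∑ ⟨e_i, g⟩ e_i`, whose norm is a quadratic form in the Gram matrix
  have h1 : S ≤ ‖V‖ * ‖g‖ := by
    have : (S : ℂ) = inner ℂ V g := by
      rw [hV, sum_inner, hS]
      push_cast
      refine Finset.sum_congr rfl fun i _ => ?_
      rw [inner_smul_left, ← Complex.conj_mul']
    calc S = ‖(S : ℂ)‖ := by rw [Complex.norm_real, Real.norm_of_nonneg hS0]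
      _ ≤ _ := by rw [this]; exact norm_inner_le_norm _ _
  have h2 : ‖V‖ ^ 2 ≤ M * S := by
    have h3 : ‖V‖ ^ 2 ≤ ∑ i ∈ s, ∑ j ∈ s, ‖u i‖ * ‖u j‖ * ‖inner ℂ (e i) (e j)‖ := by
      have : (‖V‖ ^ 2 : ℝ) = ‖inner ℂ V V‖ := by
        rw [inner_self_eq_norm_sq_to_K]; simp
      rw [this, hV, sum_inner]
      refine (norm_sum_le _ _).trans (Finset.sum_le_sum fun i _ => ?_)
      rw [inner_sum]
      refine (norm_sum_le _ _).trans (Finset.sum_le_sum fun j _ => ?_)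
      rw [inner_smul_left, inner_smul_right, norm_mul, norm_mul, RCLike.norm_conj]
      linarith
    have h4 : ∑ i ∈ s, ∑ j ∈ s, ‖u i‖ ^ 2 * ‖inner ℂ (e i) (e j)‖ ≤ M * S := by
      rw [hS, Finset.mul_sum]
      refine Finset.sum_le_sum fun i hi => ?_
      rw [← Finset.mul_sum, mul_comm]
      exact mul_le_mul_of_nonneg_right (hM i hi) (by positivity)
    have h5 : ∑ i ∈ s, ∑ j ∈ s, ‖u j‖ ^ 2 * ‖inner ℂ (e i) (e j)‖ ≤ M * S := by
      rw [Finset.sum_comm]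
      refine le_trans (le_of_eq ?_) h4
      refine Finset.sum_congr rfl fun i _ => Finset.sum_congr rfl fun j _ => ?_
      rw [← inner_conj_symm, RCLike.norm_conj]
    have h6 : 2 * ∑ i ∈ s, ∑ j ∈ s, ‖u i‖ * ‖u j‖ * ‖inner ℂ (e i) (e j)‖ ≤
        ∑ i ∈ s, ∑ j ∈ s, ‖u i‖ ^ 2 * ‖inner ℂ (e i) (e j)‖ +
          ∑ i ∈ s, ∑ j ∈ s, ‖u j‖ ^ 2 * ‖inner ℂ (e i) (e j)‖ := by
      simp only [Finset.mul_sum, ← Finset.sum_add_distrib]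
      refine Finset.sum_le_sum fun i _ => Finset.sum_le_sum fun j _ => ?_
      have := mul_nonneg (sq_nonneg (‖u i‖ - ‖u j‖)) (norm_nonneg (inner ℂ (e i) (e j)))
      nlinarith
    linarith
  rcases eq_or_lt_of_le hS0 with h0 | h0
  · rw [← h0]
    positivity
  · have h7 : S ^ 2 ≤ M * S * ‖g‖ ^ 2 := by
      calc S ^ 2 ≤ (‖V‖ * ‖g‖) ^ 2 := by gcongr
        _ = ‖V‖ ^ 2 * ‖g‖ ^ 2 := by ring
        _ ≤ _ := by gcongr
    nlinarith

variable [CompleteSpace H]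

theorem integral_inner_left {f : α → H}
    (hf : Integrable f μ) (c : H) : ∫ x, inner ℂ (f x) c ∂μ = inner ℂ (∫ x, f x ∂μ) c := by
  rw [← inner_conj_symm, ← integral_inner hf c, ← integral_conj]
  simp only [inner_conj_symm]

theorem enorm_inner_integral_integral_le {f : α → H} {g : β → H} (hf : Integrable f μ)
    (hg : Integrable g ν) : ‖inner ℂ (∫ x, f x ∂μ) (∫ y, g y ∂ν)‖ₑ ≤
      ∫⁻ x, ∫⁻ y, ‖inner ℂ (f x) (g y)‖ₑ ∂ν ∂μ := by
  rw [← integral_inner_left hf]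
  refine (enorm_integral_le_lintegral_enorm _).trans (lintegral_mono fun x => ?_)
  rw [← integral_inner hg]
  exact enorm_integral_le_lintegral_enorm _

theorem enorm_inner_synthesis_le {e : α → H} {e' : β → H} (he : StronglyMeasurable e)
    (he' : StronglyMeasurable e') {c c' : ℝ} (hc : ∀ x, ‖e x‖ ≤ c) (hc' : ∀ x, ‖e' x‖ ≤ c')
    {F : α → ℂ} {G : β → ℂ} (hF : Integrable F μ) (hG : Integrable G ν) :
    ‖inner ℂ (∫ x, F x • e x ∂μ) (∫ y, G y • e' y ∂ν)‖ₑ ≤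
      ∫⁻ x, ∫⁻ y, ‖F x‖ₑ * ‖G y‖ₑ * ‖inner ℂ (e x) (e' y)‖ₑ ∂ν ∂μ := by
  refine (enorm_inner_integral_integral_le (integrable_smul_family he hc hF)
    (integrable_smul_family he' hc' hG)).trans (le_of_eq ?_)
  refine lintegral_congr fun x => lintegral_congr fun y => ?_
  rw [inner_smul_left, inner_smul_right, enorm_mul, enorm_mul, RCLike.enorm_conj]
  ring

theorem enorm_inner_synthesis_le_mul {e : α → H} {e' : β → H} (he : StronglyMeasurable e)
    (he' : StronglyMeasurable e') {c c' : ℝ} (hc : ∀ x, ‖e x‖ ≤ c) (hc' : ∀ x, ‖e' x‖ ≤ c')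
    {D : ℝ≥0∞} (hD : ∀ᵐ x ∂μ, ∀ᵐ y ∂ν, ‖inner ℂ (e x) (e' y)‖ₑ ≤ D)
    {F : α → ℂ} {G : β → ℂ} (hFm : Measurable F) (hF : Integrable F μ) (hGm : Measurable G)
    (hG : Integrable G ν) :
    ‖inner ℂ (∫ x, F x • e x ∂μ) (∫ y, G y • e' y ∂ν)‖ₑ ≤
      D * (∫⁻ x, ‖F x‖ₑ ∂μ) * (∫⁻ y, ‖G y‖ₑ ∂ν) := by
  refine (enorm_inner_synthesis_le he he' hc hc' hF hG).trans ?_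
  calc _ ≤ ∫⁻ x, ∫⁻ y, D * ‖F x‖ₑ * ‖G y‖ₑ ∂ν ∂μ := by
        refine lintegral_mono_ae ?_
        filter_upwards [hD] with x hx
        refine lintegral_mono_ae ?_
        filter_upwards [hx] with y hy
        rw [mul_comm, mul_assoc]
        gcongr
    _ = _ := by
        simp_rw [lintegral_const_mul _ hGm.enorm]
        rw [lintegral_mul_const _ (hFm.enorm.const_mul _), lintegral_const_mul _ hFm.enorm]

theorem ENNReal.mul_le_sq_add_sq (a b : ℝ≥0∞) : a * b ≤ a ^ (2 : ℝ) + b ^ (2 : ℝ) := by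
  rw [ENNReal.rpow_ofNat, ENNReal.rpow_ofNat, pow_two, pow_two]
  rcases le_total a b with h | h
  · exact le_trans (by gcongr) le_add_self
  · exact le_trans (by gcongr) le_self_add

/-- Schur's test for the quadratic form `‖∫ F(x) e(x) dx‖²`. -/
theorem enorm_synthesis_le_of_schur [SFinite μ] {e : α → H} (he : StronglyMeasurable e) {c : ℝ}
    (hc : ∀ x, ‖e x‖ ≤ c) {M : ℝ≥0∞} (hM : ∀ x, ∫⁻ y, ‖inner ℂ (e x) (e y)‖ₑ ∂μ ≤ M)
    {F : α → ℂ} (hFm : Measurable F) (hF : Integrable F μ) :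
    ‖∫ x, F x • e x ∂μ‖ₑ ^ (2 : ℝ) ≤ 2 * M * ∫⁻ x, ‖F x‖ₑ ^ (2 : ℝ) ∂μ := by
  rw [enorm_sq_eq_enorm_inner]
  refine (enorm_inner_synthesis_le he he hc hc hF hF).trans ?_
  set k : α → α → ℝ≥0∞ := fun x y => ‖inner ℂ (e x) (e y)‖ₑ with hk
  have hkm : Measurable (Function.uncurry k) := by
    have h1 : StronglyMeasurable fun p : α × α => inner ℂ (e p.1) (e p.2) :=
      (he.comp_measurable measurable_fst).inner (he.comp_measurable measurable_snd)
    exact h1.enorm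
  have hsymm : ∀ x y, k x y = k y x := fun x y => by
    simp only [hk]
    rw [← inner_conj_symm, RCLike.enorm_conj]
  set a : α → ℝ≥0∞ := fun x => ‖F x‖ₑ ^ (2 : ℝ) with ha
  have ham : Measurable a := hFm.enorm.pow_const _
  have hone : ∫⁻ x, ∫⁻ y, a x * k x y ∂μ ∂μ ≤ M * ∫⁻ x, a x ∂μ := by
    rw [← lintegral_const_mul _ ham]
    refine lintegral_mono fun x => ?_
    rw [lintegral_const_mul _ (show Measurable fun y => k x y from hkm.comp measurable_prodMk_left),
      mul_comm]
    gcongr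
    exact hM x
  calc _ ≤ ∫⁻ x, ∫⁻ y, (a x * k x y + a y * k x y) ∂μ ∂μ := by
        refine lintegral_mono fun x => lintegral_mono fun y => ?_
        rw [← add_mul]
        gcongr
        exact ENNReal.mul_le_sq_add_sq _ _
    _ = ∫⁻ x, ∫⁻ y, a x * k x y ∂μ ∂μ + ∫⁻ x, ∫⁻ y, a y * k x y ∂μ ∂μ := by
        have h1 : Measurable fun p : α × α => a p.1 * k p.1 p.2 :=
          (ham.comp measurable_fst).mul hkm
        rw [← lintegral_add_left h1.lintegral_prod_right']
        refine lintegral_congr fun x => ?_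
        exact lintegral_add_left (h1.comp measurable_prodMk_left) _
    _ = ∫⁻ x, ∫⁻ y, a x * k x y ∂μ ∂μ + ∫⁻ x, ∫⁻ y, a x * k x y ∂μ ∂μ := by
        congr 1
        rw [lintegral_lintegral_swap]
        · refine lintegral_congr fun x => lintegral_congr fun y => ?_
          rw [hsymm]
        · exact ((ham.comp measurable_snd).mul hkm).aemeasurable
    _ ≤ _ := by
        rw [mul_assoc, two_mul]
        exact add_le_add hone hone

end TTStar

/-! ### Dual forms of the Strichartz and lateral estimates -/

section Interpolated

variable {H : Type*} [NormedAddCommGroup H] [InnerProductSpace ℂ H] [CompleteSpace H]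
  {α β : Type*} [MeasurableSpace α] [MeasurableSpace β]

/-- Interpolated bound for the pairing of two superpositions `∫ F e` and `∫ G e'`. -/
theorem enorm_inner_synthesis_le_interpolated {μ : Measure α} {ν : Measure β} {e : α → H}
    {e' : β → H} (he : StronglyMeasurable e)
    (he' : StronglyMeasurable e') {c c' : ℝ} (hc : ∀ x, ‖e x‖ ≤ c) (hc' : ∀ x, ‖e' x‖ ≤ c')
    {r b : ℝ} (hr : 1 < r) (hrb : r < b) (hb : b ≤ 2)
    {D M M' : ℝ≥0∞} (hD0 : D ≠ 0) (hD : D ≠ ∞) (hM0 : M ≠ 0) (hM : M ≠ ∞)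
    (hM'0 : M' ≠ 0) (hM' : M' ≠ ∞)
    (h1 : ∀ᵐ x ∂μ, ∀ᵐ y ∂ν, ‖inner ℂ (e x) (e' y)‖ₑ ≤ D)
    (h2 : ∀ F : α → ℂ, Measurable F → Integrable F μ →
      ‖∫ x, F x • e x ∂μ‖ₑ ≤ M * (∫⁻ x, ‖F x‖ₑ ^ b ∂μ) ^ (1 / b))
    (h3 : ∀ G : β → ℂ, Measurable G → Integrable G ν →
      ‖∫ x, G x • e' x ∂ν‖ₑ ≤ M' * (∫⁻ x, ‖G x‖ₑ ^ b ∂ν) ^ (1 / b))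
    {F : α → ℂ} {G : β → ℂ} (hF : Measurable F) (hFi : Integrable F μ) (hG : Measurable G)
    (hGi : Integrable G ν) :
    ‖inner ℂ (∫ x, F x • e x ∂μ) (∫ y, G y • e' y ∂ν)‖ₑ ≤
      interpConst r b * (D ^ ((b - r) / (r * (b - 1))) *
        (M * M') ^ (1 - (b - r) / (r * (b - 1)))) *
        ((∫⁻ x, ‖F x‖ₑ ^ r ∂μ) ^ (1 / r) * (∫⁻ y, ‖G y‖ₑ ^ r ∂ν) ^ (1 / r)) := by
  refine bilinear_interpolation
    (fun F G => ‖inner ℂ (∫ x, F x • e x ∂μ) (∫ y, G y • e' y ∂ν)‖ₑ) ?_ ?_ hr hrb hb hD0 hD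
    (mul_ne_zero hM0 hM'0) (ENNReal.mul_ne_top hM hM') ?_ ?_ hF hFi hG hGi
  · intro F F' G _ hFi _ hFi' _ _
    simp only [Pi.add_apply, add_smul]
    rw [integral_add (integrable_smul_family he hc hFi) (integrable_smul_family he hc hFi'),
      inner_add_left]
    exact enorm_add_le _ _
  · intro F G G' _ _ _ hGi _ hGi'
    simp only [Pi.add_apply, add_smul]
    rw [integral_add (integrable_smul_family he' hc' hGi) (integrable_smul_family he' hc' hGi'),
      inner_add_right]
    exact enorm_add_le _ _
  · intro F G hF hFi hG hGi
    exact enorm_inner_synthesis_le_mul he he' hc hc' h1 hF hFi hG hGi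
  · intro F G hF hFi _ hG hGi _
    refine (enorm_inner_le _ _).trans ((mul_le_mul' (h2 F hF hFi) (h3 G hG hGi)).trans (le_of_eq ?_))
    ring

/-- Abstract Strichartz estimate, dual form: energy and dispersive bounds for a family `e (x, t)`
imply a bound for `∫ F e` by the space-time norm `‖F‖_{L^r}`, `r = (2σ+2)/(σ+2)`. The pairing of two
time slices is bounded by interpolation, and the Hardy-Littlewood-Sobolev inequality sums over the
pairs of times. -/
theorem enorm_synthesis_le_of_dispersive {X : Type*} [MeasurableSpace X] {ρ : Measure X} [SFinite ρ]
    {σ : ℝ} (hσ : 0 < σ) {D M : ℝ≥0∞} (hD0 : D ≠ 0) (hD : D ≠ ∞) (hM0 : M ≠ 0) (hM : M ≠ ∞) :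
    ∃ C : ℝ≥0∞, C ≠ ∞ ∧ ∀ e : X × ℝ → H, StronglyMeasurable e → (∃ c : ℝ, ∀ z, ‖e z‖ ≤ c) →
      (∀ x y s t, s ≠ t → ‖inner ℂ (e (x, s)) (e (y, t))‖ₑ ≤ D * ENNReal.ofReal |s - t| ^ (-σ)) →
      (∀ x t, ∫⁻ y, ‖inner ℂ (e (x, t)) (e (y, t))‖ₑ ∂ρ ≤ M) →
      ∀ F : X × ℝ → ℂ, Measurable F → Integrable F (ρ.prod volume) →
        ‖∫ z, F z • e z ∂(ρ.prod volume)‖ₑ ≤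
          C * (∫⁻ z, ‖F z‖ₑ ^ ((2 * σ + 2) / (σ + 2)) ∂(ρ.prod volume)) ^
            (1 / ((2 * σ + 2) / (σ + 2))) := by
  set r := (2 * σ + 2) / (σ + 2) with hr
  have hr1 : 1 < r := by rw [hr, lt_div_iff₀ (by linarith)]; linarith
  have hr2 : r < 2 := by rw [hr, div_lt_iff₀ (by linarith)]; linarith
  obtain ⟨C₁, hC₁, hHLS⟩ := lintegral_lintegral_abs_sub_rpow_le hr1 hr2
  set M₁ : ℝ≥0∞ := (2 * M) ^ (1 / 2 : ℝ) with hM₁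
  have h2M0 : 2 * M ≠ 0 := mul_ne_zero two_ne_zero hM0
  have h2Mt : 2 * M ≠ ∞ := ENNReal.mul_ne_top (by simp) hM
  have hM₁0 : M₁ ≠ 0 := (ENNReal.rpow_pos (pos_iff_ne_zero.2 h2M0) h2Mt).ne'
  have hM₁t : M₁ ≠ ∞ := ENNReal.rpow_ne_top_of_nonneg (by norm_num) h2Mt
  set θ : ℝ := (2 - r) / (r * (2 - 1)) with hθ
  have hθ' : -σ * θ = 2 / r - 2 := by
    rw [hθ, hr]; field_simp; ring
  have hθ0 : 0 < θ := by
    rw [hθ]; exact div_pos (by linarith) (by linarith)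
  set K : ℝ≥0∞ := interpConst r 2 * (D ^ θ * (M₁ * M₁) ^ (1 - θ)) with hK
  have hKt : K ≠ ∞ := by
    refine ENNReal.mul_ne_top (interpConst_ne_top (by linarith) hr2) (ENNReal.mul_ne_top ?_ ?_)
    · exact ENNReal.rpow_ne_top_of_ne_zero hD0 hD
    · exact ENNReal.rpow_ne_top_of_ne_zero (mul_ne_zero hM₁0 hM₁0) (ENNReal.mul_ne_top hM₁t hM₁t)
  refine ⟨(K * C₁) ^ (1 / 2 : ℝ), ENNReal.rpow_ne_top_of_nonneg (by norm_num)
    (ENNReal.mul_ne_top hKt hC₁), ?_⟩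
  rintro e he ⟨c, hc⟩ hdisp hen F hF hFi
  have het : ∀ t, StronglyMeasurable fun x => e (x, t) := fun t =>
    he.comp_measurable measurable_prodMk_right
  have hFt : ∀ t, Measurable fun x => F (x, t) := fun t => hF.comp measurable_prodMk_right
  have hFti : ∀ᵐ t : ℝ, Integrable (fun x => F (x, t)) ρ := hFi.prod_left_ae
  set V : ℝ → H := fun t => ∫ x, F (x, t) • e (x, t) ∂ρ with hV
  set f : ℝ → ℝ≥0∞ := fun t => (∫⁻ x, ‖F (x, t)‖ₑ ^ r ∂ρ) ^ (1 / r) with hf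
  have hfm : Measurable f := (Measurable.lintegral_prod_left'
    (f := fun z : X × ℝ => ‖F z‖ₑ ^ r) (hF.enorm.pow_const r)).pow_const _
  -- energy bound on a time slice
  have hen' : ∀ (t : ℝ) (G : X → ℂ), Measurable G → Integrable G ρ →
      ‖∫ x, G x • e (x, t) ∂ρ‖ₑ ≤ M₁ * (∫⁻ x, ‖G x‖ₑ ^ (2 : ℝ) ∂ρ) ^ (1 / 2 : ℝ) := by
    intro t G hG hGi
    have h := enorm_synthesis_le_of_schur (het t) (fun x => hc (x, t)) (fun x => hen x t) hG hGi
    have h' := ENNReal.rpow_le_rpow h (show (0 : ℝ) ≤ 1 / 2 by norm_num)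
    rw [← ENNReal.rpow_mul, ENNReal.mul_rpow_of_nonneg _ _ (by norm_num)] at h'
    norm_num at h' ⊢
    rw [hM₁]; norm_num
    exact h'
  -- interpolation of the energy and dispersive bounds, for two time slices
  have hpair : ∀ s t, s ≠ t → Integrable (fun x => F (x, s)) ρ → Integrable (fun x => F (x, t)) ρ →
      ‖inner ℂ (V s) (V t)‖ₑ ≤ K * (ENNReal.ofReal |s - t| ^ (2 / r - 2) * (f s * f t)) := by
    intro s t hst hs ht
    have hpos : 0 < ENNReal.ofReal |s - t| := ENNReal.ofReal_pos.2 (abs_pos.2 (sub_ne_zero.2 hst))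
    have hk0 : ENNReal.ofReal |s - t| ^ (-σ) ≠ 0 := (ENNReal.rpow_pos hpos ENNReal.ofReal_ne_top).ne'
    have hkt : ENNReal.ofReal |s - t| ^ (-σ) ≠ ∞ :=
      ENNReal.rpow_ne_top_of_ne_zero hpos.ne' ENNReal.ofReal_ne_top
    refine (enorm_inner_synthesis_le_interpolated (het s) (het t) (fun x => hc (x, s))
      (fun x => hc (x, t)) hr1 hr2 le_rfl (mul_ne_zero hD0 hk0) (ENNReal.mul_ne_top hD hkt)
      hM₁0 hM₁t hM₁0 hM₁t ?_ (hen' s) (hen' t) (hFt s) hs (hFt t) ht).trans (le_of_eq ?_)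
    · exact Filter.Eventually.of_forall fun x => Filter.Eventually.of_forall fun y =>
        hdisp x y s t hst
    · rw [ENNReal.mul_rpow_of_ne_top hD hkt, ← ENNReal.rpow_mul, hθ', hK]
      ring
  have hFe := integrable_smul_family he hc hFi
  have hVi : Integrable V := hFe.integral_prod_right
  have hsq : ‖∫ z, F z • e z ∂(ρ.prod volume)‖ₑ ^ (2 : ℝ) ≤
      K * C₁ * (∫⁻ z, ‖F z‖ₑ ^ r ∂(ρ.prod volume)) ^ (2 / r) := by
    rw [enorm_sq_eq_enorm_inner, integral_prod_symm _ hFe]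
    refine (enorm_inner_integral_integral_le hVi hVi).trans ?_
    calc _ ≤ ∫⁻ s, ∫⁻ t, K * (ENNReal.ofReal |s - t| ^ (2 / r - 2) * (f s * f t)) := by
          refine lintegral_mono_ae ?_
          filter_upwards [hFti] with s hs
          refine lintegral_mono_ae ?_
          filter_upwards [hFti, measure_eq_zero_iff_ae_notMem.1 (measure_singleton (μ := volume) s)]
            with t ht hst
          exact hpair s t (fun h => hst h.symm) hs ht
      _ = K * ∫⁻ s, ∫⁻ t, ENNReal.ofReal |s - t| ^ (2 / r - 2) * (f s * f t) := by
          rw [← lintegral_const_mul' _ _ hKt]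
          refine lintegral_congr fun s => ?_
          rw [lintegral_const_mul' _ _ hKt]
      _ ≤ K * (C₁ * (∫⁻ t, f t ^ r) ^ (2 / r)) := by gcongr; exact hHLS f hfm
      _ = _ := by
          rw [mul_assoc K C₁]
          congr 3
          rw [lintegral_prod_symm _ (hF.enorm.pow_const r).aemeasurable]
          refine lintegral_congr fun t => ?_
          rw [hf, ← ENNReal.rpow_mul, one_div_mul_cancel (by linarith), ENNReal.rpow_one]
  have h := ENNReal.rpow_le_rpow hsq (show (0 : ℝ) ≤ 1 / 2 by norm_num)
  rw [← ENNReal.rpow_mul, ENNReal.mul_rpow_of_nonneg _ _ (by norm_num : (0 : ℝ) ≤ 1 / 2),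
    ← ENNReal.rpow_mul] at h
  convert h using 2
  · norm_num
  · congr 1; ring

/-- Lateral estimate, dual form: a bound of `∫ F e` by `‖F‖_{L^{4/3}}` together with the pointwise
decay `|x - x'|⁻¹` of the Gram kernel gives bounds by mixed norms `L^r_x L^s_y`, `1/r + 1/s = 3/2`,
`s < 4/3`. Interpolation between the two is done on each Whitney square in `(x, x')` separately,
because a single slice in `x` has no energy bound. -/
theorem enorm_synthesis_le_of_lateral {r s : ℝ} (hs : 1 < s) (hs' : s < 4 / 3)
    (hrs : 1 / r + 1 / s = 3 / 2) (hr : r < 2) :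
    ∃ C : ℝ≥0∞, C ≠ ∞ ∧ ∀ (Y : Type*) [MeasurableSpace Y] (ρ : Measure Y) [SFinite ρ],
      ∀ D M : ℝ≥0∞, D ≠ 0 → D ≠ ∞ → M ≠ 0 → M ≠ ∞ → ∀ e : ℝ × Y → H, StronglyMeasurable e → (∃ c : ℝ, ∀ z, ‖e z‖ ≤ c) →
      (∀ x x' y y', x ≠ x' →
        ‖inner ℂ (e (x, y)) (e (x', y'))‖ₑ ≤ D * ENNReal.ofReal |x - x'| ^ (-1 : ℝ)) →
      (∀ F : ℝ × Y → ℂ, Measurable F → Integrable F (volume.prod ρ) →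
        ‖∫ z, F z • e z ∂(volume.prod ρ)‖ₑ ≤
          M * (∫⁻ z, ‖F z‖ₑ ^ (4 / 3 : ℝ) ∂(volume.prod ρ)) ^ (1 / (4 / 3) : ℝ)) →
      ∀ F : ℝ × Y → ℂ, Measurable F → Integrable F (volume.prod ρ) →
        ‖∫ z, F z • e z ∂(volume.prod ρ)‖ₑ ≤
          C * (D ^ (2 / s - 3 / 2) * M ^ (4 - 4 / s)) *
            (∫⁻ x, (∫⁻ y, ‖F (x, y)‖ₑ ^ s ∂ρ) ^ (r / s)) ^ (1 / r) := by
  have hs0 : 0 < s := by linarith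
  have hinv : 1 / s > 3 / 4 := by
    rw [gt_iff_lt, lt_div_iff₀ hs0]; linarith
  have hinvr : 1 / r < 3 / 4 := by linarith
  have hinvr' : 1 / r > 1 / 2 := by
    have : 1 / s < 1 := by rw [div_lt_one hs0]; exact hs
    linarith
  have hr0 : 0 < r := by
    by_contra! h
    have : 1 / r ≤ 0 := one_div_nonpos.2 h
    linarith
  have hsr : s < r := by
    have : 1 / r < 1 / s := by linarith
    exact (one_div_lt_one_div hr0 hs0).1 this
  obtain ⟨C₁, hC₁, hW⟩ := tsum_whitney_le hs.le hsr hr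
  set θ : ℝ := (4 / 3 - s) / (s * (4 / 3 - 1)) with hθ
  have hθ' : -θ = 2 / r - 2 / s := by
    have h1 : 2 / r = 3 - 2 / s := by
      have : 2 / r = 2 * (1 / r) := by ring
      rw [this, show 1 / r = 3 / 2 - 1 / s by linarith]; ring
    rw [h1, hθ]; field_simp; ring
  have hθ1 : θ = 4 / s - 3 := by
    rw [hθ]; field_simp; ring
  refine ⟨(interpConst s (4 / 3) * C₁) ^ (1 / 2 : ℝ), ENNReal.rpow_ne_top_of_nonneg (by norm_num)
    (ENNReal.mul_ne_top (interpConst_ne_top hs0 hs') hC₁), ?_⟩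
  rintro Y _ ρ _ D M hD0 hD hM0 hM e he ⟨c, hc⟩ hdec hL F hF hFi
  set K : ℝ≥0∞ := interpConst s (4 / 3) * (D ^ θ * (M * M) ^ (1 - θ)) with hK
  set μ : Measure (ℝ × Y) := volume.prod ρ with hμ
  set f : ℝ → ℝ≥0∞ := fun x => (∫⁻ y, ‖F (x, y)‖ₑ ^ s ∂ρ) ^ (1 / s) with hf
  have hFs : Measurable fun z : ℝ × Y => ‖F z‖ₑ ^ s := hF.enorm.pow_const s
  have hfm : Measurable f := hFs.lintegral_prod_right'.pow_const _
  have hFe := integrable_smul_family he hc hFi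
  let S : ℤ → ℤ → Set (ℝ × Y) := fun m i => Prod.fst ⁻¹' dyadicInterval m i
  have hS : ∀ m i, MeasurableSet (S m i) := fun m i =>
    measurable_fst (measurableSet_dyadicInterval m i)
  let R : WhitneyIndex → Set ((ℝ × Y) × (ℝ × Y)) := fun w => S w.1.1 w.1.2.1 ×ˢ S w.1.1 w.1.2.2
  have hR : ∀ w, MeasurableSet (R w) := fun w => (hS _ _).prod (hS _ _)
  let k : (ℝ × Y) × (ℝ × Y) → ℂ := fun p => inner ℂ (F p.1 • e p.1) (F p.2 • e p.2)
  have hFem : StronglyMeasurable fun z => F z • e z := hF.stronglyMeasurable.smul he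
  have hki : Integrable k (μ.prod μ) := by
    refine (hFe.norm.mul_prod hFe.norm).mono' ?_ (Filter.Eventually.of_forall fun p =>
      norm_inner_le_norm _ _)
    exact ((hFem.comp_measurable measurable_fst).inner
      (hFem.comp_measurable measurable_snd)).aestronglyMeasurable
  have hRdisj : Pairwise (Function.onFun Disjoint R) := by
    intro v w hvw
    have := pairwise_disjoint_whitneySquare hvw
    rw [Function.onFun, Set.disjoint_left] at this ⊢
    rintro ⟨z, z'⟩ hv hw
    exact this (a := (z.1, z'.1)) hv hw
  have hRcover : ∀ᵐ p ∂(μ.prod μ), p ∈ ⋃ w, R w := by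
    have hm : MeasurableSet (⋃ w, R w) := MeasurableSet.iUnion hR
    refine (Measure.ae_prod_iff_ae_ae hm).2 (Filter.Eventually.of_forall fun z => ?_)
    have h1 : ∀ᵐ x : ℝ, x ≠ z.1 := by
      filter_upwards [measure_eq_zero_iff_ae_notMem.1 (measure_singleton (μ := volume) z.1)] with x hx
      exact hx
    have h2 : ∀ᵐ z' ∂μ, z'.1 ≠ z.1 := Measure.quasiMeasurePreserving_fst.ae h1
    filter_upwards [h2] with z' hz'
    obtain ⟨w, hw⟩ := exists_mem_whitneySquare hz'.symm
    exact Set.mem_iUnion.2 ⟨w, hw⟩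
  -- interpolated bound on one Whitney square, where the Gram kernel is at most `D 2^(-m)`
  have hpiece : ∀ w, ‖∫ p in R w, k p ∂(μ.prod μ)‖ₑ ≤
      K * ((2 : ℝ≥0∞) ^ ((w.1.1 : ℝ) * (2 / r - 2 / s)) *
        ((∫⁻ x in dyadicInterval w.1.1 w.1.2.1, f x ^ s) ^ (1 / s) *
          (∫⁻ x in dyadicInterval w.1.1 w.1.2.2, f x ^ s) ^ (1 / s))) := by
    intro w
    set I := S w.1.1 w.1.2.1 with hI
    set J := S w.1.1 w.1.2.2 with hJ
    have e1 : ∫ p in R w, k p ∂(μ.prod μ) =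
        inner ℂ (∫ z in I, F z • e z ∂μ) (∫ z in J, F z • e z ∂μ) := by
      have hki' : Integrable k ((μ.restrict I).prod (μ.restrict J)) := by
        rw [Measure.prod_restrict]; exact hki.restrict
      change ∫ p in I ×ˢ J, k p ∂(μ.prod μ) = _
      rw [← Measure.prod_restrict, integral_prod _ hki', ← integral_inner_left hFe.restrict]
      refine integral_congr_ae (Filter.Eventually.of_forall fun z => ?_)
      exact integral_inner (𝕜 := ℂ) (hFe.restrict (s := J)) (F z • e z)
    -- the `L^{4/3}` bound restricts to slabs
    have hres : ∀ T : Set (ℝ × Y), MeasurableSet T → ∀ G : ℝ × Y → ℂ, Measurable G →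
        Integrable G (μ.restrict T) → ‖∫ z in T, G z • e z ∂μ‖ₑ ≤
          M * (∫⁻ z in T, ‖G z‖ₑ ^ (4 / 3 : ℝ) ∂μ) ^ (1 / (4 / 3) : ℝ) := by
      intro T hT G hG hGi
      have h := hL (T.indicator G) (hG.indicator hT) ((integrable_indicator_iff hT).2 hGi)
      rw [lintegral_enorm_indicator_rpow μ hT G (by norm_num)] at h
      rw [← integral_indicator hT]
      simpa only [Set.indicator_smul_apply_left] using h
    have hint : ∀ m i, ∫⁻ z in S m i, ‖F z‖ₑ ^ s ∂μ = ∫⁻ x in dyadicInterval m i, f x ^ s := by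
      intro m i
      rw [← lintegral_indicator (hS m i), hμ, lintegral_prod _ (hFs.indicator (hS m i)).aemeasurable,
        ← lintegral_indicator (measurableSet_dyadicInterval m i)]
      refine lintegral_congr fun x => ?_
      by_cases hx : x ∈ dyadicInterval m i
      · rw [Set.indicator_of_mem hx, hf, ← ENNReal.rpow_mul, one_div_mul_cancel hs0.ne',
          ENNReal.rpow_one]
        refine lintegral_congr fun y => ?_
        rw [Set.indicator_of_mem (show (x, y) ∈ S m i from hx)]
      · rw [Set.indicator_of_notMem hx]
        rw [← lintegral_zero (μ := ρ)]
        refine lintegral_congr fun y => ?_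
        rw [Set.indicator_of_notMem (show (x, y) ∉ S m i from hx)]
    have h2p : (2 : ℝ≥0∞) ^ (-(w.1.1 : ℝ)) ≠ 0 := (ENNReal.rpow_pos (by simp) (by simp)).ne'
    have h2t : (2 : ℝ≥0∞) ^ (-(w.1.1 : ℝ)) ≠ ∞ := ENNReal.rpow_ne_top_of_ne_zero (by simp) (by simp)
    rw [e1]
    refine (enorm_inner_synthesis_le_interpolated (μ := μ.restrict I) (ν := μ.restrict J) he he
      hc hc hs hs' (by norm_num) (mul_ne_zero hD0 h2p) (ENNReal.mul_ne_top hD h2t) hM0 hM hM0 hM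
      ?_ (hres I (hS _ _)) (hres J (hS _ _)) hF hFi.restrict hF hFi.restrict).trans (le_of_eq ?_)
    · rw [ae_restrict_iff' (hS _ _)]
      refine Filter.Eventually.of_forall fun z hz => ?_
      rw [ae_restrict_iff' (hS _ _)]
      refine Filter.Eventually.of_forall fun z' hz' => ?_
      have hw : (z.1, z'.1) ∈ whitneySquare w := ⟨hz, hz'⟩
      have h1 := two_zpow_le_of_mem_whitneySquare hw
      have hne : z.1 ≠ z'.1 := by
        intro h
        rw [h, sub_self, abs_zero] at h1
        exact absurd h1 (not_le.2 (by positivity))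
      refine (hdec z.1 z'.1 z.2 z'.2 hne).trans ?_
      gcongr
      have h2 : (2 : ℝ≥0∞) ^ (w.1.1 : ℝ) ≤ ENNReal.ofReal |z.1 - z'.1| := by
        refine le_trans (le_of_eq ?_) (ENNReal.ofReal_le_ofReal h1)
        rw [← Real.rpow_intCast, ← ENNReal.ofReal_rpow_of_pos (by norm_num)]
        simp
      rw [ENNReal.rpow_neg, ENNReal.rpow_neg, ENNReal.rpow_one]
      exact ENNReal.inv_le_inv.2 h2
    · rw [hint, hint, ENNReal.mul_rpow_of_ne_top hD h2t, ← ENNReal.rpow_mul, hK, neg_mul, ← mul_neg,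
        hθ']
      ring
  have hsq : ‖∫ z, F z • e z ∂μ‖ₑ ^ (2 : ℝ) ≤ K * C₁ * (∫⁻ x, f x ^ r) ^ (2 / r) := by
    have e1 : inner ℂ (∫ z, F z • e z ∂μ) (∫ z, F z • e z ∂μ) = ∑' w, ∫ p in R w, k p ∂(μ.prod μ) := by
      rw [← integral_iUnion hR hRdisj hki.integrableOn,
        Measure.restrict_eq_self_of_ae_mem hRcover, integral_prod _ hki, ← integral_inner_left hFe]
      refine integral_congr_ae (Filter.Eventually.of_forall fun z => ?_)
      exact (integral_inner (𝕜 := ℂ) hFe (F z • e z)).symm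
    rw [enorm_sq_eq_enorm_inner, e1]
    refine enorm_tsum_le_tsum_enorm.trans ((ENNReal.tsum_le_tsum hpiece).trans ?_)
    rw [ENNReal.tsum_mul_left, mul_assoc K C₁]
    gcongr
    exact hW f hfm
  have h := ENNReal.rpow_le_rpow hsq (show (0 : ℝ) ≤ 1 / 2 by norm_num)
  rw [← ENNReal.rpow_mul, ENNReal.mul_rpow_of_nonneg _ _ (by norm_num : (0 : ℝ) ≤ 1 / 2),
    ← ENNReal.rpow_mul] at h
  convert h using 2
  · norm_num
  · have hMM : (M * M) ^ (1 - θ) = M ^ (2 * (1 - θ)) := by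
      rw [ENNReal.rpow_mul, ENNReal.rpow_ofNat, pow_two]
    have hDM : (D ^ θ * (M * M) ^ (1 - θ)) ^ (1 / 2 : ℝ) = D ^ (2 / s - 3 / 2) * M ^ (4 - 4 / s) := by
      rw [hMM, ENNReal.mul_rpow_of_nonneg _ _ (by norm_num : (0 : ℝ) ≤ 1 / 2), ← ENNReal.rpow_mul,
        ← ENNReal.rpow_mul, hθ1]
      congr 2 <;> ring
    rw [← hDM, hK, ← ENNReal.mul_rpow_of_nonneg _ _ (by norm_num : (0 : ℝ) ≤ 1 / 2)]
    congr 1; ring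
  · have : ∀ x, f x ^ r = (∫⁻ y, ‖F (x, y)‖ₑ ^ s ∂ρ) ^ (r / s) := fun x => by
      rw [hf, ← ENNReal.rpow_mul]; congr 1; ring
    simp_rw [this]
    congr 1; ring

end Interpolated

/-! ### Duality for `L^p` and mixed norms -/

section Duality

variable {H : Type*} [NormedAddCommGroup H] [InnerProductSpace ℂ H] [CompleteSpace H]
  {α : Type*} [MeasurableSpace α] {μ : Measure α}

/-- The weighted `L²` norm of the coefficients `⟨e x, g⟩` is the pairing of `g` with the
superposition with amplitude `a(x) ⟨e x, g⟩`. -/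
theorem lintegral_weight_mul_sq_le {e : α → H} (he : StronglyMeasurable e) {c : ℝ}
    (hc : ∀ x, ‖e x‖ ≤ c) (g : H) {a : α → ℝ} (ha0 : ∀ x, 0 ≤ a x)
    (hai : Integrable a μ) :
    ∫⁻ x, ENNReal.ofReal (a x) * ‖inner ℂ (e x) g‖ₑ ^ (2 : ℝ) ∂μ ≤
      ‖∫ x, ((a x : ℂ) * inner ℂ (e x) g) • e x ∂μ‖ₑ * ‖g‖ₑ := by
  set u : α → ℂ := fun x => inner ℂ (e x) g with hu
  have hum : StronglyMeasurable u := he.inner stronglyMeasurable_const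
  have hub : ∀ x, ‖u x‖ ≤ c * ‖g‖ := fun x =>
    (norm_inner_le_norm _ _).trans (mul_le_mul_of_nonneg_right (hc x) (norm_nonneg _))
  have hai' : Integrable (fun x => (a x : ℂ)) μ := hai.ofReal
  have hFi : Integrable (fun x => (a x : ℂ) * u x) μ :=
    hai'.mul_bdd hum.aestronglyMeasurable (Filter.Eventually.of_forall hub)
  have hFe := integrable_smul_family he hc hFi
  have h1 : inner ℂ (∫ x, ((a x : ℂ) * u x) • e x ∂μ) g = ((∫ x, a x * ‖u x‖ ^ 2 ∂μ : ℝ) : ℂ) := by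
    rw [← integral_inner_left hFe, ← integral_complex_ofReal]
    refine integral_congr_ae (Filter.Eventually.of_forall fun x => ?_)
    simp only
    rw [inner_smul_left, map_mul, Complex.conj_ofReal, mul_assoc]
    change (a x : ℂ) * (starRingEnd ℂ (u x) * u x) = _
    rw [Complex.conj_mul']
    push_cast; ring
  have hwi : Integrable (fun x => a x * ‖u x‖ ^ 2) μ := by
    refine hai.mul_bdd (c := (c * ‖g‖) ^ 2) (hum.norm.measurable.pow_const 2).aestronglyMeasurable
      (Filter.Eventually.of_forall fun x => ?_)
    rw [norm_pow, norm_norm]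
    exact pow_le_pow_left₀ (norm_nonneg _) (hub x) 2
  calc _ = ENNReal.ofReal (∫ x, a x * ‖u x‖ ^ 2 ∂μ) := by
        rw [ofReal_integral_eq_lintegral_ofReal hwi
          (Filter.Eventually.of_forall fun x => mul_nonneg (ha0 x) (by positivity))]
        refine lintegral_congr fun x => ?_
        rw [ENNReal.ofReal_mul (ha0 x), ENNReal.ofReal_pow (norm_nonneg _), ofReal_norm,
          ENNReal.rpow_ofNat]
    _ ≤ ‖((∫ x, a x * ‖u x‖ ^ 2 ∂μ : ℝ) : ℂ)‖ₑ := by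
        rw [← ofReal_norm, Complex.norm_real]
        exact ENNReal.ofReal_le_ofReal (le_abs_self _)
    _ ≤ _ := by rw [← h1]; exact enorm_inner_le _ _

theorem ENNReal.le_of_le_mul_rpow {X K : ℝ≥0∞} {r p : ℝ} (hrp : r.HolderConjugate p) (hX : X ≠ ∞)
    (h : X ≤ K * X ^ (1 / r)) : X ≤ K ^ p := by
  rcases eq_or_ne X 0 with rfl | hX0
  · exact zero_le
  have hp : 0 < p := hrp.symm.pos
  have h1 : X ^ (1 / p) ≤ K := by
    have h2 : X = X ^ (1 / p) * X ^ (1 / r) := by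
      rw [← ENNReal.rpow_add _ _ hX0 hX]
      have := hrp.inv_add_inv_eq_one
      rw [one_div, one_div, add_comm, this, ENNReal.rpow_one]
    have h0 : X ^ (1 / r) ≠ 0 := (ENNReal.rpow_pos (pos_iff_ne_zero.2 hX0) hX).ne'
    have ht : X ^ (1 / r) ≠ ∞ := ENNReal.rpow_ne_top_of_ne_zero hX0 hX
    nth_rewrite 1 [h2] at h
    exact (ENNReal.mul_le_mul_iff_left h0 ht).1 h
  calc X = (X ^ (1 / p)) ^ p := by rw [← ENNReal.rpow_mul, one_div_mul_cancel hp.ne', ENNReal.rpow_one]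
    _ ≤ _ := by gcongr

theorem tendsto_setLIntegral_spanningSets [SigmaFinite μ] (f : α → ℝ≥0∞) :
    Filter.Tendsto (fun n => ∫⁻ x in spanningSets μ n, f x ∂μ) Filter.atTop
      (nhds (∫⁻ x, f x ∂μ)) := by
  have h : ∫⁻ x, f x ∂μ = ⨆ n, ∫⁻ x in spanningSets μ n, f x ∂μ := by
    rw [← setLIntegral_iUnion_of_directed _ (monotone_spanningSets μ).directed_le,
      iUnion_spanningSets, setLIntegral_univ]
  rw [h]
  exact tendsto_atTop_iSup fun n m hnm =>
    lintegral_mono_set (monotone_spanningSets μ hnm)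

/-- Duality: a bound for `∫ F e` by `‖F‖_{L^r}` gives the bound of `x ↦ ⟨e x, g⟩` in the
dual space `L^p`. -/
theorem lintegral_enorm_inner_rpow_le [SigmaFinite μ] {e : α → H} (he : StronglyMeasurable e)
    {c : ℝ} (hc : ∀ x, ‖e x‖ ≤ c) {r p : ℝ} (hrp : r.HolderConjugate p) (hp : 2 ≤ p) {C : ℝ≥0∞}
    (h : ∀ F : α → ℂ, Measurable F → Integrable F μ →
      ‖∫ x, F x • e x ∂μ‖ₑ ≤ C * (∫⁻ x, ‖F x‖ₑ ^ r ∂μ) ^ (1 / r)) (g : H) :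
    ∫⁻ x, ‖inner ℂ (e x) g‖ₑ ^ p ∂μ ≤ (C * ‖g‖ₑ) ^ p := by
  set u : α → ℂ := fun x => inner ℂ (e x) g with hu
  have hum : StronglyMeasurable u := he.inner stronglyMeasurable_const
  have hub : ∀ x, ‖u x‖ ≤ c * ‖g‖ := fun x =>
    (norm_inner_le_norm _ _).trans (mul_le_mul_of_nonneg_right (hc x) (norm_nonneg _))
  have hube : ∀ x, ‖u x‖ₑ ≤ ENNReal.ofReal (c * ‖g‖) := fun x => by
    rw [← ofReal_norm]; exact ENNReal.ofReal_le_ofReal (hub x)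
  refine le_of_tendsto' (tendsto_setLIntegral_spanningSets _) fun n => ?_
  set B := spanningSets μ n
  have hB : MeasurableSet B := measurableSet_spanningSets μ n
  have hBt : μ B < ∞ := measure_spanningSets_lt_top μ n
  -- the extremizing weight, cut off so that the norm to be absorbed is finite
  set a : α → ℝ := B.indicator fun x => ‖u x‖ ^ (p - 2) with ha
  have ham : Measurable a := (hum.norm.measurable.pow_const _).indicator hB
  have ha0 : ∀ x, 0 ≤ a x := fun x => Set.indicator_nonneg (fun x _ => by positivity) x
  have hai : Integrable a μ := by
    refine (integrable_indicator_iff hB).2 ?_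
    refine Measure.integrableOn_of_bounded (M := (c * ‖g‖) ^ (p - 2)) hBt.ne
      (hum.norm.measurable.pow_const _).aestronglyMeasurable (Filter.Eventually.of_forall fun x => ?_)
    rw [Real.norm_of_nonneg (by positivity)]
    exact Real.rpow_le_rpow (norm_nonneg _) (hub x) (by linarith)
  have hae : ∀ x, ENNReal.ofReal (a x) = B.indicator (fun x => ‖u x‖ₑ ^ (p - 2)) x := fun x => by
    by_cases hx : x ∈ B
    · rw [ha, Set.indicator_of_mem hx, Set.indicator_of_mem hx,
        ← ENNReal.ofReal_rpow_of_nonneg (norm_nonneg _) (by linarith), ofReal_norm]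
    · rw [ha, Set.indicator_of_notMem hx, Set.indicator_of_notMem hx, ENNReal.ofReal_zero]
  have hFm : Measurable fun x => (a x : ℂ) * u x := (Complex.measurable_ofReal.comp ham).mul hum.measurable
  have hFi : Integrable (fun x => (a x : ℂ) * u x) μ :=
    hai.ofReal.mul_bdd hum.aestronglyMeasurable (Filter.Eventually.of_forall hub)
  have h1 := lintegral_weight_mul_sq_le he hc g ha0 hai
  have h2 := h _ hFm hFi
  have hrp' : (p - 1) * r = p := hrp.symm.sub_one_mul_conj
  have e1 : ∫⁻ x, ENNReal.ofReal (a x) * ‖u x‖ₑ ^ (2 : ℝ) ∂μ = ∫⁻ x in B, ‖u x‖ₑ ^ p ∂μ := by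
    rw [← lintegral_indicator hB]
    refine lintegral_congr fun x => ?_
    rw [hae]
    by_cases hx : x ∈ B
    · rw [Set.indicator_of_mem hx, Set.indicator_of_mem hx,
        ← ENNReal.rpow_add_of_nonneg _ _ (by linarith) (by norm_num)]
      congr 1; ring
    · rw [Set.indicator_of_notMem hx, Set.indicator_of_notMem hx, zero_mul]
  have e2 : ∫⁻ x, ‖(a x : ℂ) * u x‖ₑ ^ r ∂μ = ∫⁻ x in B, ‖u x‖ₑ ^ p ∂μ := by
    rw [← lintegral_indicator hB]
    refine lintegral_congr fun x => ?_
    have : ‖(a x : ℂ)‖ₑ = ENNReal.ofReal (a x) := by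
      rw [← ofReal_norm, Complex.norm_real, Real.norm_of_nonneg (ha0 x)]
    rw [enorm_mul, this, hae]
    by_cases hx : x ∈ B
    · rw [Set.indicator_of_mem hx, Set.indicator_of_mem hx]
      have hp2 : ‖u x‖ₑ ^ (p - 2) * ‖u x‖ₑ = ‖u x‖ₑ ^ (p - 1) := by
        have h := ENNReal.rpow_add_of_nonneg (x := ‖u x‖ₑ) (p - 2) 1 (by linarith) zero_le_one
        rw [ENNReal.rpow_one] at h
        rw [← h]
        congr 1; ring
      rw [hp2, ← ENNReal.rpow_mul, hrp']
    · rw [Set.indicator_of_notMem hx, Set.indicator_of_notMem hx, zero_mul,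
        ENNReal.zero_rpow_of_pos hrp.pos]
  rw [e2] at h2
  change ∫⁻ x, ENNReal.ofReal (a x) * ‖u x‖ₑ ^ (2 : ℝ) ∂μ ≤
    ‖∫ x, ((a x : ℂ) * u x) • e x ∂μ‖ₑ * ‖g‖ₑ at h1
  rw [e1] at h1
  refine ENNReal.le_of_le_mul_rpow hrp ?_ (h1.trans ((mul_le_mul_left h2 _).trans (le_of_eq ?_)))
  · refine ((lintegral_mono fun x => ENNReal.rpow_le_rpow (hube x) (by linarith)).trans_lt ?_).ne
    rw [lintegral_const]
    refine ENNReal.mul_lt_top ?_ (by simpa using hBt)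
    exact ENNReal.rpow_lt_top_of_nonneg (by linarith) ENNReal.ofReal_ne_top
  · ring

/-- Duality for mixed norms `L^p_x L^q_y`, `2 ≤ p ≤ q < ∞`. The extremizing weight contains a
negative power of the inner norm, so the argument is run where that norm is bounded below. -/
theorem lintegral_lintegral_enorm_inner_rpow_le {X Y : Type*} [MeasurableSpace X]
    [MeasurableSpace Y] {ν : Measure X} {ρ : Measure Y} [SigmaFinite ν] [SigmaFinite ρ]
    {e : X × Y → H} (he : StronglyMeasurable e)
    {c : ℝ} (hc : ∀ x, ‖e x‖ ≤ c) {r s p q : ℝ} (hrp : r.HolderConjugate p)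
    (hsq : s.HolderConjugate q) (hp : 2 ≤ p) (hpq : p ≤ q) {C : ℝ≥0∞}
    (h : ∀ F : X × Y → ℂ, Measurable F → Integrable F (ν.prod ρ) →
      ‖∫ z, F z • e z ∂(ν.prod ρ)‖ₑ ≤
        C * (∫⁻ x, (∫⁻ y, ‖F (x, y)‖ₑ ^ s ∂ρ) ^ (r / s) ∂ν) ^ (1 / r)) (g : H) :
    ∫⁻ x, (∫⁻ y, ‖inner ℂ (e (x, y)) g‖ₑ ^ q ∂ρ) ^ (p / q) ∂ν ≤ (C * ‖g‖ₑ) ^ p := by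
  have hq0 : 0 < q := by linarith
  have hp0 : 0 < p := by linarith
  set u : X × Y → ℂ := fun x => inner ℂ (e x) g with hu
  have hum : StronglyMeasurable u := he.inner stronglyMeasurable_const
  have hub : ∀ x, ‖u x‖ ≤ c * ‖g‖ := fun x =>
    (norm_inner_le_norm _ _).trans (mul_le_mul_of_nonneg_right (hc x) (norm_nonneg _))
  have hube : ∀ x, ‖u x‖ₑ ≤ ENNReal.ofReal (c * ‖g‖) := fun x => by
    rw [← ofReal_norm]; exact ENNReal.ofReal_le_ofReal (hub x)
  have huq : Measurable fun z => ‖u z‖ₑ ^ q := hum.enorm.pow_const q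
  let f : ℕ → X → ℝ≥0∞ := fun n x => (∫⁻ y in spanningSets ρ n, ‖u (x, y)‖ₑ ^ q ∂ρ) ^ (1 / q)
  have hfm : ∀ n, Measurable (f n) := fun n =>
    (huq.lintegral_prod_right' (ν := ρ.restrict (spanningSets ρ n))).pow_const _
  let A : ℕ → Set X := fun n => spanningSets ν n ∩ {x | ((n : ℝ≥0∞) + 1)⁻¹ ≤ f n x}
  have hA : ∀ n, MeasurableSet (A n) := fun n =>
    (measurableSet_spanningSets ν n).inter (measurableSet_le measurable_const (hfm n))
  have hfb : ∀ n, ∃ b : ℝ≥0∞, b ≠ ∞ ∧ ∀ x, f n x ≤ b := by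
    intro n
    refine ⟨(∫⁻ _ in spanningSets ρ n, ENNReal.ofReal (c * ‖g‖) ^ q ∂ρ) ^ (1 / q), ?_, fun x => ?_⟩
    · refine ENNReal.rpow_ne_top_of_nonneg (by positivity) ?_
      rw [lintegral_const]
      refine ENNReal.mul_ne_top (ENNReal.rpow_ne_top_of_nonneg hq0.le ENNReal.ofReal_ne_top) ?_
      simpa using (measure_spanningSets_lt_top ρ n).ne
    · simp only [f]
      gcongr
      exact hube _
  have hmain : ∀ n, ∫⁻ x, (A n).indicator (fun x => f n x ^ p) x ∂ν ≤ (C * ‖g‖ₑ) ^ p := by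
    intro n
    obtain ⟨b, hbt, hb⟩ := hfb n
    have hft : ∀ x, f n x ≠ ∞ := fun x => ne_top_of_le_ne_top hbt (hb x)
    have hfpos : ∀ x ∈ A n, f n x ≠ 0 := fun x hx => by
      have : (0 : ℝ≥0∞) < ((n : ℝ≥0∞) + 1)⁻¹ := by
        rw [ENNReal.inv_pos]; exact ENNReal.add_ne_top.2 ⟨by simp, by simp⟩
      exact (this.trans_le hx.2).ne'
    set B : Set (X × Y) := A n ×ˢ spanningSets ρ n with hBdef
    have hB : MeasurableSet B := (hA n).prod (measurableSet_spanningSets ρ n)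
    have hBt : (ν.prod ρ) B < ∞ := by
      rw [Measure.prod_prod]
      exact ENNReal.mul_lt_top ((measure_mono Set.inter_subset_left).trans_lt
        (measure_spanningSets_lt_top ν n)) (measure_spanningSets_lt_top ρ n)
    -- the extremizing weight for the mixed norm
    set w : X × Y → ℝ := fun z => ‖u z‖ ^ (q - 2) * (f n z.1).toReal ^ (p - q) with hw
    have hwm : Measurable w := (hum.norm.measurable.pow_const _).mul
      (((hfm n).comp measurable_fst).ennreal_toReal.pow_const _)
    set a : X × Y → ℝ := B.indicator w with ha
    have ham : Measurable a := hwm.indicator hB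
    have hw0 : ∀ z, 0 ≤ w z := fun z => by positivity
    have ha0 : ∀ x, 0 ≤ a x := fun x => Set.indicator_nonneg (fun x _ => hw0 x) x
    have hai : Integrable a (ν.prod ρ) := by
      refine (integrable_indicator_iff hB).2 ?_
      refine Measure.integrableOn_of_bounded
        (M := (c * ‖g‖) ^ (q - 2) * (((n : ℝ) + 1)⁻¹) ^ (p - q)) hBt.ne
        hwm.aestronglyMeasurable ?_
      rw [ae_restrict_iff' hB]
      refine Filter.Eventually.of_forall fun z hz => ?_
      rw [Real.norm_of_nonneg (hw0 z), hw]
      refine mul_le_mul (Real.rpow_le_rpow (norm_nonneg _) (hub z) (by linarith)) ?_ (by positivity)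
        (Real.rpow_nonneg ((norm_nonneg _).trans (hub z)) _)
      refine Real.rpow_le_rpow_of_nonpos (by positivity) ?_ (by linarith)
      have := ENNReal.toReal_mono (hft z.1) hz.1.2
      rwa [ENNReal.toReal_inv, ENNReal.toReal_add (by simp) (by simp), ENNReal.toReal_natCast,
        ENNReal.toReal_one] at this
    have hae : ∀ z, ENNReal.ofReal (a z) =
        B.indicator (fun z => ‖u z‖ₑ ^ (q - 2) * f n z.1 ^ (p - q)) z := fun z => by
      by_cases hz : z ∈ B
      · rw [ha, Set.indicator_of_mem hz, Set.indicator_of_mem hz, hw,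
          ENNReal.ofReal_mul (by positivity),
          ← ENNReal.ofReal_rpow_of_nonneg (norm_nonneg _) (by linarith), ofReal_norm,
          ← ENNReal.ofReal_rpow_of_pos (ENNReal.toReal_pos (hfpos _ hz.1) (hft _)),
          ENNReal.ofReal_toReal (hft _)]
      · rw [ha, Set.indicator_of_notMem hz, Set.indicator_of_notMem hz, ENNReal.ofReal_zero]
    have hFm : Measurable fun x => (a x : ℂ) * u x :=
      (Complex.measurable_ofReal.comp ham).mul hum.measurable
    have hFi : Integrable (fun x => (a x : ℂ) * u x) (ν.prod ρ) :=
      hai.ofReal.mul_bdd hum.aestronglyMeasurable (Filter.Eventually.of_forall hub)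
    have h1 := lintegral_weight_mul_sq_le he hc g ha0 hai
    have h2 := h _ hFm hFi
    have hrp' : (p - 1) * r = p := hrp.symm.sub_one_mul_conj
    have hsq' : (q - 1) * s = q := hsq.symm.sub_one_mul_conj
    have hq1 : q / s = q - 1 := by
      rw [div_eq_iff hsq.pos.ne']; linarith
    have hfq : ∀ x, ∫⁻ y in spanningSets ρ n, ‖u (x, y)‖ₑ ^ q ∂ρ = f n x ^ q := fun x => by
      simp only [f]
      rw [← ENNReal.rpow_mul, one_div_mul_cancel hq0.ne', ENNReal.rpow_one]
    have e1 : ∫⁻ z, ENNReal.ofReal (a z) * ‖u z‖ₑ ^ (2 : ℝ) ∂(ν.prod ρ) =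
        ∫⁻ x, (A n).indicator (fun x => f n x ^ p) x ∂ν := by
      rw [lintegral_prod]
      swap
      · exact (ham.ennreal_ofReal.mul (hum.enorm.pow_const _)).aemeasurable
      refine lintegral_congr fun x => ?_
      by_cases hx : x ∈ A n
      · rw [Set.indicator_of_mem hx]
        have : ∀ y, ENNReal.ofReal (a (x, y)) * ‖u (x, y)‖ₑ ^ (2 : ℝ) =
            (spanningSets ρ n).indicator (fun y => f n x ^ (p - q) * ‖u (x, y)‖ₑ ^ q) y := fun y => by
          rw [hae]
          by_cases hy : y ∈ spanningSets ρ n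
          · rw [Set.indicator_of_mem (show (x, y) ∈ B from ⟨hx, hy⟩), Set.indicator_of_mem hy,
              mul_right_comm, ← ENNReal.rpow_add_of_nonneg _ _ (by linarith) (by norm_num), mul_comm]
            congr 2; ring
          · rw [Set.indicator_of_notMem (fun hz : (x, y) ∈ B => hy hz.2),
              Set.indicator_of_notMem hy, zero_mul]
        simp_rw [this]
        rw [lintegral_indicator (measurableSet_spanningSets ρ n),
          lintegral_const_mul _ (show Measurable fun y => ‖u (x, y)‖ₑ ^ q from
            huq.comp measurable_prodMk_left)]
        rw [hfq, ← ENNReal.rpow_add _ _ (hfpos x hx) (hft x)]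
        congr 1; ring
      · rw [Set.indicator_of_notMem hx, ← lintegral_zero (μ := ρ)]
        refine lintegral_congr fun y => ?_
        rw [hae, Set.indicator_of_notMem (fun hz : (x, y) ∈ B => hx hz.1), zero_mul]
    have e2 : ∫⁻ x, (∫⁻ y, ‖(a (x, y) : ℂ) * u (x, y)‖ₑ ^ s ∂ρ) ^ (r / s) ∂ν =
        ∫⁻ x, (A n).indicator (fun x => f n x ^ p) x ∂ν := by
      have hcoe : ∀ z, ‖(a z : ℂ) * u z‖ₑ = ENNReal.ofReal (a z) * ‖u z‖ₑ := fun z => by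
        rw [enorm_mul, ← ofReal_norm (a z : ℂ), Complex.norm_real, Real.norm_of_nonneg (ha0 z)]
      refine lintegral_congr fun x => ?_
      by_cases hx : x ∈ A n
      · rw [Set.indicator_of_mem hx]
        have : ∀ y, ‖(a (x, y) : ℂ) * u (x, y)‖ₑ ^ s =
            (spanningSets ρ n).indicator (fun y => f n x ^ ((p - q) * s) * ‖u (x, y)‖ₑ ^ q) y :=
          fun y => by
          rw [hcoe, hae]
          by_cases hy : y ∈ spanningSets ρ n
          · rw [Set.indicator_of_mem (show (x, y) ∈ B from ⟨hx, hy⟩), Set.indicator_of_mem hy,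
              mul_right_comm]
            have hq2 : ‖u (x, y)‖ₑ ^ (q - 2) * ‖u (x, y)‖ₑ = ‖u (x, y)‖ₑ ^ (q - 1) := by
              have h := ENNReal.rpow_add_of_nonneg (x := ‖u (x, y)‖ₑ) (q - 2) 1 (by linarith)
                zero_le_one
              rw [ENNReal.rpow_one] at h
              rw [← h]
              congr 1; ring
            rw [hq2, mul_comm, ENNReal.mul_rpow_of_nonneg _ _ hsq.nonneg,
              ← ENNReal.rpow_mul ‖u (x, y)‖ₑ, ← ENNReal.rpow_mul (f n x), hsq']
          · rw [Set.indicator_of_notMem (fun hz : (x, y) ∈ B => hy hz.2),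
              Set.indicator_of_notMem hy, zero_mul, ENNReal.zero_rpow_of_pos hsq.pos]
        simp_rw [this]
        rw [lintegral_indicator (measurableSet_spanningSets ρ n),
          lintegral_const_mul _ (show Measurable fun y => ‖u (x, y)‖ₑ ^ q from
            huq.comp measurable_prodMk_left)]
        rw [hfq, ← ENNReal.rpow_add _ _ (hfpos x hx) (hft x), ← ENNReal.rpow_mul]
        congr 1
        have : ((p - q) * s + q) * (r / s) = r * ((p - q) + q / s) := by
          field_simp [hsq.pos.ne']
        rw [this, hq1]; linarith
      · rw [Set.indicator_of_notMem hx]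
        have : ∀ y, ‖(a (x, y) : ℂ) * u (x, y)‖ₑ ^ s = 0 := fun y => by
          rw [hcoe, hae, Set.indicator_of_notMem (fun hz : (x, y) ∈ B => hx hz.1), zero_mul,
            ENNReal.zero_rpow_of_pos hsq.pos]
        simp only [this, lintegral_zero]
        exact ENNReal.zero_rpow_of_pos (div_pos hrp.pos hsq.pos)
    rw [e2] at h2
    change ∫⁻ x, ENNReal.ofReal (a x) * ‖u x‖ₑ ^ (2 : ℝ) ∂(ν.prod ρ) ≤
      ‖∫ x, ((a x : ℂ) * u x) • e x ∂(ν.prod ρ)‖ₑ * ‖g‖ₑ at h1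
    rw [e1] at h1
    refine ENNReal.le_of_le_mul_rpow hrp ?_ (h1.trans ((mul_le_mul_left h2 _).trans (le_of_eq ?_)))
    · rw [lintegral_indicator (hA n)]
      refine ((lintegral_mono fun x => ENNReal.rpow_le_rpow (hb x) hp0.le).trans_lt ?_).ne
      rw [lintegral_const]
      refine ENNReal.mul_lt_top (ENNReal.rpow_lt_top_of_nonneg hp0.le hbt) ?_
      rw [Measure.restrict_apply_univ]
      exact (measure_mono Set.inter_subset_left).trans_lt (measure_spanningSets_lt_top ν n)
    · ring
  -- the truncations exhaust the set where the inner norm does not vanish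
  calc _ ≤ ∫⁻ x, Filter.liminf (fun n => (A n).indicator (fun x => f n x ^ p) x) Filter.atTop ∂ν := by
        refine lintegral_mono fun x => ?_
        set L := ∫⁻ y, ‖u (x, y)‖ₑ ^ q ∂ρ with hL
        change L ^ (p / q) ≤ _
        rcases eq_or_ne L 0 with h0 | h0
        · rw [h0, ENNReal.zero_rpow_of_pos (by positivity)]; exact zero_le
        have hlim : Filter.Tendsto (fun n => f n x) Filter.atTop (nhds (L ^ (1 / q))) :=
          (tendsto_setLIntegral_spanningSets (μ := ρ) fun y => ‖u (x, y)‖ₑ ^ q).ennrpow_const _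
        have hpos : 0 < L ^ (1 / q) := by
          rw [pos_iff_ne_zero, ne_eq, ENNReal.rpow_eq_zero_iff]
          simp [h0, hq0.not_gt]
        have hev : ∀ᶠ n in Filter.atTop, x ∈ A n := by
          have h1 : ∀ᶠ n in Filter.atTop, x ∈ spanningSets ν n := by
            obtain ⟨m, hm⟩ := Set.mem_iUnion.1 (show x ∈ ⋃ n, spanningSets ν n by
              rw [iUnion_spanningSets]; trivial)
            filter_upwards [Filter.eventually_ge_atTop m] with n hn
            exact monotone_spanningSets ν hn hm
          obtain ⟨d, hd0, hd⟩ := exists_between hpos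
          have h2 : ∀ᶠ n in Filter.atTop, d < f n x := hlim.eventually_const_lt hd
          have h3 : ∀ᶠ n : ℕ in Filter.atTop, ((n : ℝ≥0∞) + 1)⁻¹ < d := by
            have h4 : Filter.Tendsto (fun n : ℕ => ((n : ℝ≥0∞))⁻¹) Filter.atTop (nhds 0) :=
              ENNReal.tendsto_inv_nat_nhds_zero
            filter_upwards [h4.eventually_lt_const hd0] with n hn
            exact (ENNReal.inv_le_inv.2 le_self_add).trans_lt hn
          filter_upwards [h1, h2, h3] with n hn1 hn2 hn3
          exact ⟨hn1, (hn3.trans hn2).le⟩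
        have hlim2 : Filter.Tendsto (fun n => (A n).indicator (fun x => f n x ^ p) x) Filter.atTop
            (nhds (L ^ (p / q))) := by
          have h5 := hlim.ennrpow_const p
          rw [← ENNReal.rpow_mul, show 1 / q * p = p / q by ring] at h5
          refine h5.congr' ?_
          filter_upwards [hev] with n hn
          rw [Set.indicator_of_mem hn]
        rw [hlim2.liminf_eq]
    _ ≤ Filter.liminf (fun n => ∫⁻ x, (A n).indicator (fun x => f n x ^ p) x ∂ν) Filter.atTop :=
        lintegral_liminf_le fun n => ((hfm n).pow_const p).indicator (hA n)
    _ ≤ _ := by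
        refine Filter.liminf_le_of_le (by isBoundedDefault) fun b hb => ?_
        obtain ⟨n, hn⟩ := hb.exists
        exact hn.trans (hmain n)

end Duality

/-! ### The inverse Fourier transform of integrable functions -/

section FourierInverse

variable {E : Type*} [NormedAddCommGroup E] [InnerProductSpace ℝ E] [FiniteDimensional ℝ E]
  [MeasurableSpace E] [BorelSpace E]

theorem continuous_fourierInv {g : E → ℂ} (h1 : Integrable g) : Continuous (𝓕⁻ g) :=
  VectorFourier.fourierIntegral_continuous Real.continuous_fourierChar
    (show Continuous fun p : E × E => -inner ℝ p.1 p.2 from continuous_inner.neg) h1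

/-- On `L¹ ∩ L²` the inverse Fourier transform of `L²` is given by the integral. -/
theorem fourierInv_toLp_ae_eq {g : E → ℂ} (h1 : Integrable g) (h2 : MemLp g 2) :
    (𝓕⁻ h2.toLp : Lp ℂ 2 (volume : Measure E)) =ᵐ[volume] 𝓕⁻ g := by
  refine ae_eq_of_integral_contDiff_smul_eq ((Lp.memLp _).locallyIntegrable (by norm_num))
    (continuous_fourierInv h1).locallyIntegrable fun φ hφ hφs => ?_
  have hψs : HasCompactSupport fun x => (φ x : ℂ) := hφs.comp_left (g := Complex.ofReal) rfl
  have hψ : ContDiff ℝ ((⊤ : ℕ∞) : WithTop ℕ∞) fun x => (φ x : ℂ) := Complex.ofRealCLM.contDiff.comp hφ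
  set ψ := hψs.toSchwartzMap hψ with hψd
  have hψa : ∀ x, ψ x = φ x := fun x => rfl
  have e1 : ∫ x, φ x • (𝓕⁻ h2.toLp : Lp ℂ 2 (volume : Measure E)) x =
      Lp.toTemperedDistribution (𝓕⁻ h2.toLp : Lp ℂ 2 (volume : Measure E)) ψ := by
    rw [Lp.toTemperedDistribution_apply]
    rfl
  rw [e1, ← Lp.fourierInv_toTemperedDistribution_eq, TemperedDistribution.fourierInv_apply,
    Lp.toTemperedDistribution_apply]
  have e2 : ∫ x, (𝓕⁻ ψ : SchwartzMap E ℂ) x • (h2.toLp : Lp ℂ 2 (volume : Measure E)) x =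
      ∫ x, 𝓕⁻ (ψ : E → ℂ) x • g x := by
    refine integral_congr_ae ?_
    filter_upwards [h2.coeFn_toLp] with x hx
    rw [hx, SchwartzMap.fourierInv_coe]
  rw [e2]
  have e3 := VectorFourier.integral_fourierIntegral_smul_eq_flip (L := -(innerₗ E))
    (μ := volume) (ν := volume) Real.continuous_fourierChar
    (show Continuous fun p : E × E => -inner ℝ p.1 p.2 from continuous_inner.neg) ψ.integrable h1
  refine e3.trans ?_
  refine integral_congr_ae (Filter.Eventually.of_forall fun x => ?_)
  simp only
  congr 1
  have : (-(innerₗ E)).flip = -(innerₗ E) := by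
    ext x y; simp [real_inner_comm]
  rw [this]
  rfl

/-- Plancherel's inequality for integrable functions. -/
theorem lintegral_enorm_fourierInv_sq_le {g : E → ℂ} (h1 : Integrable g) :
    ∫⁻ x, ‖𝓕⁻ g x‖ₑ ^ (2 : ℝ) ≤ ∫⁻ x, ‖g x‖ₑ ^ (2 : ℝ) := by
  rcases eq_or_ne (∫⁻ x, ‖g x‖ₑ ^ (2 : ℝ)) ∞ with h | h
  · rw [h]; exact le_top
  have hL : ∀ f : E → ℂ, eLpNorm f 2 volume = (∫⁻ x, ‖f x‖ₑ ^ (2 : ℝ)) ^ (1 / 2 : ℝ) := fun f => by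
    rw [eLpNorm_eq_lintegral_rpow_enorm_toReal two_ne_zero ENNReal.ofNat_ne_top]
    simp
  have h2 : MemLp g 2 := by
    refine ⟨h1.aestronglyMeasurable, ?_⟩
    rw [hL]
    exact ENNReal.rpow_lt_top_of_nonneg (by norm_num) h
  have h3 : eLpNorm (𝓕⁻ g) 2 volume = eLpNorm g 2 volume := by
    rw [← eLpNorm_congr_ae (fourierInv_toLp_ae_eq h1 h2), ← eLpNorm_congr_ae h2.coeFn_toLp,
      ← Lp.enorm_def, ← Lp.enorm_def, ← ofReal_norm, ← ofReal_norm]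
    congr 1
    exact (Lp.fourierTransformₗᵢ E ℂ).symm.norm_map _
  rw [hL, hL] at h3
  exact ((ENNReal.rpow_left_injective (x := 1 / 2) (by norm_num)) h3).le

end FourierInverse

/-! ### Superpositions of plane waves -/

section Waves

variable {E : Type*} [NormedAddCommGroup E] [InnerProductSpace ℝ E]

/-- The phase `2π x·ζ - 4π² t |ζ|²` of the plane wave of frequency `ζ` at `z = (x, t)`. -/
noncomputable def wavePhase (z : E × ℝ) (ζ : E) : ℝ :=
  2 * Real.pi * inner ℝ z.1 ζ - z.2 * (4 * Real.pi ^ 2 * ‖ζ‖ ^ 2)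

theorem wavePhase_sub (z z' : E × ℝ) (ζ : E) :
    wavePhase (z - z') ζ = wavePhase z ζ - wavePhase z' ζ := by
  simp only [wavePhase, Prod.fst_sub, Prod.snd_sub, inner_sub_left]
  ring

theorem continuous_wavePhase : Continuous fun p : (E × ℝ) × E => wavePhase p.1 p.2 := by
  unfold wavePhase
  fun_prop

theorem norm_exp_wavePhase (z : E × ℝ) (ζ : E) : ‖Complex.exp (Complex.I * wavePhase z ζ)‖ = 1 := by
  rw [mul_comm, Complex.norm_exp_ofReal_mul_I]

theorem continuous_exp_wavePhase :
    Continuous fun p : (E × ℝ) × E => Complex.exp (Complex.I * wavePhase p.1 p.2) :=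
  Complex.continuous_exp.comp
    (continuous_const.mul (Complex.continuous_ofReal.comp continuous_wavePhase))

theorem continuous_exp_wavePhase_right (z : E × ℝ) :
    Continuous fun ζ : E => Complex.exp (Complex.I * wavePhase z ζ) :=
  continuous_exp_wavePhase.comp (Continuous.prodMk_right z)

theorem conj_exp_wavePhase (z : E × ℝ) (ζ : E) :
    starRingEnd ℂ (Complex.exp (Complex.I * wavePhase z ζ)) =
      Complex.exp (-(Complex.I * wavePhase z ζ)) := by
  rw [← Complex.exp_conj, map_mul, Complex.conj_I, Complex.conj_ofReal, neg_mul]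

theorem enorm_exp_wavePhase_mul (z : E × ℝ) (ζ : E) (w : ℂ) :
    ‖Complex.exp (Complex.I * wavePhase z ζ) * w‖ = ‖w‖ := by
  rw [norm_mul, norm_exp_wavePhase, one_mul]

variable [FiniteDimensional ℝ E] [MeasurableSpace E] [BorelSpace E]

/-- The superposition of plane waves with amplitude `g`: the free solution with (Fourier side)
data `g`. -/
noncomputable def extension (g : E → ℂ) (z : E × ℝ) : ℂ :=
  ∫ ζ, Complex.exp (Complex.I * wavePhase z ζ) * g ζ

theorem integrable_exp_wavePhase_mul {g : E → ℂ} (hg : Integrable g) (z : E × ℝ) :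
    Integrable fun ζ => Complex.exp (Complex.I * wavePhase z ζ) * g ζ :=
  hg.norm.mono' ((continuous_exp_wavePhase_right z).aestronglyMeasurable.mul hg.aestronglyMeasurable)
    (Filter.Eventually.of_forall fun ζ => (enorm_exp_wavePhase_mul z ζ (g ζ)).le)

theorem extension_congr_ae {g g' : E → ℂ} (h : g =ᵐ[volume] g') : extension g = extension g' := by
  funext z
  refine integral_congr_ae ?_
  filter_upwards [h] with ζ hζ
  rw [hζ]

theorem continuous_extension {g : E → ℂ} (hg : Integrable g) : Continuous (extension g) := by
  refine continuous_of_dominated (bound := fun ζ => ‖g ζ‖)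
    (fun z => (integrable_exp_wavePhase_mul hg z).aestronglyMeasurable)
    (fun z => Filter.Eventually.of_forall fun ζ => (enorm_exp_wavePhase_mul z ζ (g ζ)).le) hg.norm
    (Filter.Eventually.of_forall fun ζ => ?_)
  exact (continuous_exp_wavePhase.comp (Continuous.prodMk_left ζ)).mul continuous_const

theorem norm_extension_le (g : E → ℂ) (z : E × ℝ) : ‖extension g z‖ ≤ ∫ ζ, ‖g ζ‖ := by
  refine (norm_integral_le_integral_norm _).trans (le_of_eq ?_)
  exact integral_congr_ae (Filter.Eventually.of_forall fun ζ => enorm_exp_wavePhase_mul z ζ (g ζ))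

theorem extension_eq_fourierInv (g : E → ℂ) (x : E) (t : ℝ) :
    extension g (x, t) =
      𝓕⁻ (fun ζ => Complex.exp (-(Complex.I * (t * (4 * Real.pi ^ 2 * ‖ζ‖ ^ 2) : ℝ))) * g ζ) x := by
  rw [Real.fourierInv_eq']
  refine integral_congr_ae (Filter.Eventually.of_forall fun ζ => ?_)
  simp only [wavePhase, smul_eq_mul]
  rw [← mul_assoc (Complex.exp _) (Complex.exp _), ← Complex.exp_add]
  congr 2
  rw [real_inner_comm]
  push_cast
  ring

theorem memLp_wave {φ : E → ℂ} (hφ : MemLp φ 2) (z : E × ℝ) :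
    MemLp (fun ζ => starRingEnd ℂ (Complex.exp (Complex.I * wavePhase z ζ)) * φ ζ) 2 := by
  refine hφ.of_le ?_ (Filter.Eventually.of_forall fun ζ => ?_)
  · exact (Complex.continuous_conj.comp (continuous_exp_wavePhase_right z)).aestronglyMeasurable.mul
      hφ.aestronglyMeasurable
  · rw [norm_mul, RCLike.norm_conj, norm_exp_wavePhase, one_mul]

/-- The plane waves with envelope `φ`, as elements of `L²` in the frequency variable; pairing with
them is the evaluation of free solutions. -/
noncomputable def wave {φ : E → ℂ} (hφ : MemLp φ 2) (z : E × ℝ) : Lp ℂ 2 (volume : Measure E) :=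
  (memLp_wave hφ z).toLp

theorem inner_wave {φ : E → ℂ} (hφ : MemLp φ 2) (g : Lp ℂ 2 (volume : Measure E)) (z : E × ℝ) :
    inner ℂ (wave hφ z) g = extension (fun ζ => starRingEnd ℂ (φ ζ) * g ζ) z := by
  rw [L2.inner_def]
  refine integral_congr_ae ?_
  filter_upwards [(memLp_wave hφ z).coeFn_toLp] with ζ hζ
  rw [wave, hζ]
  simp only [RCLike.inner_apply, map_mul, RCLike.conj_conj]
  ring

theorem inner_wave_wave {φ : E → ℂ} (hφ : MemLp φ 2) (z z' : E × ℝ) :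
    inner ℂ (wave hφ z) (wave hφ z') =
      extension (fun ζ => starRingEnd ℂ (φ ζ) * φ ζ) (z - z') := by
  rw [inner_wave]
  refine integral_congr_ae ?_
  filter_upwards [(memLp_wave hφ z').coeFn_toLp] with ζ hζ
  rw [wave, hζ, conj_exp_wavePhase, wavePhase_sub]
  push_cast
  rw [mul_sub, sub_eq_add_neg, Complex.exp_add]
  ring

theorem integrable_conj_mul {φ g : E → ℂ} (hφ : MemLp φ 2) (hg : MemLp g 2) :
    Integrable fun ζ => starRingEnd ℂ (φ ζ) * g ζ := by
  have h : MemLp (fun ζ => starRingEnd ℂ (φ ζ)) 2 volume := hφ.star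
  exact h.integrable_mul hg

theorem continuous_wave {φ : E → ℂ} (hφ : MemLp φ 2) : Continuous (wave hφ) := by
  have hk := continuous_extension (integrable_conj_mul hφ hφ)
  rw [continuous_iff_continuousAt]
  intro z₀
  rw [ContinuousAt, tendsto_iff_norm_sub_tendsto_zero]
  have h1 : ∀ z, ‖wave hφ z - wave hφ z₀‖ ^ 2 =
      (2 * (extension (fun ζ => starRingEnd ℂ (φ ζ) * φ ζ) 0).re -
        2 * (extension (fun ζ => starRingEnd ℂ (φ ζ) * φ ζ) (z - z₀)).re) := fun z => by
    rw [@norm_sub_sq ℂ, inner_wave_wave, ← @inner_self_eq_norm_sq ℂ, ← @inner_self_eq_norm_sq ℂ,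
      inner_wave_wave, inner_wave_wave, sub_self, sub_self]
    simp only [RCLike.re_eq_complex_re]
    ring
  have h2 : Filter.Tendsto (fun z => ‖wave hφ z - wave hφ z₀‖ ^ 2) (nhds z₀) (nhds 0) := by
    simp_rw [h1]
    have h3 : Continuous fun z : E × ℝ =>
        2 * (extension (fun ζ => starRingEnd ℂ (φ ζ) * φ ζ) 0).re -
          2 * (extension (fun ζ => starRingEnd ℂ (φ ζ) * φ ζ) (z - z₀)).re := by
      have := hk.comp (continuous_id.sub (continuous_const (y := z₀)))
      exact continuous_const.sub (continuous_const.mul (Complex.continuous_re.comp this))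
    have h4 := h3.tendsto z₀
    simpa using h4
  have h5 := h2.sqrt
  simpa [Real.sqrt_sq] using h5

theorem norm_wave_le {φ : E → ℂ} (hφ : MemLp φ 2) (z : E × ℝ) :
    ‖wave hφ z‖ ≤ (eLpNorm φ 2 volume).toReal := by
  rw [wave, Lp.norm_toLp]
  refine ENNReal.toReal_mono hφ.eLpNorm_ne_top ?_
  refine eLpNorm_mono fun ζ => ?_
  rw [norm_mul, RCLike.norm_conj, norm_exp_wavePhase, one_mul]

end Waves

/-! ### The free evolution as a superposition of plane waves -/

section Identification

variable {d : ℕ}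

theorem schrodingerGroup_ae_eq_extension {h : L2Space d} {g : RSpace d → ℂ} (hg : Integrable g)
    (hh : (𝓕 h : L2Space d) =ᵐ[volume] g) (t : ℝ) :
    schrodingerGroup t h =ᵐ[volume] fun x => extension g (x, t) := by
  have hmem := memLp_symbol_mul (continuous_schrodingerSymbol (d := d) t)
    (fun ξ => (norm_schrodingerSymbol t ξ).le) (𝓕 h : L2Space d)
  have h1 : schrodingerGroup t h = 𝓕⁻ hmem.toLp := dif_pos hmem
  have hsym : ∀ ζ : RSpace d, Complex.exp (-(Complex.I * (t * ‖(2 * Real.pi) • ζ‖ ^ 2 : ℝ))) =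
      Complex.exp (-(Complex.I * (t * (4 * Real.pi ^ 2 * ‖ζ‖ ^ 2) : ℝ))) := fun ζ => by
    rw [norm_smul, Real.norm_of_nonneg (by positivity), mul_pow]
    congr 5; ring
  have hint : Integrable fun ζ : RSpace d =>
      Complex.exp (-(Complex.I * (t * ‖(2 * Real.pi) • ζ‖ ^ 2 : ℝ))) * (𝓕 h : L2Space d) ζ := by
    have hi : Integrable (𝓕 h : L2Space d) := hg.congr hh.symm
    refine hi.norm.mono' hmem.aestronglyMeasurable (Filter.Eventually.of_forall fun ζ => ?_)
    have h2 := norm_schrodingerSymbol t ((2 * Real.pi) • ζ)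
    rw [norm_mul, h2, one_mul]
  rw [h1]
  refine (fourierInv_toLp_ae_eq hint hmem).trans (Filter.Eventually.of_forall fun x => ?_)
  simp only
  rw [extension_eq_fourierInv]
  refine Real.fourierInv_congr_ae ?_ x
  filter_upwards [hh] with ζ hζ
  rw [hζ, hsym]

theorem freeEvolution_ae_eq_extension {h : L2Space d} {g : RSpace d → ℂ} (hg : Integrable g)
    (hh : (𝓕 h : L2Space d) =ᵐ[volume] g) : freeEvolution h =ᵐ[volume] extension g := by
  obtain ⟨hm, hs⟩ := freeEvolution_spec h
  have hmeas : MeasurableSet {z : RSpace d × ℝ | freeEvolution h z = extension g z} :=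
    measurableSet_eq_fun hm (continuous_extension hg).measurable
  have h1 : ∀ᵐ z ∂((volume : Measure ℝ).prod (volume : Measure (RSpace d))),
      freeEvolution h z.swap = extension g z.swap := by
    refine (Measure.ae_prod_iff_ae_ae (measurable_swap hmeas)).2
      (Filter.Eventually.of_forall fun t => ?_)
    filter_upwards [hs t, schrodingerGroup_ae_eq_extension hg hh t] with x hx hx'
    exact hx.trans hx'
  have h2 := (Measure.measurePreserving_swap (μ := (volume : Measure (RSpace d)))
    (ν := (volume : Measure ℝ))).quasiMeasurePreserving.ae h1
  filter_upwards [h2] with z hz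
  simpa using hz

end Identification

/-! ### Coordinates along and across a direction -/

section Lateral

variable {d : ℕ}

/-- The coordinates `(x₁, x') ↦ x₁ e + x'` of `ℝ^d`. -/
noncomputable def lateralCoord (e : RSpace d) (he : ‖e‖ = 1) :
    ℝ × (Submodule.span ℝ {e})ᗮ ≃ᵐ RSpace d :=
  (MeasurableEquiv.prodCongr
    (LinearIsometryEquiv.toSpanUnitSingleton (𝕜 := ℝ) e he).toHomeomorph.toMeasurableEquiv
    (MeasurableEquiv.refl _)).trans <|
  (MeasurableEquiv.toLp 2 _).trans <|
  (Submodule.span ℝ {e}).orthogonalDecomposition.symm.toHomeomorph.toMeasurableEquiv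

theorem lateralCoord_apply (e : RSpace d) (he : ‖e‖ = 1) (y : ℝ × (Submodule.span ℝ {e})ᗮ) :
    lateralCoord e he y = y.1 • e + (y.2 : RSpace d) := by
  simp [lateralCoord]
  rfl

theorem measurePreserving_lateralCoord (e : RSpace d) (he : ‖e‖ = 1) :
    MeasurePreserving (lateralCoord e he) := by
  have h1 : MeasurePreserving (MeasurableEquiv.prodCongr
      (LinearIsometryEquiv.toSpanUnitSingleton (𝕜 := ℝ) e he).toHomeomorph.toMeasurableEquiv
      (MeasurableEquiv.refl (Submodule.span ℝ {e})ᗮ)) :=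
    (LinearIsometryEquiv.measurePreserving
      (LinearIsometryEquiv.toSpanUnitSingleton (𝕜 := ℝ) e he)).prod (MeasurePreserving.id _)
  have h2 : MeasurePreserving
      (MeasurableEquiv.toLp 2 ((Submodule.span ℝ {e}) × (Submodule.span ℝ {e})ᗮ)) :=
    WithLp.volume_preserving_toLp _ _
  have h3 : MeasurePreserving
      (Submodule.span ℝ {e}).orthogonalDecomposition.symm.toHomeomorph.toMeasurableEquiv :=
    LinearIsometryEquiv.measurePreserving (Submodule.span ℝ {e}).orthogonalDecomposition.symm
  exact h1.trans (h2.trans h3)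

/-- The coordinates `(x₁, (x', t)) ↦ (x₁ e + x', t)` of space-time. -/
noncomputable def lateralSpaceTime (e : RSpace d) (he : ‖e‖ = 1) :
    ℝ × ((Submodule.span ℝ {e})ᗮ × ℝ) ≃ᵐ RSpace d × ℝ :=
  MeasurableEquiv.prodAssoc.symm.trans
    (MeasurableEquiv.prodCongr (lateralCoord e he) (MeasurableEquiv.refl _))

theorem lateralSpaceTime_apply (e : RSpace d) (he : ‖e‖ = 1)
    (y : ℝ × ((Submodule.span ℝ {e})ᗮ × ℝ)) :
    lateralSpaceTime e he y = (y.1 • e + (y.2.1 : RSpace d), y.2.2) := by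
  rw [← lateralCoord_apply e he (y.1, y.2.1)]
  rfl

theorem measurePreserving_lateralSpaceTime (e : RSpace d) (he : ‖e‖ = 1) :
    MeasurePreserving (lateralSpaceTime e he) := by
  refine MeasurePreserving.trans (μb := volume) ?_ ?_
  · exact (measurePreserving_prodAssoc volume volume volume).symm
  · exact (measurePreserving_lateralCoord e he).prod (MeasurePreserving.id _)

theorem ae_lateral_of_ae {e : RSpace d} (he : ‖e‖ = 1) {P : RSpace d × ℝ → Prop}
    (h : ∀ᵐ z, P z) : ∀ᵐ x₁ : ℝ, ∀ᵐ y : (Submodule.span ℝ {e})ᗮ × ℝ,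
      P (x₁ • e + (y.1 : RSpace d), y.2) := by
  have h1 := (measurePreserving_lateralSpaceTime e he).quasiMeasurePreserving.ae h
  have h2 := Measure.ae_ae_of_ae_prod (show ∀ᵐ y ∂((volume : Measure ℝ).prod
    (volume : Measure ((Submodule.span ℝ {e})ᗮ × ℝ))), P (lateralSpaceTime e he y) from h1)
  filter_upwards [h2] with x₁ hx
  filter_upwards [hx] with y hy
  rwa [lateralSpaceTime_apply] at hy

theorem lateralNorm_congr_ae {e : RSpace d} (he : ‖e‖ = 1) (p q : ℝ≥0∞)
    {h h' : RSpace d × ℝ → ℂ} (hh : h =ᵐ[volume] h') :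
    lateralNorm p q e h = lateralNorm p q e h' := by
  refine eLpNorm_congr_ae ?_
  filter_upwards [ae_lateral_of_ae he hh] with x₁ hx
  exact eLpNorm_congr_ae hx

/-- The map `(x, t) ↦ (x + t w, t)` preserves the measure. -/
theorem measurePreserving_shear (w : RSpace d) :
    MeasurePreserving fun z : RSpace d × ℝ => (z.1 + z.2 • w, z.2) := by
  have h : MeasurePreserving (fun z : ℝ × RSpace d => (z.1, z.2 + z.1 • w))
      ((volume : Measure ℝ).prod (volume : Measure (RSpace d)))
      ((volume : Measure ℝ).prod (volume : Measure (RSpace d))) := by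
    refine MeasurePreserving.skew_product (f := id) (g := fun t x => x + t • w)
      (MeasurePreserving.id _) (by fun_prop) (Filter.Eventually.of_forall fun t => ?_)
    exact map_add_right_eq_self _ _
  have h1 := (Measure.measurePreserving_swap (μ := (volume : Measure ℝ))
    (ν := (volume : Measure (RSpace d)))).comp (h.comp (Measure.measurePreserving_swap
      (μ := (volume : Measure (RSpace d))) (ν := (volume : Measure ℝ))))
  exact h1

theorem galilean_zero (h : RSpace d × ℝ → ℂ) : galilean 0 h = h := by
  funext z
  simp [galilean]

theorem enorm_galilean (w : RSpace d) (h : RSpace d × ℝ → ℂ) (z : RSpace d × ℝ) :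
    ‖galilean w h z‖ₑ = ‖h (z.1 + z.2 • w, z.2)‖ₑ := by
  have h1 : ∀ r : ℝ, ‖Complex.exp (-(Complex.I * (r : ℝ)))‖ = 1 := fun r => by
    have : -(Complex.I * (r : ℂ)) = ((-r : ℝ) : ℂ) * Complex.I := by push_cast; ring
    rw [this, Complex.norm_exp_ofReal_mul_I]
  rw [galilean, ← ofReal_norm, norm_mul, norm_mul, h1, h1, one_mul, one_mul, ofReal_norm]

/-- A Fatou property of the norm of `L^{∞,2}_{e,l}`. -/
theorem galileanNorm_infty_two_le_of_tendsto {e : RSpace d} (he : ‖e‖ = 1) (l : ℝ) {B : ℝ≥0∞}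
    {u : RSpace d × ℝ → ℂ} {v : ℕ → RSpace d × ℝ → ℂ} (hv : ∀ n, Continuous (v n))
    (hlim : ∀ᵐ z, Filter.Tendsto (fun n => v n z) Filter.atTop (nhds (u z)))
    (hB : ∀ n, galileanNorm ∞ 2 e l (v n) ≤ B) : galileanNorm ∞ 2 e l u ≤ B := by
  have h1 := ae_lateral_of_ae he
    ((measurePreserving_shear (l • e)).quasiMeasurePreserving.ae hlim)
  have h2 : ∀ᵐ x₁ : ℝ, ∀ n, eLpNorm (fun y : (Submodule.span ℝ {e})ᗮ × ℝ =>
      galilean (l • e) (v n) (x₁ • e + (y.1 : RSpace d), y.2)) 2 volume ≤ B := by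
    rw [ae_all_iff]
    intro n
    have h3 := hB n
    rw [galileanNorm, lateralNorm, eLpNorm_exponent_top] at h3
    filter_upwards [ae_le_eLpNormEssSup (f := fun x₁ : ℝ =>
      eLpNorm (fun y : (Submodule.span ℝ {e})ᗮ × ℝ =>
      galilean (l • e) (v n) (x₁ • e + (y.1 : RSpace d), y.2)) 2 volume)] with x hx
    exact hx.trans h3
  rw [galileanNorm, lateralNorm, eLpNorm_exponent_top]
  refine essSup_le_of_ae_le B ?_
  filter_upwards [h1, h2] with x₁ hx hx'
  rw [enorm_eq_self]
  refine (Lp.eLpNorm_lim_le_liminf_eLpNorm (f := fun n (y : (Submodule.span ℝ {e})ᗮ × ℝ) =>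
      galilean (l • e) (v n) (x₁ • e + (y.1 : RSpace d), y.2)) (fun n => ?_) _ ?_).trans ?_
  · refine Continuous.aestronglyMeasurable ?_
    unfold galilean
    have := hv n
    fun_prop
  · filter_upwards [hx] with y hy
    exact hy.const_mul _
  · refine Filter.liminf_le_of_le (by isBoundedDefault) fun b hb => ?_
    obtain ⟨n, hn⟩ := hb.exists
    exact hn.trans (hx' n)

end Lateral

/-! ### Gaussian regularization of the free evolution -/

section GaussianRegularization

variable {d : ℕ}

/-- The Gaussian envelope `e^{-4π² a |ζ|²}`. -/
noncomputable def gaussEnv (a : ℝ) (ζ : RSpace d) : ℂ :=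
  (Real.exp (-(a * (4 * Real.pi ^ 2 * ‖ζ‖ ^ 2))) : ℝ)

theorem continuous_gaussEnv (a : ℝ) : Continuous (gaussEnv a : RSpace d → ℂ) := by
  unfold gaussEnv
  fun_prop

theorem conj_gaussEnv (a : ℝ) (ζ : RSpace d) : starRingEnd ℂ (gaussEnv a ζ) = gaussEnv a ζ :=
  Complex.conj_ofReal _

theorem gaussEnv_mul_self (a : ℝ) (ζ : RSpace d) :
    gaussEnv a ζ * gaussEnv a ζ = gaussEnv (2 * a) ζ := by
  rw [gaussEnv, gaussEnv, ← Complex.ofReal_mul, ← Real.exp_add]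
  congr 2; ring

theorem norm_gaussEnv_le_one {a : ℝ} (ha : 0 ≤ a) (ζ : RSpace d) : ‖gaussEnv a ζ‖ ≤ 1 := by
  rw [gaussEnv, Complex.norm_real, Real.norm_of_nonneg (Real.exp_nonneg _), Real.exp_le_one_iff]
  have : 0 ≤ a * (4 * Real.pi ^ 2 * ‖ζ‖ ^ 2) := by positivity
  linarith

theorem memLp_gaussEnv {a : ℝ} (ha : 0 < a) : MemLp (gaussEnv a : RSpace d → ℂ) 2 := by
  refine (memLp_two_iff_integrable_sq_norm (continuous_gaussEnv a).aestronglyMeasurable).2 ?_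
  have h := GaussianFourier.integrable_cexp_neg_mul_sq_norm_add
    (b := ((2 * a * (4 * Real.pi ^ 2) : ℝ) : ℂ)) (by rw [Complex.ofReal_re]; positivity) 0 (0 : RSpace d)
  refine h.norm.congr (Filter.Eventually.of_forall fun ζ => ?_)
  simp only [gaussEnv]
  rw [Complex.norm_exp, Complex.norm_real, Real.norm_of_nonneg (Real.exp_nonneg _), ← Real.exp_nat_mul]
  congr 1
  rw [← Complex.ofReal_pow, ← Complex.ofReal_neg, ← Complex.ofReal_mul]
  simp only [zero_mul, add_zero, Complex.ofReal_re]
  push_cast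
  ring

theorem integrable_gaussEnv_mul {a : ℝ} (ha : 0 < a) (g : L2Space d) :
    Integrable fun ζ => gaussEnv a ζ * g ζ := by
  have := integrable_conj_mul (memLp_gaussEnv (d := d) ha) (Lp.memLp g)
  simpa only [conj_gaussEnv] using this

theorem norm_schrodingerGroup_sub_le (t : ℝ) (h h' : L2Space d) :
    ‖schrodingerGroup t h - schrodingerGroup t h'‖ ≤ ‖h - h'‖ := by
  have hmem := fun f : L2Space d => memLp_symbol_mul (continuous_schrodingerSymbol (d := d) t)
    (fun ξ => (norm_schrodingerSymbol t ξ).le) (𝓕 f : L2Space d)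
  have h1 : ∀ f : L2Space d, schrodingerGroup t f = 𝓕⁻ (hmem f).toLp := fun f => dif_pos (hmem f)
  have h2 : ∀ f f' : L2Space d, 𝓕⁻ f - 𝓕⁻ f' = (𝓕⁻ (f - f') : L2Space d) := fun f f' =>
    ((Lp.fourierTransformₗᵢ (RSpace d) ℂ).symm.map_sub f f').symm
  have h3 : (𝓕 (h - h') : L2Space d) = 𝓕 h - 𝓕 h' := (Lp.fourierTransformₗᵢ (RSpace d) ℂ).map_sub h h'
  have h4 : ∀ f : L2Space d, ‖(𝓕⁻ f : L2Space d)‖ = ‖f‖ :=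
    (Lp.fourierTransformₗᵢ (RSpace d) ℂ).symm.norm_map
  rw [h1, h1, h2, h4, ← Lp.norm_fourier_eq (h - h'), h3, ← MemLp.toLp_sub]
  refine Lp.norm_le_norm_of_ae_le ?_
  filter_upwards [((hmem h).sub (hmem h')).coeFn_toLp, Lp.coeFn_sub (𝓕 h : L2Space d) (𝓕 h')] with ζ h5 h6
  rw [h5, h6]
  simp only [Pi.sub_apply]
  rw [← mul_sub, norm_mul, norm_schrodingerSymbol, one_mul]

theorem exists_gaussEnv_close (g : L2Space d) {ε : ℝ} (hε : 0 < ε) :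
    ∃ a > 0, eLpNorm (fun ζ => gaussEnv a ζ * g ζ - g ζ) 2 volume ≤ ENNReal.ofReal ε := by
  have h2 : (2 : ℝ≥0∞) ≠ 0 := two_ne_zero
  have hlim : Filter.Tendsto (fun n : ℕ => eLpNorm (fun ζ => gaussEnv (1 / ((n : ℝ) + 1)) ζ * g ζ - g ζ)
      2 volume) Filter.atTop (nhds 0) := by
    have hm : ∀ n : ℕ, AEStronglyMeasurable (fun ζ => gaussEnv (1 / ((n : ℝ) + 1)) ζ * g ζ - g ζ) volume :=
      fun n => (((continuous_gaussEnv _).aestronglyMeasurable.mul (Lp.aestronglyMeasurable g)).sub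
        (Lp.aestronglyMeasurable g))
    simp only [eLpNorm_eq_lintegral_rpow_enorm_toReal h2 ENNReal.ofNat_ne_top]
    have h0 : Filter.Tendsto (fun n : ℕ => ∫⁻ ζ, ‖gaussEnv (1 / ((n : ℝ) + 1)) ζ * g ζ - g ζ‖ₑ ^
        (2 : ℝ≥0∞).toReal) Filter.atTop (nhds (∫⁻ _ : RSpace d, 0)) := by
      refine tendsto_lintegral_filter_of_dominated_convergence'
        (fun ζ => (2 * ‖g ζ‖ₑ) ^ (2 : ℝ≥0∞).toReal) ?_ ?_ ?_ ?_
      · exact Filter.Eventually.of_forall fun n => (hm n).enorm.pow_const _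
      · refine Filter.Eventually.of_forall fun n => Filter.Eventually.of_forall fun ζ => ?_
        refine ENNReal.rpow_le_rpow ?_ (by simp)
        refine enorm_sub_le.trans ?_
        rw [two_mul, enorm_mul]
        gcongr
        refine mul_le_of_le_one_left zero_le ?_
        rw [← ofReal_norm, ← ENNReal.ofReal_one]
        exact ENNReal.ofReal_le_ofReal (norm_gaussEnv_le_one (by positivity) ζ)
      · have := (Lp.memLp g).eLpNorm_lt_top
        rw [eLpNorm_lt_top_iff_lintegral_rpow_enorm_lt_top h2 ENNReal.ofNat_ne_top] at this
        simp only [ENNReal.mul_rpow_of_nonneg _ _ (ENNReal.toReal_nonneg (a := 2))]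
        rw [lintegral_const_mul' _ _ (by simp)]
        exact ENNReal.mul_ne_top (by simp) this.ne
      · refine Filter.Eventually.of_forall fun ζ => ?_
        have hc : Continuous fun s : ℝ => ‖gaussEnv s ζ * g ζ - g ζ‖ₑ ^ (2 : ℝ≥0∞).toReal := by
          refine (ENNReal.continuous_rpow_const).comp (continuous_enorm.comp ?_)
          unfold gaussEnv
          fun_prop
        have := (hc.tendsto 0).comp (tendsto_one_div_add_atTop_nhds_zero_nat (𝕜 := ℝ))
        simpa [gaussEnv, Function.comp_def] using this
    rw [lintegral_zero] at h0
    have := h0.ennrpow_const (1 / (2 : ℝ≥0∞).toReal)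
    simpa using this
  obtain ⟨n, hn⟩ := (hlim.eventually (gt_mem_nhds (ENNReal.ofReal_pos.2 hε))).exists
  exact ⟨1 / ((n : ℝ) + 1), by positivity, hn.le⟩

/-- Gaussian regularizations of the data converge to the free evolution almost everywhere, along a
sequence. -/
theorem exists_tendsto_freeEvolution (h : L2Space d) :
    ∃ a : ℕ → ℝ, (∀ n, 0 < a n) ∧ ∀ᵐ z : RSpace d × ℝ,
      Filter.Tendsto (fun n => extension (fun ζ => gaussEnv (a n) ζ * (𝓕 h : L2Space d) ζ) z)
        Filter.atTop (nhds (freeEvolution h z)) := by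
  choose a ha hclose using fun n : ℕ => exists_gaussEnv_close (𝓕 h : L2Space d)
    (show (0 : ℝ) < (1 / 2) ^ n by positivity)
  refine ⟨a, ha, ?_⟩
  set v : ℕ → RSpace d × ℝ → ℂ := fun n => extension fun ζ => gaussEnv (a n) ζ * (𝓕 h : L2Space d) ζ
  have hvc : ∀ n, Continuous (v n) := fun n => continuous_extension (integrable_gaussEnv_mul (ha n) _)
  obtain ⟨hum, hus⟩ := freeEvolution_spec h
  have hmeas : ∀ n, Measurable fun z => ‖v n z - freeEvolution h z‖ₑ ^ (2 : ℝ) := fun n =>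
    (((hvc n).measurable.sub hum).enorm).pow_const _
  -- on each time slice the error is that of the data, since the group is unitary
  have hslice : ∀ n t, ∫⁻ x, ‖v n (x, t) - freeEvolution h (x, t)‖ₑ ^ (2 : ℝ) ≤ (1 / 2 : ℝ≥0∞) ^ n := by
    intro n t
    have hmem : MemLp (fun ζ => gaussEnv (a n) ζ * (𝓕 h : L2Space d) ζ) 2 := by
      refine (Lp.memLp (𝓕 h : L2Space d)).of_le ((continuous_gaussEnv _).aestronglyMeasurable.mul
        (Lp.aestronglyMeasurable _)) (Filter.Eventually.of_forall fun ζ => ?_)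
      rw [norm_mul]
      exact mul_le_of_le_one_left (norm_nonneg _) (norm_gaussEnv_le_one (ha n).le ζ)
    set hn : L2Space d := 𝓕⁻ hmem.toLp with hhn
    have hF : (𝓕 hn : L2Space d) = hmem.toLp := (Lp.fourierTransformₗᵢ (RSpace d) ℂ).apply_symm_apply _
    have h1 := schrodingerGroup_ae_eq_extension (integrable_gaussEnv_mul (ha n) _)
      (h := hn) (by rw [hF]; exact hmem.coeFn_toLp) t
    have h2 : eLpNorm (fun x => v n (x, t) - freeEvolution h (x, t)) 2 volume ≤
        ENNReal.ofReal ((1 / 2) ^ n) := by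
      have h3 : eLpNorm (fun x => v n (x, t) - freeEvolution h (x, t)) 2 volume =
          ‖schrodingerGroup t hn - schrodingerGroup t h‖ₑ := by
        rw [Lp.enorm_def]
        refine eLpNorm_congr_ae ?_
        filter_upwards [h1, hus t, Lp.coeFn_sub (schrodingerGroup t hn) (schrodingerGroup t h)]
          with x hx hx' hx''
        rw [hx'', Pi.sub_apply, hx, ← hx']
      rw [h3, ← ofReal_norm]
      refine (ENNReal.ofReal_le_ofReal (norm_schrodingerGroup_sub_le t hn h)).trans ?_
      have h4 : (𝓕 (hn - h) : L2Space d) = 𝓕 hn - 𝓕 h :=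
        (Lp.fourierTransformₗᵢ (RSpace d) ℂ).map_sub hn h
      rw [← Lp.norm_fourier_eq (hn - h), h4, hF, ofReal_norm, Lp.enorm_def]
      refine le_trans (le_of_eq ?_) (hclose n)
      refine eLpNorm_congr_ae ?_
      filter_upwards [Lp.coeFn_sub hmem.toLp (𝓕 h : L2Space d), hmem.coeFn_toLp] with ζ h5 h6
      rw [h5, Pi.sub_apply, h6]
    rw [eLpNorm_eq_lintegral_rpow_enorm_toReal two_ne_zero ENNReal.ofNat_ne_top] at h2
    simp only [ENNReal.toReal_ofNat] at h2
    rw [one_div (2 : ℝ), ENNReal.rpow_inv_le_iff (by norm_num)] at h2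
    refine h2.trans ?_
    have h7 : ENNReal.ofReal (1 / 2) = 1 / 2 := by
      rw [ENNReal.ofReal_div_of_pos (by norm_num), ENNReal.ofReal_one, ENNReal.ofReal_ofNat]
    rw [ENNReal.ofReal_pow (by norm_num), ENNReal.rpow_ofNat, pow_two, ← one_div, h7]
    refine mul_le_of_le_one_left zero_le (pow_le_one₀ zero_le ?_)
    simp
  -- the squared errors are summable, hence tend to zero almost everywhere
  have hSm : Measurable fun z => ∑' n, ‖v n z - freeEvolution h z‖ₑ ^ (2 : ℝ) :=
    Measurable.tsum hmeas
  have h1 : ∀ᵐ z ∂((volume : Measure ℝ).prod (volume : Measure (RSpace d))),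
      ∑' n, ‖v n z.swap - freeEvolution h z.swap‖ₑ ^ (2 : ℝ) < ∞ := by
    refine (Measure.ae_prod_iff_ae_ae ((measurable_swap (measurableSet_lt hSm measurable_const)))).2
      (Filter.Eventually.of_forall fun t => ?_)
    refine ae_lt_top (hSm.comp measurable_prodMk_right) ?_
    change ∫⁻ x, ∑' n, ‖v n (x, t) - freeEvolution h (x, t)‖ₑ ^ (2 : ℝ) ≠ ∞
    rw [lintegral_tsum fun n => (show Measurable fun x => ‖v n (x, t) - freeEvolution h (x, t)‖ₑ ^ (2 : ℝ)
      from (hmeas n).comp measurable_prodMk_right).aemeasurable]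
    refine ne_top_of_le_ne_top ?_ (ENNReal.tsum_le_tsum fun n => hslice n t)
    rw [ENNReal.tsum_geometric]
    simp
  have h2 := (Measure.measurePreserving_swap (μ := (volume : Measure (RSpace d)))
    (ν := (volume : Measure ℝ))).quasiMeasurePreserving.ae h1
  filter_upwards [h2] with z hz
  rw [Prod.swap_swap] at hz
  have h3 := ENNReal.tendsto_atTop_zero_of_tsum_ne_top hz.ne
  have h4 := h3.ennrpow_const (1 / 2)
  simp only [← ENNReal.rpow_mul] at h4
  norm_num at h4
  rw [tendsto_iff_edist_tendsto_0]
  simpa [edist_eq_enorm_sub] using h4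

end GaussianRegularization

/-! ### The Gaussian kernel -/

section GaussianKernel

variable {d : ℕ}

/-- The kernel is the heat kernel at the complex time `a + i t`. -/
theorem norm_extension_gaussEnv {a : ℝ} (ha : 0 < a) (x : RSpace d) (t : ℝ) :
    ‖extension (gaussEnv a) (x, t)‖ =
      (4 * Real.pi * √(a ^ 2 + t ^ 2)) ^ (-((d : ℝ) / 2)) *
        Real.exp (-(a * ‖x‖ ^ 2 / (4 * (a ^ 2 + t ^ 2)))) := by
  set w : ℂ := (a : ℂ) + t * Complex.I with hw
  set b : ℂ := (4 * Real.pi ^ 2 : ℝ) * w with hb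
  have hwre : w.re = a := by simp [hw]
  have hwim : w.im = t := by simp [hw]
  have hbre : 0 < b.re := by
    rw [hb, Complex.re_ofReal_mul, hwre]; positivity
  have hA : 0 < a ^ 2 + t ^ 2 := by positivity
  have hwn : ‖w‖ = √(a ^ 2 + t ^ 2) := by
    rw [Complex.norm_def, Complex.normSq_apply, hwre, hwim]
    congr 1; ring
  have hw0 : w ≠ 0 := fun h => by rw [h] at hwre; simp at hwre; linarith
  have h1 : extension (gaussEnv a) (x, t) =
      ∫ v : RSpace d, Complex.exp (-b * ‖v‖ ^ 2 + (2 * Real.pi * Complex.I) * (inner ℝ x v : ℝ)) := by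
    refine integral_congr_ae (Filter.Eventually.of_forall fun ζ => ?_)
    simp only [wavePhase, gaussEnv]
    rw [Complex.ofReal_exp, ← Complex.exp_add]
    congr 1
    rw [hb, hw]
    push_cast
    ring
  rw [h1, GaussianFourier.integral_cexp_neg_mul_sq_norm_add hbre, norm_mul, Complex.norm_exp]
  have h2 : ((Module.finrank ℝ (RSpace d) : ℂ) / 2) = (((d : ℝ) / 2 : ℝ) : ℂ) := by
    rw [finrank_euclideanSpace_fin]; push_cast; rfl
  rw [h2, Complex.norm_cpow_real, norm_div, hb, norm_mul, Complex.norm_real, Complex.norm_real,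
    Real.norm_of_nonneg Real.pi_pos.le, Real.norm_of_nonneg (by positivity), hwn]
  congr 1
  · rw [Real.rpow_neg (by positivity), ← Real.inv_rpow (by positivity)]
    congr 1
    field_simp
  · congr 1
    have h3 : (2 * (Real.pi : ℂ) * Complex.I) ^ 2 * (‖x‖ : ℂ) ^ 2 / (4 * ((4 * Real.pi ^ 2 : ℝ) * w)) =
        ((-(‖x‖ ^ 2 / 4) : ℝ) : ℂ) * w⁻¹ := by
      have hpi : (Real.pi : ℂ) ≠ 0 := by exact_mod_cast Real.pi_ne_zero
      rw [mul_pow, Complex.I_sq]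
      push_cast
      field_simp
      ring
    rw [h3, Complex.re_ofReal_mul, Complex.inv_re, hwre, Complex.normSq_apply, hwre, hwim]
    field_simp

theorem inner_wave_gaussEnv {a : ℝ} (ha : 0 < a) (z z' : RSpace d × ℝ) :
    inner ℂ (wave (memLp_gaussEnv ha) z) (wave (memLp_gaussEnv ha) z') =
      extension (gaussEnv (2 * a)) (z - z') := by
  rw [inner_wave_wave]
  simp only [conj_gaussEnv, gaussEnv_mul_self]

theorem inner_wave_gaussEnv_left {a : ℝ} (ha : 0 < a) (g : L2Space d) (z : RSpace d × ℝ) :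
    inner ℂ (wave (memLp_gaussEnv ha) z) g = extension (fun ζ => gaussEnv a ζ * g ζ) z := by
  rw [inner_wave]
  simp only [conj_gaussEnv]

/-- The dispersive bound, uniform in the regularization `a`. -/
theorem enorm_extension_gaussEnv_le {a : ℝ} (ha : 0 < a) (x : RSpace d) {t : ℝ} (ht : t ≠ 0) :
    ‖extension (gaussEnv a) (x, t)‖ₑ ≤ ENNReal.ofReal |t| ^ (-((d : ℝ) / 2)) := by
  have ht' : 0 < |t| := abs_pos.2 ht
  rw [← ofReal_norm, norm_extension_gaussEnv ha, ENNReal.ofReal_rpow_of_pos ht']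
  refine ENNReal.ofReal_le_ofReal ?_
  have h1 : |t| ≤ 4 * Real.pi * √(a ^ 2 + t ^ 2) := by
    have h2 : |t| ≤ √(a ^ 2 + t ^ 2) := Real.abs_le_sqrt (by nlinarith)
    have h3 : 1 ≤ 4 * Real.pi := by linarith [Real.pi_gt_three]
    nlinarith
  have h4 : Real.exp (-(a * ‖x‖ ^ 2 / (4 * (a ^ 2 + t ^ 2)))) ≤ 1 := by
    rw [Real.exp_le_one_iff, neg_nonpos]; positivity
  calc _ ≤ (4 * Real.pi * √(a ^ 2 + t ^ 2)) ^ (-((d : ℝ) / 2)) * 1 := by gcongr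
    _ ≤ _ := by
      rw [mul_one]
      exact Real.rpow_le_rpow_of_nonpos ht' h1 (by
        have : (0 : ℝ) ≤ d / 2 := by positivity
        linarith)

/-- At equal times the Gaussian kernel has unit mass. -/
theorem lintegral_extension_gaussEnv {a : ℝ} (ha : 0 < a) (x : RSpace d) :
    ∫⁻ y : RSpace d, ‖extension (gaussEnv a) (x - y, 0)‖ₑ = 1 := by
  have h0 : ∀ y : RSpace d, ‖extension (gaussEnv a) (y, 0)‖ₑ =
      ENNReal.ofReal ((4 * Real.pi * a) ^ (-((d : ℝ) / 2)) * Real.exp (-(1 / (4 * a)) * ‖y‖ ^ 2)) := by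
    intro y
    rw [← ofReal_norm, norm_extension_gaussEnv ha]
    congr 2
    · rw [zero_pow two_ne_zero, add_zero, Real.sqrt_sq ha.le]
    · congr 1
      field_simp
      ring
  rw [lintegral_sub_left_eq_self (fun y : RSpace d => ‖extension (gaussEnv a) (y, 0)‖ₑ) x]
  simp_rw [h0]
  have hb : 0 < 1 / (4 * a) := by positivity
  have h1 := GaussianFourier.integral_rexp_neg_mul_sq_norm (V := RSpace d) hb
  have hi : Integrable fun y : RSpace d => Real.exp (-(1 / (4 * a)) * ‖y‖ ^ 2) := by
    by_contra h
    rw [integral_undef h] at h1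
    have : 0 < (Real.pi / (1 / (4 * a))) ^ ((Module.finrank ℝ (RSpace d) : ℝ) / 2) := by positivity
    linarith
  rw [← ofReal_integral_eq_lintegral_ofReal (hi.const_mul _)
    (Filter.Eventually.of_forall fun y => by positivity), integral_const_mul, h1,
    finrank_euclideanSpace_fin, Real.rpow_neg (by positivity),
    show Real.pi / (1 / (4 * a)) = 4 * Real.pi * a by field_simp,
    inv_mul_cancel₀ (by positivity), ENNReal.ofReal_one]

end GaussianKernel

/-! ### The Strichartz estimate -/

section Strichartz

variable {d : ℕ}

/-- The dual Strichartz estimate for the Gaussian wave family, uniformly in the regularization. -/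
theorem exists_enorm_synthesis_wave_le (hd : 0 < d) :
    ∃ C : ℝ≥0∞, C ≠ ∞ ∧ ∀ (a : ℝ) (ha : 0 < a), ∀ F : RSpace d × ℝ → ℂ, Measurable F →
      Integrable F → ‖∫ z, F z • wave (memLp_gaussEnv (d := d) ha) z‖ₑ ≤
        C * (∫⁻ z, ‖F z‖ₑ ^ ((2 * d + 4) / (d + 4) : ℝ)) ^ (1 / ((2 * d + 4) / (d + 4)) : ℝ) := by
  have hd' : (0 : ℝ) < d := by exact_mod_cast hd
  obtain ⟨C, hC, h⟩ := enorm_synthesis_le_of_dispersive (H := L2Space d)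
    (ρ := (volume : Measure (RSpace d))) (σ := (d : ℝ) / 2) (by positivity)
    (D := 1) (M := 1) (by simp) (by simp) (by simp) (by simp)
  refine ⟨C, hC, fun a ha F hF hFi => ?_⟩
  have hr : (2 * ((d : ℝ) / 2) + 2) / ((d : ℝ) / 2 + 2) = (2 * d + 4) / (d + 4) := by
    field_simp; ring
  rw [hr] at h
  refine h _ (continuous_wave _).stronglyMeasurable ⟨_, norm_wave_le _⟩ ?_ ?_ F hF hFi
  · intro x y s t hst
    rw [inner_wave_gaussEnv ha, one_mul]
    exact enorm_extension_gaussEnv_le (by positivity) (x - y) (sub_ne_zero.2 hst)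
  · intro x t
    simp only [inner_wave_gaussEnv ha, Prod.mk_sub_mk, sub_self]
    exact (lintegral_extension_gaussEnv (by positivity) x).le

theorem holderConjugate_strichartz (hd : 0 < d) :
    ((2 * d + 4) / (d + 4) : ℝ).HolderConjugate ((2 * d + 4) / d) := by
  have hd' : (0 : ℝ) < d := by exact_mod_cast hd
  rw [Real.holderConjugate_iff]
  refine ⟨?_, ?_⟩
  · rw [lt_div_iff₀ (by positivity)]; linarith
  · field_simp; ring

/-- The Strichartz estimate for Gaussian regularizations. -/
theorem exists_lintegral_extension_gaussEnv_mul_le (hd : 0 < d) :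
    ∃ C : ℝ≥0∞, C ≠ ∞ ∧ ∀ (a : ℝ), 0 < a → ∀ g : L2Space d,
      ∫⁻ z, ‖extension (fun ζ => gaussEnv a ζ * g ζ) z‖ₑ ^ ((2 * d + 4) / d : ℝ) ≤
        (C * ‖g‖ₑ) ^ ((2 * d + 4) / d : ℝ) := by
  have hd' : (0 : ℝ) < d := by exact_mod_cast hd
  obtain ⟨C, hC, h⟩ := exists_enorm_synthesis_wave_le hd
  refine ⟨C, hC, fun a ha g => ?_⟩
  have := lintegral_enorm_inner_rpow_le (continuous_wave (memLp_gaussEnv (d := d) ha)).stronglyMeasurable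
    (norm_wave_le _) (holderConjugate_strichartz hd)
    (by rw [le_div_iff₀ hd']; linarith) (h a ha) g
  simpa only [inner_wave_gaussEnv_left ha] using this

theorem eLpNorm_strichartzExponent {α : Type*} [MeasurableSpace α] {μ : Measure α} (hd : 0 < d)
    (u : α → ℂ) : eLpNorm u (strichartzExponent d) μ =
      (∫⁻ z, ‖u z‖ₑ ^ ((2 * d + 4) / d : ℝ) ∂μ) ^ (1 / ((2 * d + 4) / d) : ℝ) := by
  have hd' : (0 : ℝ) < d := by exact_mod_cast hd
  have hp : (0 : ℝ) < (2 * d + 4) / d := by positivity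
  rw [strichartzExponent, eLpNorm_eq_lintegral_rpow_enorm_toReal (ENNReal.ofReal_pos.2 hp).ne'
    ENNReal.ofReal_ne_top, ENNReal.toReal_ofReal hp.le]

/-- The Strichartz estimate. -/
theorem exists_eLpNorm_freeEvolution_le (hd : 0 < d) :
    ∃ C : ℝ≥0∞, C ≠ ∞ ∧ ∀ f : L2Space d,
      eLpNorm (freeEvolution f) (strichartzExponent d) volume ≤ C * ‖f‖ₑ := by
  have hd' : (0 : ℝ) < d := by exact_mod_cast hd
  obtain ⟨C, hC, h⟩ := exists_lintegral_extension_gaussEnv_mul_le hd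
  refine ⟨C, hC, fun f => ?_⟩
  obtain ⟨a, ha, hlim⟩ := exists_tendsto_freeEvolution f
  refine (Lp.eLpNorm_lim_le_liminf_eLpNorm (fun n =>
    (continuous_extension (integrable_gaussEnv_mul (ha n) _)).aestronglyMeasurable) _ hlim).trans ?_
  refine Filter.liminf_le_of_le (by isBoundedDefault) fun b hb => ?_
  obtain ⟨n, hn⟩ := hb.exists
  refine hn.trans ?_
  have h1 := h (a n) (ha n) (𝓕 f)
  rw [eLpNorm_strichartzExponent hd, one_div, ENNReal.rpow_inv_le_iff (by positivity)]
  refine h1.trans (le_of_eq ?_)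
  rw [← ofReal_norm, Lp.norm_fourier_eq, ofReal_norm]

end Strichartz

/-! ### Littlewood-Paley operators -/

section Multipliers

variable {d : ℕ}

theorem IsBaseCutoff.continuous_dyadicCutoff {η : ℝ → ℝ} (hη : IsBaseCutoff η) (k : ℤ) :
    Continuous (dyadicCutoff η k) := by
  have := hη.smooth.continuous
  unfold dyadicCutoff
  fun_prop

theorem IsBaseCutoff.abs_dyadicCutoff_le {η : ℝ → ℝ} (hη : IsBaseCutoff η) (k : ℤ) (μ : ℝ) :
    |dyadicCutoff η k μ| ≤ 1 := by
  have h1 := hη.mem_Icc (μ / 2 ^ k)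
  have h2 := hη.mem_Icc (μ / 2 ^ (k - 1))
  rw [dyadicCutoff, abs_le]
  constructor <;> linarith [h1.1, h1.2, h2.1, h2.2]

theorem IsBaseCutoff.abs_le_of_dyadicCutoff_ne_zero {η : ℝ → ℝ} (hη : IsBaseCutoff η) {k : ℤ} {μ : ℝ}
    (h : dyadicCutoff η k μ ≠ 0) : 5 / 8 * 2 ^ k ≤ |μ| ∧ |μ| ≤ 8 / 5 * 2 ^ k := by
  have hk : (0 : ℝ) < 2 ^ k := by positivity
  have hk1 : (2 : ℝ) ^ (k - 1) = 2 ^ k / 2 := by rw [zpow_sub_one₀ (by norm_num)]; rfl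
  constructor
  · by_contra! hlt
    refine h ?_
    rw [dyadicCutoff, hη.eq_one, hη.eq_one, sub_self]
    · rw [hk1, abs_div, abs_of_pos (by positivity : (0 : ℝ) < 2 ^ k / 2), div_le_iff₀ (by positivity)]
      linarith
    · rw [abs_div, abs_of_pos hk, div_le_iff₀ hk]
      linarith
  · by_contra! hlt
    refine h ?_
    rw [dyadicCutoff, hη.support, hη.support, sub_self]
    · rw [hk1, abs_div, abs_of_pos (by positivity : (0 : ℝ) < 2 ^ k / 2), lt_div_iff₀ (by positivity)]
      linarith
    · rw [abs_div, abs_of_pos hk, lt_div_iff₀ hk]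
      linarith

theorem fourier_fourierMultiplier {m : RSpace d → ℂ} (hm : Continuous m) {B : ℝ}
    (hB : ∀ ξ, ‖m ξ‖ ≤ B) (f : L2Space d) :
    (𝓕 (fourierMultiplier m f) : L2Space d) =ᵐ[volume]
      fun ζ => m ((2 * Real.pi) • ζ) * (𝓕 f : L2Space d) ζ := by
  have hmem := memLp_symbol_mul hm hB (𝓕 f : L2Space d)
  have h1 : fourierMultiplier m f = 𝓕⁻ hmem.toLp := dif_pos hmem
  have h2 : (𝓕 (fourierMultiplier m f) : L2Space d) = hmem.toLp := by
    rw [h1]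
    exact (Lp.fourierTransformₗᵢ (RSpace d) ℂ).apply_symm_apply _
  rw [h2]
  exact hmem.coeFn_toLp

theorem norm_fourierMultiplier_le {m : RSpace d → ℂ} (hm : Continuous m)
    (hB : ∀ ξ, ‖m ξ‖ ≤ 1) (f : L2Space d) : ‖fourierMultiplier m f‖ ≤ ‖f‖ := by
  rw [← Lp.norm_fourier_eq, ← Lp.norm_fourier_eq f]
  refine Lp.norm_le_norm_of_ae_le ?_
  filter_upwards [fourier_fourierMultiplier hm hB f] with ζ hζ
  rw [hζ, norm_mul]
  exact mul_le_of_le_one_left (norm_nonneg _) (hB _)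

theorem fourier_lpProj {η : ℝ → ℝ} (hη : IsBaseCutoff η) (k : ℤ) (f : L2Space d) :
    (𝓕 (lpProj η k f) : L2Space d) =ᵐ[volume]
      fun ζ => (dyadicCutoff η k (2 * Real.pi * ‖ζ‖) : ℂ) * (𝓕 f : L2Space d) ζ := by
  refine (fourier_fourierMultiplier (B := 1) ?_ (fun ξ => ?_) f).trans
    (Filter.Eventually.of_forall fun ζ => ?_)
  · exact Complex.continuous_ofReal.comp ((hη.continuous_dyadicCutoff k).comp continuous_norm)
  · rw [Complex.norm_real]; exact hη.abs_dyadicCutoff_le k _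
  · simp only
    rw [norm_smul, Real.norm_of_nonneg (by positivity)]

theorem fourier_lpProjDir {η : ℝ → ℝ} (hη : IsBaseCutoff η) (k : ℤ) (e : RSpace d) (f : L2Space d) :
    (𝓕 (lpProjDir η k e f) : L2Space d) =ᵐ[volume]
      fun ζ => (dyadicCutoff η k (2 * Real.pi * inner ℝ ζ e) : ℂ) * (𝓕 f : L2Space d) ζ := by
  refine (fourier_fourierMultiplier (B := 1) ?_ (fun ξ => ?_) f).trans
    (Filter.Eventually.of_forall fun ζ => ?_)
  · exact Complex.continuous_ofReal.comp ((hη.continuous_dyadicCutoff k).comp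
      (continuous_id.inner continuous_const))
  · rw [Complex.norm_real]; exact hη.abs_dyadicCutoff_le k _
  · simp only
    rw [real_inner_smul_left]

theorem norm_lpProjDir_le {η : ℝ → ℝ} (hη : IsBaseCutoff η) (k : ℤ) (e : RSpace d) (f : L2Space d) :
    ‖lpProjDir η k e f‖ ≤ ‖f‖ := by
  refine norm_fourierMultiplier_le ?_ (fun ξ => ?_) f
  · exact Complex.continuous_ofReal.comp ((hη.continuous_dyadicCutoff k).comp
      (continuous_id.inner continuous_const))
  · rw [Complex.norm_real]; exact hη.abs_dyadicCutoff_le k _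

theorem norm_lpProj_le {η : ℝ → ℝ} (hη : IsBaseCutoff η) (k : ℤ) (f : L2Space d) :
    ‖lpProj η k f‖ ≤ ‖f‖ := by
  refine norm_fourierMultiplier_le ?_ (fun ξ => ?_) f
  · exact Complex.continuous_ofReal.comp ((hη.continuous_dyadicCutoff k).comp continuous_norm)
  · rw [Complex.norm_real]; exact hη.abs_dyadicCutoff_le k _

/-- The free evolution of `P_k f` is a superposition of waves whose Gaussian envelope has width
`2^k`: on the support of the cutoff the envelope is bounded below, and can be divided out. -/
theorem exists_freeEvolution_lpProj_eq {η : ℝ → ℝ} (hη : IsBaseCutoff η) (k : ℤ) (f : L2Space d) :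
    ∃ g : L2Space d, ‖g‖ ≤ Real.exp 3 * ‖f‖ ∧
      (∀ᵐ ζ, g ζ ≠ 0 → 2 * Real.pi * ‖ζ‖ ≤ 8 / 5 * 2 ^ k) ∧
      freeEvolution (lpProj η k f) =ᵐ[volume]
        extension fun ζ => gaussEnv (((2 : ℝ) ^ k)⁻¹ ^ 2) ζ * g ζ := by
  have hk : (0 : ℝ) < 2 ^ k := by positivity
  set a : ℝ := ((2 : ℝ) ^ k)⁻¹ ^ 2 with ha
  have ha0 : 0 < a := by positivity
  set m : RSpace d → ℂ := fun ζ =>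
    ((dyadicCutoff η k (2 * Real.pi * ‖ζ‖) * Real.exp (a * (4 * Real.pi ^ 2 * ‖ζ‖ ^ 2)) : ℝ) : ℂ) with hm
  have hmc : Continuous m := by
    have := hη.continuous_dyadicCutoff k
    rw [hm]
    fun_prop
  have hsupp : ∀ ζ, m ζ ≠ 0 → 2 * Real.pi * ‖ζ‖ ≤ 8 / 5 * 2 ^ k := fun ζ h => by
    have h1 : dyadicCutoff η k (2 * Real.pi * ‖ζ‖) ≠ 0 := fun h0 => h (by simp [hm, h0])
    have := (hη.abs_le_of_dyadicCutoff_ne_zero h1).2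
    rwa [abs_of_nonneg (by positivity)] at this
  have hmb : ∀ ζ, ‖m ζ‖ ≤ Real.exp 3 := fun ζ => by
    by_cases h : m ζ = 0
    · rw [h, norm_zero]; positivity
    have h1 := hsupp ζ h
    have h2 : a * (4 * Real.pi ^ 2 * ‖ζ‖ ^ 2) ≤ 3 := by
      have h3 : 4 * Real.pi ^ 2 * ‖ζ‖ ^ 2 = (2 * Real.pi * ‖ζ‖) ^ 2 := by ring
      have h4 : (2 * Real.pi * ‖ζ‖) ^ 2 ≤ (8 / 5 * 2 ^ k) ^ 2 := pow_le_pow_left₀ (by positivity) h1 2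
      rw [h3]
      calc a * (2 * Real.pi * ‖ζ‖) ^ 2 ≤ a * (8 / 5 * 2 ^ k) ^ 2 := by gcongr
        _ = 64 / 25 := by rw [ha]; field_simp; norm_num
        _ ≤ 3 := by norm_num
    rw [hm, Complex.norm_real, norm_mul, Real.norm_of_nonneg (Real.exp_nonneg _)]
    calc _ ≤ 1 * Real.exp 3 := by
          gcongr
          exact hη.abs_dyadicCutoff_le k _
      _ = _ := one_mul _
  have hmem : MemLp (fun ζ => m ζ * (𝓕 f : L2Space d) ζ) 2 := by
    refine (Lp.memLp (𝓕 f : L2Space d)).of_le_mul (c := Real.exp 3)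
      (hmc.aestronglyMeasurable.mul (Lp.aestronglyMeasurable _)) (Filter.Eventually.of_forall fun ζ => ?_)
    rw [norm_mul]
    exact mul_le_mul_of_nonneg_right (hmb ζ) (norm_nonneg _)
  refine ⟨hmem.toLp, ?_, ?_, ?_⟩
  · rw [← Lp.norm_fourier_eq f]
    refine Lp.norm_le_mul_norm_of_ae_le_mul ?_
    filter_upwards [hmem.coeFn_toLp] with ζ hζ
    rw [hζ, norm_mul]
    exact mul_le_mul_of_nonneg_right (hmb ζ) (norm_nonneg _)
  · filter_upwards [hmem.coeFn_toLp] with ζ hζ h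
    rw [hζ] at h
    exact hsupp ζ (left_ne_zero_of_mul h)
  · refine freeEvolution_ae_eq_extension (integrable_gaussEnv_mul ha0 _) ?_
    filter_upwards [fourier_lpProj hη k f, hmem.coeFn_toLp] with ζ h1 h2
    rw [h1, h2, hm, gaussEnv, ← mul_assoc, ← Complex.ofReal_mul]
    congr 2
    rw [mul_left_comm, ← Real.exp_add, neg_add_cancel, Real.exp_zero, mul_one]

end Multipliers

/-! ### Spatial decay of the Gaussian kernel -/

section KernelDecay

variable {d : ℕ}

theorem Real.exp_neg_le_rpow_neg {s β : ℝ} (hs : 0 < s) (hβ : 0 ≤ β) (hβ' : β ≤ 1) :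
    Real.exp (-s) ≤ s ^ (-β) := by
  rw [Real.exp_neg, Real.rpow_neg hs.le]
  refine inv_anti₀ (Real.rpow_pos_of_pos hs _) ?_
  rcases le_total s 1 with h | h
  · exact (Real.rpow_le_one hs.le h hβ).trans (Real.one_le_exp hs.le)
  · calc s ^ β ≤ s ^ (1 : ℝ) := Real.rpow_le_rpow_of_exponent_le h hβ'
      _ = s := Real.rpow_one s
      _ ≤ Real.exp s := by linarith [Real.add_one_le_exp s]

/-- Spatial decay of the Gaussian kernel, uniformly in time: `t` enters only through `A = √(a² +
t²)`, and the powers of `A` from the dispersive and the Gaussian factor cancel. -/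
theorem norm_extension_gaussEnv_le {a β : ℝ} (ha : 0 < a) (hβ : 0 ≤ β) (hβ' : β ≤ 1)
    (hβd : 2 * β ≤ (d : ℝ) / 2) {x : RSpace d} (hx : x ≠ 0) (t : ℝ) :
    ‖extension (gaussEnv a) (x, t)‖ ≤ 4 * a ^ (β - (d : ℝ) / 2) * ‖x‖ ^ (-(2 * β)) := by
  have hx' : 0 < ‖x‖ := norm_pos_iff.2 hx
  rw [norm_extension_gaussEnv ha]
  set A := √(a ^ 2 + t ^ 2) with hA
  have hA2 : a ^ 2 + t ^ 2 = A ^ 2 := (Real.sq_sqrt (by positivity)).symm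
  have haA : a ≤ A := Real.le_sqrt_of_sq_le (by nlinarith [sq_nonneg t])
  have hA0 : 0 < A := ha.trans_le haA
  rw [hA2]
  set s := a * ‖x‖ ^ 2 / (4 * A ^ 2) with hs
  have hs0 : 0 < s := by positivity
  have h1 : (4 * Real.pi * A) ^ (-((d : ℝ) / 2)) ≤ A ^ (-((d : ℝ) / 2)) := by
    refine Real.rpow_le_rpow_of_nonpos hA0 ?_ (by
      have : (0 : ℝ) ≤ d / 2 := by positivity
      linarith)
    have h3 : 1 ≤ 4 * Real.pi := by linarith [Real.pi_gt_three]
    nlinarith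
  have h2 : A ^ (-((d : ℝ) / 2)) = A ^ (2 * β - (d : ℝ) / 2) * A ^ (-(2 * β)) := by
    rw [← Real.rpow_add hA0]; congr 1; ring
  have h3 : A ^ (2 * β - (d : ℝ) / 2) ≤ a ^ (2 * β - (d : ℝ) / 2) :=
    Real.rpow_le_rpow_of_nonpos ha haA (by linarith)
  have h4 : s ^ (-β) = 4 ^ β * (a ^ (-β) * ‖x‖ ^ (-(2 * β)) * A ^ (2 * β)) := by
    have e1 : s = 4 ^ (-1 : ℝ) * (a * ‖x‖ ^ (2 : ℝ) * A ^ (-2 : ℝ)) := by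
      rw [hs, Real.rpow_neg hA0.le, Real.rpow_neg_one, Real.rpow_ofNat, Real.rpow_ofNat]
      field_simp
    rw [e1, Real.mul_rpow (by positivity) (by positivity), Real.mul_rpow (by positivity) (by positivity),
      Real.mul_rpow (by positivity) (by positivity), ← Real.rpow_mul (by norm_num), ← Real.rpow_mul hx'.le,
      ← Real.rpow_mul hA0.le]
    congr 2
    · ring
    · congr 2; ring
    · congr 1; ring
  have h5 : (4 : ℝ) ^ β ≤ 4 := by
    calc (4 : ℝ) ^ β ≤ 4 ^ (1 : ℝ) := Real.rpow_le_rpow_of_exponent_le (by norm_num) hβ'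
      _ = 4 := Real.rpow_one 4
  have hAA : A ^ (-(2 * β)) * A ^ (2 * β) = 1 := by
    rw [← Real.rpow_add hA0, neg_add_cancel, Real.rpow_zero]
  have haa : a ^ (2 * β - (d : ℝ) / 2) * a ^ (-β) = a ^ (β - (d : ℝ) / 2) := by
    rw [← Real.rpow_add ha]; congr 1; ring
  calc _ ≤ A ^ (-((d : ℝ) / 2)) * s ^ (-β) := by
        gcongr
        exact Real.exp_neg_le_rpow_neg hs0 hβ hβ'
    _ ≤ (a ^ (2 * β - (d : ℝ) / 2) * A ^ (-(2 * β))) *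
        (4 * (a ^ (-β) * ‖x‖ ^ (-(2 * β)) * A ^ (2 * β))) := by
        rw [h2, h4]
        gcongr
    _ = 4 * (a ^ (2 * β - (d : ℝ) / 2) * a ^ (-β)) * ‖x‖ ^ (-(2 * β)) *
        (A ^ (-(2 * β)) * A ^ (2 * β)) := by ring
    _ = _ := by rw [hAA, haa, mul_one]

theorem norm_extension_gaussEnv_le_rpow {a : ℝ} (ha : 0 < a) (x : RSpace d) (t : ℝ) :
    ‖extension (gaussEnv a) (x, t)‖ ≤ a ^ (-((d : ℝ) / 2)) := by
  rw [norm_extension_gaussEnv ha]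
  have haA : a ≤ √(a ^ 2 + t ^ 2) := Real.le_sqrt_of_sq_le (by nlinarith [sq_nonneg t])
  have h4 : Real.exp (-(a * ‖x‖ ^ 2 / (4 * (a ^ 2 + t ^ 2)))) ≤ 1 := by
    rw [Real.exp_le_one_iff, neg_nonpos]; positivity
  refine (mul_le_of_le_one_right (by positivity) h4).trans ?_
  refine Real.rpow_le_rpow_of_nonpos ha ?_ (by
      have : (0 : ℝ) ≤ d / 2 := by positivity
      linarith)
  have h3 : 1 ≤ 4 * Real.pi := by linarith [Real.pi_gt_three]
  nlinarith

theorem abs_inner_le_norm_of_unit {e : RSpace d} (he : ‖e‖ = 1) (x : RSpace d) :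
    |inner ℝ x e| ≤ ‖x‖ := by
  have := abs_real_inner_le_norm x e
  rwa [he, mul_one] at this

theorem inner_lateral {e : RSpace d} (he : ‖e‖ = 1) (x₁ : ℝ) (x' : (Submodule.span ℝ {e})ᗮ) :
    inner ℝ (x₁ • e + (x' : RSpace d)) e = x₁ := by
  have h1 : inner ℝ (x' : RSpace d) e = 0 :=
    (Submodule.mem_orthogonal' _ _).1 x'.2 e (Submodule.mem_span_singleton_self e)
  rw [inner_add_left, real_inner_smul_left, real_inner_self_eq_norm_sq, he, h1]
  ring

end KernelDecay

/-! ### Maximal functions over a grid of cells -/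

section DiscreteMaximal

variable {H : Type*} [NormedAddCommGroup H] [InnerProductSpace ℂ H]

/-- A point of a nonempty cell where a bounded function is at least half of its supremum. -/
theorem exists_iSup_le_two_mul {ι : Type*} [Nonempty ι] {v : ι → ℝ≥0∞} {B : ℝ≥0∞} (hB : B ≠ ∞)
    (hv : ∀ i, v i ≤ B) : ∃ i, ⨆ j, v j ≤ 2 * v i := by
  rcases eq_or_ne (⨆ j, v j) 0 with h | h
  · exact ⟨Classical.arbitrary ι, by rw [h]; exact zero_le⟩
  have ht : ⨆ j, v j ≠ ∞ := ne_top_of_le_ne_top hB (iSup_le hv)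
  obtain ⟨i, hi⟩ := exists_lt_of_lt_ciSup' (ENNReal.half_lt_self h ht)
  refine ⟨i, ?_⟩
  rw [mul_comm, ← ENNReal.div_le_iff_le_mul (by simp) (by simp)]
  exact hi.le

/-- Maximal function bound from the summability of the Gram kernel over a grid of cells: one point
per cell nearly attains the supremum there, and the finite Schur test applies to the selected
vectors. -/
theorem lintegral_iSup_enorm_inner_sq_le {Y : Type*} [Nonempty Y] {e : ℝ × Y → H} {c : ℝ}
    (hc : ∀ z, ‖e z‖ ≤ c) (m : ℤ) {κ : ℤ → ℝ} (hκ : Summable κ) (hκ0 : ∀ j, 0 ≤ κ j)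
    (hker : ∀ i j, ∀ z z' : ℝ × Y, z.1 ∈ dyadicInterval m i → z'.1 ∈ dyadicInterval m j →
      ‖inner ℂ (e z) (e z')‖ ≤ κ (i - j)) (g : H) :
    ∫⁻ x, (⨆ y, ‖inner ℂ (e (x, y)) g‖ₑ) ^ (2 : ℝ) ≤
      2 ^ (m : ℝ) * (4 * (ENNReal.ofReal (∑' j, κ j) * ‖g‖ₑ ^ (2 : ℝ))) := by
  classical
  have hne : ∀ i, (dyadicInterval m i).Nonempty := fun i => by
    rw [dyadicInterval_eq]
    refine ⟨i * 2 ^ m, le_rfl, ?_⟩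
    have : (0 : ℝ) < 2 ^ m := by positivity
    nlinarith
  have hsel : ∀ i, ∃ z : ℝ × Y, z.1 ∈ dyadicInterval m i ∧
      ⨆ w : dyadicInterval m i × Y, ‖inner ℂ (e ((w.1 : ℝ), w.2)) g‖ₑ ≤ 2 * ‖inner ℂ (e z) g‖ₑ := by
    intro i
    have : Nonempty (dyadicInterval m i) := (hne i).to_subtype
    obtain ⟨w, hw⟩ := exists_iSup_le_two_mul (ι := dyadicInterval m i × Y)
      (v := fun w => ‖inner ℂ (e ((w.1 : ℝ), w.2)) g‖ₑ) (B := ENNReal.ofReal (c * ‖g‖))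
      ENNReal.ofReal_ne_top fun w => by
        rw [← ofReal_norm]
        exact ENNReal.ofReal_le_ofReal ((norm_inner_le_norm _ _).trans
          (mul_le_mul_of_nonneg_right (hc _) (norm_nonneg _)))
    exact ⟨((w.1 : ℝ), w.2), w.1.2, hw⟩
  choose z hz hzs using hsel
  have hsum : ∑' i, ‖inner ℂ (e (z i)) g‖ₑ ^ (2 : ℝ) ≤
      ENNReal.ofReal (∑' j, κ j) * ‖g‖ₑ ^ (2 : ℝ) := by
    rw [ENNReal.tsum_eq_iSup_sum]
    refine iSup_le fun s => ?_
    have hrow : ∀ i ∈ s, ∑ j ∈ s, ‖inner ℂ (e (z i)) (e (z j))‖ ≤ ∑' j, κ j := fun i _ => by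
      calc _ ≤ ∑ j ∈ s, κ (i - j) := Finset.sum_le_sum fun j _ => hker i j _ _ (hz i) (hz j)
        _ = ∑ j ∈ s.image (fun j => i - j), κ j := by
          rw [Finset.sum_image fun a _ b _ h => by simpa using h]
        _ ≤ _ := hκ.sum_le_tsum _ fun j _ => hκ0 j
    have h1 := sum_norm_inner_sq_le_of_schur s (fun i => e (z i)) (tsum_nonneg hκ0) hrow g
    have h2 : ∀ v : ℂ, ‖v‖ₑ ^ (2 : ℝ) = ENNReal.ofReal (‖v‖ ^ 2) := fun v => by
      rw [ENNReal.ofReal_pow (norm_nonneg _), ofReal_norm, ENNReal.rpow_ofNat]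
    simp_rw [h2]
    rw [← ENNReal.ofReal_sum_of_nonneg fun i _ => by positivity]
    refine (ENNReal.ofReal_le_ofReal h1).trans (le_of_eq ?_)
    rw [ENNReal.ofReal_mul (tsum_nonneg hκ0), ENNReal.ofReal_pow (norm_nonneg _), ofReal_norm,
      ENNReal.rpow_ofNat]
  calc _ = ∑' i, ∫⁻ x in dyadicInterval m i, (⨆ y, ‖inner ℂ (e (x, y)) g‖ₑ) ^ (2 : ℝ) := by
        have := tsum_setLIntegral_dyadicInterval m Set.univ MeasurableSet.univ
          fun x => (⨆ y, ‖inner ℂ (e (x, y)) g‖ₑ) ^ (2 : ℝ)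
        simp only [Set.inter_univ, setLIntegral_univ] at this
        exact this.symm
    _ ≤ ∑' i, ∫⁻ _ in dyadicInterval m i, (2 * ‖inner ℂ (e (z i)) g‖ₑ) ^ (2 : ℝ) := by
        refine ENNReal.tsum_le_tsum fun i =>
          setLIntegral_mono' (measurableSet_dyadicInterval m i) fun x hx => ?_
        gcongr
        refine iSup_le fun y => le_trans ?_ (hzs i)
        exact le_iSup (fun w : dyadicInterval m i × Y => ‖inner ℂ (e ((w.1 : ℝ), w.2)) g‖ₑ)
          (⟨x, hx⟩, y)
    _ = 2 ^ (m : ℝ) * (4 * ∑' i, ‖inner ℂ (e (z i)) g‖ₑ ^ (2 : ℝ)) := by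
        rw [← ENNReal.tsum_mul_left, ← ENNReal.tsum_mul_left]
        refine tsum_congr fun i => ?_
        rw [setLIntegral_const, volume_dyadicInterval,
          ENNReal.mul_rpow_of_nonneg _ _ (by norm_num : (0 : ℝ) ≤ 2), mul_comm]
        congr 2
        norm_num
    _ ≤ _ := by gcongr

theorem summable_abs_int_rpow_add {c b : ℝ} (hb : 1 < b) :
    Summable fun j : ℤ => (if j = 0 then (1 : ℝ) else 0) + c * |(j : ℝ)| ^ (-b) := by
  refine Summable.add ?_ ((Real.summable_abs_int_rpow hb).mul_left c)
  exact summable_of_ne_finset_zero (s := {0}) fun j hj => by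
    rw [Finset.mem_singleton] at hj; rw [if_neg hj]

/-- Points of two cells at index distance at least two are separated. -/
theorem abs_sub_ge_of_mem_dyadicInterval {m i j : ℤ} {x y : ℝ} (hx : x ∈ dyadicInterval m i)
    (hy : y ∈ dyadicInterval m j) : (|((i - j : ℤ) : ℝ)| - 1) * 2 ^ m ≤ |x - y| := by
  rw [dyadicInterval_eq, Set.mem_Ico] at hx hy
  have h : (0 : ℝ) < 2 ^ m := by positivity
  push_cast
  rcases le_total (0 : ℝ) ((i : ℝ) - j) with h0 | h0
  · rw [abs_of_nonneg h0]
    refine le_trans ?_ (le_abs_self _)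
    nlinarith
  · rw [abs_of_nonpos h0]
    refine le_trans ?_ (neg_le_abs _)
    nlinarith

end DiscreteMaximal

/-! ### The maximal function estimate in dimension at least three -/

section MaximalHigh

variable {d : ℕ}

theorem lateralNorm_two_infty_le {e : RSpace d} {h : RSpace d × ℝ → ℂ} :
    lateralNorm 2 ∞ e h ≤ (∫⁻ x₁ : ℝ, (⨆ y : (Submodule.span ℝ {e})ᗮ × ℝ,
      ‖h (x₁ • e + (y.1 : RSpace d), y.2)‖ₑ) ^ (2 : ℝ)) ^ (1 / 2 : ℝ) := by
  rw [lateralNorm, eLpNorm_eq_lintegral_rpow_enorm_toReal two_ne_zero ENNReal.ofNat_ne_top]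
  simp only [ENNReal.toReal_ofNat, enorm_eq_self]
  gcongr with x
  rw [eLpNorm_exponent_top]
  exact essSup_le_of_ae_le _ (Filter.Eventually.of_forall fun y => le_iSup
    (fun y : (Submodule.span ℝ {e})ᗮ × ℝ => ‖h (x • e + (y.1 : RSpace d), y.2)‖ₑ) y)

/-- Decay of the Gram kernel of the waves at frequency `2^k` over cells of length `2^{-k}`. The
exponent `3/2` is admissible since it is at most `d/2`, and it is summable; this is where `3 ≤ d` is
used. -/
theorem norm_inner_wave_gaussEnv_le_cell (hd : 3 ≤ d) {e : RSpace d} (he : ‖e‖ = 1) (k : ℤ)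
    {i j : ℤ} {z z' : RSpace d × ℝ} (hz : inner ℝ z.1 e ∈ dyadicInterval (-k) i)
    (hz' : inner ℝ z'.1 e ∈ dyadicInterval (-k) j) {a : ℝ} (ha : 0 < a) (hak : a = ((2 : ℝ) ^ k)⁻¹ ^ 2) :
    ‖inner ℂ (wave (memLp_gaussEnv ha) z) (wave (memLp_gaussEnv ha) z')‖ ≤
      ((2 : ℝ) ^ k) ^ d *
        ((if i - j = 0 then (1 : ℝ) else 0) + 16 * |((i - j : ℤ) : ℝ)| ^ (-(3 / 2) : ℝ)) := by
  have hk : (0 : ℝ) < 2 ^ k := by positivity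
  have hd3 : (3 : ℝ) ≤ d := by exact_mod_cast hd
  set N : ℝ := 2 ^ k with hN
  have hNk : (2 : ℝ) ^ (-k) = N⁻¹ := zpow_neg _ _
  have h2a : ∀ r : ℝ, 0 ≤ r → (2 * a) ^ (-r) ≤ N ^ (2 * r) := fun r hr => by
    have h1 : a ^ (-r) = N ^ (2 * r) := by
      rw [hak, ← Real.rpow_natCast, ← Real.rpow_mul (by positivity), Real.inv_rpow hk.le,
        ← Real.rpow_neg hk.le]
      congr 1; push_cast; ring
    rw [← h1]
    exact Real.rpow_le_rpow_of_nonpos ha (by linarith) (by linarith)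
  rw [inner_wave_gaussEnv ha, show z - z' = (z.1 - z'.1, z.2 - z'.2) from rfl]
  have htriv : ‖extension (gaussEnv (2 * a)) (z.1 - z'.1, z.2 - z'.2)‖ ≤ N ^ d := by
    refine (norm_extension_gaussEnv_le_rpow (by positivity) _ _).trans ((h2a _ (by positivity)).trans ?_)
    rw [← Real.rpow_natCast]
    exact le_of_eq (by congr 1; ring)
  by_cases h0 : i - j = 0
  · rw [if_pos h0]
    refine htriv.trans ?_
    have : (0 : ℝ) ≤ 16 * |((i - j : ℤ) : ℝ)| ^ (-(3 / 2) : ℝ) := by positivity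
    nlinarith [pow_pos hk d]
  rw [if_neg h0, zero_add]
  have hJ : (1 : ℝ) ≤ |((i - j : ℤ) : ℝ)| := by
    rw [← Int.cast_abs]
    exact_mod_cast Int.one_le_abs h0
  set J : ℝ := |((i - j : ℤ) : ℝ)| with hJdef
  -- adjacent cells need not be separated
  by_cases h1 : J ≤ 1
  · have hJ1 : J = 1 := le_antisymm h1 hJ
    rw [hJ1, Real.one_rpow]
    refine htriv.trans ?_
    nlinarith [pow_pos hk d]
  have hJ2 : 2 ≤ J := by
    rw [hJdef, ← Int.cast_abs] at h1 ⊢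
    have : ¬ |i - j| ≤ 1 := by exact_mod_cast h1
    exact_mod_cast (by omega : 2 ≤ |i - j|)
  have hsep := abs_sub_ge_of_mem_dyadicInterval hz hz'
  rw [← inner_sub_left, hNk, ← hJdef] at hsep
  have hx : J / 2 * N⁻¹ ≤ ‖z.1 - z'.1‖ := by
    refine le_trans ?_ (hsep.trans (abs_inner_le_norm_of_unit he _))
    have : 0 < N⁻¹ := by positivity
    nlinarith
  have hx0 : 0 < J / 2 * N⁻¹ := by positivity
  have hne : z.1 - z'.1 ≠ 0 := norm_pos_iff.1 (hx0.trans_le hx)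
  refine (norm_extension_gaussEnv_le (β := 3 / 4) (by positivity) (by norm_num) (by norm_num)
    (by linarith) hne _).trans ?_
  have e1 : (2 * a) ^ ((3 / 4 : ℝ) - (d : ℝ) / 2) ≤ N ^ ((d : ℝ) - 3 / 2) := by
    have := h2a ((d : ℝ) / 2 - 3 / 4) (by linarith)
    rw [show (3 / 4 : ℝ) - (d : ℝ) / 2 = -((d : ℝ) / 2 - 3 / 4) by ring]
    refine this.trans (le_of_eq ?_)
    congr 1; ring
  have e2 : ‖z.1 - z'.1‖ ^ (-(2 * (3 / 4 : ℝ))) ≤ (J / 2 * N⁻¹) ^ (-(3 / 2) : ℝ) := by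
    rw [show -(2 * (3 / 4 : ℝ)) = -(3 / 2) by norm_num]
    exact Real.rpow_le_rpow_of_nonpos hx0 hx (by norm_num)
  have e3 : (J / 2 * N⁻¹) ^ (-(3 / 2) : ℝ) ≤ 4 * J ^ (-(3 / 2) : ℝ) * N ^ (3 / 2 : ℝ) := by
    rw [Real.mul_rpow (by positivity) (by positivity), Real.inv_rpow hk.le, Real.rpow_neg hk.le, inv_inv,
      Real.div_rpow (by positivity) (by norm_num)]
    have h5 : (2 : ℝ) ^ (-(3 / 2) : ℝ) ≥ 1 / 4 := by
      calc (2 : ℝ) ^ (-(3 / 2) : ℝ) ≥ 2 ^ (-2 : ℝ) :=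
            Real.rpow_le_rpow_of_exponent_le (by norm_num) (by norm_num)
        _ = 1 / 4 := by rw [Real.rpow_neg (by norm_num), Real.rpow_ofNat]; norm_num
    have h6 : (0 : ℝ) < 2 ^ (-(3 / 2) : ℝ) := by positivity
    gcongr
    rw [div_le_iff₀ h6]
    have : 0 ≤ J ^ (-(3 / 2) : ℝ) := by positivity
    nlinarith
  have e4 : N ^ ((d : ℝ) - 3 / 2) * N ^ (3 / 2 : ℝ) = N ^ d := by
    rw [← Real.rpow_add hk, ← Real.rpow_natCast]; congr 1; ring
  calc _ ≤ 4 * N ^ ((d : ℝ) - 3 / 2) * (4 * J ^ (-(3 / 2) : ℝ) * N ^ (3 / 2 : ℝ)) := by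
        gcongr
        exact e2.trans e3
    _ = (N ^ ((d : ℝ) - 3 / 2) * N ^ (3 / 2 : ℝ)) * (16 * J ^ (-(3 / 2) : ℝ)) := by ring
    _ = _ := by rw [e4]

/-- The maximal function estimate in dimension at least three. -/
theorem exists_lateralNorm_two_infty_le (hd : 3 ≤ d) {η : ℝ → ℝ} (hη : IsBaseCutoff η) :
    ∃ C : ℝ, 0 < C ∧ ∀ (f : L2Space d) (k : ℤ) (e : RSpace d), ‖e‖ = 1 →
      lateralNorm 2 ∞ e (freeEvolution (lpProj η k f)) ≤
        ENNReal.ofReal (C * 2 ^ ((k : ℝ) * ((d : ℝ) - 1) / 2) * ‖f‖) := by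
  set κ : ℤ → ℝ := fun j => (if j = 0 then (1 : ℝ) else 0) + 16 * |(j : ℝ)| ^ (-(3 / 2) : ℝ) with hκ
  have hκs : Summable κ := summable_abs_int_rpow_add (by norm_num)
  have hκ0 : ∀ j, 0 ≤ κ j := fun j => by
    simp only [hκ]
    split_ifs <;> positivity
  set S := ∑' j, κ j with hS
  have hS0 : 0 < S := by
    refine hκs.tsum_pos hκ0 0 ?_
    simp only [hκ, if_true]
    positivity
  refine ⟨2 * √S * Real.exp 3, by positivity, fun f k e he => ?_⟩
  obtain ⟨g, hg, -, hfree⟩ := exists_freeEvolution_lpProj_eq hη k f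
  set N : ℝ := 2 ^ k with hN
  have hN0 : 0 < N := by positivity
  set a : ℝ := N⁻¹ ^ 2 with ha
  have ha0 : 0 < a := by positivity
  rw [lateralNorm_congr_ae he _ _ hfree]
  refine lateralNorm_two_infty_le.trans ?_
  have hmain := lintegral_iSup_enorm_inner_sq_le
    (e := fun w : ℝ × ((Submodule.span ℝ {e})ᗮ × ℝ) =>
      wave (memLp_gaussEnv (d := d) ha0) (w.1 • e + (w.2.1 : RSpace d), w.2.2))
    (fun w => norm_wave_le _ _) (-k) (κ := fun j => N ^ d * κ j) (hκs.mul_left _)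
    (fun j => mul_nonneg (by positivity) (hκ0 j))
    (fun i j w w' hw hw' => norm_inner_wave_gaussEnv_le_cell hd he k
      (by rw [inner_lateral he]; exact hw) (by rw [inner_lateral he]; exact hw') ha0 ha) g
  simp only [inner_wave_gaussEnv_left ha0] at hmain
  refine (ENNReal.rpow_le_rpow hmain (by norm_num)).trans ?_
  rw [tsum_mul_left, ← hS]
  have h2k : (2 : ℝ≥0∞) ^ ((-k : ℤ) : ℝ) = ENNReal.ofReal N⁻¹ := by
    rw [hN, ← zpow_neg, ← Real.rpow_intCast, ← ENNReal.ofReal_rpow_of_pos (by norm_num),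
      ENNReal.ofReal_ofNat]
  have hgE : ‖g‖ₑ ^ (2 : ℝ) = ENNReal.ofReal (‖g‖ ^ 2) := by
    rw [ENNReal.ofReal_pow (norm_nonneg _), ofReal_norm, ENNReal.rpow_ofNat]
  have h4 : (4 : ℝ≥0∞) = ENNReal.ofReal 4 := by simp
  rw [h2k, hgE, h4, ← ENNReal.ofReal_mul (by positivity), ← ENNReal.ofReal_mul (by norm_num),
    ← ENNReal.ofReal_mul (by positivity), ENNReal.ofReal_rpow_of_nonneg (by positivity) (by norm_num)]
  refine ENNReal.ofReal_le_ofReal ?_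
  rw [← Real.sqrt_eq_rpow]
  refine Real.sqrt_le_iff.2 ⟨by positivity, ?_⟩
  have hpow : ((2 : ℝ) ^ ((k : ℝ) * ((d : ℝ) - 1) / 2)) ^ 2 = N⁻¹ * N ^ d := by
    rw [hN, ← Real.rpow_intCast, ← Real.rpow_natCast, ← Real.rpow_natCast, ← Real.rpow_mul (by norm_num),
      ← Real.rpow_neg (by norm_num), ← Real.rpow_mul (by norm_num), ← Real.rpow_add (by norm_num)]
    congr 1; push_cast; ring
  have hg2 : ‖g‖ ^ 2 ≤ (Real.exp 3 * ‖f‖) ^ 2 := pow_le_pow_left₀ (norm_nonneg _) hg 2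
  calc N⁻¹ * (4 * (N ^ d * S * ‖g‖ ^ 2)) ≤ N⁻¹ * (4 * (N ^ d * S * (Real.exp 3 * ‖f‖) ^ 2)) := by
        gcongr
    _ = 4 * S * Real.exp 3 ^ 2 * ‖f‖ ^ 2 * (N⁻¹ * N ^ d) := by ring
    _ = (2 * √S * Real.exp 3 * 2 ^ ((k : ℝ) * ((d : ℝ) - 1) / 2) * ‖f‖) ^ 2 := by
        rw [← hpow]
        simp only [mul_pow]
        rw [Real.sq_sqrt hS0.le]
        ring

end MaximalHigh

/-! ### Lateral Strichartz estimates with `p ≤ q` -/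

section LateralStrichartz

theorem ENNReal.le_ofReal_toReal_add_one_mul {X C : ℝ≥0∞} (hC : C ≠ ∞) {r y : ℝ} (hr : 0 ≤ r)
    (h : X ≤ C * ENNReal.ofReal r * ENNReal.ofReal y) :
    X ≤ ENNReal.ofReal ((C.toReal + 1) * r * y) := by
  have hC0 : 0 ≤ C.toReal + 1 := by positivity
  rw [ENNReal.ofReal_mul (mul_nonneg hC0 hr), ENNReal.ofReal_mul hC0]
  refine h.trans ?_
  gcongr
  calc C = ENNReal.ofReal C.toReal := (ENNReal.ofReal_toReal hC).symm
    _ ≤ _ := ENNReal.ofReal_le_ofReal (by linarith)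

/-- Exponents with `1/p + 1/q = 1/2`, `2 < p`, `p` finite. -/
theorem ENNReal.toReal_inv_add_inv {p q : ℝ≥0∞} (hp : 2 < p) (hpt : p ≠ ∞)
    (hpq : 1 / p + 1 / q = 1 / 2) : q ≠ ∞ ∧ 2 < p.toReal ∧ 0 < q.toReal ∧
      1 / p.toReal + 1 / q.toReal = 1 / 2 := by
  have hP : 2 < p.toReal := by
    have := (ENNReal.toReal_lt_toReal (by simp) hpt).2 hp
    simpa using this
  have hqt : q ≠ ∞ := by
    rintro rfl
    rw [one_div, one_div, one_div, ENNReal.inv_top, add_zero, inv_inj] at hpq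
    exact hp.ne' hpq
  have hq0 : q ≠ 0 := by
    rintro rfl
    simp only [one_div, ENNReal.inv_zero, add_top] at hpq
    exact (ENNReal.inv_ne_top.2 two_ne_zero) hpq.symm
  have hQ : 0 < q.toReal := ENNReal.toReal_pos hq0 hqt
  refine ⟨hqt, hP, hQ, ?_⟩
  have h := congrArg ENNReal.toReal hpq
  have hp0 : p ≠ 0 := (zero_lt_two.trans hp).ne'
  rw [ENNReal.toReal_add (by simp [hp0]) (by simp [hq0])] at h
  simpa using h

variable {d : ℕ}

theorem lateralNorm_eq_lintegral {p q : ℝ≥0∞} (hp0 : p ≠ 0) (hp : p ≠ ∞) (hq0 : q ≠ 0) (hq : q ≠ ∞)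
    (e : RSpace d) (h : RSpace d × ℝ → ℂ) :
    lateralNorm p q e h = (∫⁻ x₁ : ℝ, (∫⁻ y : (Submodule.span ℝ {e})ᗮ × ℝ,
      ‖h (x₁ • e + (y.1 : RSpace d), y.2)‖ₑ ^ q.toReal) ^ (p.toReal / q.toReal)) ^ (1 / p.toReal) := by
  rw [lateralNorm, eLpNorm_eq_lintegral_rpow_enorm_toReal hp0 hp]
  congr 1
  refine lintegral_congr fun x => ?_
  rw [enorm_eq_self, eLpNorm_eq_lintegral_rpow_enorm_toReal hq0 hq, ← ENNReal.rpow_mul]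
  congr 1; ring

theorem lintegral_lateral {e : RSpace d} (he : ‖e‖ = 1) {φ : RSpace d × ℝ → ℝ≥0∞}
    (hφ : AEMeasurable φ volume) :
    ∫⁻ x₁ : ℝ, ∫⁻ y : (Submodule.span ℝ {e})ᗮ × ℝ, φ (x₁ • e + (y.1 : RSpace d), y.2) =
      ∫⁻ z, φ z := by
  have hmp := measurePreserving_lateralSpaceTime e he
  have h := lintegral_prod (μ := (volume : Measure ℝ))
    (ν := (volume : Measure ((Submodule.span ℝ {e})ᗮ × ℝ))) (fun y => φ (lateralSpaceTime e he y))
    (hφ.comp_quasiMeasurePreserving hmp.quasiMeasurePreserving)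
  rw [← hmp.lintegral_comp_emb (lateralSpaceTime e he).measurableEmbedding]
  refine Eq.trans ?_ h.symm
  simp only [lateralSpaceTime_apply]

theorem lateralNorm_self {e : RSpace d} (he : ‖e‖ = 1) {p : ℝ≥0∞} (hp0 : p ≠ 0) (hp : p ≠ ∞)
    {h : RSpace d × ℝ → ℂ} (hh : AEStronglyMeasurable h volume) :
    lateralNorm p p e h = eLpNorm h p volume := by
  rw [lateralNorm_eq_lintegral hp0 hp hp0 hp, eLpNorm_eq_lintegral_rpow_enorm_toReal hp0 hp,
    div_self (ENNReal.toReal_pos hp0 hp).ne']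
  simp only [ENNReal.rpow_one]
  rw [lintegral_lateral he (φ := fun z => ‖h z‖ₑ ^ p.toReal) (hh.enorm.pow_const _)]

theorem strichartzExponent_two : strichartzExponent 2 = 4 := by
  rw [strichartzExponent, ← ENNReal.ofReal_ofNat]
  congr 1
  norm_num

/-- Lateral Strichartz estimate at frequency `2^k`, for exponents `2 < p < 4 < q`: the dual lateral
estimate applied to the Gaussian wave family, whose kernel at frequency `N` is at most `4 N / |x₁ -
x₁'|`. -/
theorem exists_lateralNorm_extension_le {p q : ℝ≥0∞} (hp : 2 < p) (hpq : 1 / p + 1 / q = 1 / 2)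
    (hp4 : p < 4) :
    ∃ C : ℝ≥0∞, C ≠ ∞ ∧ ∀ (k : ℤ) (e : RSpace 2), ‖e‖ = 1 → ∀ g : L2Space 2,
      lateralNorm p q e (extension fun ζ => gaussEnv (((2 : ℝ) ^ k)⁻¹ ^ 2) ζ * g ζ) ≤
        C * ENNReal.ofReal (2 ^ ((k : ℝ) * ((2 / p).toReal - 1 / 2))) * ‖g‖ₑ := by
  have hpt : p ≠ ∞ := (hp4.trans (by simp)).ne
  obtain ⟨hqt, hP, hQ, hPQ⟩ := ENNReal.toReal_inv_add_inv hp hpt hpq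
  have hp0 : p ≠ 0 := (zero_lt_two.trans hp).ne'
  have hq0 : q ≠ 0 := fun h => by rw [h] at hQ; simp at hQ
  have h2p : (2 / p).toReal = 2 / p.toReal := by rw [ENNReal.toReal_div]; rfl
  rw [h2p]
  have hP4 : p.toReal < 4 := by
    have := (ENNReal.toReal_lt_toReal hpt (by simp)).2 hp4
    simpa using this
  set P := p.toReal
  set Q := q.toReal
  have hP0 : 0 < P := by linarith
  have h1P : 1 / 4 < 1 / P := one_div_lt_one_div_of_lt hP0 hP4
  have h1Q : 1 / Q < 1 / 4 := by linarith
  have hQ4 : 4 < Q := (one_div_lt_one_div hQ (by norm_num)).1 h1Q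
  have hr := (Real.HolderConjugate.conjExponent (show 1 < P by linarith)).symm
  have hs := (Real.HolderConjugate.conjExponent (show 1 < Q by linarith)).symm
  set r := P.conjExponent with hrdef
  set s := Q.conjExponent with hsdef
  have hr1 : 1 / r = 1 - 1 / P := by
    have := hr.inv_add_inv_eq_one
    rw [one_div, one_div]; linarith
  have hs1 : 1 / s = 1 - 1 / Q := by
    have := hs.inv_add_inv_eq_one
    rw [one_div, one_div]; linarith
  have hr2 : r < 2 := by
    have h1 : 1 / P < 1 / 2 := one_div_lt_one_div_of_lt (by norm_num) hP
    exact (one_div_lt_one_div (by norm_num) hr.pos).1 (by rw [hr1]; linarith)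
  have hs43 : s < 4 / 3 := by
    refine (one_div_lt_one_div (by norm_num) hs.pos).1 ?_
    rw [hs1]
    norm_num
    rw [one_div] at h1Q
    linarith
  obtain ⟨M, hM, hStr⟩ := exists_enorm_synthesis_wave_le (d := 2) (by norm_num)
  obtain ⟨C, hC, hLat⟩ := enorm_synthesis_le_of_lateral (H := L2Space 2) (r := r) (s := s) hs.lt hs43
    (by rw [hr1, hs1]; linarith) hr2
  set θ := 2 / P - 1 / 2 with hθ
  have hθ0 : 0 < θ := by
    rw [hθ, show 2 / P = 2 * (1 / P) by ring]; linarith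
  have hθs : 2 / s - 3 / 2 = θ := by
    rw [hθ, show 2 / s = 2 * (1 / s) by ring, hs1, show 2 / P = 2 * (1 / P) by ring]; linarith
  have hM1 : M + 1 ≠ ∞ := ENNReal.add_ne_top.2 ⟨hM, by simp⟩
  refine ⟨C * (ENNReal.ofReal (4 ^ θ) * (M + 1) ^ (4 - 4 / s)), ENNReal.mul_ne_top hC
    (ENNReal.mul_ne_top ENNReal.ofReal_ne_top
      (ENNReal.rpow_ne_top_of_ne_zero (by simp) hM1)), fun k e he g => ?_⟩
  set N : ℝ := 2 ^ k with hN
  have hN0 : 0 < N := by positivity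
  set a : ℝ := N⁻¹ ^ 2 with ha
  have ha0 : 0 < a := by positivity
  set Y := (Submodule.span ℝ {e})ᗮ × ℝ
  set w : ℝ × Y → L2Space 2 := fun v =>
    wave (memLp_gaussEnv (d := 2) ha0) (lateralSpaceTime e he v) with hw
  have hwc : StronglyMeasurable w :=
    (continuous_wave (memLp_gaussEnv (d := 2) ha0)).stronglyMeasurable.comp_measurable
      (lateralSpaceTime e he).measurable
  have hmp := measurePreserving_lateralSpaceTime e he
  have hdual := hLat Y volume (ENNReal.ofReal (4 * N)) (M + 1)
    (ENNReal.ofReal_pos.2 (by positivity)).ne' ENNReal.ofReal_ne_top (by simp) hM1 w hwc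
    ⟨_, fun v => norm_wave_le _ _⟩ (fun x x' y y' hxx => ?_) (fun F hF hFi => ?_)
  · rw [hθs] at hdual
    have h1 := lintegral_lintegral_enorm_inner_rpow_le hwc (fun v => norm_wave_le _ _) hr hs
      hP.le (by linarith) hdual g
    rw [lateralNorm_eq_lintegral hp0 hpt hq0 hqt, one_div, ENNReal.rpow_inv_le_iff hP0]
    simp only [hw, inner_wave_gaussEnv_left ha0, lateralSpaceTime_apply] at h1
    refine h1.trans (le_of_eq ?_)
    congr 1
    rw [ENNReal.ofReal_mul (by norm_num), ENNReal.mul_rpow_of_nonneg _ _ hθ0.le,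
      ENNReal.ofReal_rpow_of_pos (by norm_num), ENNReal.ofReal_rpow_of_pos hN0, Real.rpow_mul (by norm_num),
      Real.rpow_intCast]
    ring
  · have hv : lateralSpaceTime e he (x, y) - lateralSpaceTime e he (x', y') =
        ((x - x') • e + ((y.1 - y'.1 : (Submodule.span ℝ {e})ᗮ) : RSpace 2), y.2 - y'.2) := by
      rw [lateralSpaceTime_apply, lateralSpaceTime_apply, Prod.mk_sub_mk, sub_smul, Submodule.coe_sub]
      congr 1
      abel
    have hxx' : 0 < |x - x'| := abs_pos.2 (sub_ne_zero.2 hxx)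
    rw [hw, inner_wave_gaussEnv ha0, hv]
    set X := (x - x') • e + ((y.1 - y'.1 : (Submodule.span ℝ {e})ᗮ) : RSpace 2) with hX
    have hXle : |x - x'| ≤ ‖X‖ := by
      have := abs_inner_le_norm_of_unit he X
      rwa [hX, inner_lateral he] at this
    have h1 := norm_extension_gaussEnv_le (d := 2) (a := 2 * a) (β := 1 / 2) (by positivity)
      (by norm_num) (by norm_num) (by norm_num) (norm_pos_iff.1 (hxx'.trans_le hXle)) (y.2 - y'.2)
    rw [← ofReal_norm, ENNReal.ofReal_rpow_of_pos hxx', ← ENNReal.ofReal_mul (by positivity)]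
    refine ENNReal.ofReal_le_ofReal (h1.trans ?_)
    have h2 : (2 * a) ^ ((1 / 2 : ℝ) - ((2 : ℕ) : ℝ) / 2) ≤ N := by
      have : (1 / 2 : ℝ) - ((2 : ℕ) : ℝ) / 2 = -(1 / 2) := by norm_num
      rw [this]
      calc (2 * a) ^ (-(1 / 2) : ℝ) ≤ a ^ (-(1 / 2) : ℝ) :=
            Real.rpow_le_rpow_of_nonpos ha0 (by linarith) (by norm_num)
        _ = N := by
          rw [ha, Real.rpow_neg (by positivity), ← Real.sqrt_eq_rpow, Real.sqrt_sq (by positivity), inv_inv]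
    have h3 : ‖X‖ ^ (-(2 * (1 / 2 : ℝ))) ≤ |x - x'| ^ (-1 : ℝ) := by
      rw [show -(2 * (1 / 2 : ℝ)) = -1 by norm_num]
      exact Real.rpow_le_rpow_of_nonpos hxx' hXle (by norm_num)
    gcongr
  -- the `L^{4/3}` bound is the dual Strichartz estimate in rotated coordinates
  · set Φ := lateralSpaceTime e he
    have hFm : Measurable (F ∘ Φ.symm) := hF.comp Φ.symm.measurable
    have hFi' : Integrable (F ∘ Φ.symm) := by
      refine (hmp.integrable_comp_emb Φ.measurableEmbedding).1 ?_
      have : (F ∘ Φ.symm) ∘ Φ = F := by funext v; simp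
      rw [this]
      exact hFi
    have h1 := hStr a ha0 (F ∘ Φ.symm) hFm hFi'
    have e1 : ∫ z, (F ∘ Φ.symm) z • wave (memLp_gaussEnv (d := 2) ha0) z = ∫ v, F v • w v := by
      rw [← hmp.integral_comp Φ.measurableEmbedding]
      simp only [Function.comp_apply, MeasurableEquiv.symm_apply_apply]
      rfl
    have e2 : ∫⁻ z, ‖(F ∘ Φ.symm) z‖ₑ ^ ((2 * ((2 : ℕ) : ℝ) + 4) / (((2 : ℕ) : ℝ) + 4)) =
        ∫⁻ v, ‖F v‖ₑ ^ (4 / 3 : ℝ) := by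
      rw [← hmp.lintegral_comp_emb Φ.measurableEmbedding]
      simp only [Function.comp_apply, MeasurableEquiv.symm_apply_apply]
      norm_num
      rfl
    rw [e1, e2] at h1
    refine h1.trans ?_
    have e3 : ((2 * ((2 : ℕ) : ℝ) + 4) / (((2 : ℕ) : ℝ) + 4)) = 4 / 3 := by norm_num
    rw [e3]
    exact mul_le_mul_left le_self_add _

/-- The lateral Strichartz estimates with `p ≤ q`. -/
theorem exists_lateralNorm_lpProj_le {η : ℝ → ℝ} (hη : IsBaseCutoff η) {p q : ℝ≥0∞} (hp : 2 < p)
    (hpq : 1 / p + 1 / q = 1 / 2) (hle : p ≤ q) :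
    ∃ C : ℝ, 0 < C ∧ ∀ (f : L2Space 2) (k : ℤ) (e : RSpace 2), ‖e‖ = 1 →
      lateralNorm p q e (freeEvolution (lpProj η k f)) ≤
        ENNReal.ofReal (C * 2 ^ ((k : ℝ) * ((2 / p).toReal - 1 / 2)) * ‖f‖) := by
  have hpt : p ≠ ∞ := by
    rintro rfl
    rw [top_le_iff] at hle
    subst hle
    simp only [one_div, ENNReal.inv_top, add_zero] at hpq
    exact (ENNReal.inv_ne_zero.2 (by simp)) hpq.symm
  obtain ⟨hqt, hP, hQ, hPQ⟩ := ENNReal.toReal_inv_add_inv hp hpt hpq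
  have hPQ' : p.toReal ≤ q.toReal := ENNReal.toReal_mono hqt hle
  have hP0 : 0 < p.toReal := by linarith
  have hP4 : p.toReal ≤ 4 := by
    have h1 : 1 / q.toReal ≤ 1 / p.toReal := one_div_le_one_div_of_le hP0 hPQ'
    refine (one_div_le_one_div (by norm_num) hP0).1 ?_
    linarith
  -- at `p = q = 4` the estimate is the Strichartz estimate
  rcases hP4.eq_or_lt with h4 | h4
  · have hp4 : p = 4 := by
      rw [← ENNReal.ofReal_toReal hpt, h4, ENNReal.ofReal_ofNat]
    have hq4 : q = 4 := by
      rw [← ENNReal.ofReal_toReal hqt]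
      have : q.toReal = 4 := by
        rw [h4] at hPQ
        have : 1 / q.toReal = 1 / 4 := by linarith
        rw [one_div, one_div] at this
        exact inv_injective this
      rw [this, ENNReal.ofReal_ofNat]
    obtain ⟨C, hC, hS⟩ := exists_eLpNorm_freeEvolution_le (d := 2) (by norm_num)
    refine ⟨C.toReal + 1, by positivity, fun f k e he => ?_⟩
    refine ENNReal.le_ofReal_toReal_add_one_mul hC (by positivity) ?_
    have h2 : (2 / p).toReal - 1 / 2 = 0 := by
      rw [ENNReal.toReal_div, h4]; norm_num
    rw [h2, mul_zero, Real.rpow_zero, ENNReal.ofReal_one, mul_one, hp4, hq4,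
      lateralNorm_self he (by norm_num) (by simp) (freeEvolution_spec _).1.aestronglyMeasurable,
      ← strichartzExponent_two]
    refine (hS _).trans ?_
    gcongr
    rw [← ofReal_norm]
    exact ENNReal.ofReal_le_ofReal (norm_lpProj_le hη k f)
  · have hp4 : p < 4 := by
      refine (ENNReal.toReal_lt_toReal hpt (by simp)).1 ?_
      simpa using h4
    obtain ⟨C, hC, h⟩ := exists_lateralNorm_extension_le hp hpq hp4
    refine ⟨(C * ENNReal.ofReal (Real.exp 3)).toReal + 1, by positivity, fun f k e he => ?_⟩
    obtain ⟨g, hg, -, hfree⟩ := exists_freeEvolution_lpProj_eq hη k f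
    refine ENNReal.le_ofReal_toReal_add_one_mul (ENNReal.mul_ne_top hC ENNReal.ofReal_ne_top)
      (by positivity) ?_
    rw [lateralNorm_congr_ae he _ _ hfree]
    refine (h k e he g).trans ?_
    calc _ ≤ C * ENNReal.ofReal (2 ^ ((k : ℝ) * ((2 / p).toReal - 1 / 2))) *
          ENNReal.ofReal (Real.exp 3 * ‖f‖) := by
          rw [← ofReal_norm]
          gcongr
      _ = _ := by
          rw [ENNReal.ofReal_mul (by positivity)]
          ring

end LateralStrichartz

/-! ### The maximal Strichartz estimate -/

section MaximalStrichartz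

theorem hasDerivAt_extension {E : Type*} [NormedAddCommGroup E] [InnerProductSpace ℝ E]
    [FiniteDimensional ℝ E] [MeasurableSpace E] [BorelSpace E] {G G' : E → ℂ} (hG : Integrable G)
    (hG' : Integrable G')
    (h : ∀ᵐ ζ, G' ζ = -(Complex.I * (4 * Real.pi ^ 2 * ‖ζ‖ ^ 2 : ℝ)) * G ζ) (x : E) (t : ℝ) :
    HasDerivAt (fun t => extension G (x, t)) (extension G' (x, t)) t := by
  refine (hasDerivAt_integral_of_dominated_loc_of_deriv_le (μ := volume) (s := Set.univ)
    (F := fun t ζ => Complex.exp (Complex.I * wavePhase (x, t) ζ) * G ζ)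
    (F' := fun t ζ => Complex.exp (Complex.I * wavePhase (x, t) ζ) * G' ζ) (bound := fun ζ => ‖G' ζ‖)
    Filter.univ_mem ?_ (integrable_exp_wavePhase_mul hG _)
    (integrable_exp_wavePhase_mul hG' _).aestronglyMeasurable ?_ hG'.norm ?_).2
  · exact Filter.Eventually.of_forall fun s => (integrable_exp_wavePhase_mul hG _).aestronglyMeasurable
  · exact Filter.Eventually.of_forall fun ζ s _ => (enorm_exp_wavePhase_mul _ _ _).le
  · filter_upwards [h] with ζ hζ s _
    have h1 : HasDerivAt (fun t : ℝ => wavePhase (x, t) ζ) (-(4 * Real.pi ^ 2 * ‖ζ‖ ^ 2)) s := by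
      have h0 : HasDerivAt (fun t : ℝ => 2 * Real.pi * inner ℝ x ζ - t * (4 * Real.pi ^ 2 * ‖ζ‖ ^ 2))
          (0 - 1 * (4 * Real.pi ^ 2 * ‖ζ‖ ^ 2)) s :=
        (hasDerivAt_const s (2 * Real.pi * inner ℝ x ζ)).sub
          ((hasDerivAt_id s).mul_const (4 * Real.pi ^ 2 * ‖ζ‖ ^ 2))
      exact h0.congr_deriv (by ring)
    have h2 := ((h1.ofReal_comp.const_mul Complex.I).cexp).mul_const (G ζ)
    refine h2.congr_deriv ?_
    rw [hζ]
    push_cast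
    ring

/-- One-dimensional Sobolev inequality at scale `τ`. -/
theorem enorm_rpow_le_of_hasDerivAt {v v' : ℝ → ℂ} (hv : ∀ t, HasDerivAt v (v' t) t)
    (hv' : Continuous v') {p τ : ℝ} (hp : 1 ≤ p) (hτ : 0 < τ) (t : ℝ) :
    ‖v t‖ₑ ^ p ≤ 2 ^ (p - 1) * (ENNReal.ofReal τ⁻¹ * (∫⁻ s, ‖v s‖ₑ ^ p) +
      ENNReal.ofReal τ ^ (p - 1) * ∫⁻ s, ‖v' s‖ₑ ^ p) := by
  have hp0 : 0 < p := by linarith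
  set J := Set.Icc t (t + τ) with hJ
  have hJv : volume J = ENNReal.ofReal τ := by rw [hJ, Real.volume_Icc]; congr 1; ring
  have hτ0 : ENNReal.ofReal τ ≠ 0 := (ENNReal.ofReal_pos.2 hτ).ne'
  have hvc : Continuous v := continuous_iff_continuousAt.2 fun s => (hv s).continuousAt
  set D := ∫⁻ s in J, ‖v' s‖ₑ with hD
  have hDp : D ^ p ≤ ENNReal.ofReal τ ^ (p - 1) * ∫⁻ s, ‖v' s‖ₑ ^ p := by
    have h1 := setLIntegral_rpow_le (μ := volume) one_pos hp J (f := fun s => ‖v' s‖ₑ)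
      hv'.enorm.measurable.aemeasurable
    simp only [ENNReal.rpow_one, div_one, hJv] at h1
    refine h1.trans ?_
    gcongr
    exact Measure.restrict_le_self
  have hpt : ∀ s ∈ J, ‖v t‖ₑ ^ p ≤ 2 ^ (p - 1) * (‖v s‖ₑ ^ p + D ^ p) := by
    intro s hs
    have h1 : ‖v t‖ₑ ≤ ‖v s‖ₑ + D := by
      have h2 : ∫ r in t..s, v' r = v s - v t :=
        intervalIntegral.integral_eq_sub_of_hasDerivAt (fun r _ => hv r) (hv'.intervalIntegrable _ _)
      have h3 : v t = v s - ∫ r in t..s, v' r := by rw [h2]; ring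
      calc ‖v t‖ₑ ≤ ‖v s‖ₑ + ‖∫ r in t..s, v' r‖ₑ := by
            nth_rewrite 1 [h3]
            exact enorm_sub_le
        _ ≤ _ := by
            gcongr
            rw [intervalIntegral.integral_of_le hs.1]
            refine (enorm_integral_le_lintegral_enorm _).trans ?_
            exact lintegral_mono_set fun r hr => ⟨hr.1.le, hr.2.trans hs.2⟩
    refine (ENNReal.rpow_le_rpow h1 hp0.le).trans ?_
    exact ENNReal.rpow_add_le_mul_rpow_add_rpow _ _ hp
  have havg : ENNReal.ofReal τ * ‖v t‖ₑ ^ p ≤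
      2 ^ (p - 1) * ((∫⁻ s, ‖v s‖ₑ ^ p) + ENNReal.ofReal τ * D ^ p) := by
    calc ENNReal.ofReal τ * ‖v t‖ₑ ^ p = ∫⁻ _ in J, ‖v t‖ₑ ^ p := by
          rw [setLIntegral_const, hJv, mul_comm]
      _ ≤ ∫⁻ s in J, 2 ^ (p - 1) * (‖v s‖ₑ ^ p + D ^ p) := setLIntegral_mono' measurableSet_Icc hpt
      _ = 2 ^ (p - 1) * ((∫⁻ s in J, ‖v s‖ₑ ^ p) + ENNReal.ofReal τ * D ^ p) := by
          have hm : Measurable fun s => ‖v s‖ₑ ^ p := hvc.enorm.measurable.pow_const p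
          rw [lintegral_const_mul _ (show Measurable fun s => ‖v s‖ₑ ^ p + D ^ p from
            hm.add measurable_const), lintegral_add_left hm, setLIntegral_const, hJv, mul_comm (D ^ p)]
      _ ≤ _ := by
          gcongr
          exact Measure.restrict_le_self
  calc ‖v t‖ₑ ^ p = ENNReal.ofReal τ⁻¹ * (ENNReal.ofReal τ * ‖v t‖ₑ ^ p) := by
        rw [← mul_assoc, ← ENNReal.ofReal_mul (by positivity), inv_mul_cancel₀ hτ.ne', ENNReal.ofReal_one,
          one_mul]
    _ ≤ ENNReal.ofReal τ⁻¹ * (2 ^ (p - 1) * ((∫⁻ s, ‖v s‖ₑ ^ p) + ENNReal.ofReal τ * D ^ p)) := by gcongr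
    _ = 2 ^ (p - 1) * (ENNReal.ofReal τ⁻¹ * (∫⁻ s, ‖v s‖ₑ ^ p) +
        (ENNReal.ofReal τ⁻¹ * ENNReal.ofReal τ) * D ^ p) := by ring
    _ ≤ _ := by
        rw [← ENNReal.ofReal_mul (by positivity), inv_mul_cancel₀ hτ.ne', ENNReal.ofReal_one, one_mul]
        gcongr

variable {d : ℕ}

theorem maximalNorm_congr_ae (p : ℝ≥0∞) {h h' : RSpace d × ℝ → ℂ} (hh : h =ᵐ[volume] h') :
    maximalNorm p h = maximalNorm p h' := by
  refine eLpNorm_congr_ae ?_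
  filter_upwards [Measure.ae_ae_of_ae_prod hh] with x hx
  exact eLpNorm_congr_ae hx

/-- The maximal Strichartz estimate: Sobolev's inequality in time at the scale `2^{-2k}`, since a
time derivative costs `2^{2k}` at frequency `2^k`. -/
theorem exists_maximalNorm_le (hd : 0 < d) {η : ℝ → ℝ} (hη : IsBaseCutoff η) :
    ∃ C : ℝ, 0 < C ∧ ∀ (f : L2Space d) (k : ℤ),
      maximalNorm (strichartzExponent d) (freeEvolution (lpProj η k f)) ≤
        ENNReal.ofReal (C * 2 ^ ((k : ℝ) * d / (d + 2)) * ‖f‖) := by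
  have hd' : (0 : ℝ) < d := by exact_mod_cast hd
  obtain ⟨C, hC, hS⟩ := exists_lintegral_extension_gaussEnv_mul_le hd
  set p : ℝ := (2 * d + 4) / d with hp
  have hp1 : 1 ≤ p := by rw [hp, le_div_iff₀ hd']; linarith
  have hp0 : 0 < p := by linarith
  refine ⟨(6 * (C * ENNReal.ofReal (Real.exp 3))).toReal + 1, by positivity, fun f k => ?_⟩
  obtain ⟨g, hg, hgs, hfree⟩ := exists_freeEvolution_lpProj_eq hη k f
  set N : ℝ := 2 ^ k with hN
  have hN0 : 0 < N := by positivity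
  set a : ℝ := N⁻¹ ^ 2 with ha
  have ha0 : 0 < a := by positivity
  refine ENNReal.le_ofReal_toReal_add_one_mul
    (ENNReal.mul_ne_top (by simp) (ENNReal.mul_ne_top hC ENNReal.ofReal_ne_top)) (by positivity) ?_
  rw [maximalNorm_congr_ae _ hfree]
  -- the time derivative is again a superposition of waves at frequency `N`
  set q : RSpace d → ℂ := fun ζ => -(Complex.I * (4 * Real.pi ^ 2 * ‖ζ‖ ^ 2 : ℝ)) with hq
  have hqc : Continuous q := by rw [hq]; fun_prop
  have hqb : ∀ᵐ ζ, ‖q ζ * g ζ‖ ≤ 3 * N ^ 2 * ‖g ζ‖ := by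
    filter_upwards [hgs] with ζ hζ
    by_cases h0 : g ζ = 0
    · simp [h0]
    have h1 := hζ h0
    rw [norm_mul]
    gcongr
    rw [hq, norm_neg, norm_mul, Complex.norm_I, one_mul, Complex.norm_real, Real.norm_of_nonneg (by positivity)]
    calc 4 * Real.pi ^ 2 * ‖ζ‖ ^ 2 = (2 * Real.pi * ‖ζ‖) ^ 2 := by ring
      _ ≤ (8 / 5 * N) ^ 2 := pow_le_pow_left₀ (by positivity) h1 2
      _ ≤ 3 * N ^ 2 := by nlinarith [sq_nonneg N]
  have hmem : MemLp (fun ζ => q ζ * g ζ) 2 :=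
    (Lp.memLp g).of_le_mul (hqc.aestronglyMeasurable.mul (Lp.aestronglyMeasurable g)) hqb
  set g' : L2Space d := hmem.toLp with hg'
  have hg'n : ‖g'‖ ≤ 3 * N ^ 2 * ‖g‖ := by
    refine Lp.norm_le_mul_norm_of_ae_le_mul ?_
    filter_upwards [hmem.coeFn_toLp, hqb] with ζ h1 h2
    rw [h1]; exact h2
  set u := extension fun ζ => gaussEnv a ζ * g ζ with hu
  set u' := extension fun ζ => gaussEnv a ζ * g' ζ with hu'
  have huc : Continuous u := continuous_extension (integrable_gaussEnv_mul ha0 _)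
  have huc' : Continuous u' := continuous_extension (integrable_gaussEnv_mul ha0 _)
  have hder : ∀ x t, HasDerivAt (fun t => u (x, t)) (u' (x, t)) t := fun x t => by
    refine hasDerivAt_extension (integrable_gaussEnv_mul ha0 g) (integrable_gaussEnv_mul ha0 g') ?_ x t
    filter_upwards [hmem.coeFn_toLp] with ζ h1
    rw [h1]
    ring
  set τ : ℝ := N⁻¹ ^ 2 with hτ
  have hτ0 : 0 < τ := by positivity
  have hm : Measurable fun z => ‖u z‖ₑ ^ p := huc.enorm.measurable.pow_const p
  have hm' : Measurable fun z => ‖u' z‖ₑ ^ p := huc'.enorm.measurable.pow_const p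
  have hpt : ∀ x, eLpNorm (fun t => u (x, t)) ∞ volume ^ p ≤
      2 ^ (p - 1) * (ENNReal.ofReal τ⁻¹ * (∫⁻ s, ‖u (x, s)‖ₑ ^ p) +
        ENNReal.ofReal τ ^ (p - 1) * ∫⁻ s, ‖u' (x, s)‖ₑ ^ p) := fun x => by
    rw [← ENNReal.le_rpow_inv_iff hp0, eLpNorm_exponent_top]
    refine essSup_le_of_ae_le _ (Filter.Eventually.of_forall fun t => ?_)
    simp only
    rw [ENNReal.le_rpow_inv_iff hp0]
    exact enorm_rpow_le_of_hasDerivAt (hder x) (huc'.comp (Continuous.prodMk_right x)) hp1 hτ0 t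
  obtain ⟨B, hB⟩ : ∃ B : ℝ≥0∞, B = C * ‖g‖ₑ := ⟨_, rfl⟩
  have hu1 : ∫⁻ z, ‖u z‖ₑ ^ p ≤ B ^ p := hB ▸ hS a ha0 g
  have hu2 : ∫⁻ z, ‖u' z‖ₑ ^ p ≤ (3 * ENNReal.ofReal τ⁻¹ * B) ^ p := by
    refine (hS a ha0 g').trans (ENNReal.rpow_le_rpow ?_ hp0.le)
    calc C * ‖g'‖ₑ ≤ C * ENNReal.ofReal (3 * N ^ 2 * ‖g‖) := by
          rw [← ofReal_norm]
          gcongr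
      _ = 3 * ENNReal.ofReal τ⁻¹ * B := by
          rw [ENNReal.ofReal_mul (by positivity), ENNReal.ofReal_mul (by norm_num), ofReal_norm,
            ENNReal.ofReal_ofNat, hτ, inv_pow, inv_inv, hB]
          ring
  have hint : ∫⁻ x, eLpNorm (fun t => u (x, t)) ∞ volume ^ p ≤
      (6 * (ENNReal.ofReal τ⁻¹ ^ (1 / p) * B)) ^ p := by
    have hτe0 : ENNReal.ofReal τ⁻¹ ≠ 0 := (ENNReal.ofReal_pos.2 (by positivity)).ne'
    have hτinv : ENNReal.ofReal τ = (ENNReal.ofReal τ⁻¹)⁻¹ := by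
      rw [← ENNReal.ofReal_inv_of_pos (by positivity), inv_inv]
    calc _ ≤ ∫⁻ x, 2 ^ (p - 1) * (ENNReal.ofReal τ⁻¹ * (∫⁻ s, ‖u (x, s)‖ₑ ^ p) +
          ENNReal.ofReal τ ^ (p - 1) * ∫⁻ s, ‖u' (x, s)‖ₑ ^ p) := lintegral_mono hpt
      _ = 2 ^ (p - 1) * (ENNReal.ofReal τ⁻¹ * (∫⁻ z, ‖u z‖ₑ ^ p) +
          ENNReal.ofReal τ ^ (p - 1) * ∫⁻ z, ‖u' z‖ₑ ^ p) := by
          rw [lintegral_const_mul, lintegral_add_left, lintegral_const_mul, lintegral_const_mul,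
            Measure.volume_eq_prod, lintegral_prod _ hm.aemeasurable, lintegral_prod _ hm'.aemeasurable]
          · exact hm'.lintegral_prod_right'
          · exact hm.lintegral_prod_right'
          · exact hm.lintegral_prod_right'.const_mul _
          · exact (hm.lintegral_prod_right'.const_mul _).add (hm'.lintegral_prod_right'.const_mul _)
      _ ≤ 2 ^ (p - 1) * (ENNReal.ofReal τ⁻¹ * B ^ p +
          ENNReal.ofReal τ ^ (p - 1) * (3 * ENNReal.ofReal τ⁻¹ * B) ^ p) := by gcongr
      _ = 2 ^ (p - 1) * (1 + 3 ^ p) * (ENNReal.ofReal τ⁻¹ * B ^ p) := by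
          have h1 : ENNReal.ofReal τ ^ (p - 1) * ENNReal.ofReal τ⁻¹ ^ p = ENNReal.ofReal τ⁻¹ := by
            rw [hτinv, ENNReal.inv_rpow, ← ENNReal.rpow_neg, ← ENNReal.rpow_add _ _ hτe0 ENNReal.ofReal_ne_top]
            rw [show -(p - 1) + p = 1 by ring, ENNReal.rpow_one]
          rw [ENNReal.mul_rpow_of_nonneg _ _ hp0.le, ENNReal.mul_rpow_of_nonneg _ _ hp0.le]
          rw [show ENNReal.ofReal τ ^ (p - 1) * (3 ^ p * ENNReal.ofReal τ⁻¹ ^ p * B ^ p) =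
            (ENNReal.ofReal τ ^ (p - 1) * ENNReal.ofReal τ⁻¹ ^ p) * (3 ^ p * B ^ p) by ring, h1]
          ring
      _ ≤ 6 ^ p * (ENNReal.ofReal τ⁻¹ * B ^ p) := by
          gcongr
          have h3 : (1 : ℝ≥0∞) ≤ 3 ^ p := ENNReal.one_le_rpow (by norm_num) hp0
          calc (2 : ℝ≥0∞) ^ (p - 1) * (1 + 3 ^ p) ≤ 2 ^ (p - 1) * (3 ^ p + 3 ^ p) := by gcongr
            _ = (2 ^ (p - 1) * 2) * 3 ^ p := by ring
            _ = 6 ^ p := by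
              have : (2 : ℝ≥0∞) ^ (p - 1) * 2 = 2 ^ p := by
                have h4 := ENNReal.rpow_add (x := 2) (p - 1) 1 (by simp) (by simp)
                rw [ENNReal.rpow_one, sub_add_cancel] at h4
                exact h4.symm
              rw [this, ← ENNReal.mul_rpow_of_nonneg _ _ hp0.le]
              norm_num
      _ = _ := by
          rw [ENNReal.mul_rpow_of_nonneg 6 (_ * B) hp0.le, ENNReal.mul_rpow_of_nonneg _ B hp0.le, ← ENNReal.rpow_mul,
            one_div_mul_cancel hp0.ne', ENNReal.rpow_one]
  have hpE : strichartzExponent d = ENNReal.ofReal p := rfl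
  have hpe : (ENNReal.ofReal p).toReal = p := ENNReal.toReal_ofReal (by positivity)
  rw [maximalNorm, hpE, eLpNorm_eq_lintegral_rpow_enorm_toReal (ENNReal.ofReal_pos.2 hp0).ne' ENNReal.ofReal_ne_top,
    hpe, one_div, ENNReal.rpow_inv_le_iff hp0]
  simp only [enorm_eq_self]
  refine hint.trans ?_
  gcongr ?_ ^ _
  have h2 : ENNReal.ofReal τ⁻¹ ^ (1 / p) = ENNReal.ofReal (2 ^ ((k : ℝ) * d / (d + 2))) := by
    rw [ENNReal.ofReal_rpow_of_pos (by positivity)]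
    congr 1
    rw [hτ, inv_pow, inv_inv, hN, ← Real.rpow_intCast, ← Real.rpow_natCast, ← Real.rpow_mul (by positivity),
      ← Real.rpow_mul (by positivity)]
    congr 1
    rw [hp]
    field_simp
    push_cast
    ring
  rw [h2]
  calc 6 * (ENNReal.ofReal (2 ^ ((k : ℝ) * d / (d + 2))) * B)
      ≤ 6 * (ENNReal.ofReal (2 ^ ((k : ℝ) * d / (d + 2))) * (C * ENNReal.ofReal (Real.exp 3 * ‖f‖))) := by
        rw [hB, ← ofReal_norm]
        gcongr
    _ = _ := by
        rw [ENNReal.ofReal_mul (Real.exp_nonneg _)]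
        ring

end MaximalStrichartz

/-! ### Local smoothing -/

section LocalSmoothing

/-- A one-dimensional superposition of the oscillations `e^{-4π² i t ω²}` over `ω ≥ c` becomes, in
the variable `s = 2π ω²`, a Fourier transform in `t`; Plancherel's identity then gains the Jacobian
`4π ω ≥ 4π c`. -/
theorem lintegral_enorm_chirp_Ioi_sq_le {g : ℝ → ℂ} (hg : IntegrableOn g (Set.Ioi 0)) {c : ℝ} (hc : 0 < c)
    (hs : ∀ᵐ ω, g ω ≠ 0 → 0 < ω → c ≤ ω) :
    ∫⁻ t : ℝ, ‖∫ ω in Set.Ioi 0, Complex.exp (-(Complex.I * (4 * Real.pi ^ 2 * t * ω ^ 2 : ℝ))) * g ω‖ₑ ^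
      (2 : ℝ) ≤ ENNReal.ofReal (1 / (4 * Real.pi * c)) * ∫⁻ ω in Set.Ioi 0, ‖g ω‖ₑ ^ (2 : ℝ) := by
  have hpi := Real.pi_pos
  set q : ℝ → ℝ := fun ω => 2 * Real.pi * ω ^ 2 with hq
  have hqd : ∀ ω ∈ Set.Ioi (0 : ℝ), HasDerivWithinAt q (4 * Real.pi * ω) (Set.Ioi 0) ω := fun ω _ => by
    have := ((hasDerivAt_pow 2 ω).const_mul (2 * Real.pi)).hasDerivWithinAt (s := Set.Ioi 0)
    refine this.congr_deriv ?_
    push_cast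
    ring
  have hqi : Set.InjOn q (Set.Ioi 0) := by
    intro x hx y hy hxy
    have h1 : x ^ 2 = y ^ 2 := mul_left_cancel₀ (by positivity) hxy
    exact (pow_left_inj₀ (le_of_lt hx) (le_of_lt hy) two_ne_zero).1 h1
  have hroot : ∀ ω ∈ Set.Ioi (0 : ℝ), Real.sqrt (q ω / (2 * Real.pi)) = ω := fun ω hω => by
    rw [hq]
    simp only
    rw [mul_div_cancel_left₀ _ (by positivity), Real.sqrt_sq (le_of_lt hω)]
  have hqim : q '' Set.Ioi 0 = Set.Ioi 0 := by
    ext s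
    constructor
    · rintro ⟨ω, hω, rfl⟩
      have : (0 : ℝ) < ω := hω
      show 0 < 2 * Real.pi * ω ^ 2
      positivity
    · intro hs
      have hs' : (0 : ℝ) < s := hs
      refine ⟨Real.sqrt (s / (2 * Real.pi)), Real.sqrt_pos.2 (by positivity), ?_⟩
      rw [hq]
      simp only
      rw [Real.sq_sqrt (by positivity)]
      field_simp
  set Γ : ℝ → ℂ := fun s =>
    ((4 * Real.pi * Real.sqrt (s / (2 * Real.pi)))⁻¹ : ℝ) • g (Real.sqrt (s / (2 * Real.pi))) with hΓ
  have hΓq : ∀ ω ∈ Set.Ioi (0 : ℝ), Γ (q ω) = ((4 * Real.pi * ω)⁻¹ : ℝ) • g ω := fun ω hω => by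
    rw [hΓ]
    simp only
    rw [hroot ω hω]
  have hpos : ∀ ω ∈ Set.Ioi (0 : ℝ), 0 < 4 * Real.pi * ω := fun ω hω => by
    have : (0 : ℝ) < ω := hω
    positivity
  have hΓint : IntegrableOn Γ (Set.Ioi 0) := by
    rw [← hqim, integrableOn_image_iff_integrableOn_abs_deriv_smul measurableSet_Ioi hqd hqi]
    refine hg.congr_fun (fun ω hω => ?_) measurableSet_Ioi
    rw [hΓq ω hω, abs_of_pos (hpos ω hω), smul_smul, mul_inv_cancel₀ (hpos ω hω).ne', one_smul]
  set Γ' : ℝ → ℂ := (Set.Ioi 0).indicator Γ with hΓ'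
  have hΓ'int : Integrable Γ' := (integrable_indicator_iff measurableSet_Ioi).2 hΓint
  have key : ∀ t : ℝ, ∫ ω in Set.Ioi 0, Complex.exp (-(Complex.I * (4 * Real.pi ^ 2 * t * ω ^ 2 : ℝ))) * g ω =
      𝓕⁻ Γ' (-t) := fun t => by
    rw [Real.fourierInv_eq']
    have h1 : ∀ s : ℝ, Complex.exp ((2 * Real.pi * inner ℝ s (-t) : ℝ) * Complex.I) • Γ' s =
        (Set.Ioi 0).indicator (fun s => Complex.exp ((2 * Real.pi * inner ℝ s (-t) : ℝ) * Complex.I) • Γ s) s :=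
      fun s => by
        by_cases h : s ∈ Set.Ioi (0 : ℝ)
        · rw [hΓ', Set.indicator_of_mem h, Set.indicator_of_mem h]
        · rw [hΓ', Set.indicator_of_notMem h, Set.indicator_of_notMem h, smul_zero]
    rw [integral_congr_ae (Filter.Eventually.of_forall h1), integral_indicator measurableSet_Ioi]
    conv_rhs => rw [← hqim]
    rw [integral_image_eq_integral_abs_deriv_smul measurableSet_Ioi hqd hqi]
    refine setIntegral_congr_fun measurableSet_Ioi fun ω hω => ?_
    rw [hΓq ω hω, abs_of_pos (hpos ω hω), smul_comm, smul_smul, mul_inv_cancel₀ (hpos ω hω).ne', one_smul,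
      smul_eq_mul]
    congr 2
    simp only [hq, RCLike.inner_apply, conj_trivial]
    push_cast
    ring
  simp_rw [key]
  rw [(Measure.measurePreserving_neg volume).lintegral_comp_emb (MeasurableEquiv.neg ℝ).measurableEmbedding
    (fun t => ‖𝓕⁻ Γ' t‖ₑ ^ (2 : ℝ))]
  refine (lintegral_enorm_fourierInv_sq_le hΓ'int).trans ?_
  have h2 : ∀ s, ‖Γ' s‖ₑ ^ (2 : ℝ) = (Set.Ioi 0).indicator (fun s => ‖Γ s‖ₑ ^ (2 : ℝ)) s := fun s => by
    rw [hΓ']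
    by_cases h : s ∈ Set.Ioi (0 : ℝ)
    · rw [Set.indicator_of_mem h, Set.indicator_of_mem h]
    · rw [Set.indicator_of_notMem h, Set.indicator_of_notMem h]; simp
  rw [lintegral_congr h2, lintegral_indicator measurableSet_Ioi]
  conv_lhs => rw [← hqim]
  rw [lintegral_image_eq_lintegral_abs_deriv_mul measurableSet_Ioi hqd hqi, ← lintegral_const_mul' _ _ ENNReal.ofReal_ne_top]
  refine setLIntegral_mono_ae' measurableSet_Ioi ?_
  filter_upwards [hs] with ω h3 hω
  by_cases h0 : g ω = 0
  · rw [hΓq ω hω, h0]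
    simp
  have h4 := h3 h0 hω
  have h5 := hpos ω hω
  rw [hΓq ω hω, abs_of_pos h5, enorm_smul, ENNReal.mul_rpow_of_nonneg _ _ (by norm_num), ← mul_assoc]
  gcongr
  rw [Real.enorm_of_nonneg (by positivity), ENNReal.ofReal_rpow_of_nonneg (by positivity) (by norm_num),
    ← ENNReal.ofReal_mul h5.le]
  refine ENNReal.ofReal_le_ofReal ?_
  rw [Real.rpow_two]
  calc 4 * Real.pi * ω * (4 * Real.pi * ω)⁻¹ ^ 2 = 1 / (4 * Real.pi * ω) := by field_simp
    _ ≤ _ := by gcongr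

theorem lintegral_enorm_chirp_sq_le {g : ℝ → ℂ} (hg : Integrable g) {c : ℝ} (hc : 0 < c)
    (hs : ∀ᵐ ω, g ω ≠ 0 → c ≤ |ω|) :
    ∫⁻ t : ℝ, ‖∫ ω, Complex.exp (-(Complex.I * (4 * Real.pi ^ 2 * t * ω ^ 2 : ℝ))) * g ω‖ₑ ^
      (2 : ℝ) ≤ ENNReal.ofReal (1 / c) * ∫⁻ ω, ‖g ω‖ₑ ^ (2 : ℝ) := by
  have hpi := Real.pi_gt_three
  have hgn : Integrable fun ω => g (-ω) := hg.comp_neg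
  have hs' : ∀ᵐ ω, g (-ω) ≠ 0 → c ≤ |-ω| :=
    (Measure.measurePreserving_neg (volume : Measure ℝ)).quasiMeasurePreserving.ae hs
  have hexp : ∀ t : ℝ, Continuous fun ω : ℝ => Complex.exp (-(Complex.I * (4 * Real.pi ^ 2 * t * ω ^ 2 : ℝ))) :=
    fun t => by fun_prop
  have hnorm : ∀ t ω : ℝ, ‖Complex.exp (-(Complex.I * (4 * Real.pi ^ 2 * t * ω ^ 2 : ℝ)))‖ = 1 := fun t ω => by
    have h : ∀ r : ℝ, -(Complex.I * (r : ℂ)) = ((-r : ℝ) : ℂ) * Complex.I := fun r => by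
      push_cast; ring
    rw [h, Complex.norm_exp_ofReal_mul_I]
  have hint : ∀ {h : ℝ → ℂ}, Integrable h → ∀ t : ℝ, Integrable fun ω =>
      Complex.exp (-(Complex.I * (4 * Real.pi ^ 2 * t * ω ^ 2 : ℝ))) * h ω := fun {h} hh t =>
    hh.bdd_mul (hexp t).aestronglyMeasurable (Filter.Eventually.of_forall fun ω => (hnorm t ω).le)
  -- the phase is even, so the two half-lines combine
  have hfold : ∀ t : ℝ, ∫ ω, Complex.exp (-(Complex.I * (4 * Real.pi ^ 2 * t * ω ^ 2 : ℝ))) * g ω =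
      ∫ ω in Set.Ioi 0, Complex.exp (-(Complex.I * (4 * Real.pi ^ 2 * t * ω ^ 2 : ℝ))) * (g ω + g (-ω)) := fun t => by
    rw [← intervalIntegral.integral_Iic_add_Ioi (b := 0) (hint hg t).integrableOn (hint hg t).integrableOn]
    have h1 := integral_comp_neg_Ioi 0 fun ω =>
      Complex.exp (-(Complex.I * (4 * Real.pi ^ 2 * t * ω ^ 2 : ℝ))) * g ω
    rw [neg_zero] at h1
    rw [← h1, ← integral_add (hint hg t |>.comp_neg).integrableOn (hint hg t).integrableOn]
    refine setIntegral_congr_fun measurableSet_Ioi fun ω _ => ?_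
    simp only [neg_sq]
    ring
  simp_rw [hfold]
  refine (lintegral_enorm_chirp_Ioi_sq_le (hg.add hgn).integrableOn hc ?_).trans ?_
  · filter_upwards [hs, hs'] with ω h1 h2 h3 h4
    by_cases h0 : g ω = 0
    · have := h2 (by intro h; exact h3 (by simp [h0, h]))
      rwa [abs_neg, abs_of_pos h4] at this
    · have := h1 h0
      rwa [abs_of_pos h4] at this
  have hsq : ∀ a b : ℂ, ‖a + b‖ₑ ^ (2 : ℝ) ≤ 2 * (‖a‖ₑ ^ (2 : ℝ) + ‖b‖ₑ ^ (2 : ℝ)) := fun a b => by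
    refine (ENNReal.rpow_le_rpow (enorm_add_le a b) (by norm_num)).trans ?_
    have := ENNReal.rpow_add_le_mul_rpow_add_rpow ‖a‖ₑ ‖b‖ₑ (p := 2) (by norm_num)
    norm_num at this
    simpa using this
  have hm : AEMeasurable (fun ω => ‖g (-ω)‖ₑ ^ (2 : ℝ)) := hgn.aestronglyMeasurable.enorm.pow_const _
  have hm' : AEMeasurable (fun ω => ‖g ω‖ₑ ^ (2 : ℝ)) := hg.aestronglyMeasurable.enorm.pow_const _
  calc _ ≤ ENNReal.ofReal (1 / (4 * Real.pi * c)) * (∫⁻ ω in Set.Ioi 0, 2 * (‖g ω‖ₑ ^ (2 : ℝ) + ‖g (-ω)‖ₑ ^ (2 : ℝ))) := by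
        gcongr with ω
        exact hsq _ _
    _ ≤ ENNReal.ofReal (1 / (4 * Real.pi * c)) * (4 * ∫⁻ ω, ‖g ω‖ₑ ^ (2 : ℝ)) := by
        gcongr
        rw [lintegral_const_mul' _ _ (by simp)]
        calc _ ≤ 2 * (∫⁻ ω, (‖g ω‖ₑ ^ (2 : ℝ) + ‖g (-ω)‖ₑ ^ (2 : ℝ))) := by
              gcongr
              exact Measure.restrict_le_self
          _ = 4 * ∫⁻ ω, ‖g ω‖ₑ ^ (2 : ℝ) := by
              rw [lintegral_add_left' hm', (Measure.measurePreserving_neg volume).lintegral_comp_emb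
                (MeasurableEquiv.neg ℝ).measurableEmbedding (fun ω => ‖g ω‖ₑ ^ (2 : ℝ))]
              ring
    _ ≤ _ := by
        rw [← mul_assoc]
        gcongr
        rw [← ENNReal.ofReal_ofNat, ← ENNReal.ofReal_mul (by positivity)]
        refine ENNReal.ofReal_le_ofReal ?_
        rw [div_mul_eq_mul_div, one_mul, div_le_div_iff₀ (by positivity) hc]
        nlinarith

variable {d : ℕ}

/-- Local smoothing along the lines `x₁ + t l`, for amplitudes supported where the speed `4π ζ·e`
stays away from `l`: Plancherel's identity in the variables across `e`, then the one-dimensional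
bound in `ζ·e`. -/
theorem lintegral_extension_lateral_sq_le {e : RSpace d} (he : ‖e‖ = 1) (l : ℝ) {g : RSpace d → ℂ}
    (hg : Integrable g) {c : ℝ} (hc : 0 < c)
    (hs : ∀ᵐ ζ, g ζ ≠ 0 → c ≤ |inner ℝ ζ e - l / (4 * Real.pi)|) (x₁ : ℝ) :
    ∫⁻ y : (Submodule.span ℝ {e})ᗮ × ℝ,
        ‖extension g (x₁ • e + (y.1 : RSpace d) + y.2 • l • e, y.2)‖ₑ ^ (2 : ℝ) ≤
      ENNReal.ofReal (1 / c) * ∫⁻ ζ, ‖g ζ‖ₑ ^ (2 : ℝ) := by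
  have hpi := Real.pi_pos
  have hmp := measurePreserving_lateralCoord e he
  set b : ℝ := l / (4 * Real.pi) with hb
  set G : ℝ × (Submodule.span ℝ {e})ᗮ → ℂ := fun y => g (lateralCoord e he y) with hG
  have hGint : Integrable G := (hmp.integrable_comp_emb (lateralCoord e he).measurableEmbedding).2 hg
  have hGs : ∀ᵐ ζ' : (Submodule.span ℝ {e})ᗮ, ∀ᵐ ζ₁ : ℝ, G (ζ₁, ζ') ≠ 0 → c ≤ |ζ₁ - b| := by
    have h1 : ∀ᵐ y : ℝ × (Submodule.span ℝ {e})ᗮ, G y ≠ 0 → c ≤ |y.1 - b| := by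
      filter_upwards [hmp.quasiMeasurePreserving.ae hs] with y hy h0
      have h2 := hy h0
      rw [lateralCoord_apply, inner_add_left, real_inner_smul_left, real_inner_self_eq_norm_sq, he,
        show inner ℝ (y.2 : RSpace d) e = 0 from Submodule.mem_orthogonal_singleton_iff_inner_left.1 y.2.2] at h2
      simpa using h2
    have h3 := (Measure.measurePreserving_swap (μ := (volume : Measure (Submodule.span ℝ {e})ᗮ))
      (ν := (volume : Measure ℝ))).quasiMeasurePreserving.ae h1
    exact Measure.ae_ae_of_ae_prod h3
  set ψ : ℝ → ℝ → ℂ := fun t ζ₁ => Complex.exp (Complex.I *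
    (2 * Real.pi * (x₁ + t * l) * ζ₁ - t * (4 * Real.pi ^ 2 * ζ₁ ^ 2) : ℝ)) with hψ
  have hψn : ∀ t ζ₁, ‖ψ t ζ₁‖ = 1 := fun t ζ₁ => by
    rw [hψ]
    simp only
    rw [mul_comm, Complex.norm_exp_ofReal_mul_I]
  have hψc : Continuous fun p : ℝ × ℝ => ψ p.1 p.2 := by
    rw [hψ]
    fun_prop
  set J : ℝ → (Submodule.span ℝ {e})ᗮ → ℂ := fun t ζ' => ∫ ζ₁, ψ t ζ₁ * G (ζ₁, ζ') with hJ
  have hFint : ∀ t, Integrable fun y : ℝ × (Submodule.span ℝ {e})ᗮ => ψ t y.1 * G y := fun t =>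
    hGint.bdd_mul (hψc.comp ((Continuous.prodMk_right t).comp continuous_fst)).aestronglyMeasurable
      (Filter.Eventually.of_forall fun y => (hψn t y.1).le)
  have hJint : ∀ t, Integrable (J t) := fun t => (hFint t).integral_prod_right
  -- separation of the phase along and across `e`
  have hext : ∀ t (x' : (Submodule.span ℝ {e})ᗮ),
      extension g (x₁ • e + (x' : RSpace d) + t • l • e, t) = extension (J t) (x', t) := fun t x' => by
    have h1 : ∀ y : ℝ × (Submodule.span ℝ {e})ᗮ,
        Complex.exp (Complex.I * wavePhase (x₁ • e + (x' : RSpace d) + t • l • e, t) (lateralCoord e he y)) *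
          G y = Complex.exp (Complex.I * wavePhase (x', t) y.2) * (ψ t y.1 * G y) := fun y => by
      rw [← mul_assoc, hψ, ← Complex.exp_add, ← mul_add, ← Complex.ofReal_add]
      congr 4
      have h2 : inner ℝ (x₁ • e + (x' : RSpace d) + t • l • e) (y.1 • e + (y.2 : RSpace d)) =
          (x₁ + t * l) * y.1 + inner ℝ x' y.2 := by
        have h3 : inner ℝ e (y.2 : RSpace d) = 0 :=
          (Submodule.mem_orthogonal_singleton_iff_inner_right.1 y.2.2)
        have h4 : inner ℝ (x' : RSpace d) e = 0 :=
          (Submodule.mem_orthogonal_singleton_iff_inner_left.1 x'.2)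
        have h5 : inner ℝ e e = 1 := by rw [real_inner_self_eq_norm_sq, he, one_pow]
        simp only [inner_add_left, inner_add_right, real_inner_smul_left, real_inner_smul_right, h3, h4, h5,
          Submodule.coe_inner]
        ring
      have h6 : ‖y.1 • e + (y.2 : RSpace d)‖ ^ 2 = y.1 ^ 2 + ‖y.2‖ ^ 2 := by
        rw [norm_add_sq_real, norm_smul, he, real_inner_smul_left,
          (Submodule.mem_orthogonal_singleton_iff_inner_right.1 y.2.2)]
        simp
      simp only [wavePhase, lateralCoord_apply, h2, h6]
      ring
    have h7 : Integrable fun y : (Submodule.span ℝ {e})ᗮ × ℝ =>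
        Complex.exp (Complex.I * wavePhase (x', t) y.1) * (ψ t y.2 * G (y.2, y.1)) := by
      have := (hFint t).swap
      refine this.bdd_mul (c := 1) ((continuous_exp_wavePhase_right (x', t)).comp
        continuous_fst).aestronglyMeasurable (Filter.Eventually.of_forall fun y => (norm_exp_wavePhase _ _).le)
    rw [extension, extension, ← hmp.integral_comp (lateralCoord e he).measurableEmbedding]
    rw [integral_congr_ae (Filter.Eventually.of_forall h1), Measure.volume_eq_prod, ← integral_prod_swap]
    refine (integral_prod _ h7).trans ?_
    refine integral_congr_ae (Filter.Eventually.of_forall fun ζ' => ?_)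
    simp only [hJ]
    rw [← integral_const_mul]
  have hxc : Continuous fun y : (Submodule.span ℝ {e})ᗮ × ℝ =>
      (x₁ • e + (y.1 : RSpace d) + y.2 • l • e, y.2) := by fun_prop
  rw [Measure.volume_eq_prod, lintegral_prod_symm _
    (show AEMeasurable (fun y : (Submodule.span ℝ {e})ᗮ × ℝ =>
        ‖extension g (x₁ • e + (y.1 : RSpace d) + y.2 • l • e, y.2)‖ₑ ^ (2 : ℝ)) _ from
      (((continuous_extension hg).comp hxc).enorm.measurable.pow_const _).aemeasurable)]
  calc _ ≤ ∫⁻ t, ∫⁻ ζ', ‖J t ζ'‖ₑ ^ (2 : ℝ) := by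
        refine lintegral_mono fun t => ?_
        simp only [hext, extension_eq_fourierInv]
        have h1 : ∀ ζ' : (Submodule.span ℝ {e})ᗮ,
            ‖Complex.exp (-(Complex.I * (t * (4 * Real.pi ^ 2 * ‖ζ'‖ ^ 2) : ℝ)))‖ = 1 := fun ζ' => by
          have h : ∀ r : ℝ, -(Complex.I * (r : ℂ)) = ((-r : ℝ) : ℂ) * Complex.I := fun r => by
            push_cast; ring
          rw [h, Complex.norm_exp_ofReal_mul_I]
        refine (lintegral_enorm_fourierInv_sq_le ((hJint t).bdd_mul (c := 1) ?_
          (Filter.Eventually.of_forall fun ζ' => (h1 ζ').le))).trans_eq ?_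
        · exact Continuous.aestronglyMeasurable (by fun_prop)
        · refine lintegral_congr fun ζ' => ?_
          rw [← ofReal_norm, norm_mul, h1, one_mul, ofReal_norm]
    _ = ∫⁻ ζ', ∫⁻ t, ‖J t ζ'‖ₑ ^ (2 : ℝ) := by
        refine lintegral_lintegral_swap (AEMeasurable.pow_const (AEStronglyMeasurable.enorm ?_) _)
        refine AEStronglyMeasurable.integral_prod_right' (f := fun q : (ℝ × (Submodule.span ℝ {e})ᗮ) × ℝ =>
          ψ q.1.1 q.2 * G (q.2, q.1.2)) ?_
        refine (hψc.comp ((continuous_fst.comp continuous_fst).prodMk continuous_snd)).aestronglyMeasurable.mul ?_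
        refine hGint.aestronglyMeasurable.comp_quasiMeasurePreserving (f := fun q : (ℝ × (Submodule.span ℝ {e})ᗮ) × ℝ =>
          (q.2, q.1.2)) ?_
        exact (Measure.measurePreserving_swap (μ := (volume : Measure (Submodule.span ℝ {e})ᗮ))
          (ν := (volume : Measure ℝ))).quasiMeasurePreserving.comp
          (MeasureTheory.QuasiMeasurePreserving.prodMap Measure.quasiMeasurePreserving_snd
            (Measure.QuasiMeasurePreserving.id _))
    _ ≤ ∫⁻ ζ', ENNReal.ofReal (1 / c) * ∫⁻ ζ₁, ‖G (ζ₁, ζ')‖ₑ ^ (2 : ℝ) := by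
        refine lintegral_mono_ae ?_
        filter_upwards [hGs, hGint.prod_left_ae] with ζ' h1 h2
        -- completing the square moves the stationary point to the origin
        have hshift : ∀ t, ‖J t ζ'‖ₑ = ‖∫ ω, Complex.exp (-(Complex.I * (4 * Real.pi ^ 2 * t * ω ^ 2 : ℝ))) *
            (Complex.exp (Complex.I * (2 * Real.pi * x₁ * (ω + b) : ℝ)) * G (ω + b, ζ'))‖ₑ := fun t => by
          have h3 : J t ζ' = Complex.exp ((4 * Real.pi ^ 2 * t * b ^ 2 : ℝ) * Complex.I) *
              ∫ ω, Complex.exp (-(Complex.I * (4 * Real.pi ^ 2 * t * ω ^ 2 : ℝ))) *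
            (Complex.exp (Complex.I * (2 * Real.pi * x₁ * (ω + b) : ℝ)) * G (ω + b, ζ')) := by
            rw [hJ, ← integral_const_mul]
            refine (integral_add_right_eq_self (fun ζ₁ => ψ t ζ₁ * G (ζ₁, ζ')) b).symm.trans ?_
            refine integral_congr_ae (Filter.Eventually.of_forall fun ω => ?_)
            simp only [hψ]
            rw [← mul_assoc (Complex.exp _) (Complex.exp _) (G _), ← Complex.exp_add,
              ← mul_assoc (Complex.exp _) (Complex.exp _) (G _), ← Complex.exp_add]
            congr 2
            have h4 : l = 4 * Real.pi * b := by rw [hb]; field_simp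
            rw [h4]
            push_cast
            ring
          rw [h3, ← ofReal_norm, norm_mul, Complex.norm_exp_ofReal_mul_I, one_mul, ofReal_norm]
        have hen : ∀ ω : ℝ, ‖Complex.exp (Complex.I * (2 * Real.pi * x₁ * (ω + b) : ℝ)) * G (ω + b, ζ')‖ₑ =
            ‖G (ω + b, ζ')‖ₑ := fun ω => by
          rw [← ofReal_norm, norm_mul, mul_comm Complex.I, Complex.norm_exp_ofReal_mul_I, one_mul, ofReal_norm]
        have hGb : Integrable fun ω => G (ω + b, ζ') := h2.comp_add_right b
        have hsb : ∀ᵐ ω : ℝ, G (ω + b, ζ') ≠ 0 → c ≤ |ω + b - b| :=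
          (measurePreserving_add_right (volume : Measure ℝ) b).quasiMeasurePreserving.ae h1
        simp_rw [hshift]
        refine (lintegral_enorm_chirp_sq_le (hGb.bdd_mul (c := 1) ?_ ?_) hc ?_).trans_eq ?_
        · exact Continuous.aestronglyMeasurable (by fun_prop)
        · refine Filter.Eventually.of_forall fun ω => ?_
          rw [mul_comm Complex.I, Complex.norm_exp_ofReal_mul_I]
        · filter_upwards [hsb] with ω h5 h6
          have := h5 (right_ne_zero_of_mul h6)
          rwa [add_sub_cancel_right] at this
        · simp_rw [hen]
          rw [lintegral_add_right_eq_self (fun ω => ‖G (ω, ζ')‖ₑ ^ (2 : ℝ)) b]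
    _ = ENNReal.ofReal (1 / c) * ∫⁻ ζ, ‖g ζ‖ₑ ^ (2 : ℝ) := by
        rw [lintegral_const_mul' _ _ ENNReal.ofReal_ne_top]
        congr 1
        rw [← hmp.lintegral_comp_emb (lateralCoord e he).measurableEmbedding, Measure.volume_eq_prod,
          lintegral_prod_symm (fun y => ‖g (lateralCoord e he y)‖ₑ ^ (2 : ℝ))
            (hGint.aestronglyMeasurable.enorm.pow_const _)]

/-- The local smoothing estimate. -/
theorem exists_galileanNorm_lpProjDir_le {η : ℝ → ℝ} (hη : IsBaseCutoff η) :
    ∃ C : ℝ, 0 < C ∧ ∀ (f : L2Space d) (k : ℤ) (e : RSpace d), ‖e‖ = 1 →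
      ∀ l : ℝ, |l| ≤ 2 ^ (k - 5) →
        galileanNorm ∞ 2 e l (freeEvolution (lpProjDir η k e f)) ≤
          ENNReal.ofReal (C * 2 ^ (-(k : ℝ) / 2) * ‖f‖) := by
  have hpi := Real.pi_pos
  have hpi3 := Real.pi_gt_three
  have hpi4 := Real.pi_lt_four
  refine ⟨4, by norm_num, fun f k e he l hl => ?_⟩
  set N : ℝ := 2 ^ k with hN
  have hN0 : 0 < N := by positivity
  have hl' : |l| ≤ N / 32 := by
    refine hl.trans_eq ?_
    rw [hN, zpow_sub₀ two_ne_zero]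
    norm_num
  obtain ⟨a, ha, hlim⟩ := exists_tendsto_freeEvolution (lpProjDir η k e f)
  refine galileanNorm_infty_two_le_of_tendsto he l
    (fun n => continuous_extension (integrable_gaussEnv_mul (ha n) _)) hlim fun n => ?_
  -- on the support `2π |ζ·e| ≥ 5N/8`, so the speed `4π ζ·e` is far from `|l| ≤ N / 32`
  have hsupp : ∀ᵐ ζ, gaussEnv (a n) ζ * (𝓕 (lpProjDir η k e f) : L2Space d) ζ ≠ 0 →
      N / 16 ≤ |inner ℝ ζ e - l / (4 * Real.pi)| := by
    filter_upwards [fourier_lpProjDir hη k e f] with ζ h1 h2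
    rw [h1] at h2
    have h3 := left_ne_zero_of_mul (right_ne_zero_of_mul h2)
    have h4 := (hη.abs_le_of_dyadicCutoff_ne_zero (by simpa using h3)).1
    rw [abs_mul, abs_of_pos (by positivity)] at h4
    have h5 : |l / (4 * Real.pi)| ≤ N / 32 / 12 := by
      rw [abs_div, abs_of_pos (show 0 < 4 * Real.pi by positivity)]
      gcongr
      linarith
    have h6 : N * (5 / 64) ≤ |inner ℝ ζ e| := by
      have := abs_nonneg (inner ℝ ζ e)
      nlinarith
    have h7 := abs_sub_abs_le_abs_sub (inner ℝ ζ e) (l / (4 * Real.pi))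
    linarith
  rw [galileanNorm, lateralNorm, eLpNorm_exponent_top]
  refine essSup_le_of_ae_le _ (Filter.Eventually.of_forall fun x₁ => ?_)
  simp only
  rw [enorm_eq_self, eLpNorm_eq_lintegral_rpow_enorm_toReal two_ne_zero ENNReal.ofNat_ne_top]
  simp only [enorm_galilean, ENNReal.toReal_ofNat]
  rw [one_div, ENNReal.rpow_inv_le_iff (by norm_num)]
  refine (lintegral_extension_lateral_sq_le he l (integrable_gaussEnv_mul (ha n) _) (by positivity) hsupp x₁).trans ?_
  have h8 : ∫⁻ ζ, ‖gaussEnv (a n) ζ * (𝓕 (lpProjDir η k e f) : L2Space d) ζ‖ₑ ^ (2 : ℝ) ≤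
      ENNReal.ofReal ‖f‖ ^ (2 : ℝ) := by
    have h9 : ‖(𝓕 (lpProjDir η k e f) : L2Space d)‖ₑ ≤ ENNReal.ofReal ‖f‖ := by
      rw [← ofReal_norm, Lp.norm_fourier_eq]
      exact ENNReal.ofReal_le_ofReal (norm_lpProjDir_le hη k e f)
    rw [Lp.enorm_def, eLpNorm_eq_lintegral_rpow_enorm_toReal two_ne_zero ENNReal.ofNat_ne_top, one_div,
      ENNReal.rpow_inv_le_iff (by norm_num)] at h9
    refine le_trans (lintegral_mono fun ζ => ?_) h9
    simp only [ENNReal.toReal_ofNat]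
    gcongr ?_ ^ _
    rw [← ofReal_norm, ← ofReal_norm, norm_mul]
    refine ENNReal.ofReal_le_ofReal (mul_le_of_le_one_left (norm_nonneg _) (norm_gaussEnv_le_one (ha n).le ζ))
  refine (mul_le_mul_right h8 _).trans_eq ?_
  rw [ENNReal.ofReal_mul (by positivity), ENNReal.mul_rpow_of_nonneg _ _ (by norm_num)]
  congr 1
  rw [ENNReal.ofReal_rpow_of_pos (by positivity)]
  congr 1
  rw [Real.mul_rpow (by norm_num) (by positivity), ← Real.rpow_mul (by norm_num), hN]
  rw [show -(k : ℝ) / 2 * 2 = -k by ring, Real.rpow_neg (by norm_num), Real.rpow_intCast]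
  norm_num
  field_simp

end LocalSmoothing

/-! ### Lateral Strichartz estimates with `q ≤ p` -/

section LateralInterpolation

variable {d : ℕ}

/-- The lateral norms with `1/p + 1/q = 1/2`, `4 ≤ p`, interpolate between `L^{∞,2}` and `L^4`. -/
theorem lateralNorm_le_mul_of_four_le {e : RSpace d} (he : ‖e‖ = 1) {p q : ℝ≥0∞} (hp : 2 < p) (hpt : p ≠ ∞)
    (hpq : 1 / p + 1 / q = 1 / 2) (hqp : q ≤ p) {u : RSpace d × ℝ → ℂ} (hu : Measurable u) {A B : ℝ≥0∞}
    (hA : lateralNorm ∞ 2 e u ≤ A) (hB : eLpNorm u 4 volume ≤ B) :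
    lateralNorm p q e u ≤ A ^ (1 - 4 / p.toReal) * B ^ (4 / p.toReal) := by
  obtain ⟨hqt, hP2, hQ0, hPQ⟩ := ENNReal.toReal_inv_add_inv hp hpt hpq
  have hqP : q.toReal ≤ p.toReal := ENNReal.toReal_mono hpt hqp
  have hq0 : q ≠ 0 := by rintro rfl; simp at hQ0
  set P := p.toReal with hP
  set Q := q.toReal with hQ
  have hP0 : 0 < P := by linarith
  have hQP : Q = 2 * P / (P - 2) := by
    have : P - 2 ≠ 0 := by linarith
    field_simp at hPQ ⊢
    linarith
  have hP2' : 0 < P - 2 := by linarith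
  have hP4 : 4 ≤ P := by
    rw [hQP, div_le_iff₀ hP2'] at hqP
    nlinarith
  set α : ℝ := (4 - Q) / 2 with hα
  have hQ4 : Q ≤ 4 := by
    rw [hQP, div_le_iff₀ hP2']
    linarith
  have hQ2 : 2 ≤ Q := by
    rw [hQP, le_div_iff₀ hP2']
    linarith
  have hα0 : 0 ≤ α := by rw [hα]; linarith
  have hα1 : 0 ≤ 1 - α := by rw [hα]; linarith
  have e1 : (1 - α) * (P / Q) = 1 := by
    rw [hα, hQP]; field_simp; ring_nf
  have e2 : α * (P / Q) = (P - 4) / 2 := by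
    rw [hα, hQP]; field_simp; ring_nf
  have hcont : ∀ x₁ : ℝ, Measurable fun y : (Submodule.span ℝ {e})ᗮ × ℝ =>
      u (x₁ • e + (y.1 : RSpace d), y.2) := fun x₁ => hu.comp (by fun_prop)
  rw [lateralNorm, eLpNorm_exponent_top] at hA
  have hA' : ∀ᵐ x₁ : ℝ, ∫⁻ y : (Submodule.span ℝ {e})ᗮ × ℝ,
      ‖u (x₁ • e + (y.1 : RSpace d), y.2)‖ₑ ^ (2 : ℝ) ≤ A ^ (2 : ℝ) := by
    filter_upwards [ae_le_eLpNormEssSup (f := fun x₁ : ℝ => eLpNorm (fun y : (Submodule.span ℝ {e})ᗮ × ℝ =>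
      u (x₁ • e + (y.1 : RSpace d), y.2)) 2 volume)] with x₁ hx
    have h := hx.trans hA
    rw [enorm_eq_self, eLpNorm_eq_lintegral_rpow_enorm_toReal two_ne_zero ENNReal.ofNat_ne_top, one_div,
      ENNReal.toReal_ofNat, ENNReal.rpow_inv_le_iff (by norm_num)] at h
    exact h
  have hB' : ∫⁻ z, ‖u z‖ₑ ^ (4 : ℝ) ≤ B ^ (4 : ℝ) := by
    rw [eLpNorm_eq_lintegral_rpow_enorm_toReal (by norm_num) ENNReal.ofNat_ne_top, one_div,
      ENNReal.toReal_ofNat, ENNReal.rpow_inv_le_iff (by norm_num)] at hB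
    exact hB
  rw [lateralNorm_eq_lintegral (zero_lt_two.trans hp).ne' hpt hq0 hqt, one_div, ENNReal.rpow_inv_le_iff hP0]
  -- Hölder's inequality on the slice; the relation between `p` and `q` makes the power of the `L^4`
  -- norm equal to four
  have hslice : ∀ᵐ x₁ : ℝ, (∫⁻ y : (Submodule.span ℝ {e})ᗮ × ℝ,
      ‖u (x₁ • e + (y.1 : RSpace d), y.2)‖ₑ ^ Q) ^ (P / Q) ≤ A ^ (P - 4) *
      ∫⁻ y : (Submodule.span ℝ {e})ᗮ × ℝ, ‖u (x₁ • e + (y.1 : RSpace d), y.2)‖ₑ ^ (4 : ℝ) := by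
    filter_upwards [hA'] with x₁ hx
    have h1 : ∫⁻ y : (Submodule.span ℝ {e})ᗮ × ℝ, ‖u (x₁ • e + (y.1 : RSpace d), y.2)‖ₑ ^ Q ≤
        (∫⁻ y : (Submodule.span ℝ {e})ᗮ × ℝ, ‖u (x₁ • e + (y.1 : RSpace d), y.2)‖ₑ ^ (2 : ℝ)) ^ α *
        (∫⁻ y : (Submodule.span ℝ {e})ᗮ × ℝ, ‖u (x₁ • e + (y.1 : RSpace d), y.2)‖ₑ ^ (4 : ℝ)) ^ (1 - α) := by
      refine le_trans (le_of_eq ?_) (ENNReal.lintegral_mul_norm_pow_le ((hcont x₁).enorm.pow_const _).aemeasurable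
        ((hcont x₁).enorm.pow_const _).aemeasurable hα0 hα1 (by ring))
      refine lintegral_congr fun y => ?_
      rw [← ENNReal.rpow_mul, ← ENNReal.rpow_mul, ← ENNReal.rpow_add_of_nonneg _ _ (by positivity) (by positivity)]
      congr 1
      rw [hα]; ring
    calc _ ≤ (_ : ℝ≥0∞) ^ (P / Q) := ENNReal.rpow_le_rpow h1 (by positivity)
      _ ≤ ((A ^ (2 : ℝ)) ^ α * (∫⁻ y : (Submodule.span ℝ {e})ᗮ × ℝ,
          ‖u (x₁ • e + (y.1 : RSpace d), y.2)‖ₑ ^ (4 : ℝ)) ^ (1 - α)) ^ (P / Q) := by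
          gcongr
      _ = A ^ (P - 4) * ∫⁻ y : (Submodule.span ℝ {e})ᗮ × ℝ,
          ‖u (x₁ • e + (y.1 : RSpace d), y.2)‖ₑ ^ (4 : ℝ) := by
          rw [ENNReal.mul_rpow_of_nonneg _ _ (by positivity), ← ENNReal.rpow_mul, ← ENNReal.rpow_mul,
            ← ENNReal.rpow_mul, e2, e1, ENNReal.rpow_one]
          rw [mul_div_cancel₀ (P - 4) two_ne_zero]
  calc _ ≤ ∫⁻ x₁ : ℝ, A ^ (P - 4) *
      ∫⁻ y : (Submodule.span ℝ {e})ᗮ × ℝ, ‖u (x₁ • e + (y.1 : RSpace d), y.2)‖ₑ ^ (4 : ℝ) :=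
        lintegral_mono_ae hslice
    _ = A ^ (P - 4) * ∫⁻ z, ‖u z‖ₑ ^ (4 : ℝ) := by
        rw [lintegral_const_mul'', lintegral_lateral he (hu.enorm.pow_const _).aemeasurable]
        have hm : Measurable fun q : ℝ × ((Submodule.span ℝ {e})ᗮ × ℝ) =>
            ‖u (q.1 • e + (q.2.1 : RSpace d), q.2.2)‖ₑ ^ (4 : ℝ) := (hu.comp (by fun_prop)).enorm.pow_const _
        exact hm.lintegral_prod_right'.aemeasurable
    _ ≤ A ^ (P - 4) * B ^ (4 : ℝ) := by gcongr
    _ = _ := by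
        rw [ENNReal.mul_rpow_of_nonneg _ _ hP0.le, ← ENNReal.rpow_mul, ← ENNReal.rpow_mul]
        congr 2 <;> field_simp

/-- The lateral Strichartz estimates for `q ≤ p`, uniformly in the exponents. -/
theorem exists_lateralNorm_lpProjDir_le {η : ℝ → ℝ} (hη : IsBaseCutoff η) :
    ∃ C : ℝ, 0 < C ∧ ∀ p q : ℝ≥0∞, 2 < p → 2 ≤ q → 1 / p + 1 / q = 1 / 2 → q ≤ p →
      ∀ (f : L2Space 2) (k : ℤ) (e : RSpace 2), ‖e‖ = 1 →
        lateralNorm p q e (freeEvolution (lpProjDir η k e f)) ≤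
          ENNReal.ofReal (C * 2 ^ ((k : ℝ) * ((2 / p).toReal - 1 / 2)) * ‖f‖) := by
  obtain ⟨C₁, hC₁, h₁⟩ := exists_galileanNorm_lpProjDir_le (d := 2) hη
  obtain ⟨C₂, hC₂, h₂⟩ := exists_eLpNorm_freeEvolution_le (d := 2) (by norm_num)
  rw [strichartzExponent_two] at h₂
  set C : ℝ := C₁ + C₂.toReal with hC
  have hC0 : 0 < C := by positivity
  refine ⟨C, hC0, fun p q hp hq hpq hqp f k e he => ?_⟩
  have hA : lateralNorm ∞ 2 e (freeEvolution (lpProjDir η k e f)) ≤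
      ENNReal.ofReal (C * 2 ^ (-(k : ℝ) / 2) * ‖f‖) := by
    have := h₁ f k e he 0 (by simp; positivity)
    rw [galileanNorm, zero_smul, galilean_zero] at this
    refine this.trans (ENNReal.ofReal_le_ofReal ?_)
    gcongr
    rw [hC]
    exact le_add_of_nonneg_right ENNReal.toReal_nonneg
  rcases eq_or_ne p ∞ with rfl | hpt
  · have hq2 : q = 2 := by simpa using hpq
    subst hq2
    refine hA.trans_eq ?_
    congr 3
    rw [ENNReal.div_top, ENNReal.toReal_zero]
    ring_nf
  have hB : eLpNorm (freeEvolution (lpProjDir η k e f)) 4 volume ≤ ENNReal.ofReal (C * ‖f‖) := by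
    refine (h₂ _).trans ?_
    rw [ENNReal.ofReal_mul hC0.le, ← ofReal_norm]
    gcongr
    · rw [← ENNReal.ofReal_toReal hC₂]
      exact ENNReal.ofReal_le_ofReal (by rw [hC]; linarith)
    · exact norm_lpProjDir_le hη k e f
  refine (lateralNorm_le_mul_of_four_le he hp hpt hpq hqp (freeEvolution_spec _).1 hA hB).trans_eq ?_
  have hP0 : 0 < p.toReal := ENNReal.toReal_pos (zero_lt_two.trans hp).ne' hpt
  have hP4 : 4 / p.toReal ≤ 1 := by
    obtain ⟨-, hP2, hQ0, hPQ⟩ := ENNReal.toReal_inv_add_inv hp hpt hpq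
    have hqP : q.toReal ≤ p.toReal := ENNReal.toReal_mono hpt hqp
    have : 1 / p.toReal ≤ 1 / q.toReal := one_div_le_one_div_of_le hQ0 hqP
    rw [show (4 : ℝ) / p.toReal = 4 * (1 / p.toReal) by ring]
    linarith
  rw [ENNReal.toReal_div, ENNReal.toReal_ofNat]
  set θ := 4 / p.toReal with hθ
  have hθ0 : 0 < θ := by positivity
  rw [ENNReal.ofReal_rpow_of_nonneg (by positivity) (by linarith),
    ENNReal.ofReal_rpow_of_nonneg (by positivity) hθ0.le, ← ENNReal.ofReal_mul (by positivity)]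
  congr 1
  rw [show C * 2 ^ (-(k : ℝ) / 2) * ‖f‖ = 2 ^ (-(k : ℝ) / 2) * (C * ‖f‖) by ring,
    Real.mul_rpow (by positivity) (by positivity), mul_assoc, ← Real.rpow_add_of_nonneg (by positivity)
    (by linarith) hθ0.le, sub_add_cancel, Real.rpow_one, ← Real.rpow_mul (by norm_num),
    show -(k : ℝ) / 2 * (1 - θ) = (k : ℝ) * (2 / p.toReal - 1 / 2) by rw [hθ]; ring]
  ring

end LateralInterpolation

/-! ### Oscillatory integrals -/

section Oscillatory

/-- Two integrations by parts against the phase `p r - q r²`, away from its stationary point: here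
`F` is an explicit primitive of the integrand up to the term `E b`, which is of second order in
`1/c`. -/
theorem norm_integral_oscillatory_le {a a' a'' : ℝ → ℂ} (ha : ∀ r, HasDerivAt a (a' r) r)
    (ha' : ∀ r, HasDerivAt a' (a'' r) r) (hac : Continuous a'') {R M L c p q : ℝ} (hR : 0 ≤ R)
    (hc : 0 < c)
    (h0 : a R = 0 ∧ a (-R) = 0 ∧ a' R = 0 ∧ a' (-R) = 0)
    (hM : ∀ r, ‖a r‖ ≤ M ∧ ‖a' r‖ ≤ M ∧ ‖a'' r‖ ≤ M)
    (hp : ∀ r ∈ Set.Icc (-R) R, c ≤ |p - 2 * q * r|) (hq : 2 * |q| ≤ L * c) :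
    ‖∫ r in -R..R, Complex.exp (Complex.I * (p * r - q * r ^ 2 : ℝ)) * a r‖ ≤
      2 * R * (M * (1 + 3 * L + 3 * L ^ 2)) / c ^ 2 := by
  have hM0 : 0 ≤ M := (norm_nonneg _).trans (hM 0).1
  set D : ℝ → ℂ := fun r => ((p - 2 * q * r : ℝ) : ℂ) with hD
  set E : ℝ → ℂ := fun r => Complex.exp (Complex.I * (p * r - q * r ^ 2 : ℝ)) with hE
  set b : ℝ → ℂ := fun r => a'' r / D r ^ 2 + 6 * q * a' r / D r ^ 3 + 12 * q ^ 2 * a r / D r ^ 4 with hb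
  set F : ℝ → ℂ := fun r => E r * (-Complex.I * (a r / D r) + (a' r / D r ^ 2 + 2 * q * a r / D r ^ 3)) with hF
  have huIcc : Set.uIcc (-R) R = Set.Icc (-R) R := Set.uIcc_of_le (by linarith)
  have hDn : ∀ r ∈ Set.Icc (-R) R, c ≤ ‖D r‖ := fun r hr => by
    rw [hD]
    simp only
    rw [Complex.norm_real]
    exact hp r hr
  have hD0 : ∀ r ∈ Set.Icc (-R) R, D r ≠ 0 := fun r hr h => by
    have := hDn r hr
    rw [h, norm_zero] at this
    linarith
  have hDd : ∀ r, HasDerivAt D (-2 * q : ℂ) r := fun r => by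
    have h1 : HasDerivAt (fun r : ℝ => p - 2 * q * r) (-(2 * q)) r := by
      have := ((hasDerivAt_id r).const_mul (2 * q)).const_sub p
      refine this.congr_deriv (by ring)
    refine h1.ofReal_comp.congr_deriv ?_
    push_cast; ring
  have hEd : ∀ r, HasDerivAt E (E r * (Complex.I * D r)) r := fun r => by
    have h1 : HasDerivAt (fun r : ℝ => p * r - q * r ^ 2) (p - 2 * q * r) r := by
      have := ((hasDerivAt_id r).const_mul p).sub ((hasDerivAt_pow 2 r).const_mul q)
      refine this.congr_deriv ?_
      push_cast; ring
    exact (h1.ofReal_comp.const_mul Complex.I).cexp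
  have hFd : ∀ r ∈ Set.uIcc (-R) R, HasDerivAt F (E r * a r + E r * b r) r := fun r hr => by
    rw [huIcc] at hr
    have hd := hD0 r hr
    have h1 := (ha r).div (hDd r) hd
    have h2 := (ha' r).div ((hDd r).pow 2) (pow_ne_zero 2 hd)
    have h3 := ((ha r).const_mul (2 * q : ℂ)).div ((hDd r).pow 3) (pow_ne_zero 3 hd)
    refine ((hEd r).mul ((h1.const_mul (-Complex.I)).add (h2.add h3))).congr_deriv ?_
    rw [hb]
    simp only [Pi.pow_apply, Pi.add_apply, Pi.div_apply]
    field_simp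
    push_cast
    ring_nf
    rw [Complex.I_sq]
    ring
  have hDc : Continuous D := by rw [hD]; fun_prop
  have hEc : Continuous E := by rw [hE]; fun_prop
  have hac0 : Continuous a := continuous_iff_continuousAt.2 fun r => (ha r).continuousAt
  have hac1 : Continuous a' := continuous_iff_continuousAt.2 fun r => (ha' r).continuousAt
  have hbc : ContinuousOn b (Set.Icc (-R) R) := by
    refine ContinuousOn.add (ContinuousOn.add ?_ ?_) ?_
    · exact hac.continuousOn.div (hDc.pow 2).continuousOn fun r hr => pow_ne_zero _ (hD0 r hr)
    · exact (continuous_const.mul hac1).continuousOn.div (hDc.pow 3).continuousOn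
        fun r hr => pow_ne_zero _ (hD0 r hr)
    · exact (continuous_const.mul hac0).continuousOn.div (hDc.pow 4).continuousOn
        fun r hr => pow_ne_zero _ (hD0 r hr)
  have hi1 : IntervalIntegrable (fun r => E r * a r) volume (-R) R :=
    (hEc.mul hac0).intervalIntegrable _ _
  have hi2 : IntervalIntegrable (fun r => E r * b r) volume (-R) R := by
    refine ContinuousOn.intervalIntegrable ?_
    rw [huIcc]
    exact hEc.continuousOn.mul hbc
  have hftc := intervalIntegral.integral_eq_sub_of_hasDerivAt hFd (hi1.add hi2)
  obtain ⟨hz1, hz2, hz3, hz4⟩ := h0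
  rw [intervalIntegral.integral_add hi1 hi2, show F R = 0 by simp [hF, hz1, hz3],
    show F (-R) = 0 by simp [hF, hz2, hz4], sub_zero] at hftc
  rw [eq_neg_of_add_eq_zero_left hftc, norm_neg]
  have hbn : ∀ r ∈ Set.Icc (-R) R, ‖b r‖ ≤ M * (1 + 3 * L + 3 * L ^ 2) / c ^ 2 := fun r hr => by
    obtain ⟨hm0, hm1, hm2⟩ := hM r
    have hd := hDn r hr
    have hqL : |q| / c ≤ L / 2 := by rw [div_le_iff₀ hc]; linarith
    have t1 : ‖a'' r / D r ^ 2‖ ≤ M / c ^ 2 := by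
      rw [norm_div, norm_pow]
      gcongr
    have t2 : ‖6 * q * a' r / D r ^ 3‖ ≤ M * (3 * L) / c ^ 2 := by
      rw [norm_div, norm_pow, norm_mul, norm_mul, Complex.norm_real, Real.norm_eq_abs]
      calc ‖(6 : ℂ)‖ * |q| * ‖a' r‖ / ‖D r‖ ^ 3 ≤ 6 * |q| * M / c ^ 3 := by
            rw [show ‖(6 : ℂ)‖ = 6 by simp]
            gcongr
        _ = M * (6 * (|q| / c)) / c ^ 2 := by field_simp
        _ ≤ M * (3 * L) / c ^ 2 := by
            have h6 : 6 * (|q| / c) ≤ 3 * L := by linarith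
            gcongr
    have t3 : ‖12 * (q : ℂ) ^ 2 * a r / D r ^ 4‖ ≤ M * (3 * L ^ 2) / c ^ 2 := by
      rw [norm_div, norm_pow, norm_mul, norm_mul, norm_pow, Complex.norm_real, Real.norm_eq_abs]
      calc ‖(12 : ℂ)‖ * |q| ^ 2 * ‖a r‖ / ‖D r‖ ^ 4 ≤ 12 * |q| ^ 2 * M / c ^ 4 := by
            rw [show ‖(12 : ℂ)‖ = 12 by simp]
            gcongr
        _ = M * (12 * (|q| / c) ^ 2) / c ^ 2 := by field_simp
        _ ≤ M * (12 * (L / 2) ^ 2) / c ^ 2 := by gcongr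
        _ = M * (3 * L ^ 2) / c ^ 2 := by ring
    calc ‖b r‖ ≤ M / c ^ 2 + M * (3 * L) / c ^ 2 + M * (3 * L ^ 2) / c ^ 2 :=
          (norm_add₃_le).trans (add_le_add_three t1 t2 t3)
      _ = _ := by ring
  refine (intervalIntegral.norm_integral_le_of_norm_le_const
    (C := M * (1 + 3 * L + 3 * L ^ 2) / c ^ 2) fun r hr => ?_).trans_eq ?_
  · rw [Set.uIoc_of_le (by linarith)] at hr
    rw [norm_mul, hE]
    simp only
    rw [mul_comm Complex.I, Complex.norm_exp_ofReal_mul_I, one_mul]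
    exact hbn r ⟨hr.1.le, hr.2⟩
  · rw [abs_of_nonneg (by linarith)]
    ring

end Oscillatory

/-! ### Decay of waves localized in one direction -/

section LateralEnvelope

variable {d : ℕ}

/-- Multiplying the amplitude by a function of `ζ·e` with integrable Fourier transform keeps a
dispersive bound. -/
theorem norm_extension_fourierInv_mul_le {ψ : ℝ → ℂ} (hψ : Integrable ψ) {g : RSpace d → ℂ}
    (hg : Integrable g) (e x : RSpace d) (t : ℝ) {B : ℝ} (hB : ∀ x, ‖extension g (x, t)‖ ≤ B) :
    ‖extension (fun ζ => 𝓕⁻ ψ (inner ℝ ζ e) * g ζ) (x, t)‖ ≤ (∫ y, ‖ψ y‖) * B := by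
  have hswap : extension (fun ζ => 𝓕⁻ ψ (inner ℝ ζ e) * g ζ) (x, t) =
      ∫ y : ℝ, ψ y * extension g (x + y • e, t) := by
    have h1 : ∀ ζ y, Complex.exp (Complex.I * wavePhase (x, t) ζ) *
        ((Complex.exp ((2 * Real.pi * inner ℝ y (inner ℝ ζ e : ℝ) : ℝ) * Complex.I) • ψ y) * g ζ) =
        ψ y * (Complex.exp (Complex.I * wavePhase (x + y • e, t) ζ) * g ζ) := fun ζ y => by
      rw [smul_eq_mul, mul_assoc, ← mul_assoc, ← Complex.exp_add, mul_left_comm]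
      congr 3
      simp only [wavePhase, inner_add_left, real_inner_smul_left, RCLike.inner_apply, conj_trivial,
        real_inner_comm ζ e]
      push_cast
      ring
    have hint : Integrable (fun w : RSpace d × ℝ =>
        ψ w.2 * (Complex.exp (Complex.I * wavePhase (x + w.2 • e, t) w.1) * g w.1))
        ((volume : Measure (RSpace d)).prod volume) := by
      have h2 : Integrable (fun w : RSpace d × ℝ => g w.1 * ψ w.2)
        ((volume : Measure (RSpace d)).prod volume) := hg.mul_prod hψ
      refine h2.mono ?_ (Filter.Eventually.of_forall fun w => ?_)
      · have hc : Continuous fun w : RSpace d × ℝ => Complex.exp (Complex.I * wavePhase (x + w.2 • e, t) w.1) :=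
          continuous_exp_wavePhase.comp (f := fun w : RSpace d × ℝ => ((x + w.2 • e, t), w.1)) (by fun_prop)
        exact (hψ.aestronglyMeasurable.comp_snd).mul (hc.aestronglyMeasurable.mul hg.aestronglyMeasurable.comp_fst)
      · rw [norm_mul, enorm_exp_wavePhase_mul, norm_mul, mul_comm]
    rw [extension]
    calc _ = ∫ ζ, ∫ y : ℝ, ψ y * (Complex.exp (Complex.I * wavePhase (x + y • e, t) ζ) * g ζ) := by
          refine integral_congr_ae (Filter.Eventually.of_forall fun ζ => ?_)
          simp only
          rw [Real.fourierInv_eq', ← integral_mul_const, ← integral_const_mul]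
          exact integral_congr_ae (Filter.Eventually.of_forall fun y => h1 ζ y)
      _ = ∫ y : ℝ, ∫ ζ, ψ y * (Complex.exp (Complex.I * wavePhase (x + y • e, t) ζ) * g ζ) :=
          integral_integral_swap hint
      _ = _ := by
          refine integral_congr_ae (Filter.Eventually.of_forall fun y => ?_)
          simp only
          rw [integral_const_mul, extension]
  rw [hswap, ← integral_mul_const]
  refine norm_integral_le_of_norm_le (hψ.norm.mul_const _) (Filter.Eventually.of_forall fun y => ?_)
  rw [norm_mul]
  gcongr
  exact hB _

/-- A superposition whose amplitude is a product in the coordinates along and across `e` factors. -/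
theorem extension_mul_lateral {e : RSpace d} (he : ‖e‖ = 1) {α : ℝ → ℂ} {γ : (Submodule.span ℝ {e})ᗮ → ℂ}
    {A : RSpace d → ℂ} (hA : ∀ (r : ℝ) (ζ' : (Submodule.span ℝ {e})ᗮ), A (r • e + (ζ' : RSpace d)) = α r * γ ζ')
    (x₁ : ℝ) (x' : (Submodule.span ℝ {e})ᗮ) (t : ℝ) :
    extension A (x₁ • e + (x' : RSpace d), t) =
      (∫ r, Complex.exp (Complex.I * (2 * Real.pi * x₁ * r - 4 * Real.pi ^ 2 * t * r ^ 2 : ℝ)) * α r) *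
        extension γ (x', t) := by
  have hmp := measurePreserving_lateralCoord e he
  rw [extension, extension, ← hmp.integral_comp (lateralCoord e he).measurableEmbedding, ← integral_prod_mul,
    Measure.volume_eq_prod]
  refine integral_congr_ae (Filter.Eventually.of_forall fun y => ?_)
  simp only
  rw [lateralCoord_apply, hA, mul_mul_mul_comm, ← Complex.exp_add, ← mul_add, ← Complex.ofReal_add]
  congr 4
  have h3 : inner ℝ e (y.2 : RSpace d) = 0 := Submodule.mem_orthogonal_singleton_iff_inner_right.1 y.2.2
  have h4 : inner ℝ (x' : RSpace d) e = 0 := Submodule.mem_orthogonal_singleton_iff_inner_left.1 x'.2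
  have h5 : inner ℝ e e = 1 := by rw [real_inner_self_eq_norm_sq, he, one_pow]
  have h2 : inner ℝ (x₁ • e + (x' : RSpace d)) (y.1 • e + (y.2 : RSpace d)) = x₁ * y.1 + inner ℝ x' y.2 := by
    simp only [inner_add_left, inner_add_right, real_inner_smul_left, real_inner_smul_right, h3, h4, h5,
      Submodule.coe_inner]
    ring
  have h6 : ‖y.1 • e + (y.2 : RSpace d)‖ ^ 2 = y.1 ^ 2 + ‖y.2‖ ^ 2 := by
    rw [norm_add_sq_real, norm_smul, he, real_inner_smul_left, h3]
    simp
  simp only [wavePhase, h2, h6]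
  ring

/-- Bounds, at unit frequency, for the waves localized to a bounded range of `ζ·e`: dispersion, and
rapid decay beyond the region reached at the largest speed. -/
theorem exists_norm_extension_lateral_le {η : ℝ → ℝ} (hη : IsBaseCutoff η) :
    ∃ C : ℝ, 0 < C ∧ ∀ (e : RSpace 2), ‖e‖ = 1 → ∀ (x : RSpace 2) (t : ℝ),
      ‖extension (fun ζ => ((η (Real.pi * inner ℝ ζ e) ^ 2 : ℝ) : ℂ) * gaussEnv 2 ζ) (x, t)‖ ≤ C / (1 + |t|) ∧
      (16 * |t| ≤ |inner ℝ x e| →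
        ‖extension (fun ζ => ((η (Real.pi * inner ℝ ζ e) ^ 2 : ℝ) : ℂ) * gaussEnv 2 ζ) (x, t)‖ ≤
          C / (1 + (inner ℝ x e : ℝ) ^ 2)) := by
  have hpi := Real.pi_pos
  have hpi3 := Real.pi_gt_three
  have hpi4 := Real.pi_lt_four
  -- the cutoff in `ζ·e` as an inverse Fourier transform
  set m : ℝ → ℂ := fun r => ((η (Real.pi * r) ^ 2 : ℝ) : ℂ) with hm
  have hmd : ContDiff ℝ ((⊤ : ℕ∞) : WithTop ℕ∞) m :=
    Complex.ofRealCLM.contDiff.comp ((hη.smooth.comp (contDiff_const.mul contDiff_id)).pow 2)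
  have hm0 : ∀ r : ℝ, 1.7 / Real.pi ≤ |r| → m r = 0 := fun r hr => by
    have h1 : 8 / 5 < |Real.pi * r| := by
      rw [abs_mul, abs_of_pos hpi]
      rw [div_le_iff₀ hpi] at hr
      linarith
    simp [hm, hη.support _ h1]
  have hms : HasCompactSupport m := by
    refine HasCompactSupport.of_support_subset_isCompact (isCompact_Icc (a := -(1.7 / Real.pi)) (b := 1.7 / Real.pi)) ?_
    intro r hr
    by_contra h
    refine hr (hm0 r ?_)
    by_contra! h2
    exact h ⟨(abs_lt.1 h2).1.le, (abs_lt.1 h2).2.le⟩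
  set S : SchwartzMap ℝ ℂ := hms.toSchwartzMap hmd with hS
  have hSm : (S : ℝ → ℂ) = m := rfl
  have hψ : Integrable (𝓕 m) := by
    rw [← hSm, ← SchwartzMap.fourier_coe]
    exact (𝓕 S).integrable
  have hinv : 𝓕⁻ (𝓕 m) = m := by
    have hmi : Integrable m := by rw [← hSm]; exact S.integrable
    exact hmd.continuous.fourierInv_fourier_eq hmi hψ
  set C₀ : ℝ := ∫ y, ‖𝓕 m y‖ with hC₀
  have hC₀0 : 0 ≤ C₀ := integral_nonneg fun y => norm_nonneg _
  -- the one-dimensional amplitude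
  set α : ℝ → ℂ := fun r => m r * ((Real.exp (-(8 * Real.pi ^ 2 * r ^ 2)) : ℝ) : ℂ) with hα
  have hαd : ContDiff ℝ ((⊤ : ℕ∞) : WithTop ℕ∞) α := by
    refine hmd.mul (Complex.ofRealCLM.contDiff.comp (Real.contDiff_exp.comp ?_))
    fun_prop
  have hα0 : ∀ r : ℝ, 1.7 / Real.pi ≤ |r| → α r = 0 := fun r hr => by simp [hα, hm0 r hr]
  have hαs : HasCompactSupport α := hms.mul_right
  have hα1d : ContDiff ℝ ((⊤ : ℕ∞) : WithTop ℕ∞) (deriv α) := (contDiff_infty_iff_deriv.1 hαd).2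
  have hα2c : Continuous (deriv (deriv α)) := ((contDiff_infty_iff_deriv.1 hα1d).2).continuous
  have hder : ∀ r, HasDerivAt α (deriv α r) r := fun r =>
    ((contDiff_infty_iff_deriv.1 hαd).1 r).hasDerivAt
  have hder' : ∀ r, HasDerivAt (deriv α) (deriv (deriv α) r) r := fun r =>
    ((contDiff_infty_iff_deriv.1 hα1d).1 r).hasDerivAt
  obtain ⟨M₀, hM₀⟩ := hαd.continuous.bounded_above_of_compact_support hαs
  obtain ⟨M₁, hM₁⟩ := hα1d.continuous.bounded_above_of_compact_support hαs.deriv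
  obtain ⟨M₂, hM₂⟩ := hα2c.bounded_above_of_compact_support hαs.deriv.deriv
  set M := max M₀ (max M₁ M₂) with hM
  have hMb : ∀ r, ‖α r‖ ≤ M ∧ ‖deriv α r‖ ≤ M ∧ ‖deriv (deriv α) r‖ ≤ M := fun r =>
    ⟨(hM₀ r).trans (le_max_left _ _), (hM₁ r).trans ((le_max_left _ _).trans (le_max_right _ _)),
      (hM₂ r).trans ((le_max_right _ _).trans (le_max_right _ _))⟩
  have hMnn : 0 ≤ M := (norm_nonneg _).trans (hMb 0).1
  have hαR : ∀ r : ℝ, |r| = 2 / Real.pi → α r = 0 ∧ deriv α r = 0 := fun r hr => by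
    have hlt : 1.7 / Real.pi < |r| := by
      rw [hr]
      gcongr
      norm_num
    refine ⟨hα0 r hlt.le, ?_⟩
    have hev : α =ᶠ[nhds r] fun _ => 0 := by
      filter_upwards [continuous_abs.continuousAt.eventually (lt_mem_nhds hlt)] with s hs
      exact hα0 s hs.le
    rw [hev.deriv_eq, deriv_const]
  -- on the support `|r| ≤ 2/π`, the phase has no stationary point if `16 |t| ≤ |x₁|`
  have hint1 : ∀ (x₁ t : ℝ), 16 * |t| ≤ |x₁| → x₁ ≠ 0 →
      ‖∫ r, Complex.exp (Complex.I * (2 * Real.pi * x₁ * r - 4 * Real.pi ^ 2 * t * r ^ 2 : ℝ)) * α r‖ ≤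
        38 * M / x₁ ^ 2 := fun x₁ t ht hx0 => by
    have hx : 0 < |x₁| := abs_pos.2 hx0
    have hsub : (Function.support fun r : ℝ =>
        Complex.exp (Complex.I * (2 * Real.pi * x₁ * r - 4 * Real.pi ^ 2 * t * r ^ 2 : ℝ)) * α r) ⊆
        Set.Ioc (-(2 / Real.pi)) (2 / Real.pi) := fun r hr => by
      have h1 : α r ≠ 0 := right_ne_zero_of_mul hr
      have h2 : |r| < 1.7 / Real.pi := by
        by_contra! h
        exact h1 (hα0 r h)
      have h3 : 1.7 / Real.pi < 2 / Real.pi := by gcongr; norm_num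
      rw [abs_lt] at h2
      constructor <;> linarith
    rw [← intervalIntegral.integral_eq_integral_of_support_subset hsub]
    have hRpi : 2 / Real.pi ≤ 1 := by rw [div_le_one hpi]; linarith
    refine (norm_integral_oscillatory_le hder hder' hα2c (R := 2 / Real.pi) (M := M) (L := 2)
      (c := Real.pi * |x₁|) (by positivity) (by positivity) ?_ hMb ?_ ?_).trans ?_
    · have h1 := hαR (2 / Real.pi) (abs_of_pos (by positivity))
      have h2 := hαR (-(2 / Real.pi)) (by rw [abs_neg, abs_of_pos (by positivity)])
      exact ⟨h1.1, h2.1, h1.2, h2.2⟩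
    · intro r hr
      have hr' : |r| ≤ 2 / Real.pi := abs_le.2 hr
      have h1 : |2 * (4 * Real.pi ^ 2 * t) * r| ≤ Real.pi * |x₁| := by
        rw [abs_mul, abs_mul, abs_mul, abs_of_pos (show (0 : ℝ) < 2 by norm_num),
          abs_of_pos (show 0 < 4 * Real.pi ^ 2 by positivity)]
        calc 2 * (4 * Real.pi ^ 2 * |t|) * |r| ≤ 2 * (4 * Real.pi ^ 2 * |t|) * (2 / Real.pi) := by gcongr
          _ = Real.pi * (16 * |t|) := by field_simp; ring
          _ ≤ _ := by gcongr
      have h2 : |2 * Real.pi * x₁| = 2 * Real.pi * |x₁| := by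
        rw [abs_mul, abs_of_pos (show 0 < 2 * Real.pi by positivity)]
      have h3 := abs_sub_abs_le_abs_sub (2 * Real.pi * x₁) (2 * (4 * Real.pi ^ 2 * t) * r)
      rw [h2] at h3
      linarith
    · rw [abs_mul, abs_of_pos (show 0 < 4 * Real.pi ^ 2 by positivity)]
      have h5 : Real.pi * |t| ≤ 4 * |t| := by gcongr
      have : Real.pi * (8 * Real.pi * |t|) ≤ Real.pi * (2 * |x₁|) :=
        mul_le_mul_of_nonneg_left (by linarith) hpi.le
      linarith
    · rw [mul_pow, sq_abs]
      have hpi1 : 1 ≤ Real.pi ^ 2 := by nlinarith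
      have hx2 : 0 < x₁ ^ 2 := by positivity
      calc _ ≤ 2 * 1 * (M * (1 + 3 * 2 + 3 * 2 ^ 2)) / (1 * x₁ ^ 2) := by gcongr
        _ = _ := by ring
  refine ⟨2 * C₀ + 38 * M + 1, by positivity, fun e he x t => ?_⟩
  set A : RSpace 2 → ℂ := fun ζ => ((η (Real.pi * inner ℝ ζ e) ^ 2 : ℝ) : ℂ) * gaussEnv 2 ζ with hA
  have hgint : Integrable (gaussEnv 2 : RSpace 2 → ℂ) := by
    have h1 := integrable_conj_mul (memLp_gaussEnv (d := 2) one_pos) (memLp_gaussEnv (d := 2) one_pos)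
    simpa only [conj_gaussEnv, gaussEnv_mul_self, mul_one] using h1
  have hAeq : A = fun ζ => 𝓕⁻ (𝓕 m) (inner ℝ ζ e) * gaussEnv 2 ζ := by rw [hinv]
  have hb1 : ‖extension A (x, t)‖ ≤ C₀ := by
    rw [hAeq]
    refine (norm_extension_fourierInv_mul_le hψ hgint e x t (B := 1) fun x => ?_).trans_eq (mul_one _)
    refine (norm_extension_gaussEnv_le_rpow (by norm_num) x t).trans ?_
    refine Real.rpow_le_one_of_one_le_of_nonpos (by norm_num) ?_
    norm_num
  -- the dispersive bound survives the cutoff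
  have hb2 : t ≠ 0 → ‖extension A (x, t)‖ ≤ C₀ * |t|⁻¹ := fun ht => by
    rw [hAeq]
    refine norm_extension_fourierInv_mul_le hψ hgint e x t fun x => ?_
    have h1 := enorm_extension_gaussEnv_le (d := 2) (a := 2) (by norm_num) x ht
    rw [show -(((2 : ℕ) : ℝ) / 2) = -1 by norm_num, ENNReal.rpow_neg_one,
      ← ENNReal.ofReal_inv_of_pos (abs_pos.2 ht), ← ofReal_norm] at h1
    exact (ENNReal.ofReal_le_ofReal_iff (by positivity)).1 h1
  constructor
  · rw [le_div_iff₀ (by positivity)]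
    have h2 : ‖extension A (x, t)‖ * |t| ≤ C₀ := by
      by_cases ht : t = 0
      · rw [ht, abs_zero, mul_zero]; exact hC₀0
      · have := hb2 ht
        rwa [← div_eq_mul_inv, le_div_iff₀ (abs_pos.2 ht)] at this
    nlinarith
  · intro hx
    rw [le_div_iff₀ (by positivity)]
    have h2 : ‖extension A (x, t)‖ * (inner ℝ x e : ℝ) ^ 2 ≤ 38 * M := by
      by_cases hx0 : (inner ℝ x e : ℝ) = 0
      · rw [hx0, zero_pow two_ne_zero, mul_zero]; positivity
      obtain ⟨⟨x₁, x'⟩, rfl⟩ := (lateralCoord e he).surjective x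
      rw [lateralCoord_apply] at hx hx0 ⊢
      simp only at hx hx0 ⊢
      rw [inner_lateral he] at hx hx0 ⊢
      have hsplit := extension_mul_lateral he (A := A) (α := α)
        (γ := fun ζ' => ((Real.exp (-(8 * Real.pi ^ 2) * ‖ζ'‖ ^ 2) : ℝ) : ℂ)) (fun r ζ' => by
          simp only [hA, hα, hm]
          rw [inner_lateral he, mul_assoc, ← Complex.ofReal_mul, ← Real.exp_add, gaussEnv]
          congr 3
          have h3 : inner ℝ e (ζ' : RSpace 2) = 0 := Submodule.mem_orthogonal_singleton_iff_inner_right.1 ζ'.2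
          rw [norm_add_sq_real, norm_smul, he, real_inner_smul_left, h3]
          simp
          ring) x₁ x' t
      have hγ : ‖extension (fun ζ' : (Submodule.span ℝ {e})ᗮ =>
          ((Real.exp (-(8 * Real.pi ^ 2) * ‖ζ'‖ ^ 2) : ℝ) : ℂ)) (x', t)‖ ≤ 1 := by
        refine (norm_extension_le _ _).trans ?_
        simp only [Complex.norm_real, Real.norm_of_nonneg (Real.exp_nonneg _)]
        rw [GaussianFourier.integral_rexp_neg_mul_sq_norm (by positivity)]
        refine Real.rpow_le_one (by positivity) ?_ (by positivity)
        rw [div_le_one (by positivity)]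
        nlinarith
      rw [hsplit, norm_mul]
      have h4 := hint1 x₁ t hx hx0
      have hx2 : 0 < x₁ ^ 2 := by positivity
      rw [le_div_iff₀ hx2] at h4
      calc _ ≤ ‖∫ r, Complex.exp (Complex.I * (2 * Real.pi * x₁ * r - 4 * Real.pi ^ 2 * t * r ^ 2 : ℝ)) * α r‖ *
            1 * x₁ ^ 2 := by gcongr
        _ ≤ 38 * M := by rwa [mul_one]
    nlinarith

end LateralEnvelope

/-! ### Domination by duality -/

section Domination

/-- A Hahn–Banach criterion: a family of lower bounds `M i ≤ ⟪p i, w⟫` is solvable with `‖w‖ ≤ A`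
as soon as every nonnegative combination of them is consistent with that norm. -/
theorem exists_forall_le_inner {V ι : Type*} [NormedAddCommGroup V] [InnerProductSpace ℝ V] [CompleteSpace V]
    (p : ι → V) (M : ι → ℝ) {A : ℝ} (hA : 0 ≤ A)
    (h : ∀ F : ι →₀ ℝ, (∀ i, 0 ≤ F i) →
      Finsupp.linearCombination ℝ M F ≤ A * ‖Finsupp.linearCombination ℝ p F‖) :
    ∃ w : V, ‖w‖ ≤ A ∧ ∀ i, M i ≤ inner ℝ (p i) w := by
  classical
  -- the sublinear functional `N` has the property that a linear functional `φ ≤ N` satisfies both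
  -- `‖φ‖ ≤ A` and `φ (-p i) ≤ -M i`
  let Φ : V → {F : ι →₀ ℝ // ∀ i, 0 ≤ F i} → ℝ := fun x F =>
    A * ‖x + Finsupp.linearCombination ℝ p F.1‖ - Finsupp.linearCombination ℝ M F.1
  let N : V → ℝ := fun x => ⨅ F, Φ x F
  have : Nonempty {F : ι →₀ ℝ // ∀ i, 0 ≤ F i} := ⟨⟨0, fun i => le_rfl⟩⟩
  have hbdd : ∀ x, BddBelow (Set.range (Φ x)) := fun x => by
    refine ⟨-(A * ‖x‖), ?_⟩
    rintro _ ⟨F, rfl⟩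
    have h1 := h F.1 F.2
    have h2 : ‖Finsupp.linearCombination ℝ p F.1‖ ≤ ‖x + Finsupp.linearCombination ℝ p F.1‖ + ‖x‖ := by
      have := norm_sub_le (x + Finsupp.linearCombination ℝ p F.1) x
      rwa [add_sub_cancel_left] at this
    have h3 := mul_le_mul_of_nonneg_left h2 hA
    simp only [Φ]
    linarith
  have hNle : ∀ x F, N x ≤ Φ x F := fun x F => ciInf_le (hbdd x) F
  have hhom : ∀ c : ℝ, 0 < c → ∀ x, N (c • x) ≤ c * N x := fun c hc x => by
    rw [← div_le_iff₀' hc]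
    refine le_ciInf fun F => ?_
    rw [div_le_iff₀' hc]
    refine (hNle _ ⟨c • F.1, fun i => mul_nonneg hc.le (F.2 i)⟩).trans_eq ?_
    simp only [Φ, map_smul, ← smul_add, norm_smul, Real.norm_of_nonneg hc.le, smul_eq_mul]
    ring
  obtain ⟨φ, -, hφ⟩ := exists_extension_of_le_sublinear (⊥ : V →ₗ.[ℝ] ℝ) N
    (fun c hc x => by
      refine le_antisymm (hhom c hc x) ?_
      have := hhom c⁻¹ (inv_pos.2 hc) (c • x)
      rw [smul_smul, inv_mul_cancel₀ hc.ne', one_smul] at this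
      calc c * N x ≤ c * (c⁻¹ * N (c • x)) := by gcongr
        _ = N (c • x) := by field_simp)
    (fun x y => by
      rw [← sub_le_iff_le_add]
      refine le_ciInf fun F => ?_
      rw [sub_le_comm]
      refine le_ciInf fun G => ?_
      rw [sub_le_iff_le_add]
      refine (hNle _ ⟨F.1 + G.1, fun i => add_nonneg (F.2 i) (G.2 i)⟩).trans ?_
      simp only [Φ, map_add]
      have h1 : ‖x + y + (Finsupp.linearCombination ℝ p F.1 + Finsupp.linearCombination ℝ p G.1)‖ ≤
          ‖x + Finsupp.linearCombination ℝ p F.1‖ + ‖y + Finsupp.linearCombination ℝ p G.1‖ := by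
        rw [add_add_add_comm]
        exact norm_add_le _ _
      have h2 := mul_le_mul_of_nonneg_left h1 hA
      linarith)
    (fun x => by
      have hx : (x : V) = 0 := (Submodule.mem_bot ℝ).1 x.2
      have hx' : x = 0 := Subtype.ext hx
      rw [hx', LinearPMap.map_zero]
      refine le_ciInf fun F => ?_
      have := h F.1 F.2
      simp only [Φ, ZeroMemClass.coe_zero, zero_add]
      linarith)
  have hφA : ∀ x, φ x ≤ A * ‖x‖ := fun x => by
    refine (hφ x).trans ((hNle x ⟨0, fun i => le_rfl⟩).trans_eq ?_)
    simp [Φ]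
  let ψ : V →L[ℝ] ℝ := φ.mkContinuous A fun x => by
    rw [Real.norm_eq_abs, abs_le]
    refine ⟨?_, hφA x⟩
    have := hφA (-x)
    rw [map_neg, norm_neg] at this
    linarith
  refine ⟨(InnerProductSpace.toDual ℝ V).symm ψ, ?_, fun i => ?_⟩
  · rw [LinearIsometryEquiv.norm_map]
    exact LinearMap.mkContinuous_norm_le _ hA _
  · rw [real_inner_comm, InnerProductSpace.toDual_symm_apply]
    have h1 : φ (-p i) ≤ -M i := by
      refine (hφ _).trans ((hNle _ ⟨Finsupp.single i 1, fun j => ?_⟩).trans_eq ?_)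
      · rw [Finsupp.single_apply]
        split_ifs <;> norm_num
      · simp [Φ]
    rw [map_neg] at h1
    exact neg_le_neg_iff.1 h1

/-- Domination of a family of coefficients when its Gram kernel is dominated by another one. Testing
the coefficients against nonnegative weights, the quadratic form of the first kernel is at most that
of the second, which is the consistency required by `exists_forall_le_inner`. -/
theorem exists_norm_inner_le_inner_of_gram_le {H V ι : Type*} [NormedAddCommGroup H] [InnerProductSpace ℂ H]
    [NormedAddCommGroup V] [InnerProductSpace ℝ V] [CompleteSpace V] (e : ι → H) (p : ι → V) {B : ℝ}
    (hB : 0 ≤ B) (hker : ∀ i j, ‖inner ℂ (e i) (e j)‖ ≤ B * inner ℝ (p i) (p j)) (g : H) :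
    ∃ w : V, ‖w‖ ≤ √B * ‖g‖ ∧ ∀ i, ‖inner ℂ (e i) g‖ ≤ inner ℝ (p i) w := by
  refine exists_forall_le_inner p _ (by positivity) fun F hF => ?_
  rw [Finsupp.linearCombination_apply, Finsupp.linearCombination_apply, Finsupp.sum, Finsupp.sum]
  -- the unimodular factors aligning the coefficients
  set c : ι → ℂ := fun i => inner ℂ (e i) g / (‖inner ℂ (e i) g‖ : ℂ) with hc
  have hc1 : ∀ i, ‖c i‖ ≤ 1 := fun i => by
    rw [hc]
    simp only
    rw [norm_div, Complex.norm_real, norm_norm]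
    exact div_self_le_one _
  have hcz : ∀ i, starRingEnd ℂ (c i) * inner ℂ (e i) g = (‖inner ℂ (e i) g‖ : ℂ) := fun i => by
    by_cases h0 : inner ℂ (e i) g = 0
    · simp [h0]
    have h1 : (‖inner ℂ (e i) g‖ : ℂ) ≠ 0 := by simpa using h0
    rw [hc]
    simp only
    rw [map_div₀, Complex.conj_ofReal, div_mul_eq_mul_div, Complex.conj_mul', sq, mul_div_cancel_right₀ _ h1]
  set v : H := ∑ i ∈ F.support, ((F i : ℂ) * c i) • e i with hv
  have hvg : ((∑ i ∈ F.support, F i • ‖inner ℂ (e i) g‖ : ℝ) : ℂ) = inner ℂ v g := by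
    rw [hv, sum_inner]
    push_cast
    refine Finset.sum_congr rfl fun i _ => ?_
    rw [inner_smul_left, map_mul, Complex.conj_ofReal, mul_assoc, hcz]
    simp
  have hvn : ‖v‖ ^ 2 ≤ B * ‖∑ i ∈ F.support, F i • p i‖ ^ 2 := by
    have h1 : ‖v‖ ^ 2 = ‖inner ℂ v v‖ := by
      rw [inner_self_eq_norm_sq_to_K, norm_pow]
      simp
    rw [h1, ← real_inner_self_eq_norm_sq, hv, sum_inner, sum_inner, Finset.mul_sum]
    refine (norm_sum_le _ _).trans (Finset.sum_le_sum fun i _ => ?_)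
    rw [inner_sum, inner_sum, Finset.mul_sum]
    refine (norm_sum_le _ _).trans (Finset.sum_le_sum fun j _ => ?_)
    rw [inner_smul_left, inner_smul_right, real_inner_smul_left, real_inner_smul_right, norm_mul, norm_mul,
      RCLike.norm_conj, norm_mul, norm_mul, Complex.norm_real, Complex.norm_real, Real.norm_of_nonneg (hF i),
      Real.norm_of_nonneg (hF j)]
    have hFi := hF i
    have hFj := hF j
    calc F i * ‖c i‖ * (F j * ‖c j‖ * ‖inner ℂ (e i) (e j)‖)
        ≤ F i * 1 * (F j * 1 * (B * inner ℝ (p i) (p j))) := by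
          gcongr
          · exact hc1 i
          · exact hc1 j
          · exact hker i j
      _ = _ := by ring
  have hvn' : ‖v‖ ≤ √B * ‖∑ i ∈ F.support, F i • p i‖ := by
    rw [← Real.sqrt_sq (norm_nonneg (∑ i ∈ F.support, F i • p i)), ← Real.sqrt_mul hB]
    exact Real.le_sqrt_of_sq_le hvn
  calc ∑ i ∈ F.support, F i • ‖inner ℂ (e i) g‖ ≤ ‖inner ℂ v g‖ := by
        rw [← hvg, Complex.norm_real]
        exact Real.le_norm_self _
    _ ≤ ‖v‖ * ‖g‖ := norm_inner_le_norm _ _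
    _ ≤ √B * ‖∑ i ∈ F.support, F i • p i‖ * ‖g‖ := by gcongr
    _ = _ := by ring

end Domination

/-! ### Lorentz profiles -/

section LorentzProfile

/-- The profile `1 / (1 + N²(y - a)²)`. -/
noncomputable def lorentz (N a y : ℝ) : ℝ := (1 + (N * (y - a)) ^ 2)⁻¹

theorem lorentz_nonneg (N a y : ℝ) : 0 ≤ lorentz N a y := by
  rw [lorentz]; positivity

theorem lorentz_le_one (N a y : ℝ) : lorentz N a y ≤ 1 :=
  inv_le_one_of_one_le₀ (by nlinarith [sq_nonneg (N * (y - a))])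

theorem continuous_lorentz (N : ℝ) : Continuous fun q : ℝ × ℝ => lorentz N q.1 q.2 := by
  unfold lorentz
  refine Continuous.inv₀ (by fun_prop) fun q => ?_
  positivity

theorem integral_lorentz {N : ℝ} (hN : 0 < N) (a : ℝ) :
    Integrable (lorentz N a) ∧ ∫ y, lorentz N a y = Real.pi / N := by
  have h1 : lorentz N a = fun y => (fun s => (fun r : ℝ => (1 + r ^ 2)⁻¹) (N * s)) (y - a) := rfl
  constructor
  · rw [h1]
    exact ((integrable_inv_one_add_sq).comp_mul_left' hN.ne').comp_sub_right a
  · rw [h1, integral_sub_right_eq_self (fun s => (fun r : ℝ => (1 + r ^ 2)⁻¹) (N * s)) a,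
      Measure.integral_comp_mul_left (fun r : ℝ => (1 + r ^ 2)⁻¹) N, integral_univ_inv_one_add_sq, abs_of_pos (inv_pos.2 hN), smul_eq_mul]
    ring

theorem lintegral_lorentz {N : ℝ} (hN : 0 < N) (a : ℝ) :
    ∫⁻ y, ENNReal.ofReal (lorentz N a y) = ENNReal.ofReal (Real.pi / N) := by
  rw [← (integral_lorentz hN a).2,
    ofReal_integral_eq_lintegral_ofReal (integral_lorentz hN a).1 (Filter.Eventually.of_forall (lorentz_nonneg N a))]

theorem lorentz_comm (N a y : ℝ) : lorentz N a y = lorentz N y a := by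
  rw [lorentz, lorentz]; congr 2; ring

theorem memLp_lorentz {N : ℝ} (hN : 0 < N) (a : ℝ) : MemLp (lorentz N a) 2 := by
  have hc : Continuous (lorentz N a) := (continuous_lorentz N).comp (Continuous.prodMk_right a)
  refine (memLp_two_iff_integrable_sq hc.aestronglyMeasurable).2 ?_
  refine (integral_lorentz hN a).1.mono (hc.pow 2).aestronglyMeasurable (Filter.Eventually.of_forall fun y => ?_)
  have h0 := lorentz_nonneg N a y
  have h1 := lorentz_le_one N a y
  rw [Real.norm_of_nonneg (by positivity), Real.norm_of_nonneg h0]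
  nlinarith

/-- The profile centred at `a`, as an element of `L²(ℝ)`. -/
noncomputable def lorentzLp {N : ℝ} (hN : 0 < N) (a : ℝ) : Lp ℝ 2 (volume : Measure ℝ) :=
  (memLp_lorentz hN a).toLp

theorem inner_lorentzLp {N : ℝ} (hN : 0 < N) (a : ℝ) (w : Lp ℝ 2 (volume : Measure ℝ)) :
    inner ℝ (lorentzLp hN a) w = ∫ y, lorentz N a y * w y := by
  rw [L2.inner_def]
  refine integral_congr_ae ?_
  filter_upwards [(memLp_lorentz hN a).coeFn_toLp] with y hy
  rw [lorentzLp, hy, RCLike.inner_apply, conj_trivial, mul_comm]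

/-- The convolution of two profiles is, up to constants, a profile: only the lower bound, from the
points within `1/N` of `a`, is needed. -/
theorem lorentz_le_inner_lorentzLp {N : ℝ} (hN : 0 < N) (a b : ℝ) :
    lorentz N a b / (6 * N) ≤ inner ℝ (lorentzLp hN a) (lorentzLp hN b) := by
  rw [L2.inner_def]
  have h1 : ∀ᵐ y, inner ℝ (lorentzLp hN a y) (lorentzLp hN b y) = lorentz N b y * lorentz N a y := by
    filter_upwards [(memLp_lorentz hN a).coeFn_toLp, (memLp_lorentz hN b).coeFn_toLp] with y hy hy'
    rw [lorentzLp, lorentzLp, hy, hy', RCLike.inner_apply, conj_trivial]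
  rw [integral_congr_ae h1]
  have hint : Integrable fun y => lorentz N b y * lorentz N a y :=
    (memLp_lorentz hN b).integrable_mul (memLp_lorentz hN a)
  calc lorentz N a b / (6 * N) = ∫ _ in Set.Icc a (a + N⁻¹), lorentz N a b / 6 := by
        rw [setIntegral_const, Real.volume_real_Icc_of_le (by linarith [inv_pos.2 hN]), smul_eq_mul]
        field_simp
        ring
    _ ≤ ∫ y in Set.Icc a (a + N⁻¹), lorentz N b y * lorentz N a y := by
        refine setIntegral_mono_on (by simp) hint.integrableOn measurableSet_Icc fun y hy => ?_
        have h2 : (N * (y - a)) ^ 2 ≤ 1 := by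
          have h3 : 0 ≤ N * (y - a) := mul_nonneg hN.le (by linarith [hy.1])
          have h4 : N * (y - a) ≤ 1 := by
            calc N * (y - a) ≤ N * N⁻¹ := by
                  have := hy.2
                  gcongr
                  linarith
              _ = 1 := mul_inv_cancel₀ hN.ne'
          nlinarith
        have h5 : 1 / 2 ≤ lorentz N a y := by
          rw [lorentz, one_div]
          gcongr
          linarith
        have h6 : lorentz N a b / 3 ≤ lorentz N b y := by
          rw [lorentz, lorentz, div_eq_mul_inv, ← mul_inv]
          gcongr
          nlinarith [sq_nonneg (N * (y - a) + N * (b - a)), sq_nonneg (N * (b - a))]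
        have := lorentz_nonneg N a b
        nlinarith
    _ ≤ _ := setIntegral_le_integral hint (Filter.Eventually.of_forall fun y =>
        mul_nonneg (lorentz_nonneg _ _ _) (lorentz_nonneg _ _ _))

theorem measurable_ofReal_lorentz (N : ℝ) : Measurable fun q : ℝ × ℝ => ENNReal.ofReal (lorentz N q.1 q.2) :=
  (continuous_lorentz N).measurable.ennreal_ofReal

theorem continuous_lorentz_right (N a : ℝ) : Continuous (lorentz N a) :=
  (continuous_lorentz N).comp (Continuous.prodMk_right a)

theorem measurable_ofReal_lorentz_right (N a : ℝ) : Measurable fun y => ENNReal.ofReal (lorentz N a y) :=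
  (continuous_lorentz_right N a).measurable.ennreal_ofReal

/-- The Cauchy-Schwarz inequality with respect to the weight `lorentz N a`. -/
theorem enorm_inner_lorentzLp_sq_le {N : ℝ} (hN : 0 < N) (w : Lp ℝ 2 (volume : Measure ℝ)) (a : ℝ) :
    ‖(inner ℝ (lorentzLp hN a) w : ℝ)‖ₑ ^ (2 : ℝ) ≤
      ENNReal.ofReal (Real.pi / N) * ∫⁻ y, ENNReal.ofReal (lorentz N a y) * ‖w y‖ₑ ^ (2 : ℝ) := by
  have hma : Measurable fun y => ENNReal.ofReal (lorentz N a y) :=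
    measurable_ofReal_lorentz_right N a
  have hw : Measurable fun y => ‖w y‖ₑ := (Lp.stronglyMeasurable w).enorm
  have h1 : ‖(inner ℝ (lorentzLp hN a) w : ℝ)‖ₑ ≤ ∫⁻ y, ENNReal.ofReal (lorentz N a y) * ‖w y‖ₑ := by
    rw [inner_lorentzLp]
    refine (enorm_integral_le_lintegral_enorm _).trans_eq (lintegral_congr fun y => ?_)
    rw [enorm_mul, Real.enorm_of_nonneg (lorentz_nonneg _ _ _)]
  have h2 := ENNReal.lintegral_mul_norm_pow_le (μ := volume) hma.aemeasurable
    (hma.mul (hw.pow_const (2 : ℝ))).aemeasurable (p := 1 / 2) (q := 1 / 2) (by norm_num) (by norm_num)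
    (by norm_num)
  have h3 : ∀ y, ENNReal.ofReal (lorentz N a y) ^ (1 / 2 : ℝ) *
      (ENNReal.ofReal (lorentz N a y) * ‖w y‖ₑ ^ (2 : ℝ)) ^ (1 / 2 : ℝ) =
      ENNReal.ofReal (lorentz N a y) * ‖w y‖ₑ := fun y => by
    rw [ENNReal.mul_rpow_of_nonneg _ _ (by norm_num), ← ENNReal.rpow_mul, ← mul_assoc,
      ← ENNReal.rpow_add_of_nonneg _ _ (by norm_num) (by norm_num)]
    norm_num
  simp only [Pi.mul_apply, h3, lintegral_lorentz hN] at h2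
  refine (ENNReal.rpow_le_rpow (h1.trans h2) (by norm_num)).trans_eq ?_
  rw [ENNReal.mul_rpow_of_nonneg _ _ (by norm_num), ← ENNReal.rpow_mul, ← ENNReal.rpow_mul,
    show (1 / 2 : ℝ) * 2 = 1 by norm_num, ENNReal.rpow_one, ENNReal.rpow_one]

/-- The coefficients against the profiles, as a function of the centre, are square integrable. -/
theorem lintegral_inner_lorentzLp_sq_le {N : ℝ} (hN : 0 < N) (w : Lp ℝ 2 (volume : Measure ℝ)) :
    ∫⁻ a, ‖(inner ℝ (lorentzLp hN a) w : ℝ)‖ₑ ^ (2 : ℝ) ≤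
      ENNReal.ofReal (Real.pi / N) ^ (2 : ℝ) * ‖w‖ₑ ^ (2 : ℝ) := by
  have hm := measurable_ofReal_lorentz N
  have hw : Measurable fun y => ‖w y‖ₑ := (Lp.stronglyMeasurable w).enorm
  have hwn : ‖w‖ₑ ^ (2 : ℝ) = ∫⁻ y, ‖w y‖ₑ ^ (2 : ℝ) := by
    rw [Lp.enorm_def, eLpNorm_eq_lintegral_rpow_enorm_toReal two_ne_zero ENNReal.ofNat_ne_top, ← ENNReal.rpow_mul,
      ENNReal.toReal_ofNat, show (1 / 2 : ℝ) * 2 = 1 by norm_num, ENNReal.rpow_one]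
  have hcol : ∀ y, ∫⁻ a, ENNReal.ofReal (lorentz N a y) * ‖w y‖ₑ ^ (2 : ℝ) =
      ENNReal.ofReal (Real.pi / N) * ‖w y‖ₑ ^ (2 : ℝ) := fun y => by
    simp only [lorentz_comm N _ y]
    rw [lintegral_mul_const _ (measurable_ofReal_lorentz_right N y), lintegral_lorentz hN]
  refine (lintegral_mono (enorm_inner_lorentzLp_sq_le hN w)).trans_eq ?_
  rw [lintegral_const_mul' _ _ ENNReal.ofReal_ne_top, lintegral_lintegral_swap]
  · simp only [hcol]
    rw [lintegral_const_mul' _ _ ENNReal.ofReal_ne_top, hwn, ← mul_assoc, ENNReal.rpow_ofNat, sq]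
  · exact (hm.mul ((hw.comp measurable_snd).pow_const _)).aemeasurable

end LorentzProfile

/-! ### Averages over the speeds -/

section SpeedCount

theorem mem_speeds {K : ℕ} {k : ℤ} {l : ℝ} : l ∈ speeds K k ↔
    l ∈ Set.Icc (-(2 : ℝ) ^ k) (2 ^ k) ∧ ∃ n : ℤ, (2 : ℝ) ^ (k + 2 * (K : ℤ)) * l = n := by
  rw [speeds, Set.Finite.mem_toFinset]
  rfl

/-- The average over the speeds of the Lorentz profiles dominates the inverse of the elapsed time
inside the region reached by these speeds. -/
theorem card_speeds_le_sum_of_near {K : ℕ} {k : ℤ} {N : ℝ} (hN : N = 2 ^ k) {x t : ℝ}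
    (ht : |t| ≤ 2 * 2 ^ (2 * K)) (hs : 1 < N ^ 2 * |t|) (hx : N * |x| ≤ 16 * (N ^ 2 * |t|)) :
    ((speeds K (k + 5)).card : ℝ) ≤
      130 * (N ^ 2 * |t|) * ∑ l ∈ speeds K (k + 5), (1 + (N * (x - l * t)) ^ 2)⁻¹ := by
  classical
  have hN0 : 0 < N := by rw [hN]; positivity
  set h : ℝ := (2 : ℝ) ^ (k + 5 + 2 * (K : ℤ)) with hh
  have hh0 : 0 < h := by positivity
  have hhN : h = 32 * N * 2 ^ (2 * K) := by
    rw [hh, zpow_add₀ two_ne_zero, zpow_add₀ two_ne_zero, ← hN]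
    have : (2 : ℝ) ^ (2 * (K : ℤ)) = 2 ^ (2 * K) := by
      rw [← zpow_natCast]; push_cast; rfl
    rw [this]
    norm_num
    ring
  have h32 : (2 : ℝ) ^ (k + 5) = 32 * N := by
    rw [zpow_add₀ two_ne_zero, ← hN]
    norm_num
    ring
  set s : ℝ := N ^ 2 * |t| with hsdef
  have ht0 : t ≠ 0 := by
    rintro rfl
    rw [hsdef, abs_zero, mul_zero] at hs
    linarith
  have htp : 0 < |t| := abs_pos.2 ht0
  set ρ : ℝ := N * t / h with hρ
  have hρa : |ρ| = N * |t| / h := by rw [hρ, abs_div, abs_mul, abs_of_pos hN0, abs_of_pos hh0]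
  have hρ0 : 0 < |ρ| := by rw [hρa]; positivity
  have hρne : ρ ≠ 0 := abs_pos.1 hρ0
  set D : ℝ := N * h with hD
  have hD0 : 0 < D := by positivity
  have hsD : |ρ| * D = s := by rw [hρa, hD, hsdef]; field_simp
  have hρ16 : |ρ| ≤ 1 / 16 := by
    rw [hρa, div_le_iff₀ hh0, hhN]
    nlinarith
  have hD16 : 16 ≤ D := by nlinarith
  -- the speeds are the multiples of `1 / h` up to `32 N`
  have hcard : ((speeds K (k + 5)).card : ℝ) ≤ 65 * D := by
    have hsub : speeds K (k + 5) ⊆ (Finset.Icc (-⌊32 * D⌋) ⌊32 * D⌋).image fun n : ℤ => (n : ℝ) / h := by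
      intro l hl
      obtain ⟨⟨h1, h2⟩, n, hn⟩ := mem_speeds.1 hl
      rw [h32] at h1 h2
      rw [← hh] at hn
      refine Finset.mem_image.2 ⟨n, Finset.mem_Icc.2 ⟨?_, ?_⟩, ?_⟩
      · rw [neg_le, Int.le_floor]
        push_cast
        rw [← hn, hD]
        nlinarith
      · rw [Int.le_floor, ← hn, hD]
        nlinarith
      · rw [← hn]; field_simp
    have h1 := (Finset.card_le_card hsub).trans Finset.card_image_le
    rw [Int.card_Icc] at h1
    have h2 : (0 : ℤ) ≤ ⌊32 * D⌋ := Int.floor_nonneg.2 (by positivity)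
    have h3 : (((⌊32 * D⌋ + 1 - -⌊32 * D⌋).toNat : ℕ) : ℝ) = 2 * ⌊32 * D⌋ + 1 := by
      have : (((⌊32 * D⌋ + 1 - -⌊32 * D⌋).toNat : ℕ) : ℤ) = 2 * ⌊32 * D⌋ + 1 := by omega
      exact_mod_cast this
    have h4 := Int.floor_le (32 * D)
    calc ((speeds K (k + 5)).card : ℝ) ≤ ((⌊32 * D⌋ + 1 - -⌊32 * D⌋).toNat : ℕ) := by exact_mod_cast h1
      _ ≤ 65 * D := by rw [h3]; linarith
  -- the speeds matching the direction of `(x, t)` up to one unit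
  -- `A` is the index of the speed of `(x, t)`, and `1 / |ρ|` is the number of speeds per unit of
  -- the profile
  set A : ℝ := N * x / ρ with hA
  set I : Finset ℤ := Finset.Icc ⌈A - 1 / |ρ|⌉ ⌊A + 1 / |ρ|⌋ with hI
  have hIcard : 1 / |ρ| ≤ (I.card : ℝ) := by
    have h1 := Int.ceil_lt_add_one (A - 1 / |ρ|)
    have h2 := Int.lt_floor_add_one (A + 1 / |ρ|)
    have h3 : 16 ≤ 1 / |ρ| := by rw [le_div_iff₀ hρ0]; linarith
    have h5 : ((⌊A + 1 / |ρ|⌋ + 1 - ⌈A - 1 / |ρ|⌉ : ℤ) : ℝ) ≤ (I.card : ℝ) := by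
      rw [hI, Int.card_Icc]
      exact_mod_cast Int.self_le_toNat _
    push_cast at h5
    linarith
  have hclose : ∀ n ∈ I, |N * x - n * ρ| ≤ 1 := fun n hn => by
    rw [hI, Finset.mem_Icc, Int.ceil_le, Int.le_floor] at hn
    have h1 : |A - n| ≤ 1 / |ρ| := by rw [abs_le]; constructor <;> linarith [hn.1, hn.2]
    have h2 : N * x - n * ρ = (A - n) * ρ := by rw [hA]; field_simp
    rw [h2, abs_mul]
    calc |A - n| * |ρ| ≤ 1 / |ρ| * |ρ| := by gcongr
      _ = 1 := by field_simp
  have hmem : ∀ n ∈ I, (n : ℝ) / h ∈ speeds K (k + 5) := fun n hn => by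
    have h1 := hclose n hn
    have h2 : |(n : ℝ)| * |ρ| ≤ 32 * s := by
      have h3 := abs_sub_abs_le_abs_sub (n * ρ) (N * x)
      rw [abs_sub_comm, abs_mul, abs_mul, abs_of_pos hN0] at h3
      linarith
    have h4 : |(n : ℝ)| ≤ 32 * D := by
      rw [← hsD] at h2
      nlinarith
    have h5 : |(n : ℝ) / h| ≤ 32 * N := by
      rw [abs_div, abs_of_pos hh0, div_le_iff₀ hh0]
      rw [hD] at h4
      linarith
    refine mem_speeds.2 ⟨?_, n, ?_⟩
    · rw [h32]; exact abs_le.1 h5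
    · rw [← hh]; field_simp
  have hsum : 1 / |ρ| * (1 / 2) ≤ ∑ l ∈ speeds K (k + 5), (1 + (N * (x - l * t)) ^ 2)⁻¹ := by
    calc 1 / |ρ| * (1 / 2) ≤ (I.card : ℝ) * (1 / 2) := by gcongr
      _ = ∑ n ∈ I, (1 / 2 : ℝ) := by rw [Finset.sum_const, nsmul_eq_mul]
      _ ≤ ∑ n ∈ I, (1 + (N * (x - (n : ℝ) / h * t)) ^ 2)⁻¹ := by
          refine Finset.sum_le_sum fun n hn => ?_
          have h1 := hclose n hn
          have h2 : N * (x - (n : ℝ) / h * t) = N * x - n * ρ := by rw [hρ]; field_simp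
          rw [h2, one_div]
          have h3 := (sq_le_one_iff_abs_le_one _).2 h1
          gcongr
          linarith
      _ = ∑ l ∈ I.image fun n : ℤ => (n : ℝ) / h, (1 + (N * (x - l * t)) ^ 2)⁻¹ := by
          rw [Finset.sum_image]
          intro a _ b _ hab
          simpa [hh0.ne'] using hab
      _ ≤ _ := by
          refine Finset.sum_le_sum_of_subset_of_nonneg ?_ fun _ _ _ => by positivity
          intro l hl
          obtain ⟨n, hn, rfl⟩ := Finset.mem_image.1 hl
          exact hmem n hn
  refine hcard.trans ?_
  calc 65 * D = 130 * s * (1 / |ρ| * (1 / 2)) := by rw [← hsD]; field_simp; norm_num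
    _ ≤ _ := by gcongr

/-- Every profile is at least `1 / (1 + R²)` when `R` bounds the distance to the farthest line. -/
theorem card_speeds_mul_le_sum_of_le {K : ℕ} {k : ℤ} {N : ℝ} (hN : N = 2 ^ k) {x t R : ℝ}
    (hR : N * |x| + 32 * (N ^ 2 * |t|) ≤ R) :
    ((speeds K (k + 5)).card : ℝ) * (1 + R ^ 2)⁻¹ ≤
      ∑ l ∈ speeds K (k + 5), (1 + (N * (x - l * t)) ^ 2)⁻¹ := by
  have hN0 : 0 < N := by rw [hN]; positivity
  rw [← nsmul_eq_mul]
  refine Finset.card_nsmul_le_sum _ _ _ fun l hl => ?_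
  have h32 : (2 : ℝ) ^ (k + 5) = 32 * N := by
    rw [zpow_add₀ two_ne_zero, ← hN]
    norm_num
    ring
  have hl' : |l| ≤ 32 * N := by
    obtain ⟨h1, -⟩ := mem_speeds.1 hl
    rw [h32] at h1
    exact abs_le.2 h1
  have h1 : |N * (x - l * t)| ≤ R := by
    refine le_trans ?_ hR
    rw [abs_mul, abs_of_pos hN0]
    have h2 := abs_sub x (l * t)
    rw [abs_mul] at h2
    calc N * |x - l * t| ≤ N * (|x| + 32 * N * |t|) := by
          gcongr
          refine h2.trans ?_
          gcongr
      _ = _ := by ring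
  have h3 : (N * (x - l * t)) ^ 2 ≤ R ^ 2 := sq_le_sq' (abs_le.1 h1).1 (abs_le.1 h1).2
  gcongr

/-- A kernel with the dispersive decay, which is small outside the region reached by the speeds,
is dominated by the average over the speeds of the Lorentz profiles. -/
theorem card_speeds_mul_le_sum {K : ℕ} {k : ℤ} {N : ℝ} (hN : N = 2 ^ k) {x t C X : ℝ} (hC : 0 ≤ C)
    (ht : |t| ≤ 2 * 2 ^ (2 * K)) (h1 : X ≤ C / (1 + N ^ 2 * |t|))
    (h2 : 16 * (N ^ 2 * |t|) ≤ N * |x| → X ≤ C / (1 + (N * x) ^ 2)) :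
    ((speeds K (k + 5)).card : ℝ) * X ≤
      2305 * C * ∑ l ∈ speeds K (k + 5), (1 + (N * (x - l * t)) ^ 2)⁻¹ := by
  have hN0 : 0 < N := by rw [hN]; positivity
  set S := ∑ l ∈ speeds K (k + 5), (1 + (N * (x - l * t)) ^ 2)⁻¹ with hS
  have hS0 : 0 ≤ S := Finset.sum_nonneg fun _ _ => by positivity
  set s := N ^ 2 * |t| with hs
  have hs0 : 0 ≤ s := by positivity
  have hc0 : (0 : ℝ) ≤ (speeds K (k + 5)).card := by positivity
  have hxa : (N * x) ^ 2 = (N * |x|) ^ 2 := by rw [mul_pow, mul_pow, sq_abs]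
  -- beyond the reach of the speeds; close to the origin; and the region in between
  rcases le_total (16 * s) (N * |x|) with hfar | hnear
  · have h3 := card_speeds_mul_le_sum_of_le (K := K) hN (x := x) (t := t) (R := 3 * (N * |x|)) (by linarith)
    have h4 : (1 + (N * x) ^ 2)⁻¹ ≤ 9 * (1 + (3 * (N * |x|)) ^ 2)⁻¹ := by
      rw [hxa, ← one_div, ← div_eq_mul_inv, div_le_div_iff₀ (by positivity) (by positivity)]
      nlinarith [sq_nonneg (N * |x|)]
    calc ((speeds K (k + 5)).card : ℝ) * X ≤ (speeds K (k + 5)).card * (C / (1 + (N * x) ^ 2)) := by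
          gcongr
          exact h2 hfar
      _ = C * ((speeds K (k + 5)).card * (1 + (N * x) ^ 2)⁻¹) := by ring
      _ ≤ C * ((speeds K (k + 5)).card * (9 * (1 + (3 * (N * |x|)) ^ 2)⁻¹)) := by gcongr
      _ = 9 * C * ((speeds K (k + 5)).card * (1 + (3 * (N * |x|)) ^ 2)⁻¹) := by ring
      _ ≤ 9 * C * S := by gcongr
      _ ≤ 2305 * C * S := by gcongr; norm_num
  rcases le_or_gt s 1 with hs1 | hs1
  · have h3 := card_speeds_mul_le_sum_of_le (K := K) hN (x := x) (t := t) (R := 48) (by linarith)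
    calc ((speeds K (k + 5)).card : ℝ) * X ≤ (speeds K (k + 5)).card * C := by
          gcongr
          refine h1.trans (div_le_self hC (by linarith))
      _ = 2305 * C * ((speeds K (k + 5)).card * (1 + 48 ^ 2)⁻¹) := by ring
      _ ≤ 2305 * C * S := by gcongr
  · have h3 := card_speeds_le_sum_of_near hN ht hs1 hnear
    calc ((speeds K (k + 5)).card : ℝ) * X ≤ (130 * s * S) * (C / (1 + s)) := by
          refine (mul_le_mul_of_nonneg_left h1 hc0).trans ?_
          gcongr
      _ = 130 * C * S * (s / (1 + s)) := by ring
      _ ≤ 130 * C * S * 1 := by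
          gcongr
          rw [div_le_one (by positivity)]
          linarith
      _ ≤ 2305 * C * S := by
          rw [mul_one]
          gcongr
          norm_num

end SpeedCount

/-! ### The Gram kernel of the localized waves -/

section LateralEnvelopeKernel

variable {d : ℕ}

/-- The envelope at frequency `N` which is localized to a bounded range of `ζ·e / N`. -/
noncomputable def lateralEnv (η : ℝ → ℝ) (N : ℝ) (e : RSpace d) (ζ : RSpace d) : ℂ :=
  ((η (Real.pi * inner ℝ (N⁻¹ • ζ) e) : ℝ) : ℂ) * gaussEnv (N⁻¹ ^ 2) ζ

theorem IsBaseCutoff.memLp_lateralEnv {η : ℝ → ℝ} (hη : IsBaseCutoff η) {N : ℝ} (hN : 0 < N) (e : RSpace d) :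
    MemLp (lateralEnv η N e) 2 := by
  have ha : 0 < N⁻¹ ^ 2 := by positivity
  refine (memLp_gaussEnv (d := d) ha).of_le ?_ (Filter.Eventually.of_forall fun ζ => ?_)
  · refine Continuous.aestronglyMeasurable ?_
    unfold lateralEnv
    refine (Complex.continuous_ofReal.comp (hη.smooth.continuous.comp ?_)).mul (continuous_gaussEnv _)
    fun_prop
  · rw [lateralEnv, norm_mul, Complex.norm_real, Real.norm_of_nonneg (hη.mem_Icc _).1]
    exact mul_le_of_le_one_left (norm_nonneg _) (hη.mem_Icc _).2

theorem conj_lateralEnv (η : ℝ → ℝ) (N : ℝ) (e ζ : RSpace d) :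
    starRingEnd ℂ (lateralEnv η N e ζ) = lateralEnv η N e ζ := by
  rw [lateralEnv, map_mul, Complex.conj_ofReal, conj_gaussEnv]

/-- Parabolic rescaling. -/
theorem extension_comp_inv_smul (A : RSpace d → ℂ) {N : ℝ} (hN : 0 < N) (z : RSpace d × ℝ) :
    extension (fun ζ => A (N⁻¹ • ζ)) z = (N : ℂ) ^ d * extension A (N • z.1, N ^ 2 * z.2) := by
  have h1 : ∀ ζ, Complex.exp (Complex.I * wavePhase z ζ) * A (N⁻¹ • ζ) =
      (fun ζ => Complex.exp (Complex.I * wavePhase (N • z.1, N ^ 2 * z.2) ζ) * A ζ) (N⁻¹ • ζ) := fun ζ => by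
    simp only [wavePhase, real_inner_smul_left, real_inner_smul_right, norm_smul, Real.norm_of_nonneg (inv_pos.2 hN).le]
    congr 4
    field_simp
  rw [extension, integral_congr_ae (Filter.Eventually.of_forall h1), Measure.integral_comp_smul volume
      (fun ζ => Complex.exp (Complex.I * wavePhase (N • z.1, N ^ 2 * z.2) ζ) * A ζ), extension,
    finrank_euclideanSpace_fin, inv_pow, inv_inv, abs_of_pos (by positivity), Complex.real_smul]
  push_cast
  rfl

/-- The Gram kernel at frequency `N` is a rescaling of the kernel at unit frequency. -/
theorem norm_inner_wave_lateralEnv {η : ℝ → ℝ} (hη : IsBaseCutoff η) {N : ℝ} (hN : 0 < N) (e : RSpace d)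
    (z z' : RSpace d × ℝ) :
    ‖inner ℂ (wave (hη.memLp_lateralEnv hN e) z) (wave (hη.memLp_lateralEnv hN e) z')‖ =
      N ^ d * ‖extension (fun ζ => ((η (Real.pi * inner ℝ ζ e) ^ 2 : ℝ) : ℂ) * gaussEnv 2 ζ)
        (N • (z.1 - z'.1), N ^ 2 * (z.2 - z'.2))‖ := by
  have h1 : (fun ζ => starRingEnd ℂ (lateralEnv η N e ζ) * lateralEnv η N e ζ) =
      fun ζ => (fun ζ => ((η (Real.pi * inner ℝ ζ e) ^ 2 : ℝ) : ℂ) * gaussEnv 2 ζ) (N⁻¹ • ζ) := by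
    funext ζ
    have h2 : gaussEnv 2 (N⁻¹ • ζ) = gaussEnv (2 * N⁻¹ ^ 2) ζ := by
      rw [gaussEnv, gaussEnv, norm_smul, Real.norm_of_nonneg (inv_pos.2 hN).le]
      congr 3
      ring
    simp only
    rw [conj_lateralEnv, lateralEnv, h2, ← gaussEnv_mul_self]
    push_cast
    ring
  rw [inner_wave_wave, h1, extension_comp_inv_smul
    (fun ζ => ((η (Real.pi * inner ℝ ζ e) ^ 2 : ℝ) : ℂ) * gaussEnv 2 ζ) hN, norm_mul, norm_pow, Complex.norm_real,
    Real.norm_of_nonneg hN.le]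
  rfl

end LateralEnvelopeKernel

/-! ### The maximal function estimate in dimension two -/

section SumSpace

variable {d : ℕ}

/-- Pointwise domination by functions of `x₁ - l t`, one for each speed `l`, bounds the norm of the
sum space: the pieces of the decomposition are proportional to the dominating functions. -/
theorem sumSpaceNorm_two_infty_le {e : RSpace d} (he : ‖e‖ = 1) {W : Finset ℝ} {φ v : RSpace d × ℝ → ℂ}
    (hφ : φ =ᵐ[volume] v) (hv : Measurable v) {Q : ℝ → ℝ → ℝ} (hQ0 : ∀ l a, 0 ≤ Q l a)
    (hQm : ∀ l, Measurable (Q l))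
    (hle : ∀ z, ‖v z‖ ≤ ∑ l ∈ W, Q l (inner ℝ z.1 e - l * z.2)) {R : ℝ≥0∞}
    (hR : ∑ l ∈ W, ∫⁻ a, ENNReal.ofReal (Q l a) ^ (2 : ℝ) ≤ R) :
    sumSpaceNorm 2 2 ∞ e W φ ≤ (W.card * R) ^ (1 / 2 : ℝ) := by
  set Z : RSpace d × ℝ → ℝ := fun z => ∑ l ∈ W, Q l (inner ℝ z.1 e - l * z.2) with hZ
  have hZ0 : ∀ z, 0 ≤ Z z := fun z => Finset.sum_nonneg fun l _ => hQ0 _ _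
  have hQc : ∀ l, Measurable fun z : RSpace d × ℝ => Q l (inner ℝ z.1 e - l * z.2) := fun l =>
    (hQm l).comp (Continuous.measurable (by fun_prop))
  have hZm : Measurable Z := Finset.measurable_sum _ fun l _ => hQc l
  -- each piece is the share of `v` proportional to its dominating function; where `Z = 0` the
  -- quotient vanishes, as does `v`
  set ψ : ℝ → RSpace d × ℝ → ℂ := fun l z => ((Q l (inner ℝ z.1 e - l * z.2) / Z z : ℝ) : ℂ) * v z with hψ
  have hψm : ∀ l, Measurable (ψ l) := fun l =>
    (Complex.measurable_ofReal.comp ((hQc l).div hZm)).mul hv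
  have hψle : ∀ l z, ‖ψ l z‖ ≤ Q l (inner ℝ z.1 e - l * z.2) := fun l z => by
    rw [hψ]
    simp only
    rw [norm_mul, Complex.norm_real, Real.norm_of_nonneg (div_nonneg (hQ0 _ _) (hZ0 z))]
    calc _ ≤ Q l (inner ℝ z.1 e - l * z.2) / Z z * Z z := by
          have := div_nonneg (hQ0 l (inner ℝ z.1 e - l * z.2)) (hZ0 z)
          gcongr
          exact hle z
      _ ≤ _ := by
          by_cases h0 : Z z = 0
          · rw [h0, mul_zero]
            exact hQ0 _ _
          · exact (div_mul_cancel₀ _ h0).le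
  have hsum : φ =ᵐ[volume] fun z => ∑ l ∈ W, ψ l z := by
    refine hφ.trans (Filter.Eventually.of_forall fun z => ?_)
    simp only [hψ]
    rw [← Finset.sum_mul, ← Complex.ofReal_sum, ← Finset.sum_div]
    by_cases h0 : Z z = 0
    · have h1 := hle z
      rw [show ∑ l ∈ W, Q l (inner ℝ z.1 e - l * z.2) = Z z from rfl, h0] at h1
      rw [norm_le_zero_iff.1 h1, mul_zero]
    · rw [show ∑ l ∈ W, Q l (inner ℝ z.1 e - l * z.2) = Z z from rfl, div_self h0, Complex.ofReal_one, one_mul]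
  have hgal : ∀ l, galileanNorm 2 ∞ e l (ψ l) ^ (2 : ℝ) ≤ ∫⁻ a, ENNReal.ofReal (Q l a) ^ (2 : ℝ) := fun l => by
    have h1 : galileanNorm 2 ∞ e l (ψ l) ≤ (∫⁻ a, ENNReal.ofReal (Q l a) ^ (2 : ℝ)) ^ (1 / 2 : ℝ) := by
      refine lateralNorm_two_infty_le.trans ?_
      gcongr with a
      refine iSup_le fun y => ?_
      rw [enorm_galilean, ← ofReal_norm]
      refine ENNReal.ofReal_le_ofReal ((hψle l _).trans_eq ?_)
      congr 1
      simp only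
      rw [inner_add_left, inner_lateral he, real_inner_smul_left, real_inner_smul_left, real_inner_self_eq_norm_sq,
        he]
      ring
    calc _ ≤ (_ : ℝ≥0∞) ^ (2 : ℝ) := ENNReal.rpow_le_rpow h1 (by norm_num)
      _ = _ := by rw [← ENNReal.rpow_mul]; norm_num
  rw [sumSpaceNorm]
  gcongr
  · rw [show (2 : ℝ) - 1 = 1 by norm_num, ENNReal.rpow_one]
  · refine (iInf₂_le ψ fun l _ => (hψm l).aestronglyMeasurable).trans ((iInf_le _ hsum).trans ?_)
    exact (Finset.sum_le_sum fun l _ => hgal l).trans hR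

/-- The maximal function estimate in dimension two, in the sum space over the speeds. The free
evolution is dominated pointwise by a sum over the speeds `l` of functions of `x₁ - l t`, with a
single dominating vector in `⊕_l L²(ℝ)` supplied by `exists_norm_inner_le_inner_of_gram_le`. -/
theorem exists_sumSpaceNorm_le {η : ℝ → ℝ} (hη : IsBaseCutoff η) :
    ∃ C : ℝ, 0 < C ∧ ∀ (f : L2Space 2) (k : ℤ) (e : RSpace 2), ‖e‖ = 1 → ∀ K : ℕ,
      sumSpaceNorm 2 2 ∞ e (speeds K (k + 5))
          (timeCut (2 ^ (2 * K)) (freeEvolution (lpProj η k f))) ≤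
        ENNReal.ofReal (C * 2 ^ ((k : ℝ) / 2) * ‖f‖) := by
  classical
  have hpi := Real.pi_pos
  obtain ⟨C, hC, hker⟩ := exists_norm_extension_lateral_le hη
  refine ⟨Real.pi * √(13830 * C) * Real.exp 3, by positivity, fun f k e he K => ?_⟩
  obtain ⟨g, hg, hgs, hfree⟩ := exists_freeEvolution_lpProj_eq hη k f
  set N : ℝ := 2 ^ k with hN
  have hN0 : 0 < N := by positivity
  set T : ℝ := 2 ^ (2 * K) with hT
  set W := speeds K (k + 5) with hW
  have hWc : 0 < (W.card : ℝ) := by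
    have h0 : (0 : ℝ) ∈ W := mem_speeds.2 ⟨⟨by rw [neg_nonpos]; positivity, by positivity⟩, 0, by simp⟩
    exact_mod_cast Finset.card_pos.2 ⟨0, h0⟩
  set u : RSpace 2 × ℝ → ℂ := extension fun ζ => gaussEnv (N⁻¹ ^ 2) ζ * g ζ with hu
  have huc : Continuous u := continuous_extension (integrable_gaussEnv_mul (by positivity) g)
  -- the cutoff in `ζ·e` equals one on the support of `g`
  have hue : ∀ z, u z = inner ℂ (wave (hη.memLp_lateralEnv hN0 e) z) g := fun z => by
    rw [inner_wave, hu]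
    refine congrFun (extension_congr_ae ?_) z
    filter_upwards [hgs] with ζ hζ
    by_cases h0 : g ζ = 0
    · rw [h0, mul_zero, mul_zero]
    have h1 := hζ h0
    have h2 : |Real.pi * inner ℝ (N⁻¹ • ζ) e| ≤ 5 / 4 := by
      rw [real_inner_smul_left, abs_mul, abs_mul, abs_of_pos hpi, abs_of_pos (inv_pos.2 hN0)]
      calc Real.pi * (N⁻¹ * |inner ℝ ζ e|) ≤ Real.pi * (N⁻¹ * ‖ζ‖) := by
            gcongr
            exact abs_inner_le_norm_of_unit he ζ
        _ = N⁻¹ * (2 * Real.pi * ‖ζ‖) / 2 := by ring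
        _ ≤ N⁻¹ * (8 / 5 * N) / 2 := by gcongr
        _ ≤ 5 / 4 := by
            rw [mul_left_comm, inv_mul_cancel₀ hN0.ne']
            norm_num
    rw [conj_lateralEnv, lateralEnv, hη.eq_one _ h2, Complex.ofReal_one, one_mul]
  set B : ℝ := 13830 * C * N ^ 3 / W.card with hB
  have hB0 : 0 ≤ B := by positivity
  -- the Gram kernel of the localized waves is dominated by that of the profiles summed over the
  -- speeds
  obtain ⟨w, hw, hdom⟩ := exists_norm_inner_le_inner_of_gram_le
    (e := fun z : {z : RSpace 2 × ℝ // |z.2| ≤ T} => wave (hη.memLp_lateralEnv hN0 e) z.1)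
    (p := fun z : {z : RSpace 2 × ℝ // |z.2| ≤ T} =>
      (WithLp.toLp 2 fun l : W => lorentzLp hN0 (inner ℝ z.1.1 e - (l : ℝ) * z.1.2) :
        PiLp 2 fun _ : W => Lp ℝ 2 (volume : Measure ℝ))) hB0
    (fun z z' => by
      rw [norm_inner_wave_lateralEnv hη hN0]
      set X := ‖extension (fun ζ => ((η (Real.pi * inner ℝ ζ e) ^ 2 : ℝ) : ℂ) * gaussEnv 2 ζ)
        (N • (z.1.1 - z'.1.1), N ^ 2 * (z.1.2 - z'.1.2))‖ with hX
      have hk := hker e he (N • (z.1.1 - z'.1.1)) (N ^ 2 * (z.1.2 - z'.1.2))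
      rw [← hX, real_inner_smul_left, abs_mul, abs_mul, abs_of_pos hN0, abs_of_pos (by positivity : 0 < N ^ 2)] at hk
      have ht : |z.1.2 - z'.1.2| ≤ 2 * 2 ^ (2 * K) := by
        refine (abs_sub _ _).trans ?_
        have h1 := z.2
        have h2 := z'.2
        linarith
      have hcount := card_speeds_mul_le_sum (K := K) hN hC.le ht hk.1 hk.2
      rw [← hW] at hcount
      have hinner : ∑ l ∈ W, (1 + (N * (inner ℝ (z.1.1 - z'.1.1) e - l * (z.1.2 - z'.1.2))) ^ 2)⁻¹ ≤
          6 * N * inner ℝ (WithLp.toLp 2 fun l : W => lorentzLp hN0 (inner ℝ z.1.1 e - (l : ℝ) * z.1.2) :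
              PiLp 2 fun _ : W => Lp ℝ 2 (volume : Measure ℝ))
            (WithLp.toLp 2 fun l : W => lorentzLp hN0 (inner ℝ z'.1.1 e - (l : ℝ) * z'.1.2)) := by
        refine le_trans ?_ (congrArg (fun y => 6 * N * y) (PiLp.inner_apply (𝕜 := ℝ)
          (WithLp.toLp 2 fun l : W => lorentzLp hN0 (inner ℝ z.1.1 e - (l : ℝ) * z.1.2) :
              PiLp 2 fun _ : W => Lp ℝ 2 (volume : Measure ℝ))
            (WithLp.toLp 2 fun l : W => lorentzLp hN0 (inner ℝ z'.1.1 e - (l : ℝ) * z'.1.2)))).ge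
        simp only
        rw [← Finset.sum_coe_sort, Finset.mul_sum]
        refine Finset.sum_le_sum fun l _ => ?_
        have h1 := lorentz_le_inner_lorentzLp hN0 (inner ℝ z.1.1 e - (l : ℝ) * z.1.2)
          (inner ℝ z'.1.1 e - (l : ℝ) * z'.1.2)
        rw [div_le_iff₀' (by positivity)] at h1
        refine le_trans (le_of_eq ?_) h1
        rw [lorentz_comm, lorentz, inner_sub_left]
        congr 3
        ring
      rw [hB, div_mul_eq_mul_div, le_div_iff₀ hWc]
      calc N ^ 2 * X * W.card = N ^ 2 * (W.card * X) := by ring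
        _ ≤ N ^ 2 * (2305 * C * (6 * N * inner ℝ
            (WithLp.toLp 2 fun l : W => lorentzLp hN0 (inner ℝ z.1.1 e - (l : ℝ) * z.1.2) :
              PiLp 2 fun _ : W => Lp ℝ 2 (volume : Measure ℝ))
            (WithLp.toLp 2 fun l : W => lorentzLp hN0 (inner ℝ z'.1.1 e - (l : ℝ) * z'.1.2)))) := by
            exact mul_le_mul_of_nonneg_left
              (hcount.trans (mul_le_mul_of_nonneg_left hinner (by positivity))) (by positivity)
        _ = _ := by ring) g
  -- the dominating function of speed `l`
  set Q : ℝ → ℝ → ℝ := fun l a => if h : l ∈ W then |inner ℝ (lorentzLp hN0 a) (w ⟨l, h⟩)| else 0 with hQ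
  have hQ0 : ∀ l a, 0 ≤ Q l a := fun l a => by
    rw [hQ]
    simp only
    split_ifs
    · exact abs_nonneg _
    · exact le_rfl
  have hQm : ∀ l, Measurable (Q l) := fun l => by
    by_cases h : l ∈ W
    · have h1 : Q l = fun a => |∫ y, lorentz N a y * w ⟨l, h⟩ y| := by
        funext a
        simp only [hQ, dif_pos h, inner_lorentzLp]
      rw [h1]
      have h2 : StronglyMeasurable fun q : ℝ × ℝ => lorentz N q.1 q.2 * w ⟨l, h⟩ q.2 :=
        (continuous_lorentz N).stronglyMeasurable.mul
          ((Lp.stronglyMeasurable (w ⟨l, h⟩)).comp_measurable measurable_snd)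
      exact h2.integral_prod_right'.measurable.abs
    · have h1 : Q l = fun _ => 0 := by
        funext a
        simp only [hQ, dif_neg h]
      rw [h1]
      exact measurable_const
  have hQint : ∑ l ∈ W, ∫⁻ a, ENNReal.ofReal (Q l a) ^ (2 : ℝ) ≤
      ENNReal.ofReal ((Real.pi / N) ^ 2 * ‖w‖ ^ 2) := by
    rw [← Finset.sum_coe_sort, PiLp.norm_sq_eq_of_L2, Finset.mul_sum,
      ENNReal.ofReal_sum_of_nonneg fun _ _ => by positivity]
    refine Finset.sum_le_sum fun l _ => ?_
    have h1 : ∀ a, ENNReal.ofReal (Q l a) = ‖(inner ℝ (lorentzLp hN0 a) (w l) : ℝ)‖ₑ := fun a => by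
      simp only [hQ, dif_pos l.2]
      rw [← ofReal_norm, Real.norm_eq_abs]
    simp only [h1]
    refine (lintegral_inner_lorentzLp_sq_le hN0 (w l)).trans_eq ?_
    rw [ENNReal.ofReal_mul (by positivity), ENNReal.ofReal_pow (by positivity), ENNReal.ofReal_pow (norm_nonneg _),
      ofReal_norm, ENNReal.rpow_ofNat, ENNReal.rpow_ofNat]
  have hcut : timeCut T (freeEvolution (lpProj η k f)) =ᵐ[volume] timeCut T u := by
    filter_upwards [hfree] with z hz
    simp only [timeCut, hz, hu]
  have hcutm : Measurable (timeCut T u) := by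
    have h1 : timeCut T u = (Prod.snd ⁻¹' Set.Icc (-T) T).indicator u := by
      funext z
      simp only [timeCut, Set.indicator, Set.mem_preimage]
    rw [h1]
    exact huc.measurable.indicator (measurable_snd measurableSet_Icc)
  have hcutle : ∀ z, ‖timeCut T u z‖ ≤ ∑ l ∈ W, Q l (inner ℝ z.1 e - l * z.2) := fun z => by
    by_cases hz : |z.2| ≤ T
    · have h1 := hdom ⟨z, hz⟩
      simp only at h1
      rw [timeCut, Set.indicator_of_mem (show z.2 ∈ Set.Icc (-T) T from abs_le.1 hz), hue]
      refine h1.trans ((PiLp.inner_apply (𝕜 := ℝ) _ w).trans_le ?_)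
      rw [← Finset.sum_coe_sort W]
      refine Finset.sum_le_sum fun l _ => ?_
      simp only [hQ, dif_pos l.2]
      exact le_abs_self _
    · rw [timeCut, Set.indicator_of_notMem (show z.2 ∉ Set.Icc (-T) T from fun h => hz (abs_le.2 h)), norm_zero]
      exact Finset.sum_nonneg fun _ _ => hQ0 _ _
  refine (sumSpaceNorm_two_infty_le he hcut hcutm hQ0 hQm hcutle hQint).trans ?_
  rw [← ENNReal.ofReal_natCast, ← ENNReal.ofReal_mul hWc.le, ENNReal.ofReal_rpow_of_nonneg (by positivity) (by norm_num)]
  refine ENNReal.ofReal_le_ofReal ?_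
  rw [← Real.sqrt_eq_rpow]
  refine Real.sqrt_le_iff.2 ⟨by positivity, ?_⟩
  have hpow : ((2 : ℝ) ^ ((k : ℝ) / 2)) ^ 2 = N := by
    rw [hN, ← Real.rpow_intCast, ← Real.rpow_natCast, ← Real.rpow_mul (by norm_num)]
    congr 1; push_cast; ring
  have hw2 : ‖w‖ ^ 2 ≤ B * (Real.exp 3 * ‖f‖) ^ 2 := by
    calc ‖w‖ ^ 2 ≤ (√B * (Real.exp 3 * ‖f‖)) ^ 2 := by
          refine pow_le_pow_left₀ (norm_nonneg _) (hw.trans ?_) 2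
          gcongr
      _ = _ := by rw [mul_pow, Real.sq_sqrt hB0]
  calc (W.card : ℝ) * ((Real.pi / N) ^ 2 * ‖w‖ ^ 2)
      ≤ W.card * ((Real.pi / N) ^ 2 * (B * (Real.exp 3 * ‖f‖) ^ 2)) := by gcongr
    _ = Real.pi ^ 2 * (13830 * C) * Real.exp 3 ^ 2 * N * ‖f‖ ^ 2 := by
        rw [hB]
        field_simp
    _ = _ := by
        rw [← hpow]
        simp only [mul_pow]
        rw [Real.sq_sqrt (by positivity)]

end SumSpace

theorem lemma7p1 (d : ℕ) (hd : 2 ≤ d) (η : ℝ → ℝ) (hη : IsBaseCutoff η) :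
    -- local smoothing
    (∃ C : ℝ, 0 < C ∧ ∀ (f : L2Space d) (k : ℤ) (e : RSpace d), ‖e‖ = 1 →
      ∀ l : ℝ, |l| ≤ 2 ^ (k - 5) →
        galileanNorm ∞ 2 e l (freeEvolution (lpProjDir η k e f)) ≤
          ENNReal.ofReal (C * 2 ^ (-(k : ℝ) / 2) * ‖f‖)) ∧
    -- maximal function estimate in dimension at least three
    (3 ≤ d → ∃ C : ℝ, 0 < C ∧ ∀ (f : L2Space d) (k : ℤ) (e : RSpace d), ‖e‖ = 1 →
      lateralNorm 2 ∞ e (freeEvolution (lpProj η k f)) ≤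
        ENNReal.ofReal (C * 2 ^ ((k : ℝ) * ((d : ℝ) - 1) / 2) * ‖f‖)) ∧
    -- maximal function estimate in dimension two
    (d = 2 → ∃ C : ℝ, 0 < C ∧ ∀ (f : L2Space d) (k : ℤ) (e : RSpace d), ‖e‖ = 1 → ∀ K : ℕ,
      sumSpaceNorm 2 2 ∞ e (speeds K (k + 5))
          (timeCut (2 ^ (2 * K)) (freeEvolution (lpProj η k f))) ≤
        ENNReal.ofReal (C * 2 ^ ((k : ℝ) / 2) * ‖f‖)) ∧
    -- Strichartz estimate
    (∃ C : ℝ, 0 < C ∧ ∀ f : L2Space d,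
      eLpNorm (freeEvolution f) (strichartzExponent d) volume ≤ ENNReal.ofReal (C * ‖f‖)) ∧
    -- maximal Strichartz estimate
    (∃ C : ℝ, 0 < C ∧ ∀ (f : L2Space d) (k : ℤ),
      maximalNorm (strichartzExponent d) (freeEvolution (lpProj η k f)) ≤
        ENNReal.ofReal (C * 2 ^ ((k : ℝ) * d / (d + 2)) * ‖f‖)) ∧
    -- lateral Strichartz estimates in dimension two, `p ≥ q`, uniformly in the exponents
    (d = 2 → ∃ C : ℝ, 0 < C ∧ ∀ p q : ℝ≥0∞, 2 < p → 2 ≤ q → 1 / p + 1 / q = 1 / 2 → q ≤ p →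
      ∀ (f : L2Space d) (k : ℤ) (e : RSpace d), ‖e‖ = 1 →
        lateralNorm p q e (freeEvolution (lpProjDir η k e f)) ≤
          ENNReal.ofReal (C * 2 ^ ((k : ℝ) * ((2 / p).toReal - 1 / 2)) * ‖f‖)) ∧
    -- lateral Strichartz estimates in dimension two, `p ≤ q`
    (d = 2 → ∀ p q : ℝ≥0∞, 2 < p → 2 ≤ q → 1 / p + 1 / q = 1 / 2 → p ≤ q →
      ∃ C : ℝ, 0 < C ∧ ∀ (f : L2Space d) (k : ℤ) (e : RSpace d), ‖e‖ = 1 →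
        lateralNorm p q e (freeEvolution (lpProj η k f)) ≤
          ENNReal.ofReal (C * 2 ^ ((k : ℝ) * ((2 / p).toReal - 1 / 2)) * ‖f‖)) := by
  refine ⟨exists_galileanNorm_lpProjDir_le hη, fun h3 => exists_lateralNorm_two_infty_le h3 hη, ?_, ?_,
    exists_maximalNorm_le (by omega) hη, ?_, ?_⟩
  · rintro rfl
    exact exists_sumSpaceNorm_le hη
  · obtain ⟨C, hC, h⟩ := exists_eLpNorm_freeEvolution_le (d := d) (by omega)
    refine ⟨C.toReal + 1, by positivity, fun f => (h f).trans ?_⟩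
    rw [ENNReal.ofReal_mul (by positivity), ofReal_norm]
    gcongr
    exact (ENNReal.le_ofReal_iff_toReal_le hC (by positivity)).2 (by linarith)
  · rintro rfl
    exact exists_lateralNorm_lpProjDir_le hη
  · rintro rfl p q hp hq hpq hle
    exact exists_lateralNorm_lpProj_le hη hp hpq hle
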